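/- **Setting.** Algorithms are probabilistic machines with a step count; inputs include the security parameter $1^\lambda$; negligible means $o(\lambda^{-c})$ for every $c$. *Big-key encryption.* A scheme $\mathsf{PKE}=(\mathsf{KeyGen},\mathsf{Enc},\mathsf{Dec})$ of PPT algorithms for one-bit messages, where $(\mathsf{pk},\mathsf{sk})\gets\mathsf{KeyGen}(1^\lambda,\ell)$, decryption is perfectly correct, $\mathsf{sk}$ is (marginally) uniformly distributed in $\{0,1\}^\ell$, and the length of $\mathsf{pk}$, the length of ciphertexts and the running time of $\mathsf{Enc}$ are bounded by polynomials in $\lambda$ that do not depend on $\ell$; let $p(\lambda)$ be such a bound for $|\mathsf{pk}|$. *Key-knowledge security* (for key length $\ell=\ell(\lambda)$). For every PPT adversary $(\mathcal A_1,\mathcal A_2)$ there is an extractor $\mathcal E$ with running time $\mathrm{poly}(\lambda,1/\epsilon)$ such that for every inverse polynomial $\epsilon=1/q(\lambda)$ and all but finitely many $\lambda$, if $(\mathsf{pk},\mathsf{sk})\gets\mathsf{KeyGen}(1^\lambda,\ell)$ and $\mathsf{st}\gets\mathcal A_1(1^\lambda,\mathsf{pk},\mathsf{sk})$, then $$\Pr\big[\mathsf{Adv}_{\mathsf{st}}(\mathcal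 A_2)>\epsilon\ \text{ and }\ \mathcal E(\mathsf{st},\mathsf{pk},\epsilon)\neq\mathsf{sk}\big]<\epsilon,$$ where $\mathsf{Adv}_{\mathsf{st}}(\mathcal A_2)=\big|\Pr[\mathcal A_2(\mathsf{st},\mathsf{pk},\mathsf{Enc}(\mathsf{pk},1))=1]-\Pr[\mathcal A_2(\mathsf{st},\mathsf{pk},\mathsf{Enc}(\mathsf{pk},0))=1]\big|$ for fixed $\mathsf{st},\mathsf{pk}$. *The problem $\Pi_{n,\ell}$.* Let $n=n(\lambda)$ and $\ell=\ell(\lambda)$ be such that $1^\lambda\mapsto 1^{n(\lambda)}$ and $1^\lambda\mapsto 1^{\ell(\lambda)}$ are computable in polynomial time. $\mathsf{Gen}(1^\lambda)$ outputs $\mathsf{st}=((\mathsf{pk}_i,\mathsf{sk}_i))_{i\le n}$ with independent $(\mathsf{pk}_i,\mathsf{sk}_i)\gets\mathsf{KeyGen}(1^\lambda,\ell)$; $\mathsf{Samp}_{\mathsf{st}}(b)$, $b\in\{0,1\}$, outputs $(\mathsf{Enc}(\mathsf{pk}_1,b),\dots,\mathsf{Enc}(\mathsf{pk}_n,b))$.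 A learner $\mathcal L$ is a PPT algorithm that gets $\mathsf{st}$ and oracle access to $\mathsf{Samp}_{\mathsf{st}}$ (and may ignore either) and outputs a model $h$; a classifier is a PPT algorithm $\mathcal C_h(x)\in\{0,1\}$. Its advantage is $\mathsf{Adv}_{\Pi,\mathsf{st}}(\mathcal C_h)=\Pr[\mathcal C_h(\mathsf{Samp}_{\mathsf{st}}(b))=b]-\frac12$ for uniform $b$. *Metrics and adversaries.* For $I\subseteq[n]$ let $d_I(x,z)=\sum_i w_i\mathbf 1_{x_i\ne z_i}$ with $w_i=1$ for $i\in I$ and $w_i=1/n$ otherwise. A perturbation adversary $\mathcal A$ gets $1^\lambda$, the public keys $\mathsf{pk}_1,\dots,\mathsf{pk}_n$, a sample $x$ and its class, and oracle access to $\mathcal C_h$. It outputs a perturbed sample $\tilde x$ and a set $I\subseteq[n]$ with $|I|=\lceil n/2\rceil$, and must always satisfy $d_I(x,\tilde x)<1$ (whatever yes/no oracle it is run with). In probabilities, $\mathcal C_h(\mathcal A^{\mathcal C_h}(x))$ means $\mathcal C_h(\tilde x)$. Put $$\mathrm{gap}_{\mathcal A,b}(\mathsf{st},h)=\Big|\Pr[\mathcal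 C_h(\mathsf{Samp}_{\mathsf{st}}(b))=b]-\Pr[\mathcal C_h(\mathcal A^{\mathcal C_h(\cdot)}(\mathsf{Samp}_{\mathsf{st}}(1-b)))=b]\Big| .$$ *Weak robustness.* $\Pi_{n,\ell}$ is weakly robustly $(\epsilon,\delta,\gamma,\eta)$-PAC-learnable, for adaptively chosen metric and with models of size at most $B$, if there are a learner $\mathcal L$ all of whose models have at most $B$ bits and a classifier $\mathcal C$ such that, for $\mathsf{st}\gets\mathsf{Gen}(1^\lambda)$, $h\gets\mathcal L$ and all sufficiently large $\lambda$: (1) $\Pr[\mathsf{Adv}_{\Pi,\mathsf{st}}(\mathcal C_h)\ge\epsilon]\ge 1-\delta$; (2) for every PPT perturbation adversary $\mathcal A$ and every $b$, $\Pr[\mathrm{gap}_{\mathcal A,b}(\mathsf{st},h)>\gamma]\ge 1-\eta$. (The threshold on $\lambda$ may depend on $\mathcal A$ and $b$.) **Theorem.** Let $\mathsf{PKE}$ be key-knowledge secure for key length $\ell(\lambda)$, and suppose that the keys are large, $\ell(\lambda)\ge(n(\lambda)+1)(p(\lambda)+\lambda)$ for all sufficiently large $\lambda$. 1. There is a perturbation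 adversary $\mathcal A$, which takes $1/\gamma\in\mathbb N$ (in unary) as a further input and runs in time $\mathrm{poly}(\lambda,1/\gamma)$, such that for every learner/classifier pair $(\mathcal L,\mathcal C)$ for $\Pi_{n,\ell}$ whose models have at most $\frac n2\cdot\ell$ bits (in particular for pairs that have advantage at least $\epsilon$ except with probability $\delta$), and for every $\gamma=1/q(\lambda)$ with a positive polynomial $q$ (constants included), the inequality $$\Big|\Pr[\mathcal C_h(\mathsf{Samp}_{\mathsf{st}}(b))=b]-\Pr[\mathcal C_h(\mathcal A^{\mathcal C_h(\cdot)}(\mathsf{Samp}_{\mathsf{st}}(1-b)))=b]\Big|<\gamma$$ holds for both $b\in\{0,1\}$, except with negligible probability over $\mathsf{st}\gets\mathsf{Gen}(1^\lambda)$ and $h\gets\mathcal L$. 2. Hence $\Pi_{n,\ell}$ is not weakly robustly $(\epsilon,\delta,\gamma,\eta)$-PAC-learnable for adaptively chosen metric with models of size at most $\frac n2\cdot\ell$, for any functions $\epsilon,\delta,\gamma,\eta$ of $\lambda$ such that, for all sufficiently large $\lambda$, $\gamma$ is at least an inverse polynomial and $\eta\le c$ for a constant $c<1$ (in particular for negligible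 $\eta$). -/

import Mathlib

open Filter

namespace RobustLearning

/-! ## Probabilistic oracle machines with a step count

A machine is a structured program over stacks of bits (a multi-tape machine in structured form).
Every instruction costs one unit of time. -/

/-- Programs. Registers are numbered and each of them holds a bit string, used as a stack. -/
inductive Cmd where
  | skip : Cmd
  /-- push the bit `b` on register `r` -/
  | push (r : ℕ) (b : Bool) : Cmd
  /-- remove the top bit of register `r` -/
  | pop (r : ℕ) : Cmd
  /-- push a uniformly random bit on register `r` -/
  | flip (r : ℕ) : Cmd
  /-- ask the oracle about the content of register `q` and put its answer into register `r` -/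
  | query (q r : ℕ) : Cmd
  /-- first the one, then the other -/
  | seq (c d : Cmd) : Cmd
  /-- branch on register `r`: empty / top bit `false` / top bit `true` -/
  | branch (r : ℕ) (cEmpty cFalse cTrue : Cmd) : Cmd
  /-- repeat the body as long as register `r` is nonempty -/
  | loop (r : ℕ) (body : Cmd) : Cmd

/-- The contents of all registers. -/
abbrev Store := ℕ → List Bool

/-- A (randomized) oracle: each query is answered with fresh randomness. -/
abbrev Oracle := List Bool → PMF (List Bool)

/-- At most `m` rounds of the loop `while register r is nonempty do body`, with the number of
steps used. -/
noncomputable def iterate (r : ℕ) (body : Store → PMF (Store × ℕ)) : ℕ → Store → PMF (Store × ℕ)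
  | 0, s => PMF.pure (s, 1)
  | m + 1, s =>
    if s r = [] then PMF.pure (s, 1)
    else (body s).bind fun u : Store × ℕ =>
      (iterate r body m u.1).map fun v => (v.1, u.2 + v.2 + 1)

/-- The joint distribution of the final store and of the number of steps of a program that is
observed up to the time `T`: every loop is cut off after `T` rounds. A run in which a loop is cut
off has used more than `T` steps, so the runs that use at most `T` steps are exactly the runs of
the uncut program that use at most `T` steps. -/
noncomputable def exec (O : Oracle) (T : ℕ) : Cmd → Store → PMF (Store × ℕ)
  | .skip, s => PMF.pure (s, 1)
  | .push r b, s => PMF.pure (Function.update s r (b :: s r), 1)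
  | .pop r, s => PMF.pure (Function.update s r (s r).tail, 1)
  | .flip r, s =>
      (PMF.uniformOfFintype Bool).map fun b => (Function.update s r (b :: s r), 1)
  | .query q r, s => (O (s q)).map fun a => (Function.update s r a, 1)
  | .seq c d, s =>
      (exec O T c s).bind fun u => (exec O T d u.1).map fun v => (v.1, u.2 + v.2)
  | .branch r cEmpty cFalse cTrue, s =>
      (match s r with
        | [] => exec O T cEmpty s
        | false :: _ => exec O T cFalse s
        | true :: _ => exec O T cTrue s).map fun u : Store × ℕ => (u.1, u.2 + 1)
  | .loop r body, s => iterate r (exec O T body) T s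

/-- The initial store: the inputs are in the registers `0, 1, 2, …`, all others are empty. -/
def load (xs : List (List Bool)) : Store := fun i => xs.getD i []

/-- On the inputs `xs` every run of `P` with oracle `O` stops after at most `T` steps. -/
def HaltsWithin (O : Oracle) (T : ℕ) (P : Cmd) (xs : List (List Bool)) : Prop :=
  ∀ u ∈ (exec O T P (load xs)).support, u.2 ≤ T

open Classical in
/-- The distribution of the final store of `P` on the inputs `xs`, for a program whose running time
on these inputs is bounded (a dummy value otherwise). -/
noncomputable def final (O : Oracle) (P : Cmd) (xs : List (List Bool)) : PMF Store :=
  if h : ∃ T, HaltsWithin O T P xs then (exec O (Nat.find h) P (load xs)).map Prod.fst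
  else PMF.pure (load xs)

/-- The trivial oracle, for programs that are run without an oracle. -/
noncomputable def noOracle : Oracle := fun _ => PMF.pure []

/-- A yes/no oracle as an oracle that answers with one bit. -/
noncomputable def bitOracle (f : List Bool → PMF Bool) : Oracle := fun w => (f w).map fun b => [b]

/-! ## Encodings and elementary probability -/

/-- The unary string `1^k`. -/
def unary (k : ℕ) : List Bool := List.replicate k true

/-- The bit that a string stands for: its first bit (`false` for the empty string). -/
def bitOf (w : List Bool) : Bool := w.headD false

/-- Self-delimiting encoding of a list of strings as one string: every bit `b` of a string is
written `1 b`, and every string is followed by `0`. -/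
def encodeList (l : List (List Bool)) : List Bool :=
  l.flatMap fun w => (w.flatMap fun b => [true, b]) ++ [false]

/-- The encoding of a vector of strings as one string. -/
def encodeVec {n : ℕ} (x : Fin n → List Bool) : List Bool := encodeList (List.ofFn x)

/-- The probability of an event. -/
noncomputable def prob {α : Type} (μ : PMF α) (E : α → Prop) : ℝ :=
  (μ.toOuterMeasure {a | E a}).toReal

/-- Independent samples of `μ 0, …, μ (n - 1)`. -/
noncomputable def product {α : Type} : {n : ℕ} → (Fin n → PMF α) → PMF (Fin n → α)
  | 0, _ => PMF.pure Fin.elim0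
  | _ + 1, μ =>
    (μ 0).bind fun a => (product fun i => μ (Fin.succ i)).map fun x => (Fin.cons a x : Fin _ → α)

/-- The uniform distribution on the bit strings of length `m`. -/
noncomputable def uniformBits (m : ℕ) : PMF (List Bool) :=
  (PMF.uniformOfFintype (Fin m → Bool)).map List.ofFn

/-- `1^k ↦ 1^(f k)` can be computed in polynomial time. -/
def UnaryPolyTime (f : ℕ → ℕ) : Prop :=
  ∃ (P : Cmd) (p : Polynomial ℕ), ∀ k,
    HaltsWithin noOracle (p.eval k) P [unary k] ∧
      ∀ s ∈ (final noOracle P [unary k]).support, s 0 = unary (f k)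

/-! ## Big-key encryption -/

/-- `(pk, sk) ← KeyGen(1^lam, ℓ)`: the keys are the contents of registers 0 and 1 at the end. -/
noncomputable def keyGenDist (keyGen : Cmd) (lam ℓ : ℕ) : PMF (List Bool × List Bool) :=
  (final noOracle keyGen [unary lam, unary ℓ]).map fun s => (s 0, s 1)

/-- `c ← Enc(pk, m)`. -/
noncomputable def encDist (enc : Cmd) (lam : ℕ) (pk : List Bool) (m : Bool) : PMF (List Bool) :=
  (final noOracle enc [unary lam, pk, [m]]).map fun s => s 0

/-- `m ← Dec(sk, c)`. -/
noncomputable def decDist (dec : Cmd) (lam : ℕ) (sk c : List Bool) : PMF Bool :=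
  (final noOracle dec [unary lam, sk, c]).map fun s => bitOf (s 0)

/-- A public-key big-key encryption scheme for one-bit messages: efficient, perfectly correct,
with public keys, ciphertexts and an encryption time that are bounded by a polynomial in the
security parameter alone, and with secret keys that are uniformly random strings of length `ℓ`. -/
structure BigKeyEncryption where
  keyGen : Cmd
  enc : Cmd
  dec : Cmd
  /-- a bound on the length of the public keys, independent of `ℓ` -/
  pkBound : Polynomial ℕ
  keyGen_time : ∃ p : Polynomial ℕ, ∀ lam ℓ,
    HaltsWithin noOracle (p.eval (lam + ℓ)) keyGen [unary lam, unary ℓ]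
  enc_time : ∃ p : Polynomial ℕ, ∀ lam ℓ, ∀ key ∈ (keyGenDist keyGen lam ℓ).support, ∀ m : Bool,
    HaltsWithin noOracle (p.eval lam) enc [unary lam, key.1, [m]]
  dec_time : ∃ p : Polynomial ℕ, ∀ lam ℓ, ∀ key ∈ (keyGenDist keyGen lam ℓ).support, ∀ m : Bool,
    ∀ c ∈ (encDist enc lam key.1 m).support,
      HaltsWithin noOracle (p.eval (lam + ℓ)) dec [unary lam, key.2, c]
  correct : ∀ lam ℓ, ∀ key ∈ (keyGenDist keyGen lam ℓ).support, ∀ m : Bool,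
    ∀ c ∈ (encDist enc lam key.1 m).support, decDist dec lam key.2 c = PMF.pure m
  pk_compact : ∀ lam ℓ, ∀ key ∈ (keyGenDist keyGen lam ℓ).support,
    key.1.length ≤ pkBound.eval lam
  ct_compact : ∃ p : Polynomial ℕ, ∀ lam ℓ, ∀ key ∈ (keyGenDist keyGen lam ℓ).support,
    ∀ m : Bool, ∀ c ∈ (encDist enc lam key.1 m).support, c.length ≤ p.eval lam
  sk_uniform : ∀ lam ℓ, (keyGenDist keyGen lam ℓ).map Prod.snd = uniformBits ℓ

/-- `st ← A₁(1^lam, pk, sk)`. -/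
noncomputable def leakDist (A₁ : Cmd) (lam : ℕ) (key : List Bool × List Bool) :
    PMF (List Bool) :=
  (final noOracle A₁ [unary lam, key.1, key.2]).map fun s => s 0

/-- `b' ← A₂(st, pk, c)` for `c ← Enc(pk, b)`. -/
noncomputable def guessDist (S : BigKeyEncryption) (A₂ : Cmd) (lam : ℕ) (st pk : List Bool)
    (b : Bool) : PMF Bool :=
  (encDist S.enc lam pk b).bind fun c =>
    (final noOracle A₂ [unary lam, st, pk, c]).map fun s => bitOf (s 0)

/-- The distinguishing advantage of `A₂` for the fixed state `st`. -/
noncomputable def distAdv (S : BigKeyEncryption) (A₂ : Cmd) (lam : ℕ) (st pk : List Bool) : ℝ :=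
  |prob (guessDist S A₂ lam st pk true) (· = true) -
    prob (guessDist S A₂ lam st pk false) (· = true)|

/-- `(pk, sk) ← KeyGen(1^lam, ℓ)`, `st ← A₁(1^lam, pk, sk)`, `sk' ← E(1^lam, 1^k, st, pk)`, with
outcome `((pk, sk), st, sk')`. -/
noncomputable def extractionGame (S : BigKeyEncryption) (A₁ E : Cmd) (lam ℓ k : ℕ) :
    PMF ((List Bool × List Bool) × List Bool × List Bool) :=
  (keyGenDist S.keyGen lam ℓ).bind fun key =>
    (leakDist A₁ lam key).bind fun st =>
      (final noOracle E [unary lam, unary k, st, key.1]).map fun s => (key, st, s 0)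

/-- Key-knowledge security for keys of length `ℓ(lam)`: for every PPT adversary `(A₁, A₂)` there is
an extractor `E` with running time polynomial in `lam` and `1/ε` such that for every inverse
polynomial `ε = 1/q` the event that `A₂` has advantage more than `ε` while `E` does not return
the secret key has probability less than `ε`, except for finitely many `lam`. -/
def KeyKnowledgeSecure (S : BigKeyEncryption) (ℓ : ℕ → ℕ) : Prop :=
  ∀ A₁ A₂ : Cmd,
    (∃ p : Polynomial ℕ, ∀ lam, ∀ key ∈ (keyGenDist S.keyGen lam (ℓ lam)).support,
      HaltsWithin noOracle (p.eval lam) A₁ [unary lam, key.1, key.2]) →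
    (∃ p : Polynomial ℕ, ∀ lam, ∀ key ∈ (keyGenDist S.keyGen lam (ℓ lam)).support,
      ∀ st ∈ (leakDist A₁ lam key).support, ∀ b : Bool,
        ∀ c ∈ (encDist S.enc lam key.1 b).support,
          HaltsWithin noOracle (p.eval lam) A₂ [unary lam, st, key.1, c]) →
    ∃ E : Cmd,
      (∃ p : Polynomial ℕ, ∀ lam k, ∀ key ∈ (keyGenDist S.keyGen lam (ℓ lam)).support,
        ∀ st ∈ (leakDist A₁ lam key).support,
          HaltsWithin noOracle (p.eval (lam + k)) E [unary lam, unary k, st, key.1]) ∧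
      ∀ q : Polynomial ℕ, (∀ lam, 0 < q.eval lam) → ∀ᶠ lam in atTop,
        prob (extractionGame S A₁ E lam (ℓ lam) (q.eval lam))
          (fun o => distAdv S A₂ lam o.2.1 o.1.1 > 1 / ((q.eval lam : ℕ) : ℝ) ∧ o.2.2 ≠ o.1.2)
          < 1 / ((q.eval lam : ℕ) : ℝ)

/-! ## Weighted Hamming metrics -/

/-- The weighted Hamming metric with weights `w`. -/
noncomputable def weightedHamming {n : ℕ} (w : Fin n → ℝ) (x z : Fin n → List Bool) : ℝ :=
  ∑ i, w i * (if x i ≠ z i then 1 else 0)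

/-- The weights that protect the features in `I`. -/
noncomputable def protectWeight {n : ℕ} (I : Finset (Fin n)) : Fin n → ℝ :=
  fun i => if i ∈ I then 1 else 1 / (n : ℝ)

/-- The metric `d_I`. -/
noncomputable def protectMetric {n : ℕ} (I : Finset (Fin n)) (x z : Fin n → List Bool) : ℝ :=
  weightedHamming (protectWeight I) x z

/-! ## The learning task -/

/-- A private state: the `n` pairs `(pk_i, sk_i)` of feature keys. -/
abbrev State (n : ℕ) := Fin n → List Bool × List Bool

/-- The problem generator `Gen(1^lam)`. -/
noncomputable def gen (S : BigKeyEncryption) (lam n ℓ : ℕ) : PMF (State n) :=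
  product fun _ => keyGenDist S.keyGen lam ℓ

/-- The sampler `Samp_st(b)`. -/
noncomputable def samp (S : BigKeyEncryption) (lam : ℕ) {n : ℕ} (st : State n) (b : Bool) :
    PMF (Fin n → List Bool) :=
  product fun i => encDist S.enc lam (st i).1 b

/-- The sampler as an oracle: the query names the class, the answer is an encoded sample. -/
noncomputable def sampOracle (S : BigKeyEncryption) (lam : ℕ) {n : ℕ} (st : State n) : Oracle :=
  fun w => (samp S lam st (bitOf w)).map encodeVec

/-- The inputs of a learner: `1^lam` and the private state. -/
def learnInput (lam : ℕ) {n : ℕ} (st : State n) : List (List Bool) :=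
  [unary lam, encodeList ((List.ofFn st).flatMap fun key => [key.1, key.2])]

/-- `h ← L^{Samp_st}(1^lam, st)`. -/
noncomputable def learn (S : BigKeyEncryption) (L : Cmd) (lam : ℕ) {n : ℕ} (st : State n) :
    PMF (List Bool) :=
  (final (sampOracle S lam st) L (learnInput lam st)).map fun s => s 0

/-- `C_h(x)`, for a string `x`. -/
noncomputable def classify (C : Cmd) (lam : ℕ) (h x : List Bool) : PMF Bool :=
  (final noOracle C [unary lam, h, x]).map fun s => bitOf (s 0)

/-- `L` is a learner for the task: it runs in probabilistic polynomial time. It has oracle access to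
the sampler, and it is even given the private state. -/
def IsLearner (S : BigKeyEncryption) (n ℓ : ℕ → ℕ) (L : Cmd) : Prop :=
  ∃ p : Polynomial ℕ, ∀ lam, ∀ st ∈ (gen S lam (n lam) (ℓ lam)).support,
    HaltsWithin (sampOracle S lam st) (p.eval lam) L (learnInput lam st)

/-- `C` is a probabilistic polynomial-time classification algorithm. -/
def IsClassifier (C : Cmd) : Prop :=
  ∃ p : Polynomial ℕ, ∀ (lam : ℕ) (h x : List Bool),
    HaltsWithin noOracle (p.eval (lam + h.length + x.length)) C [unary lam, h, x]

/-- All models that `L` produces have at most `B(lam)` bits. -/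
def ModelSizeAtMost (S : BigKeyEncryption) (n ℓ : ℕ → ℕ) (L : Cmd) (B : ℕ → ℝ) : Prop :=
  ∀ lam, ∀ st ∈ (gen S lam (n lam) (ℓ lam)).support, ∀ h ∈ (learn S L lam st).support,
    (h.length : ℝ) ≤ B lam

/-- `st ← Gen(1^lam)`, `h ← L^{Samp_st}(1^lam, st)`. -/
noncomputable def genLearn (S : BigKeyEncryption) (L : Cmd) (lam n ℓ : ℕ) :
    PMF (State n × List Bool) :=
  (gen S lam n ℓ).bind fun st => (learn S L lam st).map fun h => (st, h)

/-- `Pr[C_h(Samp_st(b)) = b]`. -/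
noncomputable def hitProb (S : BigKeyEncryption) (C : Cmd) (lam : ℕ) {n : ℕ} (st : State n)
    (h : List Bool) (b : Bool) : ℝ :=
  prob ((samp S lam st b).bind fun x => classify C lam h (encodeVec x)) (· = b)

/-- The advantage `Pr[C_h(Samp_st(b)) = b] - 1/2` for a uniformly random class `b`. -/
noncomputable def advantage (S : BigKeyEncryption) (C : Cmd) (lam : ℕ) {n : ℕ} (st : State n)
    (h : List Bool) : ℝ :=
  (hitProb S C lam st h false + hitProb S C lam st h true) / 2 - 1 / 2

/-! ## Perturbation adversaries that choose the metric adaptively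

An adversary gets `1^lam`, the class of its sample, the public keys, the sample, and possibly a
further string, together with an oracle that answers with one bit. It leaves the perturbed
sample in register 0 and the characteristic vector of the set `I` of its target metric `d_I` in
register 1. -/

/-- The inputs of a perturbation adversary on a sample `x` of class `c`. -/
def attackInput (lam : ℕ) {n : ℕ} (st : State n) (c : Bool) (x : Fin n → List Bool)
    (aux : List (List Bool)) : List (List Bool) :=
  [unary lam, [c], encodeVec fun i => (st i).1, encodeVec x] ++ aux

/-- The final store `s` holds a perturbation of `x` together with a target metric `d_I` in the class
of all `d_I` with `|I| = ⌈n/2⌉`, and the perturbation is within the budget: `d_I(x, x') < 1`. -/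
def AllowedOutput {n : ℕ} (x : Fin n → List Bool) (s : Store) : Prop :=
  ∃ (x' : Fin n → List Bool) (I : Finset (Fin n)),
    s 0 = encodeVec x' ∧ s 1 = List.ofFn (fun i => decide (i ∈ I)) ∧
      I.card = (n + 1) / 2 ∧ protectMetric I x x' < 1

/-- On all samples, and for every oracle that answers with one bit, the adversary `A` with the
further inputs `aux` runs for at most `T` steps and produces an allowed perturbation. -/
def AttackWithin (S : BigKeyEncryption) (A : Cmd) (lam n ℓ : ℕ) (aux : List (List Bool))
    (T : ℕ) : Prop :=
  ∀ st ∈ (gen S lam n ℓ).support, ∀ c : Bool, ∀ x ∈ (samp S lam st c).support,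
    ∀ f : List Bool → PMF Bool,
      HaltsWithin (bitOracle f) T A (attackInput lam st c x aux) ∧
        ∀ s ∈ (final (bitOracle f) A (attackInput lam st c x aux)).support, AllowedOutput x s

/-- `Pr[C_h(A^{C_h}(Samp_st(1 - b))) = b]`. -/
noncomputable def foolProb (S : BigKeyEncryption) (C A : Cmd) (lam : ℕ) {n : ℕ} (st : State n)
    (h : List Bool) (aux : List (List Bool)) (b : Bool) : ℝ :=
  prob ((samp S lam st (!b)).bind fun x =>
    (final (bitOracle (classify C lam h)) A (attackInput lam st (!b) x aux)).bind fun s =>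
      classify C lam h (s 0)) (· = b)

/-- The gap `|Pr[C_h(Samp_st(b)) = b] - Pr[C_h(A^{C_h}(Samp_st(1 - b))) = b]|`. -/
noncomputable def gap (S : BigKeyEncryption) (C A : Cmd) (lam : ℕ) {n : ℕ} (st : State n)
    (h : List Bool) (aux : List (List Bool)) (b : Bool) : ℝ :=
  |hitProb S C lam st h b - foolProb S C A lam st h aux b|

/-- Negligible functions of the security parameter. -/
def Negligible (f : ℕ → ℝ) : Prop :=
  Asymptotics.SuperpolynomialDecay atTop (fun lam : ℕ => (lam : ℝ)) f

/-- The task is weakly robustly `(ε, δ, γ, η)`-PAC-learnable with models of at most `B` bits, where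
the target metric is chosen adaptively: some PPT pair `(L, C)` is an `(ε, δ)`-PAC learner, and
every PPT adversary, for either class `b`, has gap more than `γ` except with probability `η`. -/
def WeaklyRobustlyLearnable (S : BigKeyEncryption) (n ℓ : ℕ → ℕ) (B : ℕ → ℝ)
    (ε δ γ η : ℕ → ℝ) : Prop :=
  ∃ L C : Cmd, IsLearner S n ℓ L ∧ IsClassifier C ∧ ModelSizeAtMost S n ℓ L B ∧
    (∀ᶠ lam in atTop,
      1 - δ lam ≤ prob (genLearn S L lam (n lam) (ℓ lam))
        (fun o => ε lam ≤ advantage S C lam o.1 o.2)) ∧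
    ∀ A : Cmd,
      (∃ p : Polynomial ℕ, ∀ lam, AttackWithin S A lam (n lam) (ℓ lam) [] (p.eval lam)) →
      ∀ b : Bool, ∀ᶠ lam in atTop,
        1 - η lam ≤ prob (genLearn S L lam (n lam) (ℓ lam))
          (fun o => γ lam < gap S C A lam o.1 o.2 [] b)

end RobustLearning

open RobustLearning

namespace RobustLearning

/-! ## Running programs with a time bound -/

/-! Let `c` be the class of the given sample; the attack should make the classifier behave as on
class `!c`. A hybrid sample encrypts `c` under the flagged keys and `!c` under all others. The
attack starts from the hybrid without flags and goes through the features in order. For each it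
estimates, by asking the classifier about hybrids that it encrypts itself, how much flagging this
feature would change the answer. A feature with small estimated influence is flagged, which means
that it is protected and kept from the sample. A feature with large estimated influence stays
unflagged and is overwritten by a fresh encryption of `!c`. Two budgets force exactly `⌈n/2⌉`
protected features, so at most `⌊n/2⌋` entries change, at weight `1/n` each. The flags do not depend
on the sample, hence the perturbed sample is distributed as a hybrid with the chosen flags
(`MixesSamples.fool_eq`), and the gap telescopes into the influences of the protected features.

The greedy choice can lose much only if its `⌊n/2⌋` unprotected places are used up and another
influential feature follows. `mean_greedyDist_le` shows that this does not happen, up to errors of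
the tests and rare surprises, when the features that can become influential lie in a set of at most
`⌊n/2⌋` indices. The set used is `visible`.

If a feature is influential, the classifier distinguishes encryptions of the two bits in that
coordinate. The reduction plants its key pair at a random coordinate among keys of its own, runs the
learner and the greedy choice, and leaks the model together with the hybrid on which this coordinate
was decided. Its second half inserts the challenge ciphertext there and asks the classifier.
Key-knowledge security then yields an extractor that finds the secret key from the model, the hybrid
and the public key (`mean_failure_le`). Given the public keys and the model, the hybrid is drawn
without secret keys. So with high probability every visible secret key is a point of mass at least
`1/M` of a distribution that depends only on the model and the public keys (`card_visible_le_hits`).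

A distribution has at most `M` such points, and a uniform secret key falls into a fixed set of them
with probability at most `M · 2^(-ℓ)`. Dependence on the public keys costs a factor `2^(p+1)` for
each key, and dependence on the model a union bound over the strings of at most `nℓ/2` bits.
Predicting `⌊n/2⌋ + 1` secret keys saves more than these costs because `ℓ ≥ (n+1)(p+λ)`
(`mean_pow_hits_le`, `two_pow_mul_le`, `pr_hits_le`). Hence more than `⌊n/2⌋` visible features are
unlikely.

The extractor's accuracy `1/Q` occurs in the analysis but not in the attack, so `Q` may be an
arbitrarily large polynomial and the failure probability is negligible (`negligible_gap`). For the
second part the attack first computes a polynomial upper bound for `1/γ` by itself; its gap then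
exceeds `γ` only with vanishing probability.

All adversaries are concrete programs. The predicate `Runs` gives a time bound together with the
distribution of the final store, and the rules for it carry the programs of the attack
(`runs_attack`) and of the reduction (`runs_leak`, `runs_guess`). -/

theorem bind_congr_support {α β : Type} {μ : PMF α} {f g : α → PMF β}
    (h : ∀ a ∈ μ.support, f a = g a) : μ.bind f = μ.bind g := by
  ext b
  simp only [PMF.bind_apply]
  refine tsum_congr fun a => ?_
  by_cases ha : μ a = 0
  · simp [ha]
  · rw [h a ((PMF.mem_support_iff _ _).2 ha)]

theorem map_congr_support {α β : Type} {μ : PMF α} {f g : α → β}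
    (h : ∀ a ∈ μ.support, f a = g a) : μ.map f = μ.map g := by
  unfold PMF.map
  exact bind_congr_support fun a ha => by simp [h a ha]

theorem bind_const' {α β : Type} (μ : PMF α) (ν : PMF β) : (μ.bind fun _ => ν) = ν := by
  simp

/-- A run that is cut off after `m` rounds has spent at least one step per round and one more at the
end. If no run takes more than `m` steps, then none is cut off, and permitting further rounds
changes nothing. The body may be exchanged at the same time, because it is only entered where its
own bound follows from the total. -/
theorem iterate_stable {r : ℕ} {b b' : Store → PMF (Store × ℕ)} {T : ℕ}
    (hb : ∀ s, (∀ u ∈ (b s).support, u.2 ≤ T) → b' s = b s) :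
    ∀ m m', m ≤ m' → m ≤ T → ∀ s, (∀ u ∈ (iterate r b m s).support, u.2 ≤ m) →
      iterate r b' m' s = iterate r b m s := by
  intro m
  induction m with
  | zero =>
    intro m' _ _ s h
    have := h (s, 1) (by simp [iterate])
    simp at this
  | succ m ih =>
    intro m' hm hT s h
    obtain ⟨m', rfl⟩ : ∃ k, m' = k + 1 := ⟨m' - 1, by omega⟩
    by_cases hs : s r = []
    · simp [iterate, hs]
    · simp only [iterate, hs, if_false] at h ⊢
      have key : ∀ u ∈ (b s).support, ∀ v ∈ (iterate r b m u.1).support,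
          u.2 + v.2 + 1 ≤ m + 1 := by
        intro u hu v hv
        refine h (v.1, u.2 + v.2 + 1) ?_
        rw [PMF.mem_support_bind_iff]
        exact ⟨u, hu, by rw [PMF.mem_support_map_iff]; exact ⟨v, hv, rfl⟩⟩
      have h1 : b' s = b s := hb s fun u hu => by
        -- The bound on the sum bounds the first summand because some continuation is possible.
        obtain ⟨v, hv⟩ := (iterate r b m u.1).support_nonempty
        have := key u hu v hv
        omega
      rw [h1]
      refine bind_congr_support fun u hu => ?_
      rw [ih m' (by omega) (by omega) u.1 fun v hv => by have := key u hu v hv; omega]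

/-- A time bound that holds for the cut-off at the bound itself holds for the uncut program. -/
theorem exec_stable {O : Oracle} {T T' : ℕ} (hT : T ≤ T') : ∀ (P : Cmd) (s : Store),
    (∀ u ∈ (exec O T P s).support, u.2 ≤ T) → exec O T' P s = exec O T P s := by
  intro P
  induction P with
  | skip => intros; rfl
  | push => intros; rfl
  | pop => intros; rfl
  | flip => intros; rfl
  | query => intros; rfl
  | seq c d ihc ihd =>
    intro s h
    simp only [exec] at h ⊢
    have key : ∀ u ∈ (exec O T c s).support, ∀ v ∈ (exec O T d u.1).support, u.2 + v.2 ≤ T := by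
      intro u hu v hv
      refine h (v.1, u.2 + v.2) ?_
      rw [PMF.mem_support_bind_iff]
      exact ⟨u, hu, by rw [PMF.mem_support_map_iff]; exact ⟨v, hv, rfl⟩⟩
    rw [ihc s fun u hu => by
      obtain ⟨v, hv⟩ := (exec O T d u.1).support_nonempty
      have := key u hu v hv
      omega]
    refine bind_congr_support fun u hu => ?_
    rw [ihd u.1 fun v hv => by have := key u hu v hv; omega]
  | branch r a b c iha ihb ihc =>
    intro s h
    simp only [exec] at h ⊢
    have key : ∀ μ : PMF (Store × ℕ), (∀ u ∈ (μ.map fun u : Store × ℕ => (u.1, u.2 + 1)).support,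
        u.2 ≤ T) → ∀ u ∈ μ.support, u.2 ≤ T := by
      intro μ hμ u hu
      have := hμ (u.1, u.2 + 1) (by rw [PMF.mem_support_map_iff]; exact ⟨u, hu, rfl⟩)
      simp only at this
      omega
    rcases hr : s r with _ | ⟨_ | _, _⟩ <;> simp only [hr] at h ⊢
    · rw [iha s (key _ h)]
    · rw [ihb s (key _ h)]
    · rw [ihc s (key _ h)]
  | loop r body ih =>
    intro s h
    simp only [exec] at h ⊢
    exact iterate_stable ih T T' hT le_rfl s h

/-- With oracle `O`, the program `P` started in `s` always stops within `t` steps, and the final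
store has distribution `μ`. -/
def Runs (O : Oracle) (P : Cmd) (s : Store) (t : ℕ) (μ : PMF Store) : Prop :=
  (∀ u ∈ (exec O t P s).support, u.2 ≤ t) ∧ (exec O t P s).map Prod.fst = μ

/-! ### Composition rules for runs with a time bound. -/

namespace Runs

variable {O : Oracle} {P Q c d : Cmd} {s : Store} {t t' : ℕ} {μ ν : PMF Store}

theorem exec_eq (h : Runs O P s t μ) (hT : t ≤ t') : exec O t' P s = exec O t P s :=
  exec_stable hT P s h.1

theorem mono (h : Runs O P s t μ) (ht : t ≤ t') : Runs O P s t' μ := by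
  refine ⟨?_, ?_⟩
  · rw [h.exec_eq ht]
    exact fun u hu => (h.1 u hu).trans ht
  · rw [h.exec_eq ht, h.2]

theorem congr (h : Runs O P s t μ) (hμ : μ = ν) : Runs O P s t ν := hμ ▸ h

/-- `final` uses the least admissible cut-off; by `exec_stable` any other admissible one gives the
same distribution. -/
theorem of_haltsWithin {xs : List (List Bool)} (h : HaltsWithin O t P xs) :
    Runs O P (load xs) t (final O P xs) := by
  classical
  refine ⟨h, ?_⟩
  have hex : ∃ T, HaltsWithin O T P xs := ⟨t, h⟩
  rw [final, dif_pos hex, exec_stable (Nat.find_min' hex h) P _ (Nat.find_spec hex)]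

theorem haltsWithin {xs : List (List Bool)} (h : Runs O P (load xs) t μ) :
    HaltsWithin O t P xs := h.1

theorem final_eq {xs : List (List Bool)} (h : Runs O P (load xs) t μ) : final O P xs = μ := by
  rw [← (of_haltsWithin h.haltsWithin).2, h.2]

theorem skip : Runs O .skip s 1 (PMF.pure s) := by
  simp [Runs, exec, PMF.pure_map]

theorem push {r : ℕ} {b : Bool} :
    Runs O (.push r b) s 1 (PMF.pure (Function.update s r (b :: s r))) := by
  simp [Runs, exec, PMF.pure_map]

theorem pop {r : ℕ} : Runs O (.pop r) s 1 (PMF.pure (Function.update s r (s r).tail)) := by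
  simp [Runs, exec, PMF.pure_map]

theorem flip {r : ℕ} : Runs O (.flip r) s 1
    ((PMF.uniformOfFintype Bool).map fun b => Function.update s r (b :: s r)) := by
  constructor
  · intro u hu
    simp only [exec, PMF.mem_support_map_iff] at hu
    obtain ⟨b, -, rfl⟩ := hu
    simp
  · simp [exec, PMF.map_comp, Function.comp_def]

theorem query {q r : ℕ} : Runs O (.query q r) s 1
    ((O (s q)).map fun a => Function.update s r a) := by
  constructor
  · intro u hu
    simp only [exec, PMF.mem_support_map_iff] at hu
    obtain ⟨b, -, rfl⟩ := hu
    simp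
  · simp [exec, PMF.map_comp, Function.comp_def]

/-- The intermediate store is a function `g` of a random outcome `a`, so the second program can be
analysed separately for each outcome, even when `a` is not recoverable from the store. -/
theorem seq {α : Type} {μ : PMF α} {g : α → Store} {ν : α → PMF Store}
    (hc : Runs O c s t (μ.map g)) (hd : ∀ a ∈ μ.support, Runs O d (g a) t' (ν a)) :
    Runs O (.seq c d) s (t + t') (μ.bind ν) := by
  have hsupp : ∀ u ∈ (exec O t c s).support, ∃ a ∈ μ.support, g a = u.1 := by
    intro u hu
    have : u.1 ∈ ((exec O t c s).map Prod.fst).support := by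
      rw [PMF.mem_support_map_iff]; exact ⟨u, hu, rfl⟩
    rw [hc.2, PMF.mem_support_map_iff] at this
    exact this
  constructor
  · intro u hu
    simp only [exec, PMF.mem_support_bind_iff, PMF.mem_support_map_iff] at hu
    obtain ⟨v, hv, w, hw, rfl⟩ := hu
    rw [hc.exec_eq (by omega)] at hv
    obtain ⟨a, ha, hga⟩ := hsupp v hv
    rw [← hga, (hd a ha).exec_eq (by omega)] at hw
    have := hc.1 v hv
    have := (hd a ha).1 w hw
    simp only
    omega
  · simp only [exec, PMF.map_bind, PMF.map_comp]
    rw [hc.exec_eq (by omega)]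
    have h1 : ((exec O t c s).bind fun u => (exec O (t + t') d u.1).map Prod.fst) =
        ((exec O t c s).map Prod.fst).bind fun s' => (exec O (t + t') d s').map Prod.fst := by
      rw [PMF.bind_map]; rfl
    have h2 : (Prod.fst ∘ fun v : Store × ℕ => (v.1, (0 : ℕ) + v.2)) = Prod.fst := rfl
    simp only [Function.comp_def]
    change ((exec O t c s).bind fun u => (exec O (t + t') d u.1).map Prod.fst) = _
    rw [h1, hc.2, PMF.bind_map]
    refine bind_congr_support fun a ha => ?_
    simp only [Function.comp]
    rw [(hd a ha).exec_eq (by omega), (hd a ha).2]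

theorem seq_pure {s' : Store} (hc : Runs O c s t (PMF.pure s')) (hd : Runs O d s' t' ν) :
    Runs O (.seq c d) s (t + t') ν := by
  have := seq (d := d) (t' := t') (μ := PMF.pure s') (g := id) (ν := fun _ => ν)
    (by simpa [PMF.map_id] using hc) (by intro a ha; simp at ha; subst ha; exact hd)
  simpa using this

theorem seqp {s' : Store} {T : ℕ} (hc : Runs O c s t (PMF.pure s')) (hd : Runs O d s' t' ν)
    (hT : t + t' ≤ T) : Runs O (.seq c d) s T ν := (seq_pure hc hd).mono hT

/-- A deterministic step after a random one. -/
theorem seq_map {α : Type} {μ : PMF α} {g g' : α → Store}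
    (hc : Runs O c s t (μ.map g)) (hd : ∀ a ∈ μ.support, Runs O d (g a) t' (PMF.pure (g' a))) :
    Runs O (.seq c d) s (t + t') (μ.map g') :=
  seq hc hd

theorem branch {r : ℕ} {a b c : Cmd}
    (h : Runs O (match s r with | [] => a | false :: _ => b | true :: _ => c) s t μ) :
    Runs O (.branch r a b c) s (t + 1) μ := by
  have key : exec O (t + 1) (.branch r a b c) s =
      (exec O t (match s r with | [] => a | false :: _ => b | true :: _ => c) s).map
        fun u : Store × ℕ => (u.1, u.2 + 1) := by
    rw [← h.exec_eq (Nat.le_succ t)]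
    simp only [exec]
    rcases s r with _ | ⟨_ | _, _⟩ <;> rfl
  constructor
  · intro u hu
    rw [key, PMF.mem_support_map_iff] at hu
    obtain ⟨v, hv, rfl⟩ := hu
    simpa using h.1 v hv
  · rw [key, PMF.map_comp, ← h.2]; rfl

theorem branch_nil {r : ℕ} {a b c : Cmd} (hr : s r = []) (h : Runs O a s t μ) :
    Runs O (.branch r a b c) s (t + 1) μ := branch (by rw [hr]; exact h)

theorem branch_false {r : ℕ} {a b c : Cmd} {l : List Bool} (hr : s r = false :: l)
    (h : Runs O b s t μ) : Runs O (.branch r a b c) s (t + 1) μ := branch (by rw [hr]; exact h)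

theorem branch_true {r : ℕ} {a b c : Cmd} {l : List Bool} (hr : s r = true :: l)
    (h : Runs O c s t μ) : Runs O (.branch r a b c) s (t + 1) μ := branch (by rw [hr]; exact h)

theorem loop_nil {r : ℕ} {body : Cmd} (hr : s r = []) :
    Runs O (.loop r body) s 1 (PMF.pure s) := by
  simp [Runs, exec, iterate, hr, PMF.pure_map]

/-- Unrolls one round and charges one step for the test. The rest of the loop is known with cut-off
`t'` but occurs here with `t + t'` rounds; `iterate_stable` reconciles the two. -/
theorem loop_cons {α : Type} {r : ℕ} {body : Cmd} {μ : PMF α} {g : α → Store} {ν : α → PMF Store}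
    (hr : s r ≠ []) (hb : Runs O body s t (μ.map g))
    (hl : ∀ a ∈ μ.support, Runs O (.loop r body) (g a) t' (ν a)) :
    Runs O (.loop r body) s (t + t' + 1) (μ.bind ν) := by
  have hsupp : ∀ u ∈ (exec O t body s).support, ∃ a ∈ μ.support, g a = u.1 := by
    intro u hu
    have : u.1 ∈ ((exec O t body s).map Prod.fst).support := by
      rw [PMF.mem_support_map_iff]; exact ⟨u, hu, rfl⟩
    rw [hb.2, PMF.mem_support_map_iff] at this
    exact this
  have hit : ∀ a ∈ μ.support, iterate r (exec O (t + t' + 1) body) (t + t') (g a) =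
      iterate r (exec O t' body) t' (g a) := fun a ha =>
    iterate_stable (fun s h => exec_stable (by omega) body s h) t' (t + t') (by omega) le_rfl _
      (hl a ha).1
  constructor
  · intro u hu
    simp only [exec, iterate, hr, if_false, PMF.mem_support_bind_iff,
      PMF.mem_support_map_iff] at hu
    obtain ⟨v, hv, w, hw, rfl⟩ := hu
    rw [hb.exec_eq (by omega)] at hv
    obtain ⟨a, ha, hga⟩ := hsupp v hv
    rw [← hga, hit a ha] at hw
    have := hb.1 v hv
    have := (hl a ha).1 w hw
    simp only
    omega
  · simp only [exec, iterate, hr, if_false, PMF.map_bind, PMF.map_comp]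
    rw [hb.exec_eq (by omega)]
    change ((exec O t body s).bind fun u =>
      (iterate r (exec O (t + t' + 1) body) (t + t') u.1).map Prod.fst) = _
    have h1 : ((exec O t body s).bind fun u =>
        (iterate r (exec O (t + t' + 1) body) (t + t') u.1).map Prod.fst) =
        ((exec O t body s).map Prod.fst).bind fun s' =>
          (iterate r (exec O (t + t' + 1) body) (t + t') s').map Prod.fst := by
      rw [PMF.bind_map]; rfl
    rw [h1, hb.2, PMF.bind_map]
    refine bind_congr_support fun a ha => ?_
    simp only [Function.comp]
    rw [hit a ha]
    exact (hl a ha).2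

theorem loop_cons_pure {r : ℕ} {body : Cmd} {s' : Store}
    (hr : s r ≠ []) (hb : Runs O body s t (PMF.pure s'))
    (hl : Runs O (.loop r body) s' t' ν) :
    Runs O (.loop r body) s (t + t' + 1) ν := by
  have := loop_cons (body := body) (t' := t') (μ := PMF.pure s') (g := id) (ν := fun _ => ν) hr
    (by simpa [PMF.map_id] using hb) (by intro a ha; simp at ha; subst ha; exact hl)
  simpa using this

theorem loopp {r : ℕ} {body : Cmd} {s' : Store} {T : ℕ}
    (hr : s r ≠ []) (hb : Runs O body s t (PMF.pure s'))
    (hl : Runs O (.loop r body) s' t' ν) (hT : t + t' + 1 ≤ T) :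
    Runs O (.loop r body) s T ν := (loop_cons_pure hr hb hl).mono hT

theorem congr_store {s₁ s₂ : Store} (h : Runs O P s t (PMF.pure s₁)) (hs : s₁ = s₂) :
    Runs O P s t (PMF.pure s₂) := hs ▸ h

end Runs

/-! ## Growth of registers -/

/-- Invariant principle for loops: `R` relates the start, the elapsed time and the end. It has to
hold for stopping at once and to survive a further round in front. -/
theorem iterate_support {r : ℕ} {b : Store → PMF (Store × ℕ)} {R : Store → ℕ → Store → Prop}
    (h0 : ∀ s, R s 1 s)
    (hb : ∀ s, ∀ u ∈ (b s).support, ∀ t s'', R u.1 t s'' → R s (u.2 + t + 1) s'') :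
    ∀ m s, ∀ u ∈ (iterate r b m s).support, R s u.2 u.1 := by
  intro m
  induction m with
  | zero => intro s u hu; simp [iterate] at hu; subst hu; exact h0 s
  | succ m ih =>
    intro s u hu
    by_cases hs : s r = []
    · simp [iterate, hs] at hu; subst hu; exact h0 s
    · simp only [iterate, hs, if_false, PMF.mem_support_bind_iff, PMF.mem_support_map_iff] at hu
      obtain ⟨v, hv, w, hw, rfl⟩ := hu
      exact hb s v hv _ _ (ih _ _ hw)

/-- One instruction lengthens a register by at most one bit; for queries this holds because
`noOracle` answers with the empty string. The outputs of a called program are thereby bounded by its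
running time. -/
theorem length_le_of_mem_support_exec {T : ℕ} (P : Cmd) : ∀ (s : Store),
    ∀ u ∈ (exec noOracle T P s).support, ∀ i, (u.1 i).length ≤ (s i).length + u.2 := by
  have aux : ∀ (s : Store) (r : ℕ) (x : List Bool) (i : ℕ), x.length ≤ (s r).length + 1 →
      (Function.update s r x i).length ≤ (s i).length + 1 := by
    intro s r x i h
    by_cases hi : i = r
    · subst hi; simpa using h
    · simp [hi]
  induction P with
  | skip => intro s u hu i; simp [exec] at hu; subst hu; simp
  | push r b => intro s u hu i; simp [exec] at hu; subst hu; exact aux _ _ _ _ (by simp)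
  | pop r => intro s u hu i; simp [exec] at hu; subst hu; exact aux _ _ _ _ (by simp; omega)
  | flip r =>
    intro s u hu i
    simp only [exec, PMF.mem_support_map_iff] at hu
    obtain ⟨b, -, rfl⟩ := hu
    exact aux _ _ _ _ (by simp)
  | query q r =>
    intro s u hu i
    simp only [exec, PMF.mem_support_map_iff, noOracle] at hu
    obtain ⟨b, hb, rfl⟩ := hu
    simp at hb
    exact aux _ _ _ _ (by simp [hb])
  | seq c d ihc ihd =>
    intro s u hu i
    simp only [exec, PMF.mem_support_bind_iff, PMF.mem_support_map_iff] at hu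
    obtain ⟨v, hv, w, hw, rfl⟩ := hu
    have := ihc _ _ hv i
    have := ihd _ _ hw i
    simp only
    omega
  | branch r a b c iha ihb ihc =>
    intro s u hu i
    simp only [exec, PMF.mem_support_map_iff] at hu
    obtain ⟨v, hv, rfl⟩ := hu
    have : (v.1 i).length ≤ (s i).length + v.2 := by
      rcases hr : s r with _ | ⟨_ | _, _⟩ <;> simp only [hr] at hv
      · exact iha _ _ hv i
      · exact ihb _ _ hv i
      · exact ihc _ _ hv i
    simp only
    omega
  | loop r body ih =>
    intro s u hu
    simp only [exec] at hu
    refine iterate_support (R := fun s t s' => ∀ i, (s' i).length ≤ (s i).length + t)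
      (by simp) ?_ T s u hu
    intro s u hu t s'' h i
    have := ih _ _ hu i
    have := h i
    omega

theorem length_le_of_mem_support_final {P : Cmd} {xs : List (List Bool)} {T : ℕ}
    (h : HaltsWithin noOracle T P xs) {v : Store} (hv : v ∈ (final noOracle P xs).support) (i : ℕ) :
    (v i).length ≤ (load xs i).length + T := by
  rw [← (Runs.of_haltsWithin h).2, PMF.mem_support_map_iff] at hv
  obtain ⟨u, hu, rfl⟩ := hv
  have := length_le_of_mem_support_exec P _ u hu i
  have := h u hu
  omega

/-! ## Registers that a program does not use -/

/-- A bound on the registers that occur in a program. -/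
def Cmd.width : Cmd → ℕ
  | .skip => 0
  | .push r _ => r + 1
  | .pop r => r + 1
  | .flip r => r + 1
  | .query q r => max q r + 1
  | .seq c d => max c.width d.width
  | .branch r a b c => max (r + 1) (max a.width (max b.width c.width))
  | .loop r c => max (r + 1) c.width

/-- Needed to clean up after a call: only finitely many registers can have been touched. -/
theorem eq_of_width_le {O : Oracle} {T : ℕ} (P : Cmd) : ∀ (s : Store),
    ∀ u ∈ (exec O T P s).support, ∀ i, P.width ≤ i → u.1 i = s i := by
  induction P with
  | skip => intro s u hu i _; simp [exec] at hu; subst hu; simp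
  | push r b =>
    intro s u hu i hi; simp [exec] at hu; subst hu; simp only [Cmd.width] at hi
    exact Function.update_of_ne (by omega) _ _
  | pop r =>
    intro s u hu i hi; simp [exec] at hu; subst hu; simp only [Cmd.width] at hi
    exact Function.update_of_ne (by omega) _ _
  | flip r =>
    intro s u hu i hi
    simp only [exec, PMF.mem_support_map_iff] at hu
    obtain ⟨b, -, rfl⟩ := hu
    simp only [Cmd.width] at hi
    exact Function.update_of_ne (by omega) _ _
  | query q r =>
    intro s u hu i hi
    simp only [exec, PMF.mem_support_map_iff] at hu
    obtain ⟨b, -, rfl⟩ := hu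
    simp only [Cmd.width] at hi
    exact Function.update_of_ne (by omega) _ _
  | seq c d ihc ihd =>
    intro s u hu i hi
    simp only [exec, PMF.mem_support_bind_iff, PMF.mem_support_map_iff] at hu
    obtain ⟨v, hv, w, hw, rfl⟩ := hu
    simp only [Cmd.width] at hi
    exact (ihd _ _ hw i (by omega)).trans (ihc _ _ hv i (by omega))
  | branch r a b c iha ihb ihc =>
    intro s u hu i hi
    simp only [exec, PMF.mem_support_map_iff] at hu
    obtain ⟨v, hv, rfl⟩ := hu
    simp only [Cmd.width] at hi
    rcases hr : s r with _ | ⟨_ | _, _⟩ <;> simp only [hr] at hv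
    · exact iha _ _ hv i (by omega)
    · exact ihb _ _ hv i (by omega)
    · exact ihc _ _ hv i (by omega)
  | loop r body ih =>
    intro s u hu i hi
    simp only [Cmd.width] at hi
    simp only [exec] at hu
    exact iterate_support (R := fun s _ s' => s' i = s i) (by simp)
      (fun s u hu t s'' h => h.trans (ih _ _ hu i (by omega))) T s u hu

theorem final_eq_of_width_le {O : Oracle} {P : Cmd} {xs : List (List Bool)} {T : ℕ}
    (h : HaltsWithin O T P xs) {v : Store} (hv : v ∈ (final O P xs).support) {i : ℕ}
    (hi : P.width ≤ i) : v i = load xs i := by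
  rw [← (Runs.of_haltsWithin h).2, PMF.mem_support_map_iff] at hv
  obtain ⟨u, hu, rfl⟩ := hv
  exact eq_of_width_le P _ u hu i hi

/-! ## Programs as parts of other programs -/

/-- The program with renamed registers and with its queries replaced by programs. -/
def Cmd.rename (ρ : ℕ → ℕ) (ask : ℕ → ℕ → Cmd) : Cmd → Cmd
  | .skip => .skip
  | .push r b => .push (ρ r) b
  | .pop r => .pop (ρ r)
  | .flip r => .flip (ρ r)
  | .query q r => ask q r
  | .seq c d => .seq (c.rename ρ ask) (d.rename ρ ask)
  | .branch r a b c => .branch (ρ r) (a.rename ρ ask) (b.rename ρ ask) (c.rename ρ ask)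
  | .loop r c => .loop (ρ r) (c.rename ρ ask)

/-- A time bound for the renamed program, where `Q` bounds the time for a query and `T` the time of
the original program. -/
def Cmd.renameTime (Q T : ℕ) : Cmd → ℕ
  | .skip => 1
  | .push _ _ => 1
  | .pop _ => 1
  | .flip _ => 1
  | .query _ _ => Q
  | .seq c d => c.renameTime Q T + d.renameTime Q T
  | .branch _ a b c => a.renameTime Q T + b.renameTime Q T + c.renameTime Q T + 1
  | .loop _ c => T * (c.renameTime Q T + 1) + 1

theorem update_extend {ρ : ℕ → ℕ} (hρ : Function.Injective ρ) (v s : Store) (r : ℕ)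
    (x : List Bool) :
    Function.update (Function.extend ρ v s) (ρ r) x =
      Function.extend ρ (Function.update v r x) s := by
  funext i
  by_cases hi : ∃ k, ρ k = i
  · obtain ⟨k, rfl⟩ := hi
    by_cases hk : k = r
    · subst hk; simp [hρ.extend_apply]
    · rw [Function.update_of_ne (fun h => hk (hρ h)), hρ.extend_apply, hρ.extend_apply,
        Function.update_of_ne hk]
  · rw [Function.extend_apply' _ _ _ hi, Function.update_of_ne, Function.extend_apply' _ _ _ hi]
    rintro rfl
    exact hi ⟨r, rfl⟩

/-- In `Function.extend ρ v s` the callee's registers `v` sit on the range of `ρ`, and everything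
else stays frozen at the caller's `s`. A query turns into a run of `ask`, which has to preserve `s`.
The callee's own time bound `T` limits the rounds of each of its loops. -/
theorem Runs.rename {O O' : Oracle} {ρ : ℕ → ℕ} (hρ : Function.Injective ρ) {ask : ℕ → ℕ → Cmd}
    {s : Store} {Q T : ℕ}
    (hask : ∀ q r v, Runs O' (ask q r) (Function.extend ρ v s) Q
      ((O (v q)).map fun a => Function.extend ρ (Function.update v r a) s)) :
    ∀ (P : Cmd) (v : Store), (∀ u ∈ (exec O T P v).support, u.2 ≤ T) →
      Runs O' (P.rename ρ ask) (Function.extend ρ v s) (P.renameTime Q T)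
        ((exec O T P v).map fun u => Function.extend ρ u.1 s) := by
  intro P
  induction P with
  | skip => intro v _; exact Runs.skip.congr (by simp [exec, PMF.pure_map])
  | push r b =>
    intro v _
    exact Runs.push.congr (by simp [exec, PMF.pure_map, update_extend hρ, hρ.extend_apply])
  | pop r =>
    intro v _
    exact Runs.pop.congr (by simp [exec, PMF.pure_map, update_extend hρ, hρ.extend_apply])
  | flip r =>
    intro v _
    exact Runs.flip.congr (by
      simp [exec, PMF.map_comp, Function.comp_def, update_extend hρ, hρ.extend_apply])
  | query q r =>
    intro v _
    exact (hask q r v).congr (by simp [exec, PMF.map_comp, Function.comp_def])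
  | seq c d ihc ihd =>
    intro v h
    have key : ∀ u ∈ (exec O T c v).support, ∀ w ∈ (exec O T d u.1).support, u.2 + w.2 ≤ T := by
      intro u hu w hw
      refine h (w.1, u.2 + w.2) ?_
      simp only [exec]
      rw [PMF.mem_support_bind_iff]
      exact ⟨u, hu, by rw [PMF.mem_support_map_iff]; exact ⟨w, hw, rfl⟩⟩
    have hc := ihc v fun u hu => by
      obtain ⟨w, hw⟩ := (exec O T d u.1).support_nonempty
      have := key u hu w hw
      omega
    refine (Runs.seq hc fun u hu => ihd u.1 fun w hw => by
      have := key u hu w hw; omega).congr ?_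
    simp only [exec, PMF.map_bind, PMF.map_comp, Function.comp_def]
  | branch r a b c iha ihb ihc =>
    intro v h
    have key : ∀ μ : PMF (Store × ℕ), (∀ u ∈ (μ.map fun u : Store × ℕ => (u.1, u.2 + 1)).support,
        u.2 ≤ T) → ∀ u ∈ μ.support, u.2 ≤ T := by
      intro μ hμ u hu
      have := hμ (u.1, u.2 + 1) (by rw [PMF.mem_support_map_iff]; exact ⟨u, hu, rfl⟩)
      simp only at this
      omega
    simp only [exec] at h ⊢
    simp only [PMF.map_comp, Function.comp_def]
    simp only [Cmd.rename, Cmd.renameTime]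
    have hx : ∀ r, Function.extend ρ v s (ρ r) = v r := fun r => hρ.extend_apply _ _ _
    rcases hr : v r with _ | ⟨_ | _, _⟩ <;> simp only [hr] at h ⊢
    · exact ((iha v (key _ h)).mono (by omega)).branch_nil ((hx r).trans hr)
    · exact ((ihb v (key _ h)).mono (by omega)).branch_false ((hx r).trans hr)
    · exact ((ihc v (key _ h)).mono (by omega)).branch_true ((hx r).trans hr)
  | loop r body ih =>
    intro v h
    simp only [exec] at h ⊢
    simp only [Cmd.rename, Cmd.renameTime]
    -- Induction on the number of rounds still permitted, while the body remains cut off at the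
    -- fixed `T`.
    have main : ∀ m ≤ T, ∀ v, (∀ u ∈ (iterate r (exec O T body) m v).support, u.2 ≤ m) →
        Runs O' (.loop (ρ r) (body.rename ρ ask)) (Function.extend ρ v s)
          (m * (body.renameTime Q T + 1) + 1)
          ((iterate r (exec O T body) m v).map fun u => Function.extend ρ u.1 s) := by
      intro m
      induction m with
      | zero =>
        intro _ v h
        have := h (v, 1) (by simp [iterate])
        simp at this
      | succ m ihm =>
        intro hm v h
        have hx : Function.extend ρ v s (ρ r) = v r := hρ.extend_apply _ _ _
        by_cases hv : v r = []
        · simp only [iterate, hv, if_true, PMF.pure_map]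
          exact (Runs.loop_nil (hx.trans hv)).mono (by omega)
        · simp only [iterate, hv, if_false] at h ⊢
          have key : ∀ u ∈ (exec O T body v).support,
              ∀ w ∈ (iterate r (exec O T body) m u.1).support, u.2 + w.2 + 1 ≤ m + 1 := by
            intro u hu w hw
            refine h (w.1, u.2 + w.2 + 1) ?_
            rw [PMF.mem_support_bind_iff]
            exact ⟨u, hu, by rw [PMF.mem_support_map_iff]; exact ⟨w, hw, rfl⟩⟩
          have hb := ih v fun u hu => by
            obtain ⟨w, hw⟩ := (iterate r (exec O T body) m u.1).support_nonempty
            have := key u hu w hw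
            omega
          refine ((Runs.loop_cons (by rwa [hx]) hb fun u hu => ihm (by omega) u.1 fun w hw => by
            have := key u hu w hw; omega).mono ?_).congr ?_
          · rw [Nat.add_mul]; omega
          · simp only [PMF.map_bind, PMF.map_comp, Function.comp_def]
    exact main T le_rfl v h

open Function (update)
/-! ## Polynomially bounded functions -/

/-- The function is bounded by a polynomial. -/
@[fun_prop]
def PolyBounded (f : ℕ → ℕ) : Prop := ∃ p : Polynomial ℕ, ∀ x, f x ≤ p.eval x

theorem monotone_eval (p : Polynomial ℕ) : Monotone fun x => p.eval x := by
  intro x y h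
  simp only [Polynomial.eval_eq_sum, Polynomial.sum]
  exact Finset.sum_le_sum fun i _ => Nat.mul_le_mul_left _ (Nat.pow_le_pow_left h i)

namespace PolyBounded

@[fun_prop]
theorem const (c : ℕ) : PolyBounded fun _ => c := ⟨Polynomial.C c, by simp⟩

@[fun_prop]
theorem id : PolyBounded fun x => x := ⟨Polynomial.X, by simp⟩

@[fun_prop]
theorem add {f g : ℕ → ℕ} (hf : PolyBounded f) (hg : PolyBounded g) :
    PolyBounded fun x => f x + g x := by
  obtain ⟨p, hp⟩ := hf
  obtain ⟨q, hq⟩ := hg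
  exact ⟨p + q, fun x => by simpa using Nat.add_le_add (hp x) (hq x)⟩

@[fun_prop]
theorem mul {f g : ℕ → ℕ} (hf : PolyBounded f) (hg : PolyBounded g) :
    PolyBounded fun x => f x * g x := by
  obtain ⟨p, hp⟩ := hf
  obtain ⟨q, hq⟩ := hg
  exact ⟨p * q, fun x => by simpa using Nat.mul_le_mul (hp x) (hq x)⟩

@[fun_prop]
theorem pow {f : ℕ → ℕ} (hf : PolyBounded f) (k : ℕ) : PolyBounded fun x => f x ^ k := by
  obtain ⟨p, hp⟩ := hf
  exact ⟨p ^ k, fun x => by simpa using Nat.pow_le_pow_left (hp x) k⟩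

@[fun_prop]
theorem comp {f g : ℕ → ℕ} (hf : PolyBounded f) (hg : PolyBounded g) :
    PolyBounded fun x => f (g x) := by
  obtain ⟨p, hp⟩ := hf
  obtain ⟨q, hq⟩ := hg
  exact ⟨p.comp q, fun x => by
    simpa using (hp _).trans (monotone_eval p (hq x))⟩

theorem eval (p : Polynomial ℕ) : PolyBounded fun x => p.eval x := ⟨p, fun _ => le_rfl⟩

theorem mono {f g : ℕ → ℕ} (hg : PolyBounded g) (h : ∀ x, f x ≤ g x) : PolyBounded f := by
  obtain ⟨p, hp⟩ := hg
  exact ⟨p, fun x => (h x).trans (hp x)⟩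

-- The nesting depth of the loops of a fixed program is a constant, so simulating it multiplies only
-- a fixed number of polynomial factors.
@[fun_prop]
theorem renameTime (P : Cmd) {Q T : ℕ → ℕ} (hQ : PolyBounded Q) (hT : PolyBounded T) :
    PolyBounded fun x => P.renameTime (Q x) (T x) := by
  induction P <;> simp only [Cmd.renameTime] <;> fun_prop

end PolyBounded

/-! ## Basic programs -/

infixr:60 " ;; " => Cmd.seq

/-- The answers of the oracle have at most one bit. -/
def ShortOracle (O : Oracle) : Prop := ∀ w, ∀ a ∈ (O w).support, a.length ≤ 1

theorem shortOracle_noOracle : ShortOracle noOracle := by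
  intro w a ha
  simp [noOracle] at ha
  simp [ha]

theorem shortOracle_bitOracle (f : List Bool → PMF Bool) : ShortOracle (bitOracle f) := by
  intro w a ha
  simp only [bitOracle, PMF.mem_support_map_iff] at ha
  obtain ⟨b, -, rfl⟩ := ha
  simp

/-- Empty a register in constant time: the answer to a query overwrites its content. -/
def clr (r : ℕ) : Cmd := .query r r ;; .pop r

/-- The answer has at most one bit and replaces the old content, however long that was; one pop
removes the answer. -/
theorem runs_clear_query {O : Oracle} (hO : ShortOracle O) (q r : ℕ) (s : Store) :
    Runs O (.query q r ;; .pop r) s 2 (PMF.pure (update s r [])) := by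
  refine (Runs.seq Runs.query (ν := fun _ => PMF.pure (update s r [])) (t' := 1)
    fun a ha => ?_).congr (by simp)
  have := hO _ a ha
  refine Runs.pop.congr ?_
  congr 1
  rcases a with _ | ⟨_, _ | _⟩ <;> simp_all

theorem runs_clr {O : Oracle} (hO : ShortOracle O) (r : ℕ) (s : Store) :
    Runs O (clr r) s 2 (PMF.pure (update s r [])) := runs_clear_query hO r r s

/-- Move the content of `a` on top of `b`, in reverse order. -/
def pour (a b : ℕ) : Cmd := .loop a (.branch a .skip (.push b false) (.push b true) ;; .pop a)

theorem runs_pour {O : Oracle} {a b : ℕ} (hab : a ≠ b) {x : List Bool} {s : Store}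
    (hx : s a = x) :
    Runs O (pour a b) s (4 * x.length + 1)
      (PMF.pure (update (update s a []) b (x.reverse ++ s b))) := by
  induction x generalizing s with
  | nil =>
    refine (Runs.loop_nil hx).congr_store ?_
    funext i
    grind [Function.update_apply]
  | cons y x ih =>
    have hb : Runs O (.branch a .skip (.push b false) (.push b true) ;; .pop a) s 3
        (PMF.pure (update (update s b (y :: s b)) a x)) := by
      refine Runs.seqp (t := 2) (t' := 1) (s' := update s b (y :: s b)) ?_ ?_ le_rfl
      · cases y
        · exact Runs.branch_false hx Runs.push
        · exact Runs.branch_true hx Runs.push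
      · exact Runs.pop.congr (by simp [hab, hx])
    refine (Runs.loopp (by simp [hx]) hb (ih (by simp)) ?_).congr_store ?_
    · simp; omega
    · funext i
      grind [Function.update_apply]

/-- Move the content of `a` on top of `b`. -/
def mv (a b : ℕ) : Cmd := pour a 10 ;; pour 10 b

theorem runs_mv {O : Oracle} {a b : ℕ} (hab : a ≠ b) (ha : a ≠ 10) (hb : b ≠ 10) {x : List Bool}
    {s : Store} (hx : s a = x) (h10 : s 10 = []) :
    Runs O (mv a b) s (8 * x.length + 2) (PMF.pure (update (update s a []) b (x ++ s b))) := by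
  refine (Runs.seqp (runs_pour ha hx) (runs_pour hb.symm rfl) ?_).congr_store ?_
  · simp [h10]; omega
  · funext i
    grind [Function.update_apply]

/-- Move the reversed content of register 10 on top of `a` and of `b`. -/
def unpour (a b : ℕ) : Cmd :=
  .loop 10 (.branch 10 .skip (.push a false ;; .push b false) (.push a true ;; .push b true) ;;
    .pop 10)

theorem runs_unpour {O : Oracle} {a b : ℕ} (hab : a ≠ b) (ha : a ≠ 10) (hb : b ≠ 10)
    {x : List Bool} {s : Store} (hx : s 10 = x) :
    Runs O (unpour a b) s (5 * x.length + 1)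
      (PMF.pure (update (update (update s 10 []) a (x.reverse ++ s a)) b
        (x.reverse ++ s b))) := by
  induction x generalizing s with
  | nil =>
    refine (Runs.loop_nil hx).congr_store ?_
    funext i
    grind [Function.update_apply]
  | cons y x ih =>
    have h : Runs O (.branch 10 .skip (.push a false ;; .push b false)
        (.push a true ;; .push b true) ;; .pop 10) s 4
        (PMF.pure (update (update (update s a (y :: s a)) b (y :: s b)) 10 x)) := by
      refine Runs.seqp (t := 3) (t' := 1) (s' := update (update s a (y :: s a)) b (y :: s b))
        ?_ ?_ le_rfl
      · cases y
        · exact Runs.branch_false hx ((Runs.seq_pure Runs.push Runs.push).congr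
            (by simp [hab.symm]))
        · exact Runs.branch_true hx ((Runs.seq_pure Runs.push Runs.push).congr
            (by simp [hab.symm]))
      · exact Runs.pop.congr (by simp [ha.symm, hb.symm, hx])
    refine (Runs.loopp (by simp [hx]) h (ih (by simp)) ?_).congr_store ?_
    · simp; omega
    · funext i
      simp only [Function.update_apply]
      split_ifs <;> simp_all

/-- Copy the content of `a` on top of `b`. -/
def cpy (a b : ℕ) : Cmd := pour a 10 ;; unpour a b

theorem runs_cpy {O : Oracle} {a b : ℕ} (hab : a ≠ b) (ha : a ≠ 10) (hb : b ≠ 10) {x : List Bool}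
    {s : Store} (hx : s a = x) (h10 : s 10 = []) :
    Runs O (cpy a b) s (9 * x.length + 2) (PMF.pure (update s b (x ++ s b))) := by
  refine (Runs.seqp (runs_pour ha hx) (runs_unpour hab ha hb rfl) ?_).congr_store ?_
  · simp [h10]; omega
  · funext i
    simp only [Function.update_apply]
    split_ifs <;> simp_all

/-! ## Lists of strings -/

/-- The self-delimiting encoding of one string. -/
def encodeString (w : List Bool) : List Bool := (w.flatMap fun b => [true, b]) ++ [false]

theorem encodeString_cons (b : Bool) (w : List Bool) :
    encodeString (b :: w) = true :: b :: encodeString w := by simp [encodeString]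

theorem length_encodeString (w : List Bool) : (encodeString w).length = 2 * w.length + 1 := by
  induction w with
  | nil => simp [encodeString]
  | cons b w ih => rw [encodeString_cons]; simp [ih]; omega

theorem encodeString_ne_nil (w : List Bool) : encodeString w ≠ [] := by simp [encodeString]

@[simp]
theorem encodeList_nil : encodeList [] = [] := rfl

theorem encodeList_cons (w : List Bool) (l : List (List Bool)) :
    encodeList (w :: l) = encodeString w ++ encodeList l := by simp [encodeList, encodeString]

theorem encodeList_append (l l' : List (List Bool)) :
    encodeList (l ++ l') = encodeList l ++ encodeList l' := by simp [encodeList]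

theorem length_encodeList_le {l : List (List Bool)} {m : ℕ} (h : ∀ w ∈ l, w.length ≤ m) :
    (encodeList l).length ≤ l.length * (2 * m + 1) := by
  induction l with
  | nil => simp
  | cons w l ih =>
    have h1 := h w (by simp)
    have h2 := ih fun v hv => h v (by simp [hv])
    rw [encodeList_cons, List.length_append, length_encodeString, List.length_cons, Nat.add_mul]
    omega

theorem length_encodeList_reverse (l : List (List Bool)) :
    (encodeList l.reverse).length = (encodeList l).length := by
  induction l with
  | nil => rfl
  | cons w l ih =>
    rw [List.reverse_cons, encodeList_append, encodeList_cons, encodeList_cons]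
    simp [ih, Nat.add_comm]

/-- Prefix `o` by the encoding of the reversed content of register 10. -/
def encPour (o : ℕ) : Cmd :=
  .loop 10 (.branch 10 .skip (.push o false ;; .push o true) (.push o true ;; .push o true) ;;
    .pop 10)

theorem runs_encPour {O : Oracle} {o : ℕ} (ho : o ≠ 10) {x : List Bool} {s : Store}
    (hx : s 10 = x) :
    Runs O (encPour o) s (5 * x.length + 1)
      (PMF.pure (update (update s 10 []) o
        ((x.reverse.flatMap fun b => [true, b]) ++ s o))) := by
  induction x generalizing s with
  | nil =>
    refine (Runs.loop_nil hx).congr_store ?_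
    funext i
    grind [Function.update_apply]
  | cons y x ih =>
    have hb : Runs O (.branch 10 .skip (.push o false ;; .push o true)
        (.push o true ;; .push o true) ;; .pop 10) s 4
        (PMF.pure (update (update s o (true :: y :: s o)) 10 x)) := by
      refine Runs.seqp (t := 3) (t' := 1) (s' := update s o (true :: y :: s o)) ?_ ?_ le_rfl
      · cases y
        · exact Runs.branch_false hx ((Runs.seq_pure Runs.push Runs.push).congr (by simp))
        · exact Runs.branch_true hx ((Runs.seq_pure Runs.push Runs.push).congr (by simp))
      · exact Runs.pop.congr (by simp [ho.symm, hx])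
    refine (Runs.loopp (by simp [hx]) hb (ih (by simp)) ?_).congr_store ?_
    · simp; omega
    · funext i
      grind [Function.update_apply]

/-- Prefix the list in `o` by the string in `w`. -/
def encPush (w o : ℕ) : Cmd := pour w 10 ;; .push o false ;; encPour o

theorem runs_encPush {O : Oracle} {w o : ℕ} (hwo : w ≠ o) (hw : w ≠ 10) (ho : o ≠ 10)
    {x : List Bool} {s : Store} (hx : s w = x) (h10 : s 10 = []) :
    Runs O (encPush w o) s (9 * x.length + 3)
      (PMF.pure (update (update s w []) o (encodeString x ++ s o))) := by
  refine (Runs.seqp (runs_pour hw hx) (Runs.seqp Runs.push (runs_encPour ho rfl) le_rfl)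
    ?_).congr_store ?_
  · simp [h10, ho.symm]; omega
  · funext i
    simp only [Function.update_apply]
    split_ifs <;> simp_all [encodeString]

/-- Move the first string of the list in `a` in reverse order to register 10, provided that
register 11 is nonempty. -/
def decPour (a : ℕ) : Cmd :=
  .loop 11 (.branch a (.pop 11) (.pop a ;; .pop 11)
    (.pop a ;; .branch a .skip (.push 10 false) (.push 10 true) ;; .pop a))

/-- Register `a` cannot control the loop, since the rest of the list is still there after the first
string. Register 11 serves as a flag instead, and the terminator of the string lowers it. -/
theorem runs_decPour {O : Oracle} {a : ℕ} (ha : a ≠ 10) (ha' : a ≠ 11) {x z : List Bool}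
    {s : Store} (hx : s a = encodeString x ++ z) (h11 : s 11 = [true]) :
    Runs O (decPour a) s (6 * x.length + 5)
      (PMF.pure (update (update (update s a z) 10 (x.reverse ++ s 10)) 11 [])) := by
  induction x generalizing s with
  | nil =>
    have hx' : s a = false :: z := by simpa [encodeString] using hx
    have hb : Runs O (.branch a (.pop 11) (.pop a ;; .pop 11)
        (.pop a ;; .branch a .skip (.push 10 false) (.push 10 true) ;; .pop a)) s 3
        (PMF.pure (update (update s a z) 11 [])) :=
      Runs.branch_false hx' ((Runs.seq_pure Runs.pop Runs.pop).congr
        (by simp [hx', ha'.symm, h11]))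
    refine (Runs.loopp (by simp [h11]) hb (Runs.loop_nil (by simp)) ?_).congr_store ?_
    · simp
    · funext i
      grind [Function.update_apply]
  | cons y x ih =>
    rw [encodeString_cons] at hx
    have hb : Runs O (.branch a (.pop 11) (.pop a ;; .pop 11)
        (.pop a ;; .branch a .skip (.push 10 false) (.push 10 true) ;; .pop a)) s 5
        (PMF.pure (update (update s 10 (y :: s 10)) a (encodeString x ++ z))) := by
      refine Runs.branch_true hx (Runs.seqp (t := 1) (t' := 3) Runs.pop
        (Runs.seqp (t := 2) (t' := 1)
        (s' := update (update s a (y :: (encodeString x ++ z))) 10 (y :: s 10)) ?_ ?_ le_rfl)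
        le_rfl)
      · cases y
        · exact Runs.branch_false (l := encodeString x ++ z) (by simp [hx])
            (Runs.push.congr (by simp [hx, ha.symm]))
        · exact Runs.branch_true (l := encodeString x ++ z) (by simp [hx])
            (Runs.push.congr (by simp [hx, ha.symm]))
      · refine Runs.pop.congr_store ?_
        funext i
        grind [Function.update_apply]
    refine (Runs.loopp (by simp [h11]) hb (ih (by simp) (by simp [ha'.symm, h11]))
      ?_).congr_store ?_
    · simp; omega
    · funext i
      grind [Function.update_apply]

/-- Move the first string of the list in `a` to the register `w`. -/
def decPop (a w : ℕ) : Cmd := .push 11 true ;; decPour a ;; pour 10 w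

theorem runs_decPop {O : Oracle} {a w : ℕ} (haw : a ≠ w) (ha : a ≠ 10) (ha' : a ≠ 11)
    (hw : w ≠ 10) (hw' : w ≠ 11) {x z : List Bool} {s : Store} (hx : s a = encodeString x ++ z)
    (h10 : s 10 = []) (h11 : s 11 = []) (h : s w = []) :
    Runs O (decPop a w) s (10 * x.length + 10) (PMF.pure (update (update s a z) w x)) := by
  refine (Runs.seqp Runs.push (Runs.seqp (runs_decPour (x := x) (z := z) ha ha' (by simp [ha', hx])
    (by simp [h11])) (runs_pour hw.symm rfl) le_rfl) ?_).congr_store ?_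
  · simp [h10]; omega
  · funext i
    simp only [Function.update_apply]
    split_ifs <;> simp_all

/-- Move the strings of the list in `a` in reverse order to the list in `b`. -/
def revList (a b : ℕ) : Cmd := .loop a (decPop a 12 ;; encPush 12 b)

theorem runs_revList {O : Oracle} {a b : ℕ} (hab : a ≠ b) (ha : a ≠ 10 ∧ a ≠ 11 ∧ a ≠ 12)
    (hb : b ≠ 10 ∧ b ≠ 11 ∧ b ≠ 12) {l : List (List Bool)} {s : Store} (hx : s a = encodeList l)
    (h10 : s 10 = []) (h11 : s 11 = []) (h12 : s 12 = []) :
    Runs O (revList a b) s (20 * (encodeList l).length + 1)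
      (PMF.pure (update (update s a []) b (encodeList l.reverse ++ s b))) := by
  induction l generalizing s with
  | nil =>
    refine (Runs.loop_nil hx).congr_store ?_
    funext i
    grind [Function.update_apply, encodeList_nil]
  | cons w l ih =>
    rw [encodeList_cons] at hx
    have h : Runs O (decPop a 12 ;; encPush 12 b) s (19 * w.length + 13)
        (PMF.pure (update (update s a (encodeList l)) b (encodeString w ++ s b))) := by
      refine (Runs.seqp (runs_decPop ha.2.2 ha.1 ha.2.1 (by decide) (by decide) hx h10 h11 h12)
        (runs_encPush (x := w) hb.2.2.symm (by decide) hb.1 (by simp)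
          (by simp [ha.1.symm, h10])) (by omega)).congr_store ?_
      funext i
      grind [Function.update_apply]
    refine (Runs.loopp (by simp [hx, encodeString_ne_nil]) h (ih (by simp [hab])
      (by simp [ha.1.symm, hb.1.symm, h10]) (by simp [ha.2.1.symm, hb.2.1.symm, h11])
      (by simp [ha.2.2.symm, hb.2.2.symm, h12])) ?_).congr_store ?_
    · simp [encodeList_cons, length_encodeString]; omega
    · funext i
      grind [Function.update_apply, encodeList_append, encodeList_cons, encodeList_nil]


/-- The list with the entries of the first list where the flag is set and with the entries of
the second list elsewhere. -/
def mixL {α : Type} : List Bool → List α → List α → List α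
  | v :: V, x :: X, y :: Y => (if v then x else y) :: mixL V X Y
  | _, _, _ => []

/-- Mix the lists in the registers 20 and 21 according to the flags in register 19; the result is
put in reverse order on the list in register 22. -/
def mix : Cmd :=
  .loop 19 (.branch 19 .skip (decPop 20 12 ;; clr 12 ;; decPop 21 12)
    (decPop 21 12 ;; clr 12 ;; decPop 20 12) ;; .pop 19 ;; encPush 12 22)

/-- The two lists have to advance in step, so the entry that is not wanted is popped as well and
thrown away. Pushing reverses the order, which is why callers supply reversed lists and flags. -/
theorem runs_mix {O : Oracle} (hO : ShortOracle O) {V : List Bool} {X Y : List (List Bool)}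
    (hX : X.length = V.length) (hY : Y.length = V.length) {s : Store} (hV : s 19 = V)
    (hsX : s 20 = encodeList X) (hsY : s 21 = encodeList Y)
    (h10 : s 10 = []) (h11 : s 11 = []) (h12 : s 12 = []) :
    Runs O mix s (30 * ((encodeList X).length + (encodeList Y).length) + 1)
      (PMF.pure (update (update (update (update s 19 []) 20 []) 21 []) 22
        (encodeList (mixL V X Y).reverse ++ s 22))) := by
  induction V generalizing X Y s with
  | nil =>
    refine ((Runs.loop_nil hV).mono (by omega)).congr_store ?_
    obtain rfl : X = [] := by simpa using hX
    obtain rfl : Y = [] := by simpa using hY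
    funext i
    grind [Function.update_apply, mixL, encodeList_nil]
  | cons v V ih =>
    obtain ⟨x, X, rfl⟩ : ∃ x X', X = x :: X' := by cases X <;> simp_all
    obtain ⟨y, Y, rfl⟩ : ∃ y Y', Y = y :: Y' := by cases Y <;> simp_all
    rw [encodeList_cons] at hsX hsY
    have h : Runs O (.branch 19 .skip (decPop 20 12 ;; clr 12 ;; decPop 21 12)
        (decPop 21 12 ;; clr 12 ;; decPop 20 12) ;; .pop 19 ;; encPush 12 22) s
        (20 * x.length + 20 * y.length + 30)
        (PMF.pure (update (update (update (update s 19 V) 20 (encodeList X)) 21 (encodeList Y)) 22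
          (encodeString (if v then x else y) ++ s 22))) := by
      refine (Runs.seqp (t := 10 * x.length + 10 * y.length + 23)
        (t' := 9 * (x.length + y.length) + 4)
        (s' := update (update (update s 20 (encodeList X)) 21 (encodeList Y)) 12
          (if v then x else y)) ?_ ?_ (by omega))
      · cases v
        · refine ((Runs.branch_false hV (Runs.seqp (runs_decPop (x := x) (z := encodeList X)
            (by decide) (by decide) (by decide) (by decide) (by decide) hsX h10 h11 h12)
            (Runs.seqp (runs_clr hO 12 _) (runs_decPop (x := y) (z := encodeList Y)
            (by decide) (by decide) (by decide) (by decide) (by decide) (by simp [hsY])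
            (by simp [h10]) (by simp [h11]) (by simp)) le_rfl) le_rfl)).mono ?_).congr_store ?_
          · omega
          · funext i
            grind [Function.update_apply]
        · refine ((Runs.branch_true hV (Runs.seqp (runs_decPop (x := y) (z := encodeList Y)
            (by decide) (by decide) (by decide) (by decide) (by decide) hsY h10 h11 h12)
            (Runs.seqp (runs_clr hO 12 _) (runs_decPop (x := x) (z := encodeList X)
            (by decide) (by decide) (by decide) (by decide) (by decide) (by simp [hsX])
            (by simp [h10]) (by simp [h11]) (by simp)) le_rfl) le_rfl)).mono ?_).congr_store ?_
          · omega
          · funext i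
            grind [Function.update_apply]
      · refine (Runs.seqp Runs.pop (runs_encPush (by decide) (by decide) (by decide)
          (x := if v then x else y) (by simp) (by simp [h10])) ?_).congr_store ?_
        · split_ifs <;> omega
        · funext i
          grind [Function.update_apply]
    refine (Runs.loopp (by simp [hV]) h (ih (by simpa using hX) (by simpa using hY) (by simp)
      (by simp) (by simp) (by simp [h10]) (by simp [h11]) (by simp [h12])) ?_).congr_store ?_
    · simp [encodeList_cons, length_encodeString]; omega
    · funext i
      grind [Function.update_apply, encodeList_append, encodeList_cons, encodeList_nil, mixL]

/-! ## Unary arithmetic -/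

theorem unary_append (a b : ℕ) : unary a ++ unary b = unary (a + b) := by
  simp [unary]

@[simp]
theorem length_unary (a : ℕ) : (unary a).length = a := by simp [unary]

theorem unary_succ (a : ℕ) : unary (a + 1) = true :: unary a := rfl

@[simp]
theorem unary_zero : unary 0 = [] := rfl

theorem reverse_unary (a : ℕ) : (unary a).reverse = unary a := by simp [unary]

/-- Push the bit `true` `k` times. -/
def pushN (r : ℕ) : ℕ → Cmd
  | 0 => .skip
  | k + 1 => .push r true ;; pushN r k

theorem runs_pushN {O : Oracle} {r k j : ℕ} {s : Store} (h : s r = unary j) :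
    Runs O (pushN r k) s (k + 1) (PMF.pure (update s r (unary (k + j)))) := by
  induction k generalizing s j with
  | zero => exact Runs.skip.congr_store (by funext i; grind [Function.update_apply])
  | succ k ih =>
    refine (Runs.seqp Runs.push (ih (j := j + 1) (by simp [h, unary_succ])) ?_).congr_store ?_
    · omega
    · rw [Function.update_idem, show k + (j + 1) = k + 1 + j by omega]

/-- Add the product of the numbers in `x` and `y` to the one in `z`, in unary notation. -/
def mul (x y z : ℕ) : Cmd := .loop x (.pop x ;; cpy y z)

theorem runs_mul {O : Oracle} {x y z : ℕ} (hxy : x ≠ y) (hxz : x ≠ z) (hyz : y ≠ z) (hx : x ≠ 10)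
    (hy : y ≠ 10) (hz : z ≠ 10) {m k j : ℕ} {s : Store} (hsx : s x = unary m)
    (hsy : s y = unary k) (hsz : s z = unary j) (h10 : s 10 = []) :
    Runs O (mul x y z) s (m * (9 * k + 4) + 1)
      (PMF.pure (update (update s x []) z (unary (m * k + j)))) := by
  induction m generalizing s j with
  | zero =>
    refine ((Runs.loop_nil hsx).mono (by omega)).congr_store ?_
    funext i
    grind [Function.update_apply, unary_zero]
  | succ m ih =>
    have h : Runs O (.pop x ;; cpy y z) s (9 * k + 3)
        (PMF.pure (update (update s x (unary m)) z (unary (k + j)))) := by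
      refine (Runs.seqp Runs.pop (runs_cpy (x := unary k) hyz hy hz (by simp [hxy.symm, hsy])
        (by simp [hx.symm, h10])) ?_).congr_store ?_
      · simp; omega
      · rw [hsx, unary_succ, List.tail_cons, Function.update_of_ne hxz.symm, hsz, unary_append]
    refine (Runs.loopp (by simp [hsx, unary_succ]) h (ih (j := k + j) (by simp [hxz])
      (by simp [hyz, hxy.symm, hsy]) (by simp) (by simp [hz.symm, hx.symm, h10]))
      ?_).congr_store ?_
    · rw [Nat.add_mul]; omega
    · funext i
      grind [Function.update_apply]

/-- Polynomials can be evaluated in polynomial time, in unary notation. -/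
theorem exists_eval_program (p : Polynomial ℕ) {x o : ℕ} (hxo : x ≠ o) (hx : x ≠ 10) (hx6 : x ≠ 6)
    (ho : o ≠ 10) (ho6 : o ≠ 6) : ∃ (P : Cmd) (t : ℕ → ℕ), PolyBounded t ∧
      ∀ (O : Oracle) (s : Store) (k : ℕ), s x = unary k → s o = [] → s 6 = [] → s 10 = [] →
        Runs O P s (t k) (PMF.pure (update s o (unary (p.eval k)))) := by
  -- Horner's rule needs only the addition of a constant and the multiplication by the variable, and
  -- in unary notation both are elementary programs.
  induction p using Polynomial.recOnHorner with
  | M0 =>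
    refine ⟨.skip, fun _ => 1, by fun_prop, fun O s k _ h _ _ => Runs.skip.congr_store ?_⟩
    funext i
    grind [Function.update_apply, unary_zero, Polynomial.eval_zero]
  | MC p a _ _ ih =>
    obtain ⟨P, t, ht, hP⟩ := ih
    refine ⟨P ;; pushN o a, fun k => t k + (a + 1), by fun_prop, fun O s k h1 h2 h3 h4 => ?_⟩
    refine (Runs.seqp (hP O s k h1 h2 h3 h4) (runs_pushN (by simp; rfl)) le_rfl).congr_store ?_
    simp [Nat.add_comm]
  | MX p _ ih =>
    obtain ⟨P, t, ht, hP⟩ := ih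
    refine ⟨P ;; mv o 6 ;; mul 6 x o,
      fun k => t k + (8 * p.eval k + 2 + (p.eval k * (9 * k + 4) + 1)), ?_,
      fun O s k h1 h2 h3 h4 => ?_⟩
    · have := PolyBounded.eval p
      fun_prop
    refine (Runs.seqp (hP O s k h1 h2 h3 h4) (Runs.seqp (runs_mv (x := unary (p.eval k))
      ho6 ho (by decide) (by simp) (by simp [ho.symm, h4])) (runs_mul (m := p.eval k) (k := k)
      (j := 0) hx6.symm ho6.symm hxo (by decide) hx ho (by simp [ho6.symm, h3])
      (by simp [hxo, hx6, h1]) (by simp [ho6]) (by simp [ho.symm, h4])) le_rfl)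
      ?_).congr_store ?_
    · simp
    · funext i
      grind [Function.update_apply, Polynomial.eval_mul, Polynomial.eval_X]

/-! ## Calling a program -/

/-- The registers of the private working space number `j`. -/
def region (j r : ℕ) : ℕ := 64 + 4 * r + j

theorem region_injective (j : ℕ) : Function.Injective (region j) := by
  intro a b h
  simp only [region] at h
  omega

theorem extend_region_of_lt {j i : ℕ} (v s : Store) (hi : i < 64) :
    Function.extend (region j) v s i = s i := by
  rw [Function.extend_apply']
  rintro ⟨k, hk⟩
  simp only [region] at hk
  omega

theorem extend_region_self (j : ℕ) (s : Store) (h : ∀ r, s (region j r) = []) :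
    Function.extend (region j) (fun _ => []) s = s := by
  funext i
  by_cases hi : ∃ k, region j k = i
  · obtain ⟨k, rfl⟩ := hi
    rw [(region_injective j).extend_apply, h]
  · rw [Function.extend_apply' _ _ _ hi]

theorem update_extend_region {j i : ℕ} (v s : Store) (x : List Bool) (hi : i < 64) :
    update (Function.extend (region j) v s) i x = Function.extend (region j) v (update s i x) := by
  funext k
  by_cases hk : ∃ r, region j r = k
  · obtain ⟨r, rfl⟩ := hk
    rw [(region_injective j).extend_apply, Function.update_of_ne,
      (region_injective j).extend_apply]
    simp only [region]
    omega
  · rw [Function.extend_apply' _ _ _ hk]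
    simp only [Function.update_apply]
    rw [Function.extend_apply' _ _ _ hk]

/-- The program in its private working space, with all queries answered by the empty string. -/
def Cmd.embed (j : ℕ) (P : Cmd) : Cmd := P.rename (region j) fun _ r => clr (region j r)

theorem runs_embed {O : Oracle} (hO : ShortOracle O) {P : Cmd} {xs : List (List Bool)} {T : ℕ}
    (h : HaltsWithin noOracle T P xs) (j : ℕ) (s : Store) :
    Runs O (P.embed j) (Function.extend (region j) (load xs) s) (P.renameTime 2 T)
      ((final noOracle P xs).map fun v => Function.extend (region j) v s) := by
  refine (Runs.rename (region_injective j) (Q := 2) ?_ P (load xs) h).congr ?_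
  · intro q r v
    refine (runs_clr hO _ _).congr ?_
    simp [noOracle, PMF.pure_map, update_extend (region_injective j)]
  · rw [← (Runs.of_haltsWithin h).2, PMF.map_comp]
    rfl

/-- Empty the first registers of a private working space. -/
def clearRegion (j : ℕ) : ℕ → Cmd
  | 0 => .skip
  | k + 1 => clearRegion j k ;; clr (region j k)

theorem runs_clearRegion {O : Oracle} (hO : ShortOracle O) (j k : ℕ) (v s : Store) :
    Runs O (clearRegion j k) (Function.extend (region j) v s) (2 * k + 1)
      (PMF.pure (Function.extend (region j) (fun i => if i < k then [] else v i) s)) := by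
  induction k with
  | zero => exact Runs.skip.congr_store (by simp)
  | succ k ih =>
    refine (Runs.seqp ih (runs_clr hO _ _) (by omega)).congr_store ?_
    rw [update_extend (region_injective j)]
    congr 1
    funext i
    grind [Function.update_apply]

/-- Copy inputs into a private working space. -/
def copyIns (j : ℕ) : ℕ → List ℕ → Cmd
  | _, [] => .skip
  | k, a :: as => cpy a (region j k) ;; copyIns j (k + 1) as

theorem runs_copyIns {O : Oracle} (j : ℕ) {ins : List ℕ} {k b : ℕ} {v s : Store}
    (hins : ∀ a ∈ ins, a < 64 ∧ a ≠ 10 ∧ (s a).length ≤ b) (h10 : s 10 = [])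
    (hv : ∀ i, k ≤ i → v i = []) :
    Runs O (copyIns j k ins) (Function.extend (region j) v s) (ins.length * (9 * b + 2) + 1)
      (PMF.pure (Function.extend (region j)
        (fun i => if i < k then v i else (ins.map s).getD (i - k) []) s)) := by
  induction ins generalizing k v with
  | nil =>
    refine (Runs.skip.mono (by omega)).congr_store ?_
    congr 1
    funext i
    grind
  | cons a as ih =>
    obtain ⟨ha, ha', hb⟩ := hins a (by simp)
    have h1 : a ≠ region j k := by simp only [region]; omega
    have h2 : region j k ≠ 10 := by simp only [region]; omega
    have h3 : Runs O (cpy a (region j k)) (Function.extend (region j) v s) (9 * b + 2)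
        (PMF.pure (Function.extend (region j) (update v k (s a)) s)) := by
      refine ((runs_cpy (x := s a) h1 ha' h2 (extend_region_of_lt _ _ ha)
        (by rw [extend_region_of_lt _ _ (by decide), h10])).mono (by omega)).congr_store ?_
      rw [update_extend (region_injective j), (region_injective j).extend_apply, hv k le_rfl,
        List.append_nil]
    refine (Runs.seqp h3 (ih (k := k + 1) (v := update v k (s a))
      (fun c hc => hins c (by simp [hc])) (fun i hi => ?_)) ?_).congr_store ?_
    · rw [Function.update_of_ne (by omega), hv i (by omega)]
    · simp only [List.length_cons, Nat.add_mul]; omega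
    · congr 1
      funext i
      rcases lt_trichotomy i k with h | h | h
      · simp [h, h.ne, Nat.lt_succ_of_lt h]
      · subst h; simp
      · obtain ⟨d, rfl⟩ : ∃ d, i = k + 1 + d := ⟨i - (k + 1), by omega⟩
        have e1 : ¬ k + 1 + d < k + 1 := by omega
        have e2 : ¬ k + 1 + d < k := by omega
        simp only [e1, e2, if_false, show k + 1 + d - (k + 1) = d by omega,
          show k + 1 + d - k = d + 1 by omega, List.map_cons, List.getD_cons_succ]

/-- Run a program on the contents of the registers `ins` in the private working space `j`, and put
the contents of its registers 0 and 1 into `o₀` and `o₁`. -/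
def call2 (j : ℕ) (P : Cmd) (ins : List ℕ) (o₀ o₁ : ℕ) : Cmd :=
  copyIns j 0 ins ;; P.embed j ;; mv (region j 0) o₀ ;; mv (region j 1) o₁ ;;
    clearRegion j (P.width + ins.length)

/-- A time bound for `call2`. -/
def callTime (P : Cmd) (m b T : ℕ) : ℕ :=
  m * (9 * b + 2) + P.renameTime 2 T + 16 * (b + T) + 2 * (P.width + m) + 9

@[fun_prop]
theorem PolyBounded.callTime (P : Cmd) {m b T : ℕ → ℕ} (hm : PolyBounded m) (hb : PolyBounded b)
    (hT : PolyBounded T) : PolyBounded fun x => callTime P (m x) (b x) (T x) := by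
  unfold RobustLearning.callTime
  fun_prop

/-- Beyond the width of the program and its inputs the working space is still empty at the end, and
the registers below are cleared. This restores the invariant that working spaces are empty between
calls. -/
theorem runs_call2 {O : Oracle} (hO : ShortOracle O) {j : ℕ} {P : Cmd} {ins : List ℕ}
    {o₀ o₁ b T : ℕ} {s : Store} {xs : List (List Bool)} (hxs : ins.map s = xs)
    (h : HaltsWithin noOracle T P xs)
    (hins : ∀ a ∈ ins, a < 64 ∧ a ≠ 10) (hb : ∀ x ∈ xs, x.length ≤ b) (h₀ : o₀ < 64 ∧ o₀ ≠ 10)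
    (h₁ : o₁ < 64 ∧ o₁ ≠ 10) (h10 : s 10 = []) (hs : ∀ r, s (region j r) = []) :
    Runs O (call2 j P ins o₀ o₁) s (callTime P ins.length b T)
      ((final noOracle P xs).map fun v =>
        update (update s o₀ (v 0 ++ s o₀)) o₁ (v 1 ++ update s o₀ (v 0 ++ s o₀) o₁)) := by
  subst hxs
  have hlen : ∀ i, (load (ins.map s) i).length ≤ b := by
    intro i
    simp only [load, List.getD]
    rcases lt_or_ge i (ins.map s).length with hi | hi
    · rw [List.getElem?_eq_getElem hi]; exact hb _ (List.getElem_mem hi)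
    · rw [List.getElem?_eq_none hi]; simp
  have hr : ∀ r, r < 64 → ∀ k, r ≠ region j k := by intro r h k; simp only [region]; omega
  have h1 : Runs O (copyIns j 0 ins) s (ins.length * (9 * b + 2) + 1)
      (PMF.pure (Function.extend (region j) (load (ins.map s)) s)) := by
    have := runs_copyIns (O := O) (b := b) (v := fun _ => []) j (k := 0) (s := s) (ins := ins)
      (fun a ha => ⟨(hins a ha).1, (hins a ha).2, hb _ (List.mem_map_of_mem ha)⟩) h10 (by simp)
    rw [extend_region_self j s hs] at this
    exact this
  refine (Runs.seq_pure h1 (Runs.seq_map (t' := 16 * (b + T) + 2 * (P.width + ins.length) + 5)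
    (runs_embed hO h j s) fun v hv => ?_)).mono ?_
  · have hv0 := (length_le_of_mem_support_final h hv 0).trans (Nat.add_le_add_right (hlen 0) T)
    have hv1 := (length_le_of_mem_support_final h hv 1).trans (Nat.add_le_add_right (hlen 1) T)
    refine (Runs.seqp (t := 8 * (b + T) + 2) ((runs_mv (hr _ h₀.1 0).symm (hr 10 (by decide) 0).symm
      h₀.2 ((region_injective j).extend_apply _ _ 0) (by
        rw [extend_region_of_lt _ _ (by decide), h10])).mono (by omega))
      (Runs.seqp (t := 8 * (b + T) + 2) (s' := Function.extend (region j) (update (update v 0 []) 1 [])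
        (update (update s o₀ (v 0 ++ s o₀)) o₁ (v 1 ++ update s o₀ (v 0 ++ s o₀) o₁)))
        (((runs_mv (x := v 1) (hr _ h₁.1 1).symm (hr 10 (by decide) 1).symm h₁.2 ?_ ?_).mono
          (by omega)).congr_store ?_) (runs_clearRegion hO j _ _ _) le_rfl) (by omega)).congr_store ?_
    · rw [Function.update_of_ne (hr _ h₀.1 1).symm, Function.update_of_ne
        (fun h => absurd (region_injective j h) (by decide)), (region_injective j).extend_apply]
    · rw [Function.update_of_ne h₀.2.symm, Function.update_of_ne (hr 10 (by decide) 0),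
        extend_region_of_lt _ _ (by decide), h10]
    · rw [extend_region_of_lt _ _ h₀.1, update_extend (region_injective j),
        update_extend_region _ _ _ h₀.1, update_extend (region_injective j),
        update_extend_region _ _ _ h₁.1, extend_region_of_lt _ _ h₁.1]
    · rw [← extend_region_self j (update (update s o₀ (v 0 ++ s o₀)) o₁
        (v 1 ++ update s o₀ (v 0 ++ s o₀) o₁))]
      · congr 1
        · funext i
          split_ifs with hi
          · rfl
          · have := final_eq_of_width_le h hv (i := i) (by omega)
            have hl : load (ins.map s) i = [] := by
              simp only [load, List.getD]
              rw [List.getElem?_eq_none (by simp; omega)]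
              rfl
            simp only [Function.update_apply]
            split_ifs <;> simp_all
        · rw [extend_region_self]
          intro r
          rw [Function.update_of_ne (hr _ h₁.1 r).symm, Function.update_of_ne (hr _ h₀.1 r).symm,
            hs]
      · intro r
        rw [Function.update_of_ne (hr _ h₁.1 r).symm, Function.update_of_ne (hr _ h₀.1 r).symm, hs]
  · simp only [callTime]; omega

/-- Like `call2`, but with only one output, which overwrites the register `o`. -/
def call (j : ℕ) (P : Cmd) (ins : List ℕ) (o : ℕ) : Cmd :=
  clr o ;; call2 j P ins o 9 ;; clr 9

theorem runs_call {O : Oracle} (hO : ShortOracle O) {j : ℕ} {P : Cmd} {ins : List ℕ}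
    {o b T : ℕ} {s : Store} {xs : List (List Bool)} (hxs : ins.map s = xs)
    (h : HaltsWithin noOracle T P xs)
    (hins : ∀ a ∈ ins, a < 64 ∧ a ≠ 10 ∧ a ≠ o) (hb : ∀ x ∈ xs, x.length ≤ b)
    (ho : o < 64 ∧ o ≠ 10 ∧ o ≠ 9) (h9 : s 9 = []) (h10 : s 10 = [])
    (hs : ∀ r, s (region j r) = []) :
    Runs O (call j P ins o) s (callTime P ins.length b T + 4)
      ((final noOracle P xs).map fun v => update s o (v 0)) := by
  have hr : ∀ r, r < 64 → ∀ k, r ≠ region j k := by intro r h k; simp only [region]; omega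
  refine (Runs.seq_pure (runs_clr hO o s) (Runs.seq_map (runs_call2 hO (xs := xs) (b := b) ?_ h
    (fun a ha => ⟨(hins a ha).1, (hins a ha).2.1⟩) hb ⟨ho.1, ho.2.1⟩ ⟨by decide, by decide⟩
    (by simp [ho.2.1.symm, h10]) ?_) fun v _ => (runs_clr hO 9 _).congr_store ?_)).mono (by omega)
  · rw [← hxs]
    refine List.map_congr_left fun a ha => ?_
    rw [Function.update_of_ne (hins a ha).2.2]
  · intro r
    rw [Function.update_of_ne (hr _ ho.1 r).symm, hs]
  · funext i
    grind [Function.update_apply]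


/-! ## Products of lists of distributions -/

/-- Independent samples of the distributions in a list. -/
noncomputable def prodL {α : Type} : List (PMF α) → PMF (List α)
  | [] => PMF.pure []
  | μ :: ms => μ.bind fun a => (prodL ms).map (List.cons a)

theorem map_ofFn_product {α : Type} {n : ℕ} (μ : Fin n → PMF α) :
    (product μ).map List.ofFn = prodL (List.ofFn μ) := by
  induction n with
  | zero => simp [product, prodL, PMF.pure_map]
  | succ n ih =>
    rw [List.ofFn_succ]
    simp only [product, prodL, ← ih, PMF.map_bind, PMF.map_comp]
    congr 1
    funext a
    congr 1
    funext x
    simp [List.ofFn_succ]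

theorem length_of_mem_support_prodL {α : Type} {ms : List (PMF α)} {x : List α}
    (h : x ∈ (prodL ms).support) : x.length = ms.length := by
  induction ms generalizing x with
  | nil => simp [prodL] at h; simp [h]
  | cons μ ms ih =>
    simp only [prodL, PMF.mem_support_bind_iff, PMF.mem_support_map_iff] at h
    obtain ⟨a, -, y, hy, rfl⟩ := h
    simp [ih hy]

theorem exists_mem_of_mem_support_prodL {α : Type} {ms : List (PMF α)} {x : List α}
    (h : x ∈ (prodL ms).support) {a : α} (ha : a ∈ x) : ∃ μ ∈ ms, a ∈ μ.support := by
  induction ms generalizing x with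
  | nil => simp [prodL] at h; simp [h] at ha
  | cons μ ms ih =>
    simp only [prodL, PMF.mem_support_bind_iff, PMF.mem_support_map_iff] at h
    obtain ⟨b, hb, y, hy, rfl⟩ := h
    rcases List.mem_cons.1 ha with rfl | ha
    · exact ⟨μ, by simp, hb⟩
    · obtain ⟨ν, hν, h⟩ := ih hy ha
      exact ⟨ν, by simp [hν], h⟩

/-- In every coordinate one of the two independent draws is discarded, and a draw that is not used
integrates to one. So mixing a sample with an independent sample of the other class gives exactly a
hybrid. -/
theorem prodL_bind_mixL {α : Type} {V : List Bool} {ms ms' : List (PMF α)}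
    (h : ms.length = V.length) (h' : ms'.length = V.length) :
    ((prodL ms).bind fun x => (prodL ms').map fun y => mixL V x y) = prodL (mixL V ms ms') := by
  induction V generalizing ms ms' with
  | nil =>
    obtain rfl : ms = [] := by simpa using h
    obtain rfl : ms' = [] := by simpa using h'
    simp [prodL, mixL, PMF.pure_map]
  | cons v V ih =>
    obtain ⟨μ, ms, rfl⟩ : ∃ x X', ms = x :: X' := by cases ms <;> simp_all
    obtain ⟨ν, ms', rfl⟩ : ∃ x X', ms' = x :: X' := by cases ms' <;> simp_all
    simp only [prodL, mixL, ← ih (by simpa using h) (by simpa using h'), PMF.bind_bind,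
      PMF.bind_map, PMF.map_bind, PMF.map_comp, Function.comp_def]
    cases v
    · simp only [Bool.false_eq_true, if_false]
      rw [bind_const']
      rw [PMF.bind_comm]
    · simp only [if_true, bind_const']

/-- Overwriting a coordinate by an independent draw forgets the old value, so only this factor of
the product changes. This serves both for the challenge ciphertext and for the planted key pair. -/
theorem prodL_bind_set {α : Type} (ms : List (PMF α)) (ν : PMF α) (i : ℕ) :
    ((prodL ms).bind fun z => ν.map fun a => z.set i a) = prodL (ms.set i ν) := by
  induction ms generalizing i with
  | nil => simp only [prodL, PMF.pure_bind, List.set_nil]; exact PMF.map_const ν []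
  | cons μ ms ih =>
    cases i with
    | zero =>
      simp only [prodL, PMF.bind_bind, PMF.bind_map, Function.comp_def, List.set_cons_zero,
        bind_const']
      simp only [PMF.map]
      rw [PMF.bind_comm]
      rfl
    | succ i =>
      simp only [prodL, PMF.bind_bind, PMF.bind_map, Function.comp_def, List.set_cons_succ, ← ih,
        PMF.map_bind, PMF.map_comp]

theorem prodL_append {α : Type} (ms ms' : List (PMF α)) :
    prodL (ms ++ ms') = (prodL ms).bind fun x => (prodL ms').map fun y => x ++ y := by
  induction ms with
  | nil => simp only [List.nil_append, prodL, PMF.pure_bind]; exact (PMF.map_id _).symm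
  | cons μ ms ih =>
    simp only [List.cons_append, prodL, ih, PMF.map_bind, PMF.map_comp, PMF.bind_bind,
      PMF.bind_map, Function.comp_def]

/-- The lengths have to agree because `mixL` truncates to the shortest list, and reversal would
change which end is lost. -/
theorem mixL_reverse {α : Type} {V : List Bool} {X Y : List α}
    (h : X.length = V.length) (h' : Y.length = V.length) :
    mixL V.reverse X.reverse Y.reverse = (mixL V X Y).reverse := by
  have app : ∀ (V : List Bool) (X Y : List α) v x y, X.length = V.length → Y.length = V.length →
      mixL (V ++ [v]) (X ++ [x]) (Y ++ [y]) = mixL V X Y ++ [if v then x else y] := by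
    intro V
    induction V with
    | nil =>
      intro X Y v x y h h'
      obtain rfl : X = [] := by simpa using h
      obtain rfl : Y = [] := by simpa using h'
      rfl
    | cons w V ih =>
      intro X Y v x y h h'
      obtain ⟨a, X, rfl⟩ : ∃ x X', X = x :: X' := by cases X <;> simp_all
      obtain ⟨b, Y, rfl⟩ : ∃ x X', Y = x :: X' := by cases Y <;> simp_all
      simp [mixL, ih X Y v x y (by simpa using h) (by simpa using h')]
  induction V generalizing X Y with
  | nil =>
    obtain rfl : X = [] := by simpa using h
    rfl
  | cons w V ih =>
    obtain ⟨a, X, rfl⟩ : ∃ x X', X = x :: X' := by cases X <;> simp_all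
    obtain ⟨b, Y, rfl⟩ : ∃ x X', Y = x :: X' := by cases Y <;> simp_all
    simp only [List.reverse_cons, mixL]
    rw [app _ _ _ _ _ _ (by simpa using h) (by simpa using h'),
      ih (by simpa using h) (by simpa using h')]

theorem length_mixL {α : Type} {V : List Bool} {X Y : List α}
    (h : X.length = V.length) (h' : Y.length = V.length) : (mixL V X Y).length = V.length := by
  induction V generalizing X Y with
  | nil => simp [mixL]
  | cons w V ih =>
    obtain ⟨a, X, rfl⟩ : ∃ x X', X = x :: X' := by cases X <;> simp_all
    obtain ⟨b, Y, rfl⟩ : ∃ x X', Y = x :: X' := by cases Y <;> simp_all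
    simp [mixL, ih (by simpa using h) (by simpa using h')]

theorem mem_or_mem_of_mem_mixL {α : Type} {V : List Bool} {X Y : List α} {a : α}
    (h : a ∈ mixL V X Y) : a ∈ X ∨ a ∈ Y := by
  induction V generalizing X Y with
  | nil => simp [mixL] at h
  | cons w V ih =>
    cases X with
    | nil => simp [mixL] at h
    | cons x X =>
      cases Y with
      | nil => simp [mixL] at h
      | cons y Y =>
        simp only [mixL, List.mem_cons] at h
        rcases h with rfl | h
        · cases w <;> simp
        · rcases ih h with h | h <;> simp [h]

/-! ## Sampling encryptions -/

/-- The working registers of the basic programs are empty. -/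
def Idle (s : Store) : Prop := (∀ r, 9 ≤ r → r ≤ 14 → s r = []) ∧ ∀ r, s (region 1 r) = []

theorem Idle.update {s : Store} (h : Idle s) {r : ℕ} (hr : r < 9 ∨ 14 < r ∧ r < 64)
    (x : List Bool) : Idle (update s r x) := by
  constructor
  · intro k h1 h2
    rw [Function.update_of_ne (by omega), h.1 k h1 h2]
  · intro k
    rw [Function.update_of_ne (by simp only [region]; omega), h.2 k]

/-- The keys `l` can be used for encryption within the bound `b`. -/
structure KeysBounded (enc : Cmd) (lam b : ℕ) (l : List (List Bool)) : Prop where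
  lam_le : lam ≤ b
  one_le : 1 ≤ b
  count : l.length ≤ b
  halts : ∀ p ∈ l, ∀ m : Bool, HaltsWithin noOracle b enc [unary lam, p, [m]]
  key_le : ∀ p ∈ l, p.length ≤ b
  ct_le : ∀ p ∈ l, ∀ m : Bool, ∀ c ∈ (encDist enc lam p m).support, c.length ≤ b

theorem KeysBounded.length_le {enc : Cmd} {lam b : ℕ} {l : List (List Bool)}
    (h : KeysBounded enc lam b l) : (encodeList l).length ≤ b * (2 * b + 1) :=
  (length_encodeList_le h.key_le).trans (Nat.mul_le_mul_right _ h.count)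

/-- Independent encryptions of the bit `m` under the keys `l`. -/
noncomputable def sampL (enc : Cmd) (lam : ℕ) (l : List (List Bool)) (m : Bool) :
    PMF (List (List Bool)) := prodL (l.map fun p => encDist enc lam p m)

theorem length_of_mem_support_sampL {enc : Cmd} {lam : ℕ} {l : List (List Bool)} {m : Bool}
    {cs : List (List Bool)} (h : cs ∈ (sampL enc lam l m).support) : cs.length = l.length := by
  simpa using length_of_mem_support_prodL h

theorem KeysBounded.length_sampL_le {enc : Cmd} {lam b : ℕ} {l : List (List Bool)}
    (h : KeysBounded enc lam b l) {m : Bool} {cs : List (List Bool)}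
    (hcs : cs ∈ (sampL enc lam l m).support) :
    (∀ c ∈ cs, c.length ≤ b) ∧ (encodeList cs).length ≤ b * (2 * b + 1) := by
  have h1 : ∀ c ∈ cs, c.length ≤ b := by
    intro c hc
    obtain ⟨μ, hμ, hc⟩ := exists_mem_of_mem_support_prodL hcs hc
    obtain ⟨p, hp, rfl⟩ := List.mem_map.1 hμ
    exact h.ct_le p hp m c hc
  refine ⟨h1, (length_encodeList_le h1).trans (Nat.mul_le_mul_right _ ?_)⟩
  rw [length_of_mem_support_sampL hcs]
  exact h.count

/-- Encrypt the bit in register `m` under the keys in register 14, and put the ciphertexts in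
reverse order on the list in register `o`. -/
def encryptLoop (enc : Cmd) (m o : ℕ) : Cmd :=
  .loop 14 (decPop 14 12 ;; call 1 enc [0, 12, m] 13 ;; clr 12 ;; encPush 13 o)

theorem runs_encryptLoop {O : Oracle} (hO : ShortOracle O) {enc : Cmd} {lam b : ℕ}
    {l : List (List Bool)} (hl : KeysBounded enc lam b l) {m o : ℕ}
    (hm : m < 9 ∨ 14 < m ∧ m < 64) (ho : 14 < o ∧ o < 64) (hmo : m ≠ o) {bit : Bool} {s : Store}
    (h0 : s 0 = unary lam) (hsm : s m = [bit]) (hs : Idle (update s 14 []))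
    (hs14 : s 14 = encodeList l) :
    Runs O (encryptLoop enc m o) s (l.length * (callTime enc 3 b b + 19 * b + 20) + 1)
      ((sampL enc lam l bit).map fun cs =>
        update (update s 14 []) o (encodeList cs.reverse ++ s o)) := by
  have hr : ∀ r, r < 64 → ∀ k, r ≠ region 1 k := by intro r h k; simp only [region]; omega
  induction l generalizing s with
  | nil =>
    refine ((Runs.loop_nil hs14).mono (by omega)).congr ?_
    simp only [sampL, List.map_nil, prodL, PMF.pure_map]
    congr 1
    funext i
    grind [Function.update_apply, encodeList_nil]
  | cons p l ih =>
    rw [encodeList_cons] at hs14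
    have i9 := hs.1 9 (by decide) (by decide)
    have i10 := hs.1 10 (by decide) (by decide)
    have i11 := hs.1 11 (by decide) (by decide)
    have i12 := hs.1 12 (by decide) (by decide)
    have i13 := hs.1 13 (by decide) (by decide)
    simp only [ne_eq, Nat.reduceEqDiff, not_false_eq_true,
      Function.update_of_ne] at i9 i10 i11 i12 i13
    have i1 : ∀ r, s (region 1 r) = [] := fun r => by
      have := hs.2 r
      rwa [Function.update_of_ne (hr _ (by decide) r).symm] at this
    have hbody : Runs O (decPop 14 12 ;; call 1 enc [0, 12, m] 13 ;; clr 12 ;; encPush 13 o) s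
        (callTime enc 3 b b + 19 * b + 19)
        ((encDist enc lam p bit).map fun c =>
          update (update s 14 (encodeList l)) o (encodeString c ++ s o)) := by
      have hp := hl.key_le p (by simp)
      have hcall := runs_call (xs := [unary lam, p, [bit]]) hO (j := 1) (P := enc)
        (ins := [0, 12, m]) (o := 13) (b := b)
        (T := b) (s := update (update s 14 (encodeList l)) 12 p)
        (by simp [h0, hsm, show m ≠ 12 by omega, show m ≠ 14 by omega])
        (hl.halts p (by simp) bit) (by simp; omega)
        (by simp [hl.lam_le, hp, hl.one_le]) (by decide) (by simp [i9]) (by simp [i10])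
        (fun r => by
          rw [Function.update_of_ne (hr _ (by decide) r).symm,
            Function.update_of_ne (hr _ (by decide) r).symm, i1])
      refine (Runs.seq_pure (runs_decPop (x := p) (z := encodeList l) (by decide) (by decide)
        (by decide) (by decide) (by decide) hs14 i10 i11 i12) (Runs.seq_map
          (μ := encDist enc lam p bit)
          (g := fun c => update (update (update s 14 (encodeList l)) 12 p) 13 c)
          (t := callTime enc 3 b b + 4) (t' := 9 * b + 5) ?_ ?_)).mono (by omega)
      · refine hcall.congr ?_
        rw [encDist, PMF.map_comp]
        rfl
      · intro c hc
        have hc' := hl.ct_le p (by simp) bit c hc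
        refine (Runs.seqp (runs_clr hO 12 _) (runs_encPush (x := c) (by omega) (by decide)
          (by omega) (by simp) (by simp [i10])) (by omega)).congr_store ?_
        funext i
        grind [Function.update_apply]
    refine ((Runs.loop_cons (by simp [hs14, encodeString_ne_nil]) hbody fun c _ =>
      ih ⟨hl.lam_le, hl.one_le, by have := hl.count; simp at this; omega,
        fun p hp => hl.halts p (by simp [hp]), fun p hp => hl.key_le p (by simp [hp]),
        fun p hp => hl.ct_le p (by simp [hp])⟩ ?_ ?_ ?_ ?_).mono ?_).congr ?_
    · simp [h0, show (0 : ℕ) ≠ o by omega]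
    · simp [hsm, hmo, show m ≠ 14 by omega]
    · have : update (update (update s 14 (encodeList l)) o (encodeString c ++ s o)) 14 [] =
          update (update s 14 []) o (encodeString c ++ s o) := by
        funext i
        grind [Function.update_apply]
      rw [this]
      exact hs.update (by omega) _
    · simp [show (14 : ℕ) ≠ o by omega]
    · simp only [List.length_cons, Nat.add_mul]; omega
    · simp only [sampL, List.map_cons, prodL, PMF.map_bind, PMF.map_comp, Function.comp_def]
      refine bind_congr_support fun c _ => map_congr_support fun cs _ => ?_
      funext i
      grind [Function.update_apply, encodeList_append, encodeList_cons, encodeList_nil]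

/-- Encrypt the bit in register `m` under the keys in register 2, and put the ciphertexts in
reverse order on the list in register `o`. -/
def encryptAll (enc : Cmd) (m o : ℕ) : Cmd := cpy 2 14 ;; encryptLoop enc m o

/-- A time bound for `encryptAll`. -/
def encryptTime (enc : Cmd) (b : ℕ) : ℕ :=
  b * (callTime enc 3 b b + 19 * b + 20) + 9 * (b * (2 * b + 1)) + 3

@[fun_prop]
theorem PolyBounded.encryptTime (enc : Cmd) {b : ℕ → ℕ} (hb : PolyBounded b) :
    PolyBounded fun x => encryptTime enc (b x) := by
  unfold RobustLearning.encryptTime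
  fun_prop

theorem runs_encryptAll {O : Oracle} (hO : ShortOracle O) {enc : Cmd} {lam b : ℕ}
    {l : List (List Bool)} (hl : KeysBounded enc lam b l) {m o : ℕ}
    (hm : m < 9 ∨ 14 < m ∧ m < 64) (ho : 14 < o ∧ o < 64) (hmo : m ≠ o) {bit : Bool} {s : Store}
    (h0 : s 0 = unary lam) (h2 : s 2 = encodeList l) (hsm : s m = [bit]) (hs : Idle s) :
    Runs O (encryptAll enc m o) s (encryptTime enc b)
      ((sampL enc lam l bit).map fun cs => update s o (encodeList cs.reverse ++ s o)) := by
  have i10 := hs.1 10 (by decide) (by decide)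
  have i14 := hs.1 14 (by decide) (by decide)
  have e : update (update s 14 (encodeList l ++ s 14)) 14 [] = s := by
    funext i
    grind [Function.update_apply]
  refine ((Runs.seq_pure (runs_cpy (by decide) (by decide) (by decide) h2 i10)
    (runs_encryptLoop hO hl hm ho hmo (bit := bit) ?_ ?_ ?_ ?_)).mono ?_).congr ?_
  · simp [h0]
  · simp [hsm, show m ≠ 14 by omega]
  · rwa [e]
  · simp [i14]
  · have := hl.length_le
    have := Nat.mul_le_mul_right (callTime enc 3 b b + 19 * b + 20) hl.count
    simp only [encryptTime]
    omega
  · rw [e]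
    simp [show o ≠ 14 by omega]


/-! ## Samples of mixed classes -/

/-- Independent encryptions of `c` where the flag is set and of the opposite bit elsewhere. -/
noncomputable def hybrid (enc : Cmd) (lam : ℕ) (l : List (List Bool)) (c : Bool) (V : List Bool) :
    PMF (List (List Bool)) :=
  prodL (mixL V (l.map fun p => encDist enc lam p c) (l.map fun p => encDist enc lam p (!c)))

theorem sampL_bind_mixL {enc : Cmd} {lam : ℕ} {l : List (List Bool)} {c : Bool} {V : List Bool}
    (h : V.length = l.length) :
    ((sampL enc lam l c).bind fun x => (sampL enc lam l (!c)).map fun y => mixL V x y) =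
      hybrid enc lam l c V :=
  prodL_bind_mixL (by simp [h]) (by simp [h])

theorem KeysBounded.length_hybrid_le {enc : Cmd} {lam b : ℕ} {l : List (List Bool)}
    (h : KeysBounded enc lam b l) {c : Bool} {V : List Bool} (hV : V.length = l.length)
    {z : List (List Bool)} (hz : z ∈ (hybrid enc lam l c V).support) :
    z.length = l.length ∧ (encodeList z).length ≤ b * (2 * b + 1) := by
  rw [← sampL_bind_mixL hV, PMF.mem_support_bind_iff] at hz
  obtain ⟨x, hx, hz⟩ := hz
  rw [PMF.mem_support_map_iff] at hz
  obtain ⟨y, hy, rfl⟩ := hz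
  have hl : (mixL V x y).length = l.length := by
    rw [length_mixL, hV] <;> simp [length_of_mem_support_sampL hx, length_of_mem_support_sampL hy,
      hV]
  refine ⟨hl, (length_encodeList_le (m := b) fun w hw => ?_).trans (Nat.mul_le_mul_right _ ?_)⟩
  · rcases mem_or_mem_of_mem_mixL hw with hw | hw
    · exact (h.length_sampL_le hx).1 w hw
    · exact (h.length_sampL_le hy).1 w hw
  · rw [hl]; exact h.count

/-- Sample with the flags in register 19; the result is put on the list in register 22. -/
def mixedSample (enc : Cmd) : Cmd := encryptAll enc 1 20 ;; encryptAll enc 29 21 ;; mix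

/-- A time bound for `mixedSample`. -/
def mixedTime (enc : Cmd) (b : ℕ) : ℕ := 2 * encryptTime enc b + 60 * (b * (2 * b + 1)) + 1

@[fun_prop]
theorem PolyBounded.mixedTime (enc : Cmd) {b : ℕ → ℕ} (hb : PolyBounded b) :
    PolyBounded fun x => mixedTime enc (b x) := by
  unfold RobustLearning.mixedTime
  fun_prop

/-- Two complete samples are drawn and mixed. `encryptAll` delivers ciphertexts in reverse order, so
the flags are expected reversed too; mixing reverses once more and restores the order. -/
theorem runs_mixedSample {O : Oracle} (hO : ShortOracle O) {enc : Cmd} {lam b : ℕ}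
    {l : List (List Bool)} (hl : KeysBounded enc lam b l) {c : Bool} {V : List Bool} {s : Store}
    (hV : V.length = l.length) (h0 : s 0 = unary lam) (h1 : s 1 = [c]) (h2 : s 2 = encodeList l)
    (h29 : s 29 = [!c]) (h19 : s 19 = V.reverse) (h20 : s 20 = []) (h21 : s 21 = [])
    (hs : Idle s) :
    Runs O (mixedSample enc) s (mixedTime enc b)
      ((hybrid enc lam l c V).map fun z =>
        update (update s 19 []) 22 (encodeList z ++ s 22)) := by
  have h10 := hs.1 10 (by decide) (by decide)
  have h11 := hs.1 11 (by decide) (by decide)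
  have h12 := hs.1 12 (by decide) (by decide)
  rw [← sampL_bind_mixL hV, PMF.map_bind]
  refine (Runs.seq (runs_encryptAll hO hl (m := 1) (o := 20) (by decide) (by decide) (by decide)
    h0 h2 h1 hs) fun x hx => ?_).mono (t := encryptTime enc b + (encryptTime enc b +
      (60 * (b * (2 * b + 1)) + 1))) (by simp only [mixedTime]; omega)
  rw [PMF.map_comp]
  refine Runs.seq_map (runs_encryptAll hO hl (m := 29) (o := 21) (bit := !c) (by decide)
    (by decide) (by decide) (by simp [h0]) (by simp [h2]) (by simp [h29])
    (hs.update (by decide) _)) fun y hy => ?_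
  have hx' := length_of_mem_support_sampL hx
  have hy' := length_of_mem_support_sampL hy
  refine ((runs_mix hO (V := V.reverse) (X := x.reverse) (Y := y.reverse) (by simp [hx', hV])
    (by simp [hy', hV]) (by simp [h19]) (by simp [h20]) (by simp [h21]) (by simp [h10])
    (by simp [h11]) (by simp [h12])).mono ?_).congr_store ?_
  · rw [length_encodeList_reverse, length_encodeList_reverse]
    have := (hl.length_sampL_le hx).2
    have := (hl.length_sampL_le hy).2
    omega
  · rw [mixL_reverse (by simp [hx', hV]) (by simp [hy', hV]), List.reverse_reverse]
    funext i
    grind [Function.update_apply]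

/-! ## Estimating the influence of a feature -/

/-- The program `ask` replaces a query `w` in register 22 by an answer in register 23 with
distribution `f w`, for all `w` of length at most `m` and all stores with the property `F`. -/
structure Asks (O : Oracle) (ask : Cmd) (f : List Bool → PMF Bool) (F : Store → Prop)
    (m t : ℕ) : Prop where
  run : ∀ s, F s → Idle s → (s 22).length ≤ m →
    Runs O ask s t ((f (s 22)).map fun b => update (update s 22 []) 23 [b])
  frame : ∀ s r x, F s → 15 ≤ r → r ≤ 32 → F (update s r x)

/-- The store is ready for the estimation of influences with `N` rounds and threshold `θ`. -/
structure Ready (lam : ℕ) (l : List (List Bool)) (c : Bool) (N θ : ℕ) (F : Store → Prop)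
    (s : Store) : Prop where
  frame : F s
  idle : Idle s
  h0 : s 0 = unary lam
  h1 : s 1 = [c]
  h2 : s 2 = encodeList l
  h29 : s 29 = [!c]
  h26 : s 26 = unary N
  h27 : s 27 = unary θ
  h19 : s 19 = []
  h20 : s 20 = []
  h21 : s 21 = []
  h22 : s 22 = []
  h23 : s 23 = []
  h30 : s 30 = []

section Greedy

variable {O : Oracle} {enc ask : Cmd} {lam b N θ t : ℕ} {l : List (List Bool)} {c : Bool}
  {f : List Bool → PMF Bool} {F : Store → Prop} {s : Store}

theorem Ready.update (ha : Asks O ask f F (b * (2 * b + 1)) t) (h : Ready lam l c N θ F s) {r : ℕ}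
    (hr : r ∈ [15, 16, 17, 18, 24, 25, 28]) (x : List Bool) :
    Ready lam l c N θ F (update s r x) := by
  have hr' : 15 ≤ r ∧ r ≤ 28 := by simp at hr; omega
  have key : ∀ i, i ∉ [15, 16, 17, 18, 24, 25, 28] → Function.update s r x i = s i := by
    intro i hi
    exact Function.update_of_ne (by rintro rfl; exact hi hr) _ _
  constructor
  · exact ha.frame _ _ _ h.frame hr'.1 (by omega)
  · exact h.idle.update (by omega) _
  · rw [key _ (by decide), h.h0]
  · rw [key _ (by decide), h.h1]
  · rw [key _ (by decide), h.h2]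
  · rw [key _ (by decide), h.h29]
  · rw [key _ (by decide), h.h26]
  · rw [key _ (by decide), h.h27]
  · rw [key _ (by decide), h.h19]
  · rw [key _ (by decide), h.h20]
  · rw [key _ (by decide), h.h21]
  · rw [key _ (by decide), h.h22]
  · rw [key _ (by decide), h.h23]
  · rw [key _ (by decide), h.h30]

/-- Push as many unset flags on register 19 as there are bits in register 30. -/
def padFlags : Cmd := .loop 30 (.pop 30 ;; .push 19 false)

theorem runs_padFlags {rem : ℕ} {J : List Bool} (h : s 30 = unary rem) (h19 : s 19 = J) :
    Runs O padFlags s (3 * rem + 1)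
      (PMF.pure (update (update s 30 []) 19 (List.replicate rem false ++ J))) := by
  induction rem generalizing s J with
  | zero =>
    refine (Runs.loop_nil h).congr_store ?_
    funext i
    grind [Function.update_apply, unary_zero]
  | succ rem ih =>
    refine (Runs.loopp (by simp [h, unary_succ]) (Runs.seq_pure Runs.pop Runs.push)
      (ih (J := false :: J) (by simp [h, unary_succ]) (by simp [h19])) (by omega)).congr_store ?_
    rw [List.replicate_succ', List.append_assoc]
    funext i
    grind [Function.update_apply]

/-- Ask about a sample with the flags in register 15, the flag in register 28 for the next feature
and unset flags for the others. -/
def probe (enc ask : Cmd) : Cmd :=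
  cpy 15 19 ;; .branch 28 .skip (.push 19 false) (.push 19 true) ;; cpy 16 30 ;; padFlags ;;
    mixedSample enc ;; ask

/-- A time bound for `probe`. -/
def probeTime (enc : Cmd) (b t : ℕ) : ℕ := 21 * b + mixedTime enc b + t + 7

/-- The flags of a probe. -/
def probeFlags (J : List Bool) (v : Bool) (rem : ℕ) : List Bool :=
  J.reverse ++ v :: List.replicate rem false

/-- The decided flags are stored with the latest on top. Pushing the tentative flag and then unset
flags for the remaining features produces directly the reversed list that the sampling program
expects. -/
theorem runs_probe (hO : ShortOracle O) (hl : KeysBounded enc lam b l)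
    (ha : Asks O ask f F (b * (2 * b + 1)) t) {J : List Bool} {rem : ℕ} {v : Bool}
    (h : Ready lam l c N θ F s) (h15 : s 15 = J) (h16 : s 16 = unary rem) (h28 : s 28 = [v])
    (hlen : J.length + 1 + rem = l.length) :
    Runs O (probe enc ask) s (probeTime enc b t)
      (((hybrid enc lam l c (probeFlags J v rem)).bind fun z => f (encodeList z)).map
        fun a => update s 23 [a]) := by
  have h10 := h.idle.1 10 (by decide) (by decide)
  have hb := hl.count
  have hV : (probeFlags J v rem).length = l.length := by simp [probeFlags]; omega
  have hflags : Runs O (.branch 28 .skip (.push 19 false) (.push 19 true))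
      (update s 19 J) 2 (PMF.pure (update s 19 (v :: J))) := by
    cases v
    · exact Runs.branch_false (l := []) (by simp [h28]) (Runs.push.congr_store (by simp))
    · exact Runs.branch_true (l := []) (by simp [h28]) (Runs.push.congr_store (by simp))
  rw [PMF.map_bind]
  have h1 : Runs O (cpy 15 19) s (9 * J.length + 2) (PMF.pure (update s 19 J)) :=
    (runs_cpy (by decide) (by decide) (by decide) h15 h10).congr_store (by simp [h.h19])
  have h3 : Runs O (cpy 16 30) (update s 19 (v :: J)) (9 * rem + 2)
      (PMF.pure (update (update s 19 (v :: J)) 30 (unary rem))) :=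
    ((runs_cpy (x := unary rem) (by decide) (by decide) (by decide) (by simp [h16])
      (by simp [h10])).mono (by simp)).congr_store (by simp [h.h30])
  have h4 : Runs O padFlags (update (update s 19 (v :: J)) 30 (unary rem)) (3 * rem + 1)
      (PMF.pure (update s 19 (probeFlags J v rem).reverse)) := by
    refine (runs_padFlags (rem := rem) (J := v :: J) (by simp) (by simp)).congr_store ?_
    have := h.h30
    funext i
    grind [Function.update_apply, probeFlags]
  have h5 := runs_mixedSample hO hl (c := c) (V := probeFlags J v rem)
    (s := update s 19 (probeFlags J v rem).reverse) hV (by simp [h.h0])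
    (by simp [h.h1]) (by simp [h.h2]) (by simp [h.h29]) (by simp) (by simp [h.h20])
    (by simp [h.h21]) (h.idle.update (by decide) _)
  refine (Runs.seq_pure h1 (Runs.seq_pure hflags (Runs.seq_pure h3 (Runs.seq_pure h4
    (Runs.seq h5 (t' := t) fun z hz => ?_))))).mono (by simp only [probeTime]; omega)
  have hz' := (hl.length_hybrid_le hV hz).2
  have e : update (update (update s 19 (probeFlags J v rem).reverse) 19 []) 22
      (encodeList z ++ update s 19 (probeFlags J v rem).reverse 22) =
      update s 22 (encodeList z) := by
    have := h.h22
    have := h.h19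
    funext i
    grind [Function.update_apply]
  rw [e]
  refine (ha.run _ (ha.frame _ _ _ h.frame (by decide) (by decide))
    (h.idle.update (by decide) _) (by simpa using hz')).congr ?_
  simp only [Function.update_self, Function.update_idem]
  refine map_congr_support fun a _ => ?_
  have := h.h22
  funext i
  grind [Function.update_apply]

/-- The signed unary notation for integers. -/
def signed (z : ℤ) : List Bool := List.replicate z.natAbs (decide (0 < z))

/-- Add one to the integer in register 24. -/
def incr : Cmd := .branch 24 (.push 24 true) (.pop 24) (.push 24 true)

/-- Subtract one from the integer in register 24. -/
def decr : Cmd := .branch 24 (.push 24 false) (.push 24 false) (.pop 24)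

theorem signed_of_pos (n : ℕ) : signed ((n : ℤ) + 1) = true :: List.replicate n true := by
  have h : ((n : ℤ) + 1).natAbs = n + 1 := by omega
  rw [signed, h, List.replicate_succ]
  simp [show (0 : ℤ) < n + 1 by omega]

theorem signed_of_neg (n : ℕ) : signed (-((n : ℤ) + 1)) = false :: List.replicate n false := by
  have h : (-((n : ℤ) + 1)).natAbs = n + 1 := by omega
  rw [signed, h, List.replicate_succ]
  simp

theorem signed_zero : signed 0 = [] := rfl

theorem replicate_true_eq_signed (n : ℕ) : List.replicate n true = signed n := by
  cases n with
  | zero => rfl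
  | succ n => push_cast; rw [signed_of_pos, List.replicate_succ]

theorem replicate_false_eq_signed (n : ℕ) : List.replicate n false = signed (-(n : ℤ)) := by
  cases n with
  | zero => rfl
  | succ n => push_cast; rw [signed_of_neg, List.replicate_succ]

theorem int_cases (z : ℤ) : z = 0 ∨ (∃ n : ℕ, z = n + 1) ∨ ∃ n : ℕ, z = -((n : ℤ) + 1) := by
  rcases lt_trichotomy z 0 with h | h | h
  · exact Or.inr (Or.inr ⟨(-z - 1).toNat, by omega⟩)
  · exact Or.inl h
  · exact Or.inr (Or.inl ⟨(z - 1).toNat, by omega⟩)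

theorem runs_incr {z : ℤ} (h : s 24 = signed z) :
    Runs O incr s 2 (PMF.pure (update s 24 (signed (z + 1)))) := by
  rcases int_cases z with rfl | ⟨n, rfl⟩ | ⟨n, rfl⟩
  · exact Runs.branch_nil h (Runs.push.congr_store (by rw [h]; rfl))
  · rw [signed_of_pos] at h
    refine Runs.branch_true h (Runs.push.congr_store ?_)
    have := signed_of_pos (n + 1)
    push_cast at this
    rw [this, h, List.replicate_succ]
  · rw [signed_of_neg] at h
    refine Runs.branch_false h (Runs.pop.congr_store ?_)
    rw [h, List.tail_cons, replicate_false_eq_signed]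
    congr 2
    omega

theorem runs_decr {z : ℤ} (h : s 24 = signed z) :
    Runs O decr s 2 (PMF.pure (update s 24 (signed (z - 1)))) := by
  rcases int_cases z with rfl | ⟨n, rfl⟩ | ⟨n, rfl⟩
  · exact Runs.branch_nil h (Runs.push.congr_store (by rw [h]; rfl))
  · rw [signed_of_pos] at h
    refine Runs.branch_true h (Runs.pop.congr_store ?_)
    rw [h, List.tail_cons, replicate_true_eq_signed]
    congr 2
    omega
  · rw [signed_of_neg] at h
    refine Runs.branch_false h (Runs.push.congr_store ?_)
    have := signed_of_neg (n + 1)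
    push_cast at this
    rw [h, show -((n : ℤ) + 1) - 1 = -((n : ℤ) + 1 + 1) by ring, this, List.replicate_succ]

/-- One step of the random walk that compares the two distributions `g true` and `g false`. -/
noncomputable def walkStep (g : Bool → PMF Bool) : PMF ℤ :=
  (PMF.uniformOfFintype Bool).bind fun v =>
    (g v).map fun a => if a then (if v then 1 else -1) else 0

/-- `N` steps of a random walk. -/
noncomputable def walk (ξ : PMF ℤ) : ℕ → ℤ → PMF ℤ
  | 0, z => PMF.pure z
  | N + 1, z => ξ.bind fun x => walk ξ N (z + x)

/-- The answers to probes. -/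
noncomputable def probeDist (enc : Cmd) (lam : ℕ) (l : List (List Bool)) (c : Bool)
    (f : List Bool → PMF Bool) (J : List Bool) (rem : ℕ) (v : Bool) : PMF Bool :=
  (hybrid enc lam l c (probeFlags J v rem)).bind fun z => f (encodeList z)

/-- The body of the estimation loop. -/
def estimateStep (enc ask : Cmd) : Cmd :=
  .pop 25 ;; .flip 28 ;; probe enc ask ;; .branch 23 .skip .skip (.branch 28 .skip decr incr) ;;
    clr 23 ;; clr 28

/-- The flag `v` of a probe is a fair coin, and an answer `true` moves the counter up or down
according to `v`. The mean of this step is half the signed influence, so a single random walk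
estimates the difference of two acceptance probabilities. -/
theorem runs_estimateStep (hO : ShortOracle O) (hl : KeysBounded enc lam b l)
    (ha : Asks O ask f F (b * (2 * b + 1)) t) {J : List Bool} {rem N' : ℕ} {z : ℤ}
    (h : Ready lam l c N θ F s) (h15 : s 15 = J) (h16 : s 16 = unary rem) (h24 : s 24 = signed z)
    (h25 : s 25 = unary (N' + 1)) (h28 : s 28 = []) (hlen : J.length + 1 + rem = l.length) :
    Runs O (estimateStep enc ask) s (probeTime enc b t + 10)
      ((walkStep (probeDist enc lam l c f J rem)).map fun x =>
        update (update s 25 (unary N')) 24 (signed (z + x))) := by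
  rw [walkStep, PMF.map_bind]
  refine (Runs.seq_pure Runs.pop (Runs.seq (t' := probeTime enc b t + 8) Runs.flip
    fun v _ => ?_)).mono (by omega)
  have e : update (update s 25 (s 25).tail) 28 (v :: update s 25 (s 25).tail 28) =
      update (update s 25 (unary N')) 28 [v] := by
    simp [h25, unary_succ, h28]
  rw [e, PMF.map_comp]
  refine (Runs.seq_map (t' := 8) (runs_probe hO hl ha (J := J) (rem := rem) (v := v)
    ((h.update ha (by decide) _).update ha (by decide) _) (by simp [h15]) (by simp [h16])
    (by simp) hlen) fun a _ => ?_)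
  have h23 := h.h23
  refine Runs.seqp (t := 4) (t' := 4) (s' := update (update (update (update s 25 (unary N')) 28 [v])
    23 [a]) 24 (signed (z + if a then (if v then 1 else -1) else 0))) ?_ ?_ le_rfl
  · cases a
    · refine (Runs.branch_false (l := []) (by simp) (Runs.skip.mono (t' := 3)
        (by decide))).congr_store ?_
      funext i
      grind [Function.update_apply]
    · cases v
      · refine (Runs.branch_true (l := []) (by simp) (Runs.branch_false (l := []) (by simp)
          (runs_decr (z := z) (by simp [h24])))).congr_store ?_
        simp [sub_eq_add_neg]
      · refine (Runs.branch_true (l := []) (by simp) (Runs.branch_true (l := []) (by simp)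
          (runs_incr (z := z) (by simp [h24])))).congr_store ?_
        simp
  · refine (Runs.seqp (runs_clr hO 23 _) (runs_clr hO 28 _) le_rfl).congr_store ?_
    funext i
    grind [Function.update_apply]

/-- Estimate the influence of the next feature, with the result in register 24. -/
def estimate (enc ask : Cmd) : Cmd := cpy 26 25 ;; .loop 25 (estimateStep enc ask)

/-- A time bound for `estimate`. -/
def estimateTime (enc : Cmd) (b t N : ℕ) : ℕ := N * (probeTime enc b t + 20) + 3

theorem runs_estimate (hO : ShortOracle O) (hl : KeysBounded enc lam b l)
    (ha : Asks O ask f F (b * (2 * b + 1)) t) {J : List Bool} {rem : ℕ}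
    (h : Ready lam l c N θ F s) (h15 : s 15 = J) (h16 : s 16 = unary rem) (h24 : s 24 = [])
    (h25 : s 25 = []) (h28 : s 28 = []) (hlen : J.length + 1 + rem = l.length) :
    Runs O (estimate enc ask) s (estimateTime enc b t N)
      ((walk (walkStep (probeDist enc lam l c f J rem)) N 0).map fun x =>
        update s 24 (signed x)) := by
  -- The induction has to start from an arbitrary position `z` of the walk, since the counter is not
  -- reset between rounds.
  have key : ∀ (N' : ℕ) (z : ℤ) (s : Store), Ready lam l c N θ F s → s 15 = J → s 16 = unary rem →
      s 24 = signed z → s 25 = unary N' → s 28 = [] →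
      Runs O (.loop 25 (estimateStep enc ask)) s (N' * (probeTime enc b t + 11) + 1)
        ((walk (walkStep (probeDist enc lam l c f J rem)) N' z).map fun x =>
          update (update s 25 []) 24 (signed x)) := by
    intro N'
    induction N' with
    | zero =>
      intro z s h h15 h16 h24 h25 h28
      refine ((Runs.loop_nil h25).mono (by omega)).congr ?_
      simp only [walk, PMF.pure_map]
      congr 1
      funext i
      grind [Function.update_apply, unary_zero]
    | succ N' ih =>
      intro z s h h15 h16 h24 h25 h28
      refine ((Runs.loop_cons (by simp [h25, unary_succ]) (runs_estimateStep hO hl ha h h15 h16 h24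
        h25 h28 hlen) fun x _ => ih (z + x) _ ((h.update ha (by decide) _).update ha (by decide) _)
        (by simp [h15]) (by simp [h16]) (by simp) (by simp) (by simp [h28])).mono ?_).congr ?_
      · rw [Nat.add_mul]; omega
      · rw [walk, PMF.map_bind]
        refine bind_congr_support fun x _ => map_congr_support fun y _ => ?_
        funext i
        grind [Function.update_apply]
  refine ((Runs.seq_pure (runs_cpy (x := unary N) (by decide) (by decide) (by decide) h.h26
    (h.idle.1 10 (by decide) (by decide))) (key N 0 _ (h.update ha (by decide) _) (by simp [h15])
    (by simp [h16]) (by simp [h24, signed_zero]) (by simp [h25]) (by simp [h28]))).mono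
    ?_).congr ?_
  · simp only [estimateTime, length_unary, Nat.mul_add]; omega
  · refine map_congr_support fun x _ => ?_
    funext i
    grind [Function.update_apply]

end Greedy


/-! ## The greedy choice of the protected features -/

/-- The decision on the next feature, where `cnt` more features have to be protected and `sl` more
features have to be left unprotected. -/
noncomputable def decideFeature (test : List Bool → ℕ → PMF Bool) (rem : ℕ) (J : List Bool)
    (cnt sl : ℕ) : PMF Bool :=
  if cnt = 0 then PMF.pure false else if sl = 0 then PMF.pure true else test J rem

/-- The greedy choice of flags: the features with set flags are protected. -/
noncomputable def greedyDist (test : List Bool → ℕ → PMF Bool) :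
    ℕ → List Bool → ℕ → ℕ → PMF (List Bool)
  | 0, J, _, _ => PMF.pure J
  | rem + 1, J, cnt, sl => (decideFeature test rem J cnt sl).bind fun a =>
      greedyDist test rem (a :: J) (if a then cnt - 1 else cnt) (if a then sl else sl - 1)

/-- The test whether the estimated influence of a feature is below the threshold. -/
noncomputable def testDist (enc : Cmd) (lam : ℕ) (l : List (List Bool)) (c : Bool)
    (f : List Bool → PMF Bool) (N θ : ℕ) (J : List Bool) (rem : ℕ) : PMF Bool :=
  (walk (walkStep (probeDist enc lam l c f J rem)) N 0).map fun x => decide (x.natAbs < θ)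

/-- Subtract the absolute value of the integer in register 24 from the number in register 30. -/
def subAbs : Cmd := .loop 24 (.pop 24 ;; .pop 30)

theorem runs_subAbs {O : Oracle} {x : List Bool} {θ : ℕ} {s : Store} (h24 : s 24 = x)
    (h30 : s 30 = unary θ) :
    Runs O subAbs s (3 * x.length + 1)
      (PMF.pure (update (update s 24 []) 30 (unary (θ - x.length)))) := by
  induction x generalizing s θ with
  | nil =>
    refine (Runs.loop_nil h24).congr_store ?_
    funext i
    grind [Function.update_apply]
  | cons a x ih =>
    have hb : Runs O (.pop 24 ;; .pop 30) s 2
        (PMF.pure (update (update s 24 x) 30 (unary (θ - 1)))) := by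
      refine (Runs.seq_pure Runs.pop Runs.pop).congr_store ?_
      rw [h24]
      simp [h30, unary]
    refine (Runs.loopp (by simp [h24]) hb (ih (θ := θ - 1) (by simp) (by simp)) ?_).congr_store ?_
    · simp; omega
    · rw [show θ - (a :: x).length = θ - 1 - x.length by simp; omega]
      funext i
      grind [Function.update_apply]

/-- Leave the next feature unprotected. -/
def reject : Cmd := .push 15 false ;; .pop 18

/-- Protect the next feature. -/
def accept : Cmd := .push 15 true ;; .pop 17

/-- Decide on the next feature. -/
def greedyStep (enc ask : Cmd) : Cmd :=
  .pop 16 ;; .branch 17 reject .skip (.branch 18 accept .skip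
    (estimate enc ask ;; cpy 27 30 ;; subAbs ;; .branch 30 reject .skip accept ;; clr 30))

/-- The store after a decision. -/
def afterStep (s : Store) (J : List Bool) (rem cnt sl : ℕ) (a : Bool) : Store :=
  update (update (update (update s 16 (unary rem)) 15 (a :: J)) 17
    (unary (if a then cnt - 1 else cnt))) 18 (unary (if a then sl else sl - 1))

section Greedy

variable {O : Oracle} {enc ask : Cmd} {lam b N θ t : ℕ} {l : List (List Bool)} {c : Bool}
  {f : List Bool → PMF Bool} {F : Store → Prop} {s : Store}

theorem tail_unary (k : ℕ) : (unary k).tail = unary (k - 1) := by simp [unary]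

theorem runs_reject {J : List Bool} {rem cnt sl : ℕ} (h15 : s 15 = J) (h16 : s 16 = unary rem)
    (h17 : s 17 = unary cnt) (h18 : s 18 = unary sl) :
    Runs O reject s 2 (PMF.pure (afterStep s J rem cnt sl false)) := by
  refine (Runs.seq_pure Runs.push Runs.pop).congr_store ?_
  simp only [afterStep]
  have := tail_unary sl
  funext i
  grind [Function.update_apply]

theorem runs_accept {J : List Bool} {rem cnt sl : ℕ} (h15 : s 15 = J) (h16 : s 16 = unary rem)
    (h17 : s 17 = unary cnt) (h18 : s 18 = unary sl) :
    Runs O accept s 2 (PMF.pure (afterStep s J rem cnt sl true)) := by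
  refine (Runs.seq_pure Runs.push Runs.pop).congr_store ?_
  simp only [afterStep]
  have := tail_unary cnt
  funext i
  grind [Function.update_apply]

/-- A time bound for `greedyStep`. -/
def greedyStepTime (enc : Cmd) (b t N θ : ℕ) : ℕ := estimateTime enc b t N + 3 * N + 9 * θ + 20

/-- Comparing the estimate with the threshold is a loop of length `|x|`, so its running time needs
this deterministic bound. -/
theorem natAbs_le_of_mem_support_walk {g : Bool → PMF Bool} {z x : ℤ}
    (h : x ∈ (walk (walkStep g) N z).support) : x.natAbs ≤ z.natAbs + N := by
  induction N generalizing z with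
  | zero => simp [walk] at h; simp [h]
  | succ N ih =>
    simp only [walk, PMF.mem_support_bind_iff] at h
    obtain ⟨y, hy, hx⟩ := h
    have := ih hx
    have hy' : y.natAbs ≤ 1 := by
      simp only [walkStep, PMF.mem_support_bind_iff, PMF.mem_support_map_iff] at hy
      obtain ⟨v, -, a, -, rfl⟩ := hy
      cases v <;> cases a <;> simp
    omega

theorem runs_greedyStep (hO : ShortOracle O) (hl : KeysBounded enc lam b l)
    (ha : Asks O ask f F (b * (2 * b + 1)) t) {J : List Bool} {rem cnt sl : ℕ}
    (h : Ready lam l c N θ F s) (h15 : s 15 = J) (h16 : s 16 = unary (rem + 1))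
    (h17 : s 17 = unary cnt) (h18 : s 18 = unary sl) (h24 : s 24 = [])
    (h25 : s 25 = []) (h28 : s 28 = []) (hlen : J.length + 1 + rem = l.length) :
    Runs O (greedyStep enc ask) s (greedyStepTime enc b t N θ)
      ((decideFeature (testDist enc lam l c f N θ) rem J cnt sl).map
        (afterStep s J rem cnt sl)) := by
  have e16 : update s 16 (s 16).tail = update s 16 (unary rem) := by rw [h16]; rfl
  have eaft : ∀ a, afterStep (update s 16 (unary rem)) J rem cnt sl a =
      afterStep s J rem cnt sl a := by
    intro a
    simp only [afterStep, Function.update_idem]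
  refine (Runs.seq_pure Runs.pop (t' := greedyStepTime enc b t N θ - 1) ?_).mono
    (by simp only [greedyStepTime]; omega)
  rw [e16]
  by_cases hc : cnt = 0
  · rw [decideFeature, if_pos hc, PMF.pure_map, ← eaft]
    exact (Runs.branch_nil (by simp [h17, hc]) (runs_reject (by simp [h15]) (by simp)
      (by simp [h17]) (by simp [h18]))).mono (by simp only [greedyStepTime]; omega)
  obtain ⟨cnt', rfl⟩ : ∃ k, cnt = k + 1 := ⟨cnt - 1, by omega⟩
  by_cases hsl : sl = 0
  · rw [decideFeature, if_neg hc, if_pos hsl, PMF.pure_map, ← eaft]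
    exact (Runs.branch_true (l := unary cnt') (by simp [h17, unary_succ])
      (Runs.branch_nil (by simp [h18, hsl]) (runs_accept (by simp [h15])
      (by simp) (by simp [h17]) (by simp [h18])))).mono (by simp only [greedyStepTime]; omega)
  obtain ⟨sl', rfl⟩ : ∃ k, sl = k + 1 := ⟨sl - 1, by omega⟩
  rw [decideFeature, if_neg hc, if_neg hsl, testDist, PMF.map_comp]
  refine (Runs.branch_true (l := unary cnt') (by simp [h17, unary_succ]) (Runs.branch_true
    (l := unary sl') (by simp [h18, unary_succ]) (Runs.seq_map (t' := 9 * θ + 3 * N + 11)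
    (runs_estimate hO hl ha (J := J) (rem := rem) (h.update ha (by decide) _) (by simp [h15])
      (by simp) (by simp [h24]) (by simp [h25]) (by simp [h28]) hlen) fun x hx => ?_))).mono
    (by simp only [greedyStepTime]; omega)
  have hx' := natAbs_le_of_mem_support_walk hx
  have hlx : (signed x).length = x.natAbs := by simp [signed]
  have h30 := h.h30
  have h10 := h.idle.1 10 (by decide) (by decide)
  refine Runs.seqp (runs_cpy (x := unary θ) (by decide) (by decide) (by decide) (by simp [h.h27])
    (by simp [h10])) (Runs.seqp (t := 3 * N + 1) (t' := 5)
    (s' := update (update s 16 (unary rem)) 30 (unary (θ - x.natAbs)))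
    (((runs_subAbs (x := signed x) (θ := θ) (by simp) (by simp [h30])).mono ?_).congr_store ?_)
    (Runs.seqp (t := 3) (t' := 2) (s' := update (afterStep s J rem (cnt' + 1) (sl' + 1)
      (decide (x.natAbs < θ))) 30 (unary (θ - x.natAbs))) ?_
      ((runs_clr hO 30 _).congr_store ?_) le_rfl) le_rfl) ?_
  · simp only [Int.natAbs_zero] at hx'
    omega
  · rw [hlx]
    funext i
    grind [Function.update_apply]
  · have e : ∀ a, afterStep (update (update s 16 (unary rem)) 30 (unary (θ - x.natAbs))) J rem
        (cnt' + 1) (sl' + 1) a = update (afterStep s J rem (cnt' + 1) (sl' + 1) a) 30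
          (unary (θ - x.natAbs)) := by
      intro a
      simp only [afterStep]
      funext i
      grind [Function.update_apply]
    -- The truncated difference `θ - |x|` is a nonempty unary string exactly when the estimate lies
    -- below the threshold, so branching on register 30 performs the comparison.
    by_cases hθ : x.natAbs < θ
    · obtain ⟨k, hk⟩ : ∃ k, θ - x.natAbs = k + 1 := ⟨θ - x.natAbs - 1, by omega⟩
      rw [decide_eq_true hθ, ← e]
      exact Runs.branch_true (l := unary k) (by simp [hk, unary_succ]) (runs_accept (by simp [h15])
        (by simp) (by simp [h17]) (by simp [h18]))
    · rw [decide_eq_false hθ, ← e]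
      exact Runs.branch_nil (by simp [show θ - x.natAbs = 0 by omega]) (runs_reject (by simp [h15])
        (by simp) (by simp [h17]) (by simp [h18]))
  · simp only [afterStep, Function.comp]
    funext i
    grind [Function.update_apply]
  · simp; omega

theorem runs_greedyLoop (hO : ShortOracle O) (hl : KeysBounded enc lam b l)
    (ha : Asks O ask f F (b * (2 * b + 1)) t) {J : List Bool} {rem cnt sl : ℕ}
    (h : Ready lam l c N θ F s) (h15 : s 15 = J) (h16 : s 16 = unary rem)
    (h17 : s 17 = unary cnt) (h18 : s 18 = unary sl) (h24 : s 24 = [])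
    (h25 : s 25 = []) (h28 : s 28 = []) (hlen : J.length + rem = l.length)
    (hcnt : cnt + sl = rem) :
    Runs O (.loop 16 (greedyStep enc ask)) s (rem * (greedyStepTime enc b t N θ + 1) + 1)
      ((greedyDist (testDist enc lam l c f N θ) rem J cnt sl).map fun J' =>
        update (update (update (update s 16 []) 17 []) 18 []) 15 J') := by
  induction rem generalizing s J cnt sl with
  | zero =>
    obtain rfl : cnt = 0 := by omega
    obtain rfl : sl = 0 := by omega
    refine ((Runs.loop_nil h16).mono (by omega)).congr ?_
    simp only [greedyDist, PMF.pure_map]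
    congr 1
    funext i
    grind [Function.update_apply, unary_zero]
  | succ rem ih =>
    -- Every decision takes one unit from one of the two budgets. The forced decisions prevent
    -- either from being overdrawn, so `cnt + sl = rem` persists.
    have hsupp : ∀ a ∈ (decideFeature (testDist enc lam l c f N θ) rem J cnt sl).support,
        (if a then cnt - 1 else cnt) + (if a then sl else sl - 1) = rem := by
      intro a ha
      unfold decideFeature at ha
      split_ifs at ha <;> simp at ha <;> cases a <;> simp_all <;> omega
    refine ((Runs.loop_cons (by simp [h16, unary_succ]) (runs_greedyStep hO hl ha h h15 h16 h17 h18
      h24 h25 h28 (by omega)) fun a haa => ih (J := a :: J) ((((h.update ha (by decide) _).update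
      ha (by decide) _).update ha (by decide) _).update ha (by decide) _) (by simp [afterStep])
      (by simp [afterStep]) (by simp only [afterStep]; rw [Function.update_of_ne (by decide),
        Function.update_self]) (by simp only [afterStep]; rw [Function.update_self])
      (by simp [afterStep, h24]) (by simp [afterStep, h25])
      (by simp [afterStep, h28]) (by simp; omega) (hsupp a haa)).mono ?_).congr ?_
    · rw [Nat.add_mul]; omega
    · rw [greedyDist, PMF.map_bind]
      refine bind_congr_support fun a _ => map_congr_support fun J' _ => ?_
      simp only [afterStep]
      funext i
      grind [Function.update_apply]

end Greedy

theorem length_of_mem_support_greedyDist {test : List Bool → ℕ → PMF Bool} {rem : ℕ}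
    {J J' : List Bool} {cnt sl : ℕ} (h : J' ∈ (greedyDist test rem J cnt sl).support) :
    J'.length = J.length + rem := by
  induction rem generalizing J cnt sl with
  | zero => simp [greedyDist] at h; simp [h]
  | succ rem ih =>
    simp only [greedyDist, PMF.mem_support_bind_iff] at h
    obtain ⟨a, -, h⟩ := h
    have := ih h
    simp at this
    omega

/-- Since `cnt + sl = rem` and the forced decisions take over when a budget is empty, both budgets
are spent exactly, whatever the tests answer. This makes the output an allowed one for every yes/no
oracle. -/
theorem count_of_mem_support_greedyDist {test : List Bool → ℕ → PMF Bool} {rem : ℕ}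
    {J J' : List Bool} {cnt sl : ℕ} (hcnt : cnt + sl = rem)
    (h : J' ∈ (greedyDist test rem J cnt sl).support) :
    J'.count true = J.count true + cnt := by
  induction rem generalizing J cnt sl with
  | zero => simp [greedyDist] at h; simp [h]; omega
  | succ rem ih =>
    simp only [greedyDist, PMF.mem_support_bind_iff] at h
    obtain ⟨a, ha, h⟩ := h
    unfold decideFeature at ha
    split_ifs at ha with h1 h2
    · simp at ha; subst ha
      have := ih (by simp; omega) h
      simp at this; omega
    · simp at ha; subst ha
      have := ih (by simp; omega) h
      simp at this; omega
    · cases a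
      · have := ih (by simp; omega) h
        simp at this; omega
      · have := ih (by simp; omega) h
        simp at this; omega

/-! ## The complete choice of the protected features -/

theorem runs_call_unary {O : Oracle} (hO : ShortOracle O) {j : ℕ} {P : Cmd} {o lam m b T : ℕ}
    {s : Store} (h0 : s 0 = unary lam) (h : HaltsWithin noOracle T P [unary lam])
    (hm : ∀ v ∈ (final noOracle P [unary lam]).support, v 0 = unary m) (hb : lam ≤ b)
    (ho : o < 64 ∧ o ≠ 10 ∧ o ≠ 9 ∧ o ≠ 0) (h9 : s 9 = []) (h10 : s 10 = [])
    (hs : ∀ r, s (region j r) = []) :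
    Runs O (call j P [0] o) s (callTime P 1 b T + 4) (PMF.pure (update s o (unary m))) := by
  refine (runs_call hO (ins := [0]) (xs := [unary lam]) (by simp [h0]) h (by simp; omega)
    (by simpa using hb) ⟨ho.1, ho.2.1, ho.2.2.1⟩ h9 h10 hs).congr ?_
  rw [map_congr_support (g := fun _ => update s o (unary m)) fun v hv => by rw [hm v hv]]
  exact PMF.map_const _ _

/-- Divide the number in register 31 into two halves in the registers 17 and 18. -/
def halve : Cmd :=
  .loop 31 (.pop 31 ;; .push 17 true ;; .branch 31 .skip .skip (.pop 31 ;; .push 18 true))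

/-- Each round gives a unit to register 17 first, so the rounded-up half ends there: it is the
number of protected features, and register 18 gets the number of the others. -/
theorem runs_halve {O : Oracle} : ∀ (m : ℕ) {i j : ℕ} {s : Store}, s 31 = unary m →
    s 17 = unary i → s 18 = unary j → Runs O halve s (6 * m + 1) (PMF.pure (update (update
      (update s 31 []) 17 (unary (i + (m + 1) / 2))) 18 (unary (j + m / 2)))) := by
  intro m
  induction m using Nat.strong_induction_on with
  | _ m ih =>
    intro i j s h31 h17 h18
    rcases m with _ | _ | m
    · clear ih
      refine (Runs.loop_nil h31).congr_store ?_
      funext i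
      grind [Function.update_apply, unary_zero]
    · clear ih
      have hb : Runs O (.pop 31 ;; .push 17 true ;; .branch 31 .skip .skip
          (.pop 31 ;; .push 18 true)) s 4
          (PMF.pure (update (update s 31 []) 17 (unary (i + 1)))) := by
        refine (Runs.seqp Runs.pop (Runs.seqp Runs.push (Runs.branch_nil (by simp [h31, unary])
          Runs.skip) le_rfl) (by omega)).congr_store ?_
        rw [h31, Function.update_of_ne (by decide), h17, ← unary_succ]
        rfl
      refine (Runs.loopp (by simp [h31, unary]) hb (Runs.loop_nil (by simp))
        (by omega)).congr_store ?_
      funext i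
      grind [Function.update_apply]
    · have hb : Runs O (.pop 31 ;; .push 17 true ;; .branch 31 .skip .skip
          (.pop 31 ;; .push 18 true)) s 5
          (PMF.pure (update (update (update s 31 (unary m)) 17 (unary (i + 1))) 18
            (unary (j + 1)))) := by
        refine (Runs.seqp Runs.pop (Runs.seqp Runs.push (Runs.branch_true (l := unary m)
          (by simp [h31, unary_succ]) (Runs.seq_pure Runs.pop Runs.push)) le_rfl)
          (by omega)).congr_store ?_
        have e1 := unary_succ i
        have e2 := unary_succ j
        have e3 : (unary (m + 2)).tail.tail = unary m := rfl
        clear ih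
        funext i
        grind [Function.update_apply]
      refine (Runs.loopp (by simp [h31, unary_succ]) hb (ih m (by omega) (i := i + 1) (j := j + 1)
        (by simp) (by simp) (by simp)) (by omega)).congr_store ?_
      rw [show i + (m + 2 + 1) / 2 = i + 1 + (m + 1) / 2 by omega,
        show j + (m + 2) / 2 = j + 1 + m / 2 by omega]
      clear ih
      funext i
      grind [Function.update_apply]


/-- The program `P` computes the function `g` in unary notation, from register `x` to register
`o`, within time `t`. -/
def Evaluates (P : Cmd) (g : ℕ → ℕ) (x o : ℕ) (t : ℕ → ℕ) : Prop :=
  ∀ (O : Oracle) (s : Store) (k : ℕ), s x = unary k → s o = [] → s 6 = [] → s 10 = [] →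
    Runs O P s (t k) (PMF.pure (update s o (unary (g k))))

/-- The precision of the estimates. -/
def precision (m : ℕ) : ℕ := 24 * m

/-- The number of rounds of an estimate. -/
def rounds (m : ℕ) : ℕ := 4 * precision m ^ 3

/-- The threshold for the estimates. -/
def threshold (m : ℕ) : ℕ := 8 * precision m ^ 2

/-- The store contains the inputs for the choice of the protected features. -/
structure Fresh (lam : ℕ) (l : List (List Bool)) (c : Bool) (k : ℕ) (F : Store → Prop)
    (s : Store) : Prop where
  frame : F s
  idle : Idle s
  h0 : s 0 = unary lam
  h1 : s 1 = [c]
  h2 : s 2 = encodeList l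
  h4 : s 4 = unary k
  h6 : s 6 = []
  work : ∀ r, 15 ≤ r → r ≤ 32 → s r = []
  region : ∀ r, s (region 2 r) = []

/-- Compute the parameters of the greedy choice. -/
def setup (Pn PN Pθ : Cmd) : Cmd :=
  call 2 Pn [0] 16 ;; cpy 16 31 ;; halve ;; .branch 1 .skip (.push 29 true) (.push 29 false) ;;
    cpy 16 31 ;; mul 31 4 32 ;; PN ;; Pθ ;; clr 32

/-- The bound `W` covers the parameters of the greedy choice and the time to compute them. -/
structure ParamBound (PN Pθ : Cmd) (tN tθ : ℕ → ℕ) (m W : ℕ) : Prop where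
  evalN : Evaluates PN rounds 32 26 tN
  evalθ : Evaluates Pθ threshold 32 27 tθ
  timeN : tN m ≤ W
  timeθ : tθ m ≤ W
  le_N : rounds m ≤ W
  le_θ : threshold m ≤ W

/-- A time bound for `setup`. -/
def setupTime (Pn : Cmd) (b k W : ℕ) : ℕ :=
  callTime Pn 1 b b + 28 * b + b * (9 * k + 4) + 2 * W + 20

section Choice

variable {O : Oracle} {enc ask Pn PN Pθ : Cmd} {lam n b k t W : ℕ} {l : List (List Bool)}
  {c : Bool} {f : List Bool → PMF Bool} {F : Store → Prop} {s : Store} {tN tθ : ℕ → ℕ}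

/-- The store after `setup`. -/
def afterSetup (s : Store) (c : Bool) (n k : ℕ) : Store :=
  update (update (update (update (update (update s 16 (unary n)) 17 (unary ((n + 1) / 2))) 18
    (unary (n / 2))) 29 [!c]) 26 (unary (rounds (n * k)))) 27 (unary (threshold (n * k)))

theorem runs_setup (hO : ShortOracle O) (hlam : lam ≤ b) (hnb : n ≤ b)
    (hPn : HaltsWithin noOracle b Pn [unary lam])
    (hn : ∀ v ∈ (final noOracle Pn [unary lam]).support, v 0 = unary n)
    (hW : ParamBound PN Pθ tN tθ (n * k) W) (h : Fresh lam l c k F s) :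
    Runs O (setup Pn PN Pθ) s (setupTime Pn b k W) (PMF.pure (afterSetup s c n k)) := by
  have w := h.work
  have w16 := w 16 (by decide) (by decide)
  have w17 := w 17 (by decide) (by decide)
  have w18 := w 18 (by decide) (by decide)
  have w26 := w 26 (by decide) (by decide)
  have w27 := w 27 (by decide) (by decide)
  have w29 := w 29 (by decide) (by decide)
  have w31 := w 31 (by decide) (by decide)
  have w32 := w 32 (by decide) (by decide)
  have h9 := h.idle.1 9 (by decide) (by decide)
  have h10 := h.idle.1 10 (by decide) (by decide)
  have h1 := h.h1
  have h4 := h.h4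
  have h6 := h.h6
  have r1 : Runs O (call 2 Pn [0] 16) s (callTime Pn 1 b b + 4)
      (PMF.pure (update s 16 (unary n))) :=
    runs_call_unary hO h.h0 hPn hn hlam (by decide) h9 h10 h.region
  have r2 : Runs O (cpy 16 31) (update s 16 (unary n)) (9 * n + 2)
      (PMF.pure (update (update s 16 (unary n)) 31 (unary n))) :=
    ((runs_cpy (x := unary n) (by decide) (by decide) (by decide) (by simp)
      (by simp [h10])).mono (by simp)).congr_store (by simp [w31])
  have r3 : Runs O halve (update (update s 16 (unary n)) 31 (unary n)) (6 * n + 1)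
      (PMF.pure (update (update (update s 16 (unary n)) 17 (unary ((n + 1) / 2))) 18
        (unary (n / 2)))) := by
    refine (runs_halve n (i := 0) (j := 0) (by simp) (by simp [w17]) (by simp [w18])).congr_store ?_
    rw [zero_add, zero_add]
    funext i
    grind [Function.update_apply]
  have r4 : Runs O (.branch 1 .skip (.push 29 true) (.push 29 false))
      (update (update (update s 16 (unary n)) 17 (unary ((n + 1) / 2))) 18 (unary (n / 2))) 2
      (PMF.pure (update (update (update (update s 16 (unary n)) 17 (unary ((n + 1) / 2))) 18
        (unary (n / 2))) 29 [!c])) := by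
    cases c
    · exact Runs.branch_false (l := []) (by simp [h1]) (Runs.push.congr_store (by simp [w29]))
    · exact Runs.branch_true (l := []) (by simp [h1]) (Runs.push.congr_store (by simp [w29]))
  generalize hs1 : (update (update (update (update s 16 (unary n)) 17 (unary ((n + 1) / 2))) 18
        (unary (n / 2))) 29 [!c]) = s1 at r4
  have e16 : s1 16 = unary n := by simp [← hs1]
  have e4 : s1 4 = unary k := by simp [← hs1, h4]
  have e6 : s1 6 = [] := by simp [← hs1, h6]
  have e10 : s1 10 = [] := by simp [← hs1, h10]
  have e26 : s1 26 = [] := by simp [← hs1, w26]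
  have e27 : s1 27 = [] := by simp [← hs1, w27]
  have e31 : s1 31 = [] := by simp [← hs1, w31]
  have e32 : s1 32 = [] := by simp [← hs1, w32]
  have r5 : Runs O (cpy 16 31) s1 (9 * n + 2) (PMF.pure (update s1 31 (unary n))) :=
    ((runs_cpy (x := unary n) (by decide) (by decide) (by decide) e16
      e10).mono (by simp)).congr_store (by simp [e31])
  have r6 : Runs O (mul 31 4 32) (update s1 31 (unary n)) (n * (9 * k + 4) + 1)
      (PMF.pure (update s1 32 (unary (n * k)))) := by
    refine (runs_mul (m := n) (k := k) (j := 0) (by decide) (by decide) (by decide) (by decide)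
      (by decide) (by decide) (by simp) (by simp [e4]) (by simp [e32]) (by simp [e10])).congr_store ?_
    rw [add_zero]
    funext i
    grind [Function.update_apply]
  have r7 := hW.evalN O (update s1 32 (unary (n * k))) (n * k) (by simp) (by simp [e26])
    (by simp [e6]) (by simp [e10])
  have r8 := hW.evalθ O (update (update s1 32 (unary (n * k))) 26 (unary (rounds (n * k)))) (n * k)
    (by simp) (by simp [e27]) (by simp [e6]) (by simp [e10])
  have r9 := runs_clr hO 32 (update (update (update s1 32 (unary (n * k))) 26
    (unary (rounds (n * k)))) 27 (unary (threshold (n * k))))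
  refine ((Runs.seq_pure r1 (Runs.seq_pure r2 (Runs.seq_pure r3 (Runs.seq_pure r4
    (Runs.seq_pure r5 (Runs.seq_pure r6 (Runs.seq_pure r7
      (Runs.seq_pure r8 r9)))))))).mono ?_).congr_store ?_
  · have := hW.timeN
    have := hW.timeθ
    have := Nat.mul_le_mul_right (9 * k + 4) hnb
    simp only [setupTime]
    omega
  · rw [afterSetup, hs1]
    funext i
    grind [Function.update_apply]

/-- Choose the protected features. -/
def choose (enc ask Pn PN Pθ : Cmd) : Cmd :=
  setup Pn PN Pθ ;; .loop 16 (greedyStep enc ask)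

/-- A time bound for `choose`. -/
def chooseTime (enc Pn : Cmd) (b k t W : ℕ) : ℕ :=
  setupTime Pn b k W + (b * (greedyStepTime enc b t W W + 1) + 1)

@[fun_prop]
theorem PolyBounded.chooseTime (enc Pn : Cmd) {b k t W : ℕ → ℕ} (hb : PolyBounded b)
    (hk : PolyBounded k) (ht : PolyBounded t) (hW : PolyBounded W) :
    PolyBounded fun x => chooseTime enc Pn (b x) (k x) (t x) (W x) := by
  unfold RobustLearning.chooseTime setupTime greedyStepTime estimateTime probeTime
  fun_prop

/-- The distribution of the flags of the protected features, last feature first. -/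
noncomputable def flagsDist (enc : Cmd) (lam : ℕ) (l : List (List Bool)) (c : Bool) (k : ℕ)
    (f : List Bool → PMF Bool) : PMF (List Bool) :=
  greedyDist (testDist enc lam l c f (rounds (l.length * k)) (threshold (l.length * k))) l.length []
    ((l.length + 1) / 2) (l.length / 2)

/-- The subprogram `ask` and the frame `F` are left open because the same choice is run twice: by
the attack with its oracle, and by the reduction with its own copy of the classifier. -/
theorem runs_choose (hO : ShortOracle O) (hl : KeysBounded enc lam b l)
    (hPn : HaltsWithin noOracle b Pn [unary lam])
    (hn : ∀ v ∈ (final noOracle Pn [unary lam]).support, v 0 = unary l.length)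
    (hW : ParamBound PN Pθ tN tθ (l.length * k) W)
    (ha : Asks O ask f F (b * (2 * b + 1)) t) (h : Fresh lam l c k F s) :
    Runs O (choose enc ask Pn PN Pθ) s (chooseTime enc Pn b k t W)
      ((flagsDist enc lam l c k f).map fun J => update (update (update (update s 29 [!c]) 26
        (unary (rounds (l.length * k)))) 27 (unary (threshold (l.length * k)))) 15 J) := by
  have w := h.work
  have hr : Ready lam l c (rounds (l.length * k)) (threshold (l.length * k)) F
      (afterSetup s c l.length k) := by
    have key : ∀ i, i ∉ [16, 17, 18, 29, 26, 27] → afterSetup s c l.length k i = s i := by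
      intro i hi
      simp only [List.mem_cons, List.not_mem_nil, or_false, not_or] at hi
      obtain ⟨h1, h2, h3, h4, h5, h6⟩ := hi
      simp only [afterSetup, ne_eq, h1, h2, h3, h4, h5, h6, not_false_eq_true,
        Function.update_of_ne]
    refine ⟨?_, ?_, ?_, ?_, ?_, ?_, ?_, ?_, ?_, ?_, ?_, ?_, ?_, ?_⟩
    · unfold afterSetup
      iterate 6 refine ha.frame _ _ _ ?_ (by decide) (by decide)
      exact h.frame
    · unfold afterSetup
      exact (((((h.idle.update (by decide) _).update (by decide) _).update (by decide) _).update
        (by decide) _).update (by decide) _).update (by decide) _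
    · rw [key _ (by decide), h.h0]
    · rw [key _ (by decide), h.h1]
    · rw [key _ (by decide), h.h2]
    · simp [afterSetup]
    · simp [afterSetup]
    · simp [afterSetup]
    all_goals rw [key _ (by decide), w _ (by decide) (by decide)]
  refine ((Runs.seq_pure (runs_setup hO hl.lam_le hl.count hPn hn hW h) (runs_greedyLoop hO hl ha
    (J := []) (rem := l.length) (cnt := (l.length + 1) / 2) (sl := l.length / 2) hr ?_ ?_ ?_ ?_ ?_
      ?_ ?_ (by simp) (by omega))).mono ?_).congr ?_
  · simp [afterSetup, w]
  · simp [afterSetup]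
  · simp [afterSetup]
  · simp [afterSetup]
  · simp [afterSetup, w]
  · simp [afterSetup, w]
  · simp [afterSetup, w]
  · simp only [chooseTime, greedyStepTime, estimateTime]
    have h1 := hW.le_N
    have h2 := hW.le_θ
    have h3 := hl.count
    gcongr
  · unfold flagsDist
    refine map_congr_support fun J _ => ?_
    have w16 := w 16 (by decide) (by decide)
    have w17 := w 17 (by decide) (by decide)
    have w18 := w 18 (by decide) (by decide)
    simp only [afterSetup]
    clear hr w
    funext i
    simp only [Function.update_apply]
    split_ifs <;> simp_all

end Choice

/-! ## The perturbation adversary -/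

/-- Put the perturbed sample into register 0 and the flags into register 1. -/
def assemble (enc : Cmd) : Cmd :=
  revList 3 20 ;; encryptAll enc 29 21 ;; cpy 15 19 ;; mix ;; clr 0 ;; mv 22 0 ;; clr 1 ;; pour 15 1

/-- A time bound for `assemble`. -/
def assembleTime (enc : Cmd) (b : ℕ) : ℕ :=
  encryptTime enc b + 88 * (b * (2 * b + 1)) + 13 * b + 20

theorem runs_assemble {O : Oracle} (hO : ShortOracle O) {enc : Cmd} {lam b : ℕ}
    {l : List (List Bool)} (hl : KeysBounded enc lam b l) {c : Bool} {J : List Bool}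
    {x : List (List Bool)} {s : Store} (hJ : J.length = l.length) (hx : x.length = l.length)
    (hxb : ∀ w ∈ x, w.length ≤ b) (h0 : s 0 = unary lam) (h2 : s 2 = encodeList l)
    (h3 : s 3 = encodeList x) (h29 : s 29 = [!c]) (h15 : s 15 = J)
    (hw : ∀ r, 19 ≤ r → r ≤ 22 → s r = []) (hs : Idle s) :
    Runs O (assemble enc) s (assembleTime enc b)
      ((sampL enc lam l (!c)).map fun y => update (update (update (update s 3 []) 0
        (encodeList (mixL J.reverse x y))) 1 J.reverse) 15 []) := by
  have h10 := hs.1 10 (by decide) (by decide)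
  have h11 := hs.1 11 (by decide) (by decide)
  have h12 := hs.1 12 (by decide) (by decide)
  have w19 := hw 19 (by decide) (by decide)
  have w20 := hw 20 (by decide) (by decide)
  have w21 := hw 21 (by decide) (by decide)
  have w22 := hw 22 (by decide) (by decide)
  have hb := hl.count
  have hxl : (encodeList x).length ≤ b * (2 * b + 1) :=
    (length_encodeList_le hxb).trans (Nat.mul_le_mul_right _ (hx ▸ hb))
  have r1 : Runs O (revList 3 20) s (20 * (b * (2 * b + 1)) + 1)
      (PMF.pure (update (update s 3 []) 20 (encodeList x.reverse))) :=
    ((runs_revList (by decide) (by decide) (by decide) h3 h10 h11 h12).mono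
      (by omega)).congr_store (by simp [w20])
  have r2 := runs_encryptAll hO hl (m := 29) (o := 21) (bit := !c)
    (s := update (update s 3 []) 20 (encodeList x.reverse)) (by decide) (by decide) (by decide)
    (by simp [h0]) (by simp [h2]) (by simp [h29]) ((hs.update (by decide) _).update (by decide) _)
  refine (Runs.seq_pure r1 (Runs.seq_map (t' := 68 * (b * (2 * b + 1)) + 13 * b + 19) r2
    fun y hy => ?_)).mono (by simp only [assembleTime]; omega)
  have hy' := length_of_mem_support_sampL hy
  have hyl := (hl.length_sampL_le hy).2
  have e21 : update (update s 3 []) 20 (encodeList x.reverse) 21 = [] := by simp [w21]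
  rw [e21, List.append_nil]
  have r3 : Runs O (cpy 15 19) (update (update (update s 3 []) 20 (encodeList x.reverse)) 21
      (encodeList y.reverse)) (9 * b + 2) (PMF.pure (update (update (update (update s 3 []) 20
      (encodeList x.reverse)) 21 (encodeList y.reverse)) 19 J)) :=
    ((runs_cpy (x := J) (by decide) (by decide) (by decide) (by simp [h15])
      (by simp [h10])).mono (by omega)).congr_store (by simp [w19])
  have r4 : Runs O mix (update (update (update (update s 3 []) 20
      (encodeList x.reverse)) 21 (encodeList y.reverse)) 19 J) (60 * (b * (2 * b + 1)) + 1)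
      (PMF.pure (update (update s 3 []) 22 (encodeList (mixL J.reverse x y)))) := by
    refine ((runs_mix hO (V := J) (X := x.reverse) (Y := y.reverse) (by simp [hx, hJ])
      (by simp [hy', hJ]) (by simp) (by simp) (by simp) (by simp [h10]) (by simp [h11])
      (by simp [h12])).mono ?_).congr_store ?_
    · rw [length_encodeList_reverse, length_encodeList_reverse]
      omega
    · rw [← mixL_reverse (by simp [hx, hJ]) (by simp [hy', hJ]), List.reverse_reverse,
        List.reverse_reverse]
      funext i
      grind [Function.update_apply]
  have hml : (encodeList (mixL J.reverse x y)).length ≤ b * (2 * b + 1) := by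
    refine (length_encodeList_le (m := b) fun w hw => ?_).trans (Nat.mul_le_mul_right _ ?_)
    · rcases mem_or_mem_of_mem_mixL hw with hw | hw
      · exact hxb w hw
      · exact (hl.length_sampL_le hy).1 w hw
    · rw [length_mixL] <;> simp [hJ, hx, hy', hb]
  refine (Runs.seqp r3 (Runs.seqp r4 (Runs.seqp (runs_clr hO 0 _) (Runs.seqp (runs_mv
    (x := encodeList (mixL J.reverse x y)) (by decide) (by decide) (by decide) (by simp)
    (by simp [h10])) (Runs.seqp (runs_clr hO 1 _) (runs_pour (x := J) (by decide) (by simp [h15]))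
    le_rfl) le_rfl) le_rfl) le_rfl) ?_).congr_store ?_
  · omega
  · funext i
    grind [Function.update_apply]

/-- The perturbation adversary. -/
def attack (enc Pn PN Pθ : Cmd) : Cmd :=
  choose enc (.query 22 23 ;; clr 22) Pn PN Pθ ;; assemble enc

theorem runs_askOracle (f : List Bool → PMF Bool) (s : Store) :
    Runs (bitOracle f) (.query 22 23 ;; clr 22) s 3
      ((f (s 22)).map fun b => update (update s 22 []) 23 [b]) := by
  have h1 : Runs (bitOracle f) (.query 22 23) s 1
      ((f (s 22)).map fun b => update s 23 [b]) :=
    Runs.query.congr (by simp only [bitOracle, PMF.map_comp, Function.comp_def])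
  refine (Runs.seq_map h1 fun b _ =>
    (runs_clr (shortOracle_bitOracle f) 22 _).congr_store ?_).mono (by decide)
  exact Function.update_comm (by decide) _ _ _

theorem asks_bitOracle (f : List Bool → PMF Bool) (m : ℕ) :
    Asks (bitOracle f) (.query 22 23 ;; clr 22) f (fun _ => True) m 3 where
  run s _ _ _ := runs_askOracle f s
  frame _ _ _ _ _ _ := trivial

/-- Only the two output registers of the final store are described. The form of the distribution
matters: the law of the flags does not mention `x`, and the fresh sample is independent of the
flags. -/
theorem runs_attack {enc Pn PN Pθ : Cmd} {lam b k W : ℕ} {l : List (List Bool)}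
    {c : Bool} {f : List Bool → PMF Bool} {s : Store} {tN tθ : ℕ → ℕ}
    {x : List (List Bool)} (hl : KeysBounded enc lam b l)
    (hPn : HaltsWithin noOracle b Pn [unary lam])
    (hn : ∀ v ∈ (final noOracle Pn [unary lam]).support, v 0 = unary l.length)
    (hW : ParamBound PN Pθ tN tθ (l.length * k) W) (h : Fresh lam l c k (fun _ => True) s)
    (hx : x.length = l.length) (hxb : ∀ w ∈ x, w.length ≤ b) (h3 : s 3 = encodeList x) :
    ∃ g : List Bool → List (List Bool) → Store,
      (∀ J y, g J y 0 = encodeList (mixL J.reverse x y) ∧ g J y 1 = J.reverse) ∧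
      Runs (bitOracle f) (attack enc Pn PN Pθ) s (chooseTime enc Pn b k 3 W + assembleTime enc b)
        ((flagsDist enc lam l c k f).bind fun J => (sampL enc lam l (!c)).map (g J)) := by
  have hO := shortOracle_bitOracle f
  have w := h.work
  refine ⟨fun J y => update (update (update (update (update (update (update (update s 29 [!c]) 26
    (unary (rounds (l.length * k)))) 27 (unary (threshold (l.length * k)))) 15 J) 3 []) 0
    (encodeList (mixL J.reverse x y))) 1 J.reverse) 15 [], fun J y => ?_, Runs.seq (runs_choose hO
      hl hPn hn hW (asks_bitOracle f _) h) fun J hJ => ?_⟩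
  · simp
  · refine runs_assemble hO hl (c := c) ?_ hx hxb ?_ ?_ ?_ ?_ ?_ ?_ ?_
    · simpa using length_of_mem_support_greedyDist hJ
    · simp [h.h0]
    · simp [h.h2]
    · simp [h3]
    · simp
    · simp
    · intro r h1 h2
      rw [Function.update_of_ne (by omega), Function.update_of_ne (by omega),
        Function.update_of_ne (by omega), Function.update_of_ne (by omega), w r (by omega)
        (by omega)]
    · exact (((h.idle.update (by decide) _).update (by decide) _).update (by decide) _).update
        (by decide) _


/-! ## A random index -/

/-- Append `t` random bits to the binary representation of a number. -/
noncomputable def bitsDist : ℕ → ℕ → PMF ℕ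
  | 0, m => PMF.pure m
  | t + 1, m => (PMF.uniformOfFintype Bool).bind fun b => bitsDist t (2 * m + b.toNat)

/-- Double the number in register 39, and add a random bit. -/
def appendBit : Cmd :=
  pour 39 32 ;; .loop 32 (.pop 32 ;; .push 39 true ;; .push 39 true) ;; .flip 28 ;;
    .branch 28 .skip .skip (.push 39 true) ;; .pop 28

theorem runs_appendBit {O : Oracle} {m : ℕ} {s : Store} (h39 : s 39 = unary m) (h32 : s 32 = [])
    (h28 : s 28 = []) :
    Runs O appendBit s (8 * m + 6) ((PMF.uniformOfFintype Bool).map fun b =>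
      update s 39 (unary (2 * m + b.toNat))) := by
  have dbl : ∀ (k j : ℕ) (s : Store), s 32 = unary k → s 39 = unary j →
      Runs O (.loop 32 (.pop 32 ;; .push 39 true ;; .push 39 true)) s (4 * k + 1)
        (PMF.pure (update (update s 32 []) 39 (unary (2 * k + j)))) := by
    intro k
    induction k with
    | zero =>
      intro j s h h'
      refine (Runs.loop_nil h).congr_store ?_
      funext i
      grind [Function.update_apply, unary_zero]
    | succ k ih =>
      intro j s h h'
      have hb : Runs O (.pop 32 ;; .push 39 true ;; .push 39 true) s 3
          (PMF.pure (update (update s 32 (unary k)) 39 (unary (j + 2)))) := by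
        refine (Runs.seqp Runs.pop (Runs.seq_pure Runs.push Runs.push) le_rfl).congr_store ?_
        simp [h, h', unary_succ]
      refine (Runs.loopp (by simp [h, unary_succ]) hb (ih (j + 2) _ (by simp) (by simp))
        (by omega)).congr_store ?_
      rw [show 2 * k + (j + 2) = 2 * (k + 1) + j by ring]
      clear ih
      funext i
      grind [Function.update_apply]
  refine (Runs.seq_pure (runs_pour (x := unary m) (by decide) h39) (Runs.seq_pure
    (dbl m 0 _ (by simp [h32, reverse_unary]) (by simp)) (t' := 4) (Runs.seq_map (t' := 3) Runs.flip
    fun b _ => ?_))).mono (by rw [length_unary]; omega)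
  clear dbl
  cases b
  · refine (Runs.seqp (Runs.branch_false (l := []) (by simp [h28]) Runs.skip) Runs.pop
      (by decide)).congr_store ?_
    funext i
    simp only [Function.update_apply]
    split_ifs <;> simp_all
  · refine (Runs.seqp (Runs.branch_true (l := []) (by simp [h28]) Runs.push) Runs.pop
      (by decide)).congr_store ?_
    simp only [Bool.toNat_true, unary_succ]
    funext i
    grind [Function.update_apply]

/-- Put a random number with as many bits as the number in register 31 into register 39. -/
def pickIndex : Cmd := .loop 31 (halve ;; clr 17 ;; pour 18 31 ;; appendBit)

/-- Halving register 31 until it is empty gives one round for each binary digit of `m`, and each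
round appends one random digit. The resulting number stays below `(j + 1) * 2 ^ m.size`, hence its
unary notation stays polynomial. -/
theorem runs_pickIndex {O : Oracle} (hO : ShortOracle O) : ∀ (m : ℕ) {j : ℕ} {s : Store},
    s 31 = unary m → s 39 = unary j → s 17 = [] → s 18 = [] → s 32 = [] → s 28 = [] →
    Runs O pickIndex s (m * (8 * ((j + 1) * (m + 1)) + 10 * m + 20) + 1)
      ((bitsDist m.size j).map fun i => update (update s 31 []) 39 (unary i)) := by
  intro m
  induction m using Nat.strong_induction_on with
  | _ m ih =>
    intro j s h31 h39 h17 h18 h32 h28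
    rcases Nat.eq_zero_or_pos m with rfl | hm
    · clear ih
      refine ((Runs.loop_nil h31).mono (by omega)).congr ?_
      simp only [Nat.size_zero, bitsDist, PMF.pure_map]
      congr 1
      funext i
      grind [Function.update_apply, unary_zero]
    · have hbody : Runs O (halve ;; clr 17 ;; pour 18 31 ;; appendBit) s
          (6 * m + 1 + (2 + (4 * m + 1 + (8 * j + 6))))
          ((PMF.uniformOfFintype Bool).map fun b =>
            update (update s 31 (unary (m / 2))) 39 (unary (2 * j + b.toNat))) := by
        have e : update (update (update (update (update (update s 31 []) 17
            (unary (0 + (m + 1) / 2))) 18 (unary (0 + m / 2))) 17 []) 18 []) 31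
              ((unary (m / 2)).reverse ++ []) = update s 31 (unary (m / 2)) := by
          rw [reverse_unary]
          clear ih
          funext i
          grind [Function.update_apply]
        have h3 : Runs O (pour 18 31) (update (update (update (update s 31 []) 17
            (unary (0 + (m + 1) / 2))) 18 (unary (0 + m / 2))) 17 []) (4 * m + 1)
            (PMF.pure (update s 31 (unary (m / 2)))) := by
          refine ((runs_pour (x := unary (m / 2)) (by decide) (by simp)).mono
            (by simp; omega)).congr_store ?_
          rw [← e]
          simp
        refine Runs.seq_pure (runs_halve m (i := 0) (j := 0) h31 (by simp [h17]) (by simp [h18]))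
          (Runs.seq_pure (runs_clr hO 17 _) (Runs.seq_pure h3
            (runs_appendBit (by simp [h39]) (by simp [h32]) (by simp [h28]))))
      have hlt : m / 2 < m := Nat.div_lt_self hm (by decide)
      refine ((Runs.loop_cons (t' := (m / 2) * (8 * ((2 * j + 2) * (m / 2 + 1)) +
        10 * (m / 2) + 20) + 1) (by simp [h31, unary, hm.ne']) hbody
        fun b _ => (ih (m / 2) hlt (j := 2 * j + b.toNat)
        (by simp) (by simp) (by simp [h17]) (by simp [h18]) (by simp [h32])
        (by simp [h28])).mono ?_).mono ?_).congr ?_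
      · have : b.toNat ≤ 1 := Bool.toNat_le b
        have hj : 2 * j + b.toNat + 1 ≤ 2 * j + 2 := by omega
        generalize 2 * j + b.toNat + 1 = u at *
        gcongr
      · have h2 : 2 * (m / 2) ≤ m := Nat.mul_div_le m 2
        generalize m / 2 = k at *
        obtain ⟨d, rfl⟩ := Nat.exists_eq_add_of_le h2
        clear ih hbody
        have : k + d ≥ 1 := by omega
        nlinarith [Nat.zero_le (k * j), Nat.zero_le (d * j), Nat.zero_le (k * k * j),
          Nat.zero_le (k * d * j), Nat.zero_le (k * d), Nat.zero_le (d * d * j), Nat.zero_le (d * d),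
          Nat.zero_le (k * k), Nat.mul_le_mul_left j this]
      · have hs : m.size = (m / 2).size + 1 := by
          conv_lhs => rw [← Nat.bit_bodd_div2 m]
          rw [Nat.size_bit, Nat.div2_val]
          rw [Nat.bit_bodd_div2]
          exact hm.ne'
        rw [hs, bitsDist, PMF.map_bind]
        refine bind_congr_support fun b _ => map_congr_support fun i _ => ?_
        clear ih hbody
        funext i
        grind [Function.update_apply]

/-- The coin sequence that spells the binary digits of `j` leads to this number. A lower bound is
all that the reduction uses. -/
theorem le_bitsDist {t m j : ℕ} (hj : j < 2 ^ t) :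
    ((2 : ENNReal)⁻¹) ^ t ≤ bitsDist t m (m * 2 ^ t + j) := by
  induction t generalizing m j with
  | zero =>
    obtain rfl : j = 0 := by simpa using hj
    simp [bitsDist]
  | succ t ih =>
    obtain ⟨b, j', hj', e⟩ : ∃ (b : Bool) (j' : ℕ), j' < 2 ^ t ∧
        m * 2 ^ (t + 1) + j = (2 * m + b.toNat) * 2 ^ t + j' := by
      by_cases h : j < 2 ^ t
      · exact ⟨false, j, h, by simp; ring⟩
      · refine ⟨true, j - 2 ^ t, by rw [pow_succ] at hj; omega, ?_⟩
        obtain ⟨d, rfl⟩ := Nat.exists_eq_add_of_le (not_lt.1 h)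
        simp; ring
    rw [bitsDist, PMF.bind_apply, e, pow_succ', ]
    refine le_trans ?_ (ENNReal.le_tsum b)
    rw [PMF.uniformOfFintype_apply]
    exact mul_le_mul' (by simp) (ih hj')

/-! ## The flag of the chosen feature -/

/-- The flags of `m` features of which only the `d`-th is set, where the features are counted from
one. -/
def selectFlags : ℕ → ℕ → List Bool
  | 0, _ => []
  | m + 1, d => decide (d = 1) :: selectFlags m (d - 1)

/-- After the chosen feature the truncated counter rests at `0`, so no further flag is set. This is
why features are counted from one, and why the index is shifted. -/
theorem selectFlags_succ {m i : ℕ} :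
    selectFlags m (i + 1) = (List.replicate m false).set i true := by
  induction m generalizing i with
  | zero => rfl
  | succ m ih =>
    cases i with
    | zero =>
      have : ∀ k, selectFlags k 0 = List.replicate k false := by
        intro k
        induction k with
        | zero => rfl
        | succ k ih => simp [selectFlags, ih, List.replicate_succ]
      simp [selectFlags, this, List.replicate_succ]
    | succ i => simp [selectFlags, ih, List.replicate_succ]

theorem length_selectFlags (m d : ℕ) : (selectFlags m d).length = m := by
  induction m generalizing d with
  | zero => rfl
  | succ m ih => simp [selectFlags, ih]

/-- Put the flags on register 37, where the number of features is in register 38 and the chosen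
feature in register 39. -/
def pushFlags : Cmd :=
  .loop 38 (.pop 38 ;; .branch 39 (.push 37 false) .skip
    (.pop 39 ;; .branch 39 (.push 37 true) .skip (.push 37 false)))

theorem runs_pushFlags {O : Oracle} {m d : ℕ} {E : List Bool} {s : Store} (h38 : s 38 = unary m)
    (h39 : s 39 = unary d) (h37 : s 37 = E) :
    Runs O pushFlags s (6 * m + 1) (PMF.pure (update (update (update s 38 []) 39 (unary (d - m)))
      37 ((selectFlags m d).reverse ++ E))) := by
  induction m generalizing d E s with
  | zero =>
    refine (Runs.loop_nil h38).congr_store ?_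
    funext i
    grind [Function.update_apply, unary_zero, selectFlags]
  | succ m ih =>
    have hb : Runs O (.pop 38 ;; .branch 39 (.push 37 false) .skip
        (.pop 39 ;; .branch 39 (.push 37 true) .skip (.push 37 false))) s 5
        (PMF.pure (update (update (update s 38 (unary m)) 39 (unary (d - 1))) 37
          (decide (d = 1) :: E))) := by
      clear ih
      have e : (unary (m + 1)).tail = unary m := rfl
      rcases d with _ | _ | d
      · refine (Runs.seqp Runs.pop (Runs.branch_nil (by simp [h39]) Runs.push)
          (by decide)).congr_store ?_
        funext i
        grind [Function.update_apply, unary_zero]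
      · refine (Runs.seqp Runs.pop (Runs.branch_true (l := []) (by simp [h39, unary])
          (Runs.seq_pure Runs.pop (Runs.branch_nil (by simp [h39, unary]) Runs.push)))
          (by decide)).congr_store ?_
        have e' : (unary 1).tail = unary 0 := rfl
        funext i
        grind [Function.update_apply]
      · refine (Runs.seqp Runs.pop (Runs.branch_true (l := unary (d + 1)) (by simp [h39, unary_succ])
          (Runs.seq_pure Runs.pop (Runs.branch_true (l := unary d) (by simp [h39, unary_succ])
          Runs.push))) (by decide)).congr_store ?_
        have e' : (unary (d + 2)).tail = unary (d + 1) := rfl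
        funext i
        grind [Function.update_apply]
    refine (Runs.loopp (by simp [h38, unary_succ]) hb (ih (d := d - 1) (E := decide (d = 1) :: E)
      (by simp) (by simp) (by simp)) (by omega)).congr_store ?_
    have e1 : d - 1 - m = d - (m + 1) := by omega
    have e2 : (selectFlags (m + 1) d).reverse ++ E =
        (selectFlags m (d - 1)).reverse ++ decide (d = 1) :: E := by simp [selectFlags]
    rw [e1, e2]
    clear ih
    funext i
    grind [Function.update_apply]

/-! ## The keys of all features -/

/-- The encoding of a list of key pairs. -/
def keysCode (ks : List (List Bool × List Bool)) : List Bool :=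
  encodeList (ks.flatMap fun key => [key.1, key.2])

theorem keysCode_cons (key : List Bool × List Bool) (ks : List (List Bool × List Bool)) :
    keysCode (key :: ks) = encodeString key.1 ++ (encodeString key.2 ++ keysCode ks) := by
  simp [keysCode, encodeList_cons]

/-- For every flag in register 38, the key pair in the registers 35 and 36 or a new one is put on
the list of keys in register 42, and the public key on the list in register 2. -/
def pushKeys (keyGen : Cmd) : Cmd :=
  .loop 38 (.branch 38 .skip (call2 3 keyGen [0, 34] 40 41) (cpy 35 40 ;; cpy 36 41) ;; .pop 38 ;;
    cpy 40 43 ;; encPush 43 2 ;; encPush 41 42 ;; encPush 40 42)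

/-- Independent key pairs, of which the flagged ones are fixed. -/
noncomputable def keysDist (G : PMF (List Bool × List Bool)) (key : List Bool × List Bool)
    (E : List Bool) : PMF (List (List Bool × List Bool)) :=
  prodL (E.map fun e => if e then PMF.pure key else G)

/-- A time bound for one round of `pushKeys`. -/
def pushKeysTime (keyGen : Cmd) (b : ℕ) : ℕ := callTime keyGen 2 b b + 60 * b + 30

section Keys

variable {O : Oracle} {keyGen : Cmd} {lam ℓ b : ℕ} {key : List Bool × List Bool}

theorem runs_nextKey (hO : ShortOracle O)
    (hhalt : HaltsWithin noOracle b keyGen [unary lam, unary ℓ])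
    (hkey : key.1.length ≤ b ∧ key.2.length ≤ b) (hlam : lam ≤ b) (hℓ : ℓ ≤ b)
    {e : Bool} {E : List Bool} {s : Store}
    (h0 : s 0 = unary lam) (h34 : s 34 = unary ℓ) (h35 : s 35 = key.1) (h36 : s 36 = key.2)
    (h38 : s 38 = e :: E) (h40 : s 40 = []) (h41 : s 41 = []) (h10 : s 10 = [])
    (hr : ∀ r, s (region 3 r) = []) :
    Runs O (.branch 38 .skip (call2 3 keyGen [0, 34] 40 41) (cpy 35 40 ;; cpy 36 41)) s
      (callTime keyGen 2 b b + 18 * b + 5)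
      ((if e then PMF.pure key else keyGenDist keyGen lam ℓ).map fun k =>
        update (update s 40 k.1) 41 k.2) := by
  cases e
  · rw [if_neg (by simp), keyGenDist, PMF.map_comp]
    refine ((Runs.branch_false h38 (runs_call2 hO (ins := [0, 34]) (b := b)
      (xs := [unary lam, unary ℓ]) (by simp [h0, h34]) hhalt (by decide) (by simp [hlam, hℓ])
      (by decide) (by decide) h10 hr)).mono (by simp; omega)).congr ?_
    refine map_congr_support fun v _ => ?_
    simp [h40, h41]
  · rw [if_pos rfl, PMF.pure_map]
    refine ((Runs.branch_true h38 (Runs.seq_pure (runs_cpy (by decide) (by decide) (by decide)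
      h35 h10) (runs_cpy (x := key.2) (by decide) (by decide) (by decide) (by simp [h36])
      (by simp [h10])))).mono (by omega)).congr_store ?_
    simp [h40, h41]

theorem runs_recordKey {x y : List Bool} {ks : List (List Bool × List Bool)} {e : Bool}
    {E : List Bool} {s : Store} (hx : x.length ≤ b) (hy : y.length ≤ b) (h38 : s 38 = e :: E)
    (h40 : s 40 = []) (h41 : s 41 = []) (h43 : s 43 = []) (h10 : s 10 = [])
    (h42 : s 42 = keysCode ks) (h2 : s 2 = encodeList (ks.map Prod.fst)) :
    Runs O (.pop 38 ;; cpy 40 43 ;; encPush 43 2 ;; encPush 41 42 ;; encPush 40 42)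
      (update (update s 40 x) 41 y) (36 * b + 14)
      (PMF.pure (update (update (update s 38 E) 42 (keysCode ((x, y) :: ks))) 2
        (encodeList (((x, y) :: ks).map Prod.fst)))) := by
  have r1 : Runs O (.pop 38) (update (update s 40 x) 41 y) 1
      (PMF.pure (update (update (update s 40 x) 41 y) 38 E)) :=
    Runs.pop.congr_store (by simp [h38])
  have r2 : Runs O (cpy 40 43) (update (update (update s 40 x) 41 y) 38 E) (9 * x.length + 2)
      (PMF.pure (update (update (update (update s 40 x) 41 y) 38 E) 43 x)) :=
    (runs_cpy (x := x) (by decide) (by decide) (by decide) (by simp)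
      (by simp [h10])).congr_store (by simp [h43])
  have r3 : Runs O (encPush 43 2) (update (update (update (update s 40 x) 41 y) 38 E) 43 x)
      (9 * x.length + 3) (PMF.pure (update (update (update (update s 40 x) 41 y) 38 E) 2
        (encodeList (x :: ks.map Prod.fst)))) := by
    refine (runs_encPush (x := x) (by decide) (by decide) (by decide) (by simp)
      (by simp [h10])).congr_store ?_
    rw [encodeList_cons, ← h2]
    funext i
    grind [Function.update_apply]
  have r4 : Runs O (encPush 41 42) (update (update (update (update s 40 x) 41 y) 38 E) 2
        (encodeList (x :: ks.map Prod.fst))) (9 * y.length + 3) (PMF.pure (update (update (update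
          (update s 40 x) 38 E) 2 (encodeList (x :: ks.map Prod.fst))) 42
            (encodeString y ++ keysCode ks))) := by
    refine (runs_encPush (x := y) (by decide) (by decide) (by decide) (by simp)
      (by simp [h10])).congr_store ?_
    rw [← h42]
    funext i
    grind [Function.update_apply]
  have r5 : Runs O (encPush 40 42) (update (update (update (update s 40 x) 38 E) 2
      (encodeList (x :: ks.map Prod.fst))) 42 (encodeString y ++ keysCode ks)) (9 * x.length + 3)
      (PMF.pure (update (update (update s 38 E) 42 (keysCode ((x, y) :: ks))) 2
        (encodeList (((x, y) :: ks).map Prod.fst)))) := by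
    refine (runs_encPush (x := x) (by decide) (by decide) (by decide) (by simp)
      (by simp [h10])).congr_store ?_
    rw [keysCode_cons, List.map_cons]
    funext i
    grind [Function.update_apply]
  exact Runs.seqp r1 (Runs.seqp r2 (Runs.seqp r3 (Runs.seqp r4 r5 le_rfl) le_rfl) le_rfl)
    (by omega)

/-- Key pairs are pushed on a stack, so the first flag to be processed belongs to the last entry of
the list; the induction on the flags has to split off that entry. -/
theorem keysDist_reverse_cons (G : PMF (List Bool × List Bool)) (e : Bool) (E : List Bool) :
    keysDist G key (e :: E).reverse = (if e then PMF.pure key else G).bind fun k =>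
      (keysDist G key E.reverse).map fun ks => ks ++ [k] := by
  simp only [keysDist, List.reverse_cons, List.map_append, List.map_cons, List.map_nil,
    prodL_append, prodL, PMF.map, PMF.pure_bind, PMF.bind_bind,
    Function.comp_def]
  rw [PMF.bind_comm]

theorem runs_pushKeys (hO : ShortOracle O)
    (hhalt : HaltsWithin noOracle b keyGen [unary lam, unary ℓ])
    (hG : ∀ k ∈ (keyGenDist keyGen lam ℓ).support, k.1.length ≤ b ∧ k.2.length ≤ b)
    (hkey : key ∈ (keyGenDist keyGen lam ℓ).support) (hlam : lam ≤ b) (hℓ : ℓ ≤ b)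
    {E : List Bool} {ks : List (List Bool × List Bool)} {s : Store}
    (h0 : s 0 = unary lam) (h34 : s 34 = unary ℓ) (h35 : s 35 = key.1) (h36 : s 36 = key.2)
    (h38 : s 38 = E) (h40 : s 40 = []) (h41 : s 41 = []) (h43 : s 43 = []) (h10 : s 10 = [])
    (h42 : s 42 = keysCode ks) (h2 : s 2 = encodeList (ks.map Prod.fst))
    (hr : ∀ r, s (region 3 r) = []) :
    Runs O (pushKeys keyGen) s (E.length * (pushKeysTime keyGen b) + 1)
      ((keysDist (keyGenDist keyGen lam ℓ) key E.reverse).map fun ks' =>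
        update (update (update s 38 []) 42 (keysCode (ks' ++ ks))) 2
          (encodeList ((ks' ++ ks).map Prod.fst))) := by
  induction E generalizing s ks with
  | nil =>
    refine ((Runs.loop_nil h38).mono (by omega)).congr ?_
    simp only [keysDist, List.reverse_nil, List.map_nil, prodL, PMF.pure_map, List.nil_append]
    congr 1
    clear hG hr
    funext i
    grind [Function.update_apply]
  | cons e E ih =>
    have hsupp : ∀ k ∈ (if e then PMF.pure key else keyGenDist keyGen lam ℓ).support,
        k.1.length ≤ b ∧ k.2.length ≤ b := by
      intro k hk
      split_ifs at hk
      · simp at hk; subst hk; exact hG _ hkey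
      · exact hG _ hk
    have hbody := Runs.seq_map (runs_nextKey hO hhalt (hG _ hkey) hlam hℓ h0 h34 h35 h36 h38 h40
      h41 h10 hr) fun k hk => runs_recordKey (O := O) (hsupp k hk).1 (hsupp k hk).2 h38 h40 h41 h43
        h10 h42 h2
    refine ((Runs.loop_cons (by simp [h38]) hbody fun k _ => ih (ks := k :: ks) (by simp [h0])
      (by simp [h34]) (by simp [h35]) (by simp [h36]) (by simp) (by simp [h40])
      (by simp [h41]) (by simp [h43]) (by simp [h10]) (by simp) (by simp) ?_).mono ?_).congr ?_
    · intro r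
      rw [Function.update_of_ne, Function.update_of_ne, Function.update_of_ne, hr] <;>
        simp only [region] <;> omega
    · simp only [List.length_cons, Nat.add_mul, pushKeysTime]
      omega
    · rw [keysDist_reverse_cons, PMF.map_bind]
      refine bind_congr_support fun k _ => ?_
      rw [PMF.map_comp]
      refine map_congr_support fun ks' _ => ?_
      clear ih hG hr hsupp hbody
      simp only [Function.comp, List.append_assoc, List.cons_append, List.nil_append]
      funext i
      simp only [Function.update_apply]
      split_ifs <;> rfl

end Keys


/-! ## Running a learner -/

/-- The sampler for the public keys `l` as an oracle. -/
noncomputable def sampleOracle (enc : Cmd) (lam : ℕ) (l : List (List Bool)) : Oracle :=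
  fun w => (sampL enc lam l (bitOf w)).map encodeList

/-- The distribution of the model that is learned for the keys `ks`. -/
noncomputable def learnDist (enc L : Cmd) (lam : ℕ) (ks : List (List Bool × List Bool)) :
    PMF (List Bool) :=
  (final (sampleOracle enc lam (ks.map Prod.fst)) L [unary lam, keysCode ks]).map fun v => v 0

/-- Answer the query in register `q` by a sample in register `r`. -/
def simulateSample (enc : Cmd) (q r : ℕ) : Cmd :=
  .branch q (.push 1 false) (.push 1 false) (.push 1 true) ;; clr r ;; encryptAll enc 1 20 ;;
    revList 20 r ;; clr 1

/-- A time bound for `simulateSample`. -/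
def simulateTime (enc : Cmd) (b : ℕ) : ℕ := encryptTime enc b + 20 * (b * (2 * b + 1)) + 7

theorem Idle.extend {s : Store} (h : Idle s) {j : ℕ} (hj : j = 2 ∨ j = 3) (v : Store) :
    Idle (Function.extend (region j) v s) := by
  refine ⟨fun r h1 h2 => ?_, fun r => ?_⟩
  · rw [extend_region_of_lt _ _ (by omega), h.1 r h1 h2]
  · rw [Function.extend_apply', h.2]
    rintro ⟨k, hk⟩
    simp only [region] at hk
    omega

/-- Sampling needs only the public keys, so the oracle of a learner can be answered by a program. As
in `bitOf`, the empty query stands for the class `false`. -/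
theorem runs_simulateSample {O : Oracle} (hO : ShortOracle O) {enc : Cmd} {lam b : ℕ}
    {l : List (List Bool)} (hl : KeysBounded enc lam b l) {s : Store} (h0 : s 0 = unary lam)
    (h1 : s 1 = []) (h2 : s 2 = encodeList l) (h20 : s 20 = []) (hs : Idle s) (q r : ℕ)
    (v : Store) :
    Runs O (simulateSample enc (region 2 q) (region 2 r)) (Function.extend (region 2) v s)
      (simulateTime enc b) ((sampleOracle enc lam l (v q)).map fun a =>
        Function.extend (region 2) (update v r a) s) := by
  have hr : ∀ r, r < 64 → ∀ k, r ≠ region 2 k := by intro r h k; simp only [region]; omega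
  have hq : Function.extend (region 2) v s (region 2 q) = v q :=
    (region_injective 2).extend_apply _ _ _
  have e1 : Function.extend (region 2) v s 1 = [] := by
    rw [extend_region_of_lt _ _ (by decide), h1]
  have r1 : Runs O (.branch (region 2 q) (.push 1 false) (.push 1 false) (.push 1 true))
      (Function.extend (region 2) v s) 2
      (PMF.pure (Function.extend (region 2) v (update s 1 [bitOf (v q)]))) := by
    have key : ∀ b, Runs O (.push 1 b) (Function.extend (region 2) v s) 1
        (PMF.pure (Function.extend (region 2) v (update s 1 [b]))) := by
      intro b
      refine Runs.push.congr_store ?_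
      rw [e1, update_extend_region _ _ _ (by decide)]
    rcases hv : v q with _ | ⟨_ | _, w⟩
    · exact Runs.branch_nil (hq.trans hv) (key _)
    · exact Runs.branch_false (hq.trans hv) (key _)
    · exact Runs.branch_true (hq.trans hv) (key _)
  have r2 : Runs O (clr (region 2 r)) (Function.extend (region 2) v (update s 1 [bitOf (v q)])) 2
      (PMF.pure (Function.extend (region 2) (update v r []) (update s 1 [bitOf (v q)]))) :=
    (runs_clr hO _ _).congr_store (update_extend (region_injective 2) _ _ _ _)
  have hidle : Idle (Function.extend (region 2) (update v r []) (update s 1 [bitOf (v q)])) :=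
    (hs.update (by decide) _).extend (Or.inl rfl) _
  have r3 := runs_encryptAll hO hl (m := 1) (o := 20) (bit := bitOf (v q))
    (s := Function.extend (region 2) (update v r []) (update s 1 [bitOf (v q)])) (by decide)
    (by decide) (by decide) (by rw [extend_region_of_lt _ _ (by decide)]; simp [h0])
    (by rw [extend_region_of_lt _ _ (by decide)]; simp [h2])
    (by rw [extend_region_of_lt _ _ (by decide)]; simp) hidle
  rw [sampleOracle, PMF.map_comp]
  refine (Runs.seq_pure r1 (Runs.seq_pure r2 (Runs.seq_map (t' := 20 * (b * (2 * b + 1)) + 3) r3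
    fun cs hcs => ?_))).mono (by simp only [simulateTime]; omega)
  have hlen := (hl.length_sampL_le hcs).2
  rw [← length_encodeList_reverse] at hlen
  rw [extend_region_of_lt _ _ (by decide), Function.update_of_ne (by decide), h20, List.append_nil]
  have r4 := runs_revList (O := O) (a := 20) (b := region 2 r) (l := cs.reverse)
    (s := update (Function.extend (region 2) (update v r []) (update s 1 [bitOf (v q)])) 20
      (encodeList cs.reverse)) (hr _ (by decide) r) (by decide)
    ⟨(hr _ (by decide) r).symm, (hr _ (by decide) r).symm, (hr _ (by decide) r).symm⟩ (by simp)
    (by rw [Function.update_of_ne (by decide), hidle.1 10 (by decide) (by decide)])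
    (by rw [Function.update_of_ne (by decide), hidle.1 11 (by decide) (by decide)])
    (by rw [Function.update_of_ne (by decide), hidle.1 12 (by decide) (by decide)])
  refine (Runs.seqp r4 (runs_clr hO 1 _) (by omega)).congr_store ?_
  rw [Function.update_of_ne (hr _ (by decide) r).symm, (region_injective 2).extend_apply,
    Function.update_self, List.append_nil, List.reverse_reverse, Function.update_idem,
    update_extend_region _ _ _ (by decide), update_extend (region_injective 2),
    update_extend_region _ _ _ (by decide), Function.update_idem, Function.comp]
  congr 1
  funext i
  grind [Function.update_apply]

/-- Run the learner `L` on the keys in register 42, with the model in register 44. -/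
def runLearner (enc L : Cmd) : Cmd :=
  copyIns 2 0 [0, 42] ;;
    L.rename (region 2) (fun q r => simulateSample enc (region 2 q) (region 2 r)) ;;
    mv (region 2 0) 44 ;; clearRegion 2 (L.width + 2)

/-- A time bound for `runLearner`. -/
def runLearnerTime (enc L : Cmd) (b B T : ℕ) : ℕ :=
  L.renameTime (simulateTime enc b) T + 26 * B + 2 * L.width + 12

theorem runs_runLearner {O : Oracle} (hO : ShortOracle O) {enc L : Cmd} {lam b B T : ℕ}
    {ks : List (List Bool × List Bool)} (hl : KeysBounded enc lam b (ks.map Prod.fst))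
    (hL : HaltsWithin (sampleOracle enc lam (ks.map Prod.fst)) T L [unary lam, keysCode ks])
    (hks : (keysCode ks).length ≤ B) (hlam : lam ≤ B)
    (hB : ∀ h ∈ (learnDist enc L lam ks).support, h.length ≤ B)
    {s : Store} (h0 : s 0 = unary lam)
    (h1 : s 1 = []) (h2 : s 2 = encodeList (ks.map Prod.fst)) (h42 : s 42 = keysCode ks)
    (h20 : s 20 = []) (h44 : s 44 = []) (hs : Idle s) (hs2 : ∀ r, s (region 2 r) = []) :
    Runs O (runLearner enc L) s (runLearnerTime enc L b B T)
      ((learnDist enc L lam ks).map fun h => update s 44 h) := by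
  have hr : ∀ r, r < 64 → ∀ k, r ≠ region 2 k := by intro r h k; simp only [region]; omega
  have h10 := hs.1 10 (by decide) (by decide)
  have r1 : Runs O (copyIns 2 0 [0, 42]) s (2 * (9 * B + 2) + 1)
      (PMF.pure (Function.extend (region 2) (load [unary lam, keysCode ks]) s)) := by
    have := runs_copyIns (O := O) (b := B) (v := fun _ => []) 2 (k := 0) (s := s) (ins := [0, 42])
      (by simp [h0, h42, hks, hlam]) h10 (by simp)
    rw [extend_region_self 2 s hs2] at this
    refine this.congr_store ?_
    simp [h0, h42]
    rfl
  have r2 := Runs.rename (region_injective 2) (O := sampleOracle enc lam (ks.map Prod.fst))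
    (runs_simulateSample hO hl h0 h1 h2 h20 hs) L (load [unary lam, keysCode ks]) hL
  have r2' := r2.congr (ν := (final (sampleOracle enc lam (ks.map Prod.fst)) L
    [unary lam, keysCode ks]).map fun v => Function.extend (region 2) v s) (by
      rw [← (Runs.of_haltsWithin hL).2, PMF.map_comp]; rfl)
  rw [learnDist, PMF.map_comp]
  refine (Runs.seq_pure r1 (Runs.seq_map (t' := 8 * B + 2 * L.width + 7) r2'
    fun v hv => ?_)).mono (by simp only [runLearnerTime]; omega)
  have hv0 : (v 0).length ≤ B := hB _ (by
    rw [learnDist, PMF.mem_support_map_iff]; exact ⟨v, hv, rfl⟩)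
  have r3 := runs_mv (O := O) (a := region 2 0) (b := 44) (hr 44 (by decide) 0).symm
    (hr 10 (by decide) 0).symm (by decide)
    ((region_injective 2).extend_apply v s 0) (by rw [extend_region_of_lt _ _ (by decide), h10])
  have r3' := r3.congr_store (s₂ := Function.extend (region 2) (update v 0 []) (update s 44 (v 0)))
    (by rw [extend_region_of_lt _ _ (by decide), h44, List.append_nil,
      update_extend (region_injective 2), update_extend_region _ _ _ (by decide)])
  refine (Runs.seqp r3' (runs_clearRegion hO 2 _ _ _) (by omega)).congr_store ?_
  have hs2' : ∀ r, update s 44 (v 0) (region 2 r) = [] := fun r => by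
    rw [Function.update_of_ne (hr _ (by decide) r).symm, hs2]
  rw [Function.comp, ← extend_region_self 2 _ hs2']
  congr 1
  · funext i
    split_ifs with hi
    · rfl
    · have := final_eq_of_width_le hL hv (i := i) (by omega)
      rw [Function.update_of_ne (by omega), this]
      simp only [load, List.getD]
      rw [List.getElem?_eq_none (by simp; omega)]
      rfl
  · exact extend_region_self 2 _ hs2'

/-! ## Running a classifier -/

/-- Ask the classifier `C` with the model in register 44 about the string in register 22. -/
def askClassifier (C : Cmd) : Cmd :=
  call 3 C [0, 44, 22] 23 ;; clr 22 ;;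
    .branch 23 (.push 23 false) (clr 23 ;; .push 23 false) (clr 23 ;; .push 23 true)

/-- The frame for `askClassifier`. -/
def HasModel (lam : ℕ) (h : List Bool) (s : Store) : Prop :=
  s 0 = unary lam ∧ s 44 = h ∧ ∀ r, s (region 3 r) = []

theorem asks_askClassifier {O : Oracle} (hO : ShortOracle O) {C : Cmd} {lam m B T : ℕ}
    {h : List Bool} (hC : ∀ x : List Bool, x.length ≤ m →
      HaltsWithin noOracle T C [unary lam, h, x]) (hlam : lam ≤ B) (hh : h.length ≤ B)
    (hm : m ≤ B) :
    Asks O (askClassifier C) (classify C lam h) (HasModel lam h) m (callTime C 3 B T + 10) where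
  run s hF hs hx := by
    obtain ⟨h0, h44, h3⟩ := hF
    rw [classify, PMF.map_comp]
    refine (Runs.seq_map (t' := 6) (runs_call hO (ins := [0, 44, 22]) (b := B)
      (xs := [unary lam, h, s 22]) (by simp [h0, h44]) (hC _ hx) (by decide)
      (by simp [hlam, hh, hx.trans hm]) (by decide) (hs.1 9 (by decide) (by decide))
      (hs.1 10 (by decide) (by decide)) h3) fun v _ => ?_).mono (by simp)
    have e : ∀ b, Runs O (clr 23 ;; .push 23 b) (update (update s 23 (v 0)) 22 []) 3
        (PMF.pure (update (update s 22 []) 23 [b])) := by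
      intro b
      refine (Runs.seqp (runs_clr hO 23 _) Runs.push (by decide)).congr_store ?_
      funext i
      grind [Function.update_apply]
    refine Runs.seqp (t := 2) (t' := 4) (runs_clr hO 22 _) ?_ le_rfl
    -- The output of the classifier is normalised to a single bit, where the empty string counts as
    -- `false`.
    rcases hv : v 0 with _ | ⟨_ | _, w⟩
    · refine (Runs.branch_nil (by simp) (Runs.push.mono (t' := 3) (by decide))).congr_store ?_
      simp only [Function.comp, hv, bitOf, List.headD_nil]
      funext i
      grind [Function.update_apply]
    · rw [hv] at e
      exact (Runs.branch_false (l := w) (by simp) (e _)).congr_store (by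
        simp [Function.comp, hv, bitOf])
    · rw [hv] at e
      exact (Runs.branch_true (l := w) (by simp) (e _)).congr_store (by
        simp [Function.comp, hv, bitOf])
  frame s r x hF h1 h2 := by
    refine ⟨?_, ?_, fun k => ?_⟩
    · rw [Function.update_of_ne (by omega), hF.1]
    · rw [Function.update_of_ne (by omega), hF.2.1]
    · rw [Function.update_of_ne (by simp only [region]; omega), hF.2.2]

/-! ## Cutting off the choice of flags at the chosen feature -/

/-- The number of entries up to and including the first set one. -/
def cutLength : List Bool → ℕ
  | [] => 0
  | true :: _ => 1
  | false :: E => cutLength E + 1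

theorem cutLength_le (E : List Bool) : cutLength E ≤ E.length := by
  induction E with
  | nil => simp [cutLength]
  | cons e E ih => cases e <;> simp [cutLength, ih]

/-- The flags `J` with all flags up to the first one that is set in `E` removed. -/
def cutFlags (E J : List Bool) : List Bool :=
  List.replicate (cutLength E) false ++ J.drop (cutLength E)

theorem length_cutFlags {E J : List Bool} (h : E.length = J.length) :
    (cutFlags E J).length = J.length := by
  have := cutLength_le E
  simp [cutFlags]
  omega

/-- Replace the flags in register 15 by `cutFlags`, in register 19. -/
def cut : Cmd :=
  cpy 37 38 ;; cpy 15 19 ;; .loop 38 (.pop 19 ;; .push 30 true ;; .branch 38 .skip (.pop 38)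
    (clr 38)) ;; padFlags

/-- Both lists run from the last feature to the first, so the prefix up to the set entry of `E`
consists of the chosen feature and all later ones. Unsetting it recovers the flags as they were
before the chosen feature was decided. -/
theorem runs_cut {O : Oracle} (hO : ShortOracle O) {E J : List Bool} {s : Store} (h37 : s 37 = E)
    (h15 : s 15 = J) (h38 : s 38 = []) (h19 : s 19 = []) (h30 : s 30 = []) (h10 : s 10 = []) :
    Runs O cut s (20 * E.length + 9 * J.length + 6) (PMF.pure (update s 19 (cutFlags E J))) := by
  have key : ∀ (E J : List Bool) (j : ℕ) (s : Store), s 38 = E → s 19 = J → s 30 = unary j →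
      Runs O (.loop 38 (.pop 19 ;; .push 30 true ;; .branch 38 .skip (.pop 38) (clr 38))) s
        (6 * E.length + 1) (PMF.pure (update (update (update s 38 []) 19 (J.drop (cutLength E))) 30
          (unary (cutLength E + j)))) := by
    intro E
    induction E with
    | nil =>
      intro J j s h h' h''
      refine (Runs.loop_nil h).congr_store ?_
      simp only [cutLength, List.drop_zero, zero_add]
      funext i
      grind [Function.update_apply]
    | cons e E ih =>
      intro J j s h h' h''
      have hJ : ∀ k, J.tail.drop k = J.drop (k + 1) := by intro k; cases J <;> simp
      have hj : true :: unary j = unary (j + 1) := rfl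
      cases e
      · have hb : Runs O (.pop 19 ;; .push 30 true ;; .branch 38 .skip (.pop 38) (clr 38)) s 5
            (PMF.pure (update (update (update s 38 E) 19 J.tail) 30 (unary (j + 1)))) := by
          refine (Runs.seqp Runs.pop (Runs.seqp Runs.push (Runs.branch_false (l := E) (by simp [h])
            Runs.pop) le_rfl) (by decide)).congr_store ?_
          clear ih
          funext i
          grind [Function.update_apply]
        refine (Runs.loopp (by simp [h]) hb (ih J.tail (j + 1) _ (by simp) (by simp) (by simp))
          (by simp; omega)).congr_store ?_
        rw [hJ, cutLength, show cutLength E + (j + 1) = cutLength E + 1 + j by ring]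
        clear ih
        funext i
        grind [Function.update_apply]
      · have hb : Runs O (.pop 19 ;; .push 30 true ;; .branch 38 .skip (.pop 38) (clr 38)) s 5
            (PMF.pure (update (update (update s 38 []) 19 J.tail) 30 (unary (j + 1)))) := by
          refine (Runs.seqp Runs.pop (Runs.seqp Runs.push (Runs.branch_true (l := E) (by simp [h])
            (runs_clr hO 38 _)) le_rfl) (by decide)).congr_store ?_
          clear ih
          funext i
          grind [Function.update_apply]
        refine (Runs.loopp (by simp [h]) hb (Runs.loop_nil (by simp)) (by simp)).congr_store ?_
        have := hJ 0
        rw [List.drop_zero] at this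
        rw [this, cutLength, Nat.add_comm 1 j]
  have hle := cutLength_le E
  refine (Runs.seqp (runs_cpy (x := E) (by decide) (by decide) (by decide) h37 h10) (Runs.seqp
    (runs_cpy (x := J) (by decide) (by decide) (by decide) (by simp [h15]) (by simp [h10]))
    (Runs.seqp (key E J 0 _ (by simp [h38]) (by simp [h19]) (by simp [h30])) (runs_padFlags
    (rem := cutLength E) (J := J.drop (cutLength E)) (by simp) (by simp)) le_rfl) le_rfl)
    (by omega)).congr_store ?_
  clear key
  unfold cutFlags
  funext i
  grind [Function.update_apply]


/-! ## The reduction to key-knowledge security -/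

/-- The programs from which the reduction is built. -/
structure Components where
  (keyGen enc Pn Pℓ PN Pθ Pq L C : Cmd)
  /-- the class of the samples -/
  c : Bool

namespace Components

/-- Compute the parameters. -/
def prepare (D : Components) : Cmd :=
  mv 1 35 ;; mv 2 36 ;; call 2 D.Pn [0] 33 ;; call 2 D.Pℓ [0] 34 ;; D.Pq

/-- Choose a random feature. -/
def pickFeature : Cmd :=
  cpy 33 31 ;; pickIndex ;; .push 39 true ;; mv 33 38 ;; pushFlags ;; clr 39

/-- Generate the keys and run the learner. -/
def simulate (D : Components) : Cmd :=
  cpy 37 38 ;; pushKeys D.keyGen ;; runLearner D.enc D.L ;; .push 1 D.c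

/-- Put the model, a reversed sample and the flags of the chosen feature into register 0. -/
def output (D : Components) : Cmd :=
  cut ;; mixedSample D.enc ;; revList 22 45 ;; clr 0 ;; encPush 37 0 ;; encPush 45 0 ;;
    encPush 44 0

/-- The first part of the reduction. -/
def leak (D : Components) : Cmd :=
  D.prepare ;; pickFeature ;; D.simulate ;; choose D.enc (askClassifier D.C) D.Pn D.PN D.Pθ ;;
    D.output

/-- The components work within the bounds `b` for the scheme, the learner and the parameters, `T`
for the classifier and `W` for the evaluation of polynomials. -/
structure Bounded (D : Components) (tN tθ tq : ℕ → ℕ) (lam n ℓ k b T W : ℕ) : Prop where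
  one_le : 1 ≤ b
  lam_le : lam ≤ b
  n_le : n ≤ b
  ℓ_le : ℓ ≤ b
  haltn : HaltsWithin noOracle b D.Pn [unary lam]
  finaln : ∀ v ∈ (final noOracle D.Pn [unary lam]).support, v 0 = unary n
  haltℓ : HaltsWithin noOracle b D.Pℓ [unary lam]
  finalℓ : ∀ v ∈ (final noOracle D.Pℓ [unary lam]).support, v 0 = unary ℓ
  haltKey : HaltsWithin noOracle b D.keyGen [unary lam, unary ℓ]
  key_le : ∀ key ∈ (keyGenDist D.keyGen lam ℓ).support, key.1.length ≤ b ∧ key.2.length ≤ b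
  haltEnc : ∀ key ∈ (keyGenDist D.keyGen lam ℓ).support, ∀ m : Bool,
    HaltsWithin noOracle b D.enc [unary lam, key.1, [m]]
  ct_le : ∀ key ∈ (keyGenDist D.keyGen lam ℓ).support, ∀ m : Bool,
    ∀ ct ∈ (encDist D.enc lam key.1 m).support, ct.length ≤ b
  haltL : ∀ ks : List (List Bool × List Bool), ks.length = n →
    (∀ key ∈ ks, key ∈ (keyGenDist D.keyGen lam ℓ).support) →
    HaltsWithin (sampleOracle D.enc lam (ks.map Prod.fst)) b D.L [unary lam, keysCode ks]
  model_le : ∀ ks : List (List Bool × List Bool), ks.length = n →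
    (∀ key ∈ ks, key ∈ (keyGenDist D.keyGen lam ℓ).support) →
    ∀ h ∈ (learnDist D.enc D.L lam ks).support, h.length ≤ b
  haltC : ∀ h x : List Bool, h.length ≤ b → x.length ≤ b * (2 * b + 1) →
    HaltsWithin noOracle T D.C [unary lam, h, x]
  param : ParamBound D.PN D.Pθ tN tθ (n * k) W
  evalq : ∀ (O : Oracle) (s : Store), s 0 = unary lam → s 4 = [] → s 6 = [] → s 10 = [] →
    Runs O D.Pq s (tq lam) (PMF.pure (update s 4 (unary k)))
  timeq : tq lam ≤ W

variable {D : Components} {tN tθ tq : ℕ → ℕ} {lam n ℓ k b T W : ℕ}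

theorem Bounded.keysBounded (h : D.Bounded tN tθ tq lam n ℓ k b T W)
    {ks : List (List Bool × List Bool)} (hks : ks.length = n)
    (hk : ∀ key ∈ ks, key ∈ (keyGenDist D.keyGen lam ℓ).support) :
    KeysBounded D.enc lam b (ks.map Prod.fst) where
  lam_le := h.lam_le
  one_le := h.one_le
  count := by simpa [hks] using h.n_le
  halts p hp := by
    obtain ⟨key, hkey, rfl⟩ := List.mem_map.1 hp
    exact h.haltEnc key (hk key hkey)
  key_le p hp := by
    obtain ⟨key, hkey, rfl⟩ := List.mem_map.1 hp
    exact (h.key_le key (hk key hkey)).1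
  ct_le p hp := by
    obtain ⟨key, hkey, rfl⟩ := List.mem_map.1 hp
    exact h.ct_le key (hk key hkey)

/-- The store with the parameters. -/
def base (key : List Bool × List Bool) (lam n ℓ k : ℕ) : Store :=
  update (update (update (update (update (update (fun _ => []) 0 (unary lam)) 35 key.1) 36
    key.2) 33 (unary n)) 34 (unary ℓ)) 4 (unary k)

theorem base_eq_nil {key : List Bool × List Bool} {r : ℕ} (hr : r ∉ [0, 35, 36, 33, 34, 4]) :
    base key lam n ℓ k r = [] := by
  simp only [List.mem_cons, List.not_mem_nil, or_false, not_or] at hr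
  obtain ⟨h1, h2, h3, h4, h5, h6⟩ := hr
  simp only [base, ne_eq, h1, h2, h3, h4, h5, h6, not_false_eq_true, Function.update_of_ne]

/-- A time bound for `prepare`. -/
def prepareTime (D : Components) (b W : ℕ) : ℕ :=
  callTime D.Pn 1 b b + callTime D.Pℓ 1 b b + 16 * b + W + 20

theorem runs_prepare {O : Oracle} (hO : ShortOracle O) (h : D.Bounded tN tθ tq lam n ℓ k b T W)
    {key : List Bool × List Bool} (hkey : key ∈ (keyGenDist D.keyGen lam ℓ).support) :
    Runs O D.prepare (load [unary lam, key.1, key.2]) (D.prepareTime b W)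
      (PMF.pure (base key lam n ℓ k)) := by
  have hr : ∀ j r, ∀ i, i < 64 → region j r ≠ i := by intro j r i hi; simp only [region]; omega
  have hload : ∀ i, 3 ≤ i → load [unary lam, key.1, key.2] i = [] := by
    intro i hi
    simp only [load, List.getD]
    rw [List.getElem?_eq_none (by simpa using hi)]
    rfl
  have hb := h.key_le key hkey
  have e0 : update (update (load [unary lam, key.1, key.2]) 1 []) 35
      (key.1 ++ load [unary lam, key.1, key.2] 35) =
      update (update (update (fun _ => []) 0 (unary lam)) 35 key.1) 2 key.2 := by
    funext i
    rcases Nat.lt_or_ge i 3 with hi | hi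
    · interval_cases i <;> simp [load]
    · simp only [Function.update_apply, hload i hi, hload 35 (by decide)]
      split_ifs <;> first | omega | simp
  have r1 := (runs_mv (O := O) (a := 1) (b := 35) (x := key.1) (by decide) (by decide) (by decide)
    (s := load [unary lam, key.1, key.2]) rfl (hload _ (by decide))).congr_store e0
  have r2 := (runs_mv (O := O) (a := 2) (b := 36) (x := key.2) (by decide) (by decide) (by decide)
    (s := update (update (update (fun _ => []) 0 (unary lam)) 35 key.1) 2 key.2)
    (by simp) (by simp)).congr_store (s₂ := update (update (update (fun _ => []) 0 (unary lam)) 35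
      key.1) 36 key.2) (by funext i; grind [Function.update_apply])
  have r3 := runs_call_unary hO (j := 2) (o := 33) (b := b) (s := update (update (update (fun _ => []) 0
    (unary lam)) 35 key.1) 36 key.2) (by simp) h.haltn h.finaln h.lam_le (by decide) (by simp)
    (by simp) (fun r => by simp [hr])
  have r4 := runs_call_unary hO (j := 2) (o := 34) (b := b) (s := update (update (update (update
    (fun _ => []) 0 (unary lam)) 35 key.1) 36 key.2) 33 (unary n)) (by simp) h.haltℓ h.finalℓ
    h.lam_le (by decide) (by simp) (by simp) (fun r => by simp [hr])
  have r5 := h.evalq O (update (update (update (update (update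
    (fun _ => []) 0 (unary lam)) 35 key.1) 36 key.2) 33 (unary n)) 34 (unary ℓ)) (by simp)
    (by simp) (by simp) (by simp)
  have := h.timeq
  exact Runs.seqp r1 (Runs.seqp r2 (Runs.seqp r3 (Runs.seqp r4 r5 le_rfl) le_rfl) le_rfl)
    (by simp only [prepareTime]; omega)

/-- The store after the choice of a feature, with flags `E`. -/
def picked (key : List Bool × List Bool) (lam ℓ k : ℕ) (E : List Bool) : Store :=
  update (update (base key lam 0 ℓ k) 33 []) 37 E

/-- A time bound for `pickFeature`. -/
def pickTime (b : ℕ) : ℕ :=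
  9 * b + 2 + (b * (8 * ((0 + 1) * (b + 1)) + 10 * b + 20) + 1) + 14 * b + 10

/-- The additional push converts the index `i`, counted from zero, to the convention of
`selectFlags`. An index `i ≥ n` selects no feature; such outcomes are discarded in the analysis. -/
theorem runs_pickFeature {O : Oracle} (hO : ShortOracle O) {key : List Bool × List Bool}
    (hn : n ≤ b) :
    Runs O pickFeature (base key lam n ℓ k) (pickTime b)
      ((bitsDist n.size 0).map fun i =>
        picked key lam ℓ k (selectFlags n (i + 1)).reverse) := by
  have hnil : ∀ r, r ∉ [0, 35, 36, 33, 34, 4] → base key lam n ℓ k r = [] := fun r => base_eq_nil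
  have h33 : base key lam n ℓ k 33 = unary n := by simp [base]
  have h38 := hnil 38 (by decide)
  have r1 := (runs_cpy (O := O) (a := 33) (b := 31) (x := unary n) (by decide) (by decide)
    (by decide) h33 (hnil 10 (by decide))).congr_store (s₂ := update (base key lam n ℓ k) 31
      (unary n)) (by rw [hnil 31 (by decide), List.append_nil])
  have r2 := runs_pickIndex hO n (j := 0) (s := update (base key lam n ℓ k) 31 (unary n))
    (by simp) (by simp [hnil]) (by simp [hnil]) (by simp [hnil]) (by simp [hnil]) (by simp [hnil])
  refine (Runs.seq_pure r1 (Runs.seq_map (t' := 14 * n + 6) r2 fun i _ => ?_)).mono ?_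
  · refine (Runs.seqp Runs.push (Runs.seqp (runs_mv (a := 33) (b := 38) (x := unary n) (by decide)
      (by decide) (by decide) (by simp [h33]) (by simp [hnil])) (Runs.seqp
      (runs_pushFlags (m := n) (d := i + 1) (E := []) (by simp [h38]) (by simp; rfl)
      (by simp [hnil])) (runs_clr hO 39 _) le_rfl) le_rfl) ?_).congr_store ?_
    · simp only [length_unary]; omega
    · have h39 := hnil 39 (by decide)
      have h31 := hnil 31 (by decide)
      rw [List.append_nil]
      clear hnil
      unfold picked
      funext j
      by_cases hj : j ∈ [38, 39, 31, 33, 37]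
      · simp only [List.mem_cons, List.not_mem_nil, or_false] at hj
        rcases hj with rfl | rfl | rfl | rfl | rfl <;> simp [base]
      · simp only [List.mem_cons, List.not_mem_nil, or_false, not_or] at hj
        obtain ⟨j1, j2, j3, j4, j5⟩ := hj
        simp only [ne_eq, j1, j2, j3, j4, j5, not_false_eq_true, Function.update_of_ne, base]
        grind [Function.update_apply]
  · simp only [pickTime, length_unary]
    have : n * (8 * ((0 + 1) * (n + 1)) + 10 * n + 20) ≤
      b * (8 * ((0 + 1) * (b + 1)) + 10 * b + 20) := by gcongr
    omega

end Components


/-! ### The first half of the reduction: simulated learning and the leaked hybrid. -/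

namespace Components

variable {D : Components} {tN tθ tq : ℕ → ℕ} {lam n ℓ k b T W : ℕ}

/-- The store after the simulation of the learner. -/
def simulated (D : Components) (key : List Bool × List Bool) (lam ℓ k : ℕ) (E : List Bool)
    (ks : List (List Bool × List Bool)) (h : List Bool) : Store :=
  update (update (update (update (picked key lam ℓ k E) 42 (keysCode ks)) 2
    (encodeList (ks.map Prod.fst))) 44 h) 1 [D.c]

theorem picked_eq_nil {key : List Bool × List Bool} {E : List Bool} {r : ℕ}
    (hr : r ∉ [0, 35, 36, 34, 4, 37]) : picked key lam ℓ k E r = [] := by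
  simp only [List.mem_cons, List.not_mem_nil, or_false, not_or] at hr
  obtain ⟨h1, h2, h3, h4, h5, h6⟩ := hr
  by_cases h : r = 33
  · subst h
    simp [picked]
  · simp only [picked, base, ne_eq, h1, h2, h3, h4, h5, h6, h, not_false_eq_true,
      Function.update_of_ne]

theorem simulated_eq_nil {key : List Bool × List Bool} {E : List Bool}
    {ks : List (List Bool × List Bool)} {h : List Bool} {r : ℕ}
    (hr : r ∉ [0, 35, 36, 34, 4, 37, 42, 2, 44, 1]) : D.simulated key lam ℓ k E ks h r = [] := by
  simp only [List.mem_cons, List.not_mem_nil, or_false, not_or] at hr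
  obtain ⟨h1, h2, h3, h4, h5, h6, h7, h8, h9, h10⟩ := hr
  simp only [simulated, ne_eq, h7, h8, h9, h10, not_false_eq_true, Function.update_of_ne]
  exact picked_eq_nil (by simp [h1, h2, h3, h4, h5, h6])

theorem not_mem_of_region {l : List ℕ} (hl : ∀ i ∈ l, i < 64) (j r : ℕ) : region j r ∉ l := by
  intro h
  have := hl _ h
  simp only [region] at this
  omega

theorem mem_of_mem_support_keysDist {G : PMF (List Bool × List Bool)} {key : List Bool × List Bool}
    (hkey : key ∈ G.support) {e : List Bool} {ks : List (List Bool × List Bool)}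
    (hks : ks ∈ (keysDist G key e).support) : ks.length = e.length ∧ ∀ k ∈ ks, k ∈ G.support := by
  refine ⟨by simpa using length_of_mem_support_prodL hks, fun k hk => ?_⟩
  obtain ⟨μ, hμ, hk⟩ := exists_mem_of_mem_support_prodL hks hk
  obtain ⟨v, -, rfl⟩ := List.mem_map.1 hμ
  split_ifs at hk
  · simp at hk; subst hk; exact hkey
  · exact hk

theorem length_keysCode_le {ks : List (List Bool × List Bool)}
    (h : ∀ k ∈ ks, k.1.length ≤ b ∧ k.2.length ≤ b) :
    (keysCode ks).length ≤ 2 * (ks.length * (2 * b + 1)) := by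
  induction ks with
  | nil => simp [keysCode]
  | cons k ks ih =>
    have h1 := h k (by simp)
    have h2 := ih fun k hk => h k (by simp [hk])
    rw [keysCode_cons, List.length_append, List.length_append, length_encodeString,
      length_encodeString, List.length_cons, Nat.add_mul]
    omega

/-- A time bound for `simulate`. -/
def simulateTime (D : Components) (b : ℕ) : ℕ :=
  9 * b + 4 + (b * pushKeysTime D.keyGen b) +
    runLearnerTime D.enc D.L b (2 * (b * (2 * b + 1)) + b) b

/-- The planted pair lies in the support of key generation, so the simulated keys form a possible
private state and all bounds for real states apply to them. -/
theorem runs_simulate {O : Oracle} (hO : ShortOracle O) (h : D.Bounded tN tθ tq lam n ℓ k b T W)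
    {key : List Bool × List Bool} (hkey : key ∈ (keyGenDist D.keyGen lam ℓ).support)
    {E : List Bool} (hE : E.length = n) :
    Runs O D.simulate (picked key lam ℓ k E) (D.simulateTime b)
      ((keysDist (keyGenDist D.keyGen lam ℓ) key E.reverse).bind fun ks =>
        (learnDist D.enc D.L lam ks).map fun m => D.simulated key lam ℓ k E ks m) := by
  have hnil : ∀ r, r ∉ [0, 35, 36, 34, 4, 37] → picked key lam ℓ k E r = [] :=
    fun r => picked_eq_nil
  have e0 : picked key lam ℓ k E 0 = unary lam := by simp [picked, base]
  have e34 : picked key lam ℓ k E 34 = unary ℓ := by simp [picked, base]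
  have e35 : picked key lam ℓ k E 35 = key.1 := by simp [picked, base]
  have e36 : picked key lam ℓ k E 36 = key.2 := by simp [picked, base]
  have e37 : picked key lam ℓ k E 37 = E := by simp [picked, base]
  have r1 := (runs_cpy (O := O) (a := 37) (b := 38) (by decide) (by decide) (by decide) e37
    (hnil 10 (by decide))).congr_store (s₂ := update (picked key lam ℓ k E) 38 E)
    (by rw [hnil 38 (by decide), List.append_nil])
  have hreg : ∀ j r, picked key lam ℓ k E (region j r) = [] := fun j r =>
    hnil _ (not_mem_of_region (by decide) j r)
  have hne : ∀ j r i, i < 64 → region j r ≠ i := by intro j r i hi; simp only [region]; omega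
  have r2 := runs_pushKeys hO h.haltKey h.key_le hkey h.lam_le h.ℓ_le (E := E) (ks := [])
    (s := update (picked key lam ℓ k E) 38 E) (by simp [e0]) (by simp [e34]) (by simp [e35])
    (by simp [e36]) (by simp) (by simp [hnil]) (by simp [hnil]) (by simp [hnil]) (by simp [hnil])
    (by simp [hnil, keysCode]) (by simp [hnil]) (fun r => by simp [hne, hreg])
  have e2 : (fun ks' : List (List Bool × List Bool) => update (update (update (update
      (picked key lam ℓ k E) 38 E) 38 []) 42 (keysCode (ks' ++ []))) 2
        (encodeList ((ks' ++ []).map Prod.fst))) = fun ks' => update (update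
      (picked key lam ℓ k E) 42 (keysCode ks')) 2 (encodeList (ks'.map Prod.fst)) := by
    have h38 := hnil 38 (by decide)
    funext ks'
    rw [List.append_nil, Function.update_idem, ← h38, Function.update_eq_self]
  rw [e2] at r2
  have hEb : E.length ≤ b := hE ▸ h.n_le
  refine (Runs.seq_pure r1 (Runs.seq r2 (t' := runLearnerTime D.enc D.L b
    (2 * (b * (2 * b + 1)) + b) b + 1) fun ks hks => ?_)).mono ?_
  · have hks' := mem_of_mem_support_keysDist hkey hks
    rw [List.length_reverse, hE] at hks'
    have hkl : (keysCode ks).length ≤ 2 * (b * (2 * b + 1)) :=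
      (length_keysCode_le fun k hk => h.key_le k (hks'.2 k hk)).trans
        (Nat.mul_le_mul_left _ (Nat.mul_le_mul_right _ (hks'.1 ▸ h.n_le)))
    have r3 := runs_runLearner hO (h.keysBounded hks'.1 hks'.2) (h.haltL ks hks'.1 hks'.2)
      (B := 2 * (b * (2 * b + 1)) + b) (by omega) (by have := h.lam_le; omega)
      (fun m hm => (h.model_le ks hks'.1 hks'.2 m hm).trans (by omega))
      (s := update (update (picked key lam ℓ k E) 42 (keysCode ks)) 2
        (encodeList (ks.map Prod.fst))) (by simp [e0]) (by simp [hnil]) (by simp) (by simp)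
      (by simp [hnil]) (by simp [hnil]) ?_ (fun r => by simp [hne, hreg])
    · refine Runs.seq_map r3 fun m _ => Runs.push.congr_store ?_
      rw [simulated]
      simp [hnil]
    · have : Idle (picked key lam ℓ k E) := by
        refine ⟨fun r h1 h2 => hnil r ?_, hreg 1⟩
        simp
        omega
      exact (this.update (by decide) _).update (by decide) _
  · have := Nat.mul_le_mul_right (pushKeysTime D.keyGen b) hEb
    simp only [simulateTime]
    omega

/-- The state that is leaked to the second part of the reduction. -/
def leakCode (E h : List Bool) (z : List (List Bool)) : List Bool :=
  encodeList [h, encodeList z.reverse, E]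

/-- A time bound for `output`. -/
def outputTime (D : Components) (b : ℕ) : ℕ :=
  mixedTime D.enc b + 40 * (b * (2 * b + 1)) + 60 * b + 40

theorem runs_output {O : Oracle} (hO : ShortOracle O) {l : List (List Bool)}
    (hl : KeysBounded D.enc lam b l) {E J h : List Bool} {s : Store} (hE : E.length = l.length)
    (hJ : J.length = l.length) (hh : h.length ≤ b) (h0 : s 0 = unary lam) (h1 : s 1 = [D.c])
    (h2 : s 2 = encodeList l) (h29 : s 29 = [!D.c]) (h15 : s 15 = J) (h37 : s 37 = E)
    (h44 : s 44 = h) (hs : Idle s)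
    (hnil : ∀ r ∈ [19, 20, 21, 22, 30, 38, 45], s r = []) :
    ∃ g : List (List Bool) → Store, (∀ z, g z 0 = leakCode E h z) ∧
      Runs O D.output s (D.outputTime b)
        ((hybrid D.enc lam l D.c (cutFlags E J).reverse).map g) := by
  have h10 := hs.1 10 (by decide) (by decide)
  have h11 := hs.1 11 (by decide) (by decide)
  have h12 := hs.1 12 (by decide) (by decide)
  have hb := hl.count
  have hV : (cutFlags E J).length = l.length := by rw [length_cutFlags (by omega), hJ]
  have r1 := runs_cut hO h37 h15 (hnil 38 (by decide)) (hnil 19 (by decide)) (hnil 30 (by decide))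
    h10
  have r2 := runs_mixedSample hO hl (c := D.c) (V := (cutFlags E J).reverse)
    (s := update s 19 (cutFlags E J)) (by simp [hV]) (by simp [h0]) (by simp [h1]) (by simp [h2])
    (by simp [h29]) (by simp) (by simp [hnil]) (by simp [hnil]) (hs.update (by decide) _)
  have e2 : (fun z => update (update (update s 19 (cutFlags E J)) 19 []) 22
      (encodeList z ++ update s 19 (cutFlags E J) 22)) = fun z => update s 22 (encodeList z) := by
    have h19 := hnil 19 (by decide)
    have h22 := hnil 22 (by decide)
    funext z
    rw [Function.update_idem, Function.update_of_ne (by decide), h22, List.append_nil, ← h19,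
      Function.update_eq_self]
  rw [e2] at r2
  have h22 := hnil 22 (by decide)
  have h45 := hnil 45 (by decide)
  refine ⟨fun z => update (update (update (update s 22 []) 37 []) 44 []) 0 (leakCode E h z),
    fun z => by simp, (Runs.seq_pure r1 (Runs.seq_map (t' := 40 * (b * (2 * b + 1)) + 18 * b + 20)
      r2 fun z hz => ?_)).mono (by simp only [outputTime]; omega)⟩
  have hzl := (hl.length_hybrid_le (by simp [hV]) hz).2
  clear hnil r1 r2 e2
  have r3 : Runs O (revList 22 45) (update s 22 (encodeList z)) (20 * (b * (2 * b + 1)) + 1)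
      (PMF.pure (update (update s 22 []) 45 (encodeList z.reverse))) := by
    refine ((runs_revList (l := z) (by decide) (by decide) (by decide) (by simp) (by simp [h10])
      (by simp [h11]) (by simp [h12])).mono (by omega)).congr_store ?_
    simp [h45]
  have r4 := runs_clr hO 0 (update (update s 22 []) 45 (encodeList z.reverse))
  have r5 : Runs O (encPush 37 0) (update (update (update s 22 []) 45 (encodeList z.reverse)) 0 [])
      (9 * E.length + 3) (PMF.pure (update (update (update (update s 22 []) 45
        (encodeList z.reverse)) 37 []) 0 (encodeString E))) := by
    refine (runs_encPush (x := E) (by decide) (by decide) (by decide) (by simp [h37])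
      (by simp [h10])).congr_store ?_
    funext i
    grind [Function.update_apply]
  have r6 : Runs O (encPush 45 0) (update (update (update (update s 22 []) 45
        (encodeList z.reverse)) 37 []) 0 (encodeString E)) (9 * (encodeList z.reverse).length + 3)
      (PMF.pure (update (update (update s 22 []) 37 []) 0 (encodeString (encodeList z.reverse) ++
        encodeString E))) := by
    refine (runs_encPush (x := encodeList z.reverse) (by decide) (by decide) (by decide) (by simp)
      (by simp [h10])).congr_store ?_
    funext i
    grind [Function.update_apply]
  have r7 : Runs O (encPush 44 0) (update (update (update s 22 []) 37 []) 0 (encodeString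
      (encodeList z.reverse) ++ encodeString E)) (9 * h.length + 3) (PMF.pure (update (update
      (update (update s 22 []) 37 []) 44 []) 0 (leakCode E h z))) := by
    refine (runs_encPush (x := h) (by decide) (by decide) (by decide) (by simp [h44])
      (by simp [h10])).congr_store ?_
    rw [leakCode, encodeList_cons, encodeList_cons, encodeList_cons, encodeList_nil,
      List.append_nil]
    funext i
    grind [Function.update_apply]
  refine Runs.seqp r3 (Runs.seqp r4 (Runs.seqp r5 (Runs.seqp r6 r7 le_rfl) le_rfl) le_rfl) ?_
  rw [length_encodeList_reverse]
  omega

/-- The distribution of the state that is leaked to the second part of the reduction. -/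
noncomputable def leakLaw (D : Components) (lam n ℓ k : ℕ) (key : List Bool × List Bool) :
    PMF (List Bool) :=
  (bitsDist n.size 0).bind fun i =>
    (keysDist (keyGenDist D.keyGen lam ℓ) key (selectFlags n (i + 1))).bind fun ks =>
      (learnDist D.enc D.L lam ks).bind fun h =>
        (flagsDist D.enc lam (ks.map Prod.fst) D.c k (classify D.C lam h)).bind fun J =>
          (hybrid D.enc lam (ks.map Prod.fst) D.c
            (cutFlags (selectFlags n (i + 1)).reverse J).reverse).map
              (leakCode (selectFlags n (i + 1)).reverse h)

/-- A time bound for `leak`. -/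
def leakTime (D : Components) (b k T W : ℕ) : ℕ :=
  D.prepareTime b W + (pickTime b + (D.simulateTime b + (chooseTime D.enc D.Pn b k
    (callTime D.C 3 (b + b * (2 * b + 1)) T + 10) W + D.outputTime b)))

theorem PolyBounded.leakTime (D : Components) {b k T W : ℕ → ℕ} (hb : PolyBounded b)
    (hk : PolyBounded k) (hT : PolyBounded T) (hW : PolyBounded W) :
    PolyBounded fun x => D.leakTime (b x) (k x) (T x) (W x) := by
  unfold Components.leakTime prepareTime pickTime simulateTime outputTime pushKeysTime
    runLearnerTime RobustLearning.simulateTime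
  fun_prop

end Components

/-- For the leaked state only register 0 of the last store matters. Asking merely for the existence
of the final distribution avoids writing out the complete store after a long composition. -/
theorem Runs.bind_of_exists {α : Type} {O : Oracle} {c d : Cmd} {s : Store} {t t' : ℕ} {μ : PMF α}
    {g : α → Store} {ν : α → PMF (List Bool)} (hc : Runs O c s t (μ.map g))
    (hd : ∀ a ∈ μ.support, ∃ ρ, Runs O d (g a) t' ρ ∧ ρ.map (fun s => s 0) = ν a) :
    ∃ ρ, Runs O (c ;; d) s (t + t') ρ ∧ ρ.map (fun s => s 0) = μ.bind ν := by
  classical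
  choose! ρ h1 h2 using hd
  refine ⟨μ.bind ρ, Runs.seq hc h1, ?_⟩
  rw [PMF.map_bind]
  exact bind_congr_support h2

namespace Components

variable {D : Components} {tN tθ tq : ℕ → ℕ} {lam n ℓ k b T W : ℕ}

theorem runs_leak {O : Oracle} (hO : ShortOracle O) (h : D.Bounded tN tθ tq lam n ℓ k b T W)
    {key : List Bool × List Bool} (hkey : key ∈ (keyGenDist D.keyGen lam ℓ).support) :
    ∃ ρ, Runs O D.leak (load [unary lam, key.1, key.2]) (D.leakTime b k T W) ρ ∧
      ρ.map (fun s => s 0) = D.leakLaw lam n ℓ k key := by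
  have hne : ∀ j r i, i < 64 → region j r ≠ i := by intro j r i hi; simp only [region]; omega
  have h1 := Runs.bind_of_exists (d := pickFeature ;; D.simulate ;; choose D.enc
    (askClassifier D.C) D.Pn D.PN D.Pθ ;; D.output) (t' := pickTime b + (D.simulateTime b +
      (chooseTime D.enc D.Pn b k (callTime D.C 3 (b + b * (2 * b + 1)) T + 10) W +
        D.outputTime b))) (ν := fun _ => D.leakLaw lam n ℓ k key)
    ((runs_prepare hO h hkey).congr (PMF.pure_map id _).symm) ?_
  · rw [PMF.pure_bind] at h1
    exact h1
  intro s hs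
  obtain rfl : s = base key lam n ℓ k := by rwa [PMF.support_pure] at hs
  refine Runs.bind_of_exists (runs_pickFeature hO h.n_le) fun i _ => ?_
  have h2 := Runs.bind_of_exists (O := O) (c := D.simulate)
    (s := picked key lam ℓ k (selectFlags n (i + 1)).reverse) (d := choose D.enc
    (askClassifier D.C) D.Pn D.PN D.Pθ ;; D.output)
    (μ := (keysDist (keyGenDist D.keyGen lam ℓ) key (selectFlags n (i + 1))).bind fun ks =>
        (learnDist D.enc D.L lam ks).map fun m => (ks, m))
    (g := fun x => D.simulated key lam ℓ k (selectFlags n (i + 1)).reverse x.1 x.2)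
    (t := D.simulateTime b) (t' := chooseTime D.enc D.Pn b k
      (callTime D.C 3 (b + b * (2 * b + 1)) T + 10) W + D.outputTime b)
    (ν := fun x => (flagsDist D.enc lam (x.1.map Prod.fst) D.c k (classify D.C lam x.2)).bind
      fun J => (hybrid D.enc lam (x.1.map Prod.fst) D.c
            (cutFlags (selectFlags n (i + 1)).reverse J).reverse).map
              (leakCode (selectFlags n (i + 1)).reverse x.2)) ?_ ?_
  · obtain ⟨ρ, hρ, e⟩ := h2
    refine ⟨ρ, hρ, e.trans ?_⟩
    rw [PMF.bind_bind]
    exact bind_congr_support fun ks _ => PMF.bind_map _ _ _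
  · refine (runs_simulate hO h hkey (E := (selectFlags n (i + 1)).reverse)
      (by rw [List.length_reverse, length_selectFlags])).congr ?_
    rw [List.reverse_reverse, PMF.map_bind]
    exact bind_congr_support fun ks _ => by rw [PMF.map_comp]; rfl
  · rintro ⟨ks, m⟩ hx
    rw [PMF.mem_support_bind_iff] at hx
    obtain ⟨ks', hks, hx⟩ := hx
    rw [PMF.mem_support_map_iff] at hx
    obtain ⟨m', hm, hx⟩ := hx
    obtain ⟨rfl, rfl⟩ := Prod.mk.injEq _ _ _ _ ▸ hx
    have hks' := mem_of_mem_support_keysDist hkey hks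
    rw [length_selectFlags] at hks'
    have hlen : (ks'.map Prod.fst).length = n := by simpa using hks'.1
    have hl := h.keysBounded hks'.1 hks'.2
    have hmb := h.model_le ks' hks'.1 hks'.2 m' hm
    have hlam := h.lam_le
    set s := D.simulated key lam ℓ k (selectFlags n (i + 1)).reverse ks' m' with hs
    have hnil : ∀ r, r ∉ [0, 35, 36, 34, 4, 37, 42, 2, 44, 1] → s r = [] := fun r hr =>
      simulated_eq_nil hr
    have hreg : ∀ j r, s (region j r) = [] := fun j r => hnil _ (not_mem_of_region (by decide) j r)
    have hidle : Idle s := ⟨fun r h1 h2 => hnil r (by simp; omega), hreg 1⟩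
    have e0 : s 0 = unary lam := by simp [hs, simulated, picked, base]
    have e1 : s 1 = [D.c] := by simp [hs, simulated]
    have e2 : s 2 = encodeList (ks'.map Prod.fst) := by simp [hs, simulated]
    have e4 : s 4 = unary k := by simp [hs, simulated, picked, base]
    have e37 : s 37 = (selectFlags n (i + 1)).reverse := by simp [hs, simulated, picked, base]
    have e44 : s 44 = m' := by simp [hs, simulated]
    have hfresh : Fresh lam (ks'.map Prod.fst) D.c k (HasModel lam m') s :=
      ⟨⟨e0, e44, hreg 3⟩, hidle, e0, e1, e2, e4, hnil 6 (by decide),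
        fun r h1 h2 => hnil r (by simp; omega), hreg 2⟩
    have hask := asks_askClassifier hO (C := D.C) (m := b * (2 * b + 1)) (T := T)
      (B := b + b * (2 * b + 1)) (h := m') (fun x hx => h.haltC m' x hmb hx) (by omega) (by omega)
      (by omega)
    refine Runs.bind_of_exists (runs_choose hO hl h.haltn (by rw [hlen]; exact h.finaln)
      (by rw [hlen]; exact h.param) hask hfresh) fun J hJ => ?_
    have hJl : J.length = (ks'.map Prod.fst).length := by
      simpa using length_of_mem_support_greedyDist hJ
    obtain ⟨g, hg, hr⟩ := runs_output hO hl (D := D) (E := (selectFlags n (i + 1)).reverse)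
      (J := J) (h := m') (s := update (update (update (update s 29 [!D.c]) 26
        (unary (rounds ((ks'.map Prod.fst).length * k)))) 27
        (unary (threshold ((ks'.map Prod.fst).length * k)))) 15 J)
      (by rw [List.length_reverse, length_selectFlags, hlen]) hJl hmb (by simp [e0]) (by simp [e1])
      (by simp [e2]) (by simp) (by simp) (by simp [e37]) (by simp [e44])
      ((((hidle.update (by decide) _).update (by decide) _).update (by decide) _).update
        (by decide) _) (by simp [hnil])
    refine ⟨_, hr, ?_⟩
    rw [PMF.map_comp]
    exact map_congr_support fun z _ => hg z

end Components


/-! ### The second half of the reduction: insertion of the challenge ciphertext. -/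

namespace Components

variable {D : Components} {tN tθ tq : ℕ → ℕ} {lam n ℓ k b T W : ℕ}

/-- Copies of register 3, as many as there are bits in register 38, on the list in register 20. -/
def copies : Cmd := .loop 38 (.pop 38 ;; cpy 3 43 ;; encPush 43 20)

theorem runs_copies {O : Oracle} {E ct : List Bool} {s : Store} (h38 : s 38 = E) (h3 : s 3 = ct)
    (h43 : s 43 = []) (h10 : s 10 = []) (hct : ct.length ≤ b) :
    Runs O copies s (E.length * (18 * b + 7) + 1) (PMF.pure (update (update s 38 []) 20
      (encodeList (List.replicate E.length ct) ++ s 20))) := by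
  induction E generalizing s with
  | nil =>
    refine (Runs.loop_nil h38).mono (by omega) |>.congr_store ?_
    simp only [List.length_nil, List.replicate_zero, encodeList_nil, List.nil_append]
    funext i
    grind [Function.update_apply]
  | cons e E ih =>
    have hb : Runs O (.pop 38 ;; cpy 3 43 ;; encPush 43 20) s (18 * b + 6)
        (PMF.pure (update (update s 38 E) 20 (encodeString ct ++ s 20))) := by
      refine (Runs.seqp Runs.pop (Runs.seqp (runs_cpy (x := ct) (by decide) (by decide) (by decide)
        (by simp [h3]) (by simp [h10])) (runs_encPush (x := ct) (by decide) (by decide) (by decide)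
        (by simp [h43]) (by simp [h10])) le_rfl) (by omega)).congr_store ?_
      clear ih
      funext i
      grind [Function.update_apply]
    refine (Runs.loopp (by simp [h38]) hb (ih (by simp) (by simp [h3]) (by simp [h43])
      (by simp [h10])) ?_).congr_store ?_
    · simp only [List.length_cons, Nat.add_mul]; omega
    · rw [List.length_cons, List.replicate_succ', encodeList_append, encodeList_cons,
        encodeList_nil, List.append_nil, List.append_assoc]
      clear ih
      funext i
      grind [Function.update_apply]

/-- The second part of the reduction: replace the chosen entry of the sample by the given
ciphertext, and run the classifier. -/
def guess (D : Components) : Cmd :=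
  decPop 1 44 ;; decPop 1 21 ;; decPop 1 19 ;; cpy 19 38 ;; copies ;; mix ;; askClassifier D.C ;;
    clr 0 ;; .branch 23 .skip (.push 0 false) (.push 0 true)

/-- A time bound for `guess`. -/
def guessTime (D : Components) (b T : ℕ) : ℕ :=
  callTime D.C 3 (b + b * (2 * b + 1)) T + b * (18 * b + 7) + 70 * (b * (2 * b + 1)) + 29 * b + 60

theorem PolyBounded.guessTime (D : Components) {b T : ℕ → ℕ} (hb : PolyBounded b)
    (hT : PolyBounded T) : PolyBounded fun x => D.guessTime (b x) (T x) := by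
  unfold Components.guessTime
  fun_prop

/-- The challenge is inserted by mixing the leaked hybrid with a list of copies of `ct` along the
selecting flags `E`. In this way the second half learns the coordinate from `E` and reuses the
program `mix`. -/
theorem runs_guess {O : Oracle} (hO : ShortOracle O) {E h pk ct : List Bool}
    {z : List (List Bool)} (hC : ∀ x : List Bool, x.length ≤ b * (2 * b + 1) →
      HaltsWithin noOracle T D.C [unary lam, h, x]) (hlam : lam ≤ b) (hh : h.length ≤ b)
    (hE : E.length ≤ b) (hz : z.length = E.length) (hzb : ∀ w ∈ z, w.length ≤ b)
    (hct : ct.length ≤ b) :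
    ∃ g : Bool → Store, (∀ a, g a 0 = [a]) ∧
      Runs O D.guess (load [unary lam, leakCode E h z, pk, ct]) (D.guessTime b T)
        ((classify D.C lam h (encodeList (mixL E.reverse (List.replicate E.length ct) z))).map
          g) := by
  have hne : ∀ j r i, i < 64 → region j r ≠ i := by intro j r i hi; simp only [region]; omega
  generalize hs0 : load [unary lam, leakCode E h z, pk, ct] = s0
  have hnil : ∀ i, 4 ≤ i → s0 i = [] := by
    intro i hi
    rw [← hs0]
    simp only [load, List.getD]
    rw [List.getElem?_eq_none (by simpa using hi)]
    rfl
  have e0 : s0 0 = unary lam := by rw [← hs0]; rfl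
  have e1 : s0 1 = encodeString h ++ (encodeString (encodeList z.reverse) ++
      (encodeString E ++ [])) := by
    rw [← hs0]
    simp only [load, leakCode, encodeList_cons, encodeList_nil]
    rfl
  have e3 : s0 3 = ct := by rw [← hs0]; rfl
  have hzl : (encodeList z).length ≤ b * (2 * b + 1) :=
    (length_encodeList_le hzb).trans (Nat.mul_le_mul_right _ (hz ▸ hE))
  have hzr : (encodeList z.reverse).length ≤ b * (2 * b + 1) := by
    rwa [length_encodeList_reverse]
  have hcl : (encodeList (List.replicate E.length ct)).length ≤ b * (2 * b + 1) := by
    refine (length_encodeList_le (m := b) fun w hw => ?_).trans (Nat.mul_le_mul_right _ (by simpa))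
    rw [List.eq_of_mem_replicate hw]
    exact hct
  have n10 := hnil 10 (by decide)
  have n11 := hnil 11 (by decide)
  have n12 := hnil 12 (by decide)
  have n19 := hnil 19 (by decide)
  have n20 := hnil 20 (by decide)
  have n21 := hnil 21 (by decide)
  have n22 := hnil 22 (by decide)
  have n38 := hnil 38 (by decide)
  have n43 := hnil 43 (by decide)
  have n44 := hnil 44 (by decide)
  have r1 := runs_decPop (O := O) (a := 1) (w := 44) (s := s0) (by decide) (by decide) (by decide)
    (by decide) (by decide) e1 n10 n11 n44
  have r2 := runs_decPop (O := O) (a := 1) (w := 21) (x := encodeList z.reverse)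
    (z := encodeString E ++ []) (s := update (update s0 1 (encodeString (encodeList z.reverse) ++
      (encodeString E ++ []))) 44 h) (by decide) (by decide) (by decide)
    (by decide) (by decide) (by simp) (by simp [n10]) (by simp [n11]) (by simp [n21])
  have r2' := r2.congr_store (s₂ := update (update (update s0 1 (encodeString E ++ [])) 44 h) 21
    (encodeList z.reverse)) (by clear hnil r1 r2; funext i; grind [Function.update_apply])
  have r3 := runs_decPop (O := O) (a := 1) (w := 19) (x := E)
    (z := []) (s := update (update (update s0 1 (encodeString E ++ [])) 44 h) 21
      (encodeList z.reverse)) (by decide) (by decide) (by decide)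
    (by decide) (by decide) (by simp) (by simp [n10]) (by simp [n11]) (by simp [n19])
  have r3' := r3.congr_store (s₂ := update (update (update (update s0 1 []) 44 h) 21
    (encodeList z.reverse)) 19 E) (by clear hnil r1 r2 r2' r3; funext i; grind [Function.update_apply])
  have r4 := runs_cpy (O := O) (a := 19) (b := 38) (x := E) (s := update (update (update (update s0
    1 []) 44 h) 21 (encodeList z.reverse)) 19 E) (by decide) (by decide) (by decide) (by simp)
    (by simp [n10])
  have r4' := r4.congr_store (s₂ := update (update (update (update (update s0 1 []) 44 h) 21
    (encodeList z.reverse)) 19 E) 38 E) (by simp [n38])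
  have r5 := runs_copies (O := O) (E := E) (ct := ct) (b := b) (s := update (update (update (update
    (update s0 1 []) 44 h) 21 (encodeList z.reverse)) 19 E) 38 E) (by simp) (by simp [e3])
    (by simp [n43]) (by simp [n10]) hct
  have r5' := r5.congr_store (s₂ := update (update (update (update (update s0 1 []) 44 h) 21
    (encodeList z.reverse)) 19 E) 20 (encodeList (List.replicate E.length ct)))
    (by clear hnil r1 r2 r2' r3 r3' r4 r4' r5; funext i; grind [Function.update_apply])
  have r6 := runs_mix hO (V := E) (X := List.replicate E.length ct) (Y := z.reverse)
    (s := update (update (update (update (update s0 1 []) 44 h) 21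
    (encodeList z.reverse)) 19 E) 20 (encodeList (List.replicate E.length ct))) (by simp)
    (by simp [hz]) (by simp) (by simp) (by simp) (by simp [n10]) (by simp [n11]) (by simp [n12])
  have hmix : (mixL E (List.replicate E.length ct) z.reverse).reverse =
      mixL E.reverse (List.replicate E.length ct) z := by
    rw [← mixL_reverse (by simp) (by simp [hz]), List.reverse_replicate, List.reverse_reverse]
  have r6' := r6.congr_store (s₂ := update (update (update s0 1 []) 44 h) 22
    (encodeList (mixL E.reverse (List.replicate E.length ct) z))) (by
      rw [hmix]
      clear hnil r1 r2 r2' r3 r3' r4 r4' r5 r5' r6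
      funext i
      grind [Function.update_apply])
  set s6 := update (update (update s0 1 []) 44 h) 22
    (encodeList (mixL E.reverse (List.replicate E.length ct) z)) with hs6
  have hml : (s6 22).length ≤ b * (2 * b + 1) := by
    rw [hs6, Function.update_self]
    refine (length_encodeList_le (m := b) fun w hw => ?_).trans (Nat.mul_le_mul_right _ ?_)
    · rcases mem_or_mem_of_mem_mixL hw with hw | hw
      · rw [List.eq_of_mem_replicate hw]
        exact hct
      · exact hzb w hw
    · rw [length_mixL] <;> simp [hz, hE]
  have hidle : Idle s6 := by
    refine ⟨fun r h1 h2 => ?_, fun r => ?_⟩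
    · rw [hs6, Function.update_of_ne (by omega), Function.update_of_ne (by omega),
        Function.update_of_ne (by omega), hnil _ (by omega)]
    · rw [hs6, Function.update_of_ne (hne _ _ _ (by decide)), Function.update_of_ne
        (hne _ _ _ (by decide)), Function.update_of_ne (hne _ _ _ (by decide)),
        hnil _ (by simp only [region]; omega)]
  have hmodel : HasModel lam h s6 := by
    refine ⟨by simp [hs6, e0], by simp [hs6], fun r => ?_⟩
    rw [hs6, Function.update_of_ne (hne _ _ _ (by decide)), Function.update_of_ne
      (hne _ _ _ (by decide)), Function.update_of_ne (hne _ _ _ (by decide)),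
      hnil _ (by simp only [region]; omega)]
  have r7 := (asks_askClassifier hO (C := D.C) (m := b * (2 * b + 1)) (T := T)
    (B := b + b * (2 * b + 1)) (h := h) hC (by omega) (by omega) (by omega)).run s6 hmodel hidle hml
  have e22 : s6 22 = encodeList (mixL E.reverse (List.replicate E.length ct) z) := by simp [hs6]
  rw [e22] at r7
  refine ⟨fun a => update (update (update s6 22 []) 23 [a]) 0 [a], fun a => by simp,
    (Runs.seq_pure r1 (Runs.seq_pure r2' (Runs.seq_pure r3' (Runs.seq_pure r4' (Runs.seq_pure r5'
      (Runs.seq_pure r6' (Runs.seq_map (t' := 4) r7 fun a _ => ?_))))))).mono ?_⟩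
  · refine Runs.seqp (runs_clr hO 0 _) (t' := 2) ?_ le_rfl
    cases a
    · exact (Runs.branch_false (l := []) (by simp) Runs.push).congr_store (by simp)
    · exact (Runs.branch_true (l := []) (by simp) Runs.push).congr_store (by simp)
  · have := Nat.mul_le_mul_right (18 * b + 7) hE
    simp only [guessTime]
    omega

theorem mixL_selectFlags {α : Type} {z : List α} (i : ℕ) (x : α) :
    mixL (selectFlags z.length (i + 1)) (List.replicate z.length x) z = z.set i x := by
  have h0 : ∀ z : List α, mixL (selectFlags z.length 0) (List.replicate z.length x) z = z := by
    intro z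
    induction z with
    | nil => rfl
    | cons a z ih => simpa [selectFlags, mixL, List.replicate_succ] using ih
  induction z generalizing i with
  | nil => rfl
  | cons a z ih =>
    cases i with
    | zero => simpa [selectFlags, mixL, List.replicate_succ] using h0 z
    | succ i => simpa [selectFlags, mixL, List.replicate_succ] using ih i

end Components


/-! ## Expected values -/

/-- The expected value of a nonnegative function. -/
noncomputable def mean {α : Type} (μ : PMF α) (f : α → ENNReal) : ENNReal := ∑' a, μ a * f a

open Classical in
/-- The probability of an event, as an extended nonnegative real. -/
noncomputable def pr {α : Type} (μ : PMF α) (E : α → Prop) : ENNReal :=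
  mean μ fun a => if E a then 1 else 0

section Mean

variable {α β : Type} {μ : PMF α} {f g : α → ENNReal} {E F : α → Prop}

theorem mean_pure (a : α) (f : α → ENNReal) : mean (PMF.pure a) f = f a := by
  rw [mean, tsum_eq_single a]
  · simp
  · intro b hb
    simp [hb]

/-- In `ENNReal` sums may be exchanged without any summability condition, which is why expectations
live there and real probabilities are translated by `ofReal_prob`. -/
theorem mean_bind (μ : PMF α) (ν : α → PMF β) (f : β → ENNReal) :
    mean (μ.bind ν) f = mean μ fun a => mean (ν a) f := by
  simp only [mean, PMF.bind_apply, ← ENNReal.tsum_mul_right, ← ENNReal.tsum_mul_left]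
  rw [ENNReal.tsum_comm]
  simp only [mul_assoc]

theorem mean_map (μ : PMF α) (u : α → β) (f : β → ENNReal) :
    mean (μ.map u) f = mean μ fun a => f (u a) := by
  rw [PMF.map, mean_bind]
  simp only [Function.comp, mean_pure]

theorem mean_mono (h : ∀ a ∈ μ.support, f a ≤ g a) : mean μ f ≤ mean μ g := by
  refine ENNReal.tsum_le_tsum fun a => ?_
  by_cases ha : μ a = 0
  · simp [ha]
  · exact mul_le_mul_right (h a ((PMF.mem_support_iff _ _).2 ha)) _

theorem mean_const (μ : PMF α) (c : ENNReal) : (mean μ fun _ => c) = c := by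
  rw [mean, ENNReal.tsum_mul_right, μ.tsum_coe, one_mul]

theorem mean_le (h : ∀ a ∈ μ.support, f a ≤ g a) {c : ENNReal} (hc : mean μ g ≤ c) :
    mean μ f ≤ c := (mean_mono h).trans hc

theorem mean_le_const {c : ENNReal} (h : ∀ a ∈ μ.support, f a ≤ c) : mean μ f ≤ c :=
  mean_le h (mean_const μ c).le

theorem mean_add (μ : PMF α) (f g : α → ENNReal) :
    (mean μ fun a => f a + g a) = mean μ f + mean μ g := by
  simp only [mean, mul_add, ENNReal.tsum_add]

theorem mean_mul_left (μ : PMF α) (c : ENNReal) (f : α → ENNReal) :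
    (mean μ fun a => c * f a) = c * mean μ f := by
  simp only [mean, mul_left_comm _ c, ENNReal.tsum_mul_left]

theorem mean_sum {ι : Type} (s : Finset ι) (f : ι → α → ENNReal) :
    (mean μ fun a => ∑ i ∈ s, f i a) = ∑ i ∈ s, mean μ (f i) := by
  classical
  induction s using Finset.induction_on with
  | empty => simp [mean]
  | insert i s hi ih => simp only [Finset.sum_insert hi, mean_add, ih]

theorem mean_tsum {ι : Type} (f : ι → α → ENNReal) :
    (mean μ fun a => ∑' i, f i a) = ∑' i, mean μ (f i) := by
  simp only [mean, ← ENNReal.tsum_mul_left]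
  exact ENNReal.tsum_comm

theorem mean_comm (μ : PMF α) (ν : PMF β) (f : α → β → ENNReal) :
    (mean μ fun a => mean ν fun b => f a b) = mean ν fun b => mean μ fun a => f a b := by
  rw [show (fun a => mean ν fun b => f a b) = fun a => ∑' b, ν b * f a b from rfl, mean_tsum]
  simp only [mean_mul_left]
  rfl

theorem apply_mul_le_mean (a : α) : μ a * f a ≤ mean μ f := ENNReal.le_tsum a

theorem pr_eq_toOuterMeasure (μ : PMF α) (E : α → Prop) : pr μ E = μ.toOuterMeasure {a | E a} := by
  classical
  rw [PMF.toOuterMeasure_apply]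
  refine tsum_congr fun a => ?_
  by_cases h : E a <;> simp [h]

theorem prob_eq (μ : PMF α) (E : α → Prop) : prob μ E = (pr μ E).toReal := by
  rw [prob, pr_eq_toOuterMeasure]

theorem pr_le_one (μ : PMF α) (E : α → Prop) : pr μ E ≤ 1 :=
  mean_le_const fun a _ => by split_ifs <;> simp

theorem pr_ne_top (μ : PMF α) (E : α → Prop) : pr μ E ≠ ⊤ :=
  ne_top_of_le_ne_top ENNReal.one_ne_top (pr_le_one μ E)

theorem prob_nonneg (μ : PMF α) (E : α → Prop) : 0 ≤ prob μ E := ENNReal.toReal_nonneg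

theorem prob_le_one (μ : PMF α) (E : α → Prop) : prob μ E ≤ 1 := by
  rw [prob_eq]
  exact ENNReal.toReal_le_of_le_ofReal zero_le_one (by simpa using pr_le_one μ E)

theorem ofReal_prob (μ : PMF α) (E : α → Prop) : ENNReal.ofReal (prob μ E) = pr μ E := by
  rw [prob_eq, ENNReal.ofReal_toReal (pr_ne_top μ E)]

theorem pr_mono (h : ∀ a ∈ μ.support, E a → F a) : pr μ E ≤ pr μ F := by
  refine mean_mono fun a ha => ?_
  by_cases hE : E a
  · simp [hE, h a ha hE]
  · simp [hE]

theorem pr_or_le (μ : PMF α) (E F : α → Prop) : pr μ (fun a => E a ∨ F a) ≤ pr μ E + pr μ F := by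
  rw [pr, pr, pr, ← mean_add]
  refine mean_mono fun a _ => ?_
  by_cases hE : E a <;> by_cases hF : F a <;> simp [hE, hF]

theorem pr_exists_le {ι : Type} (s : Finset ι) (E : ι → α → Prop) :
    pr μ (fun a => ∃ i ∈ s, E i a) ≤ ∑ i ∈ s, pr μ (E i) := by
  classical
  rw [pr]
  simp only [pr]
  rw [← mean_sum]
  refine mean_mono fun a _ => ?_
  split_ifs with h
  · obtain ⟨i, hi, hE⟩ := h
    refine le_trans ?_ (Finset.single_le_sum (f := fun i => if E i a then (1 : ENNReal) else 0)
      (fun _ _ => zero_le) hi)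
    simp [hE]
  · simp

/-- Markov's inequality, in a form without division. -/
theorem mul_pr_le_mean (c : ENNReal) (h : ∀ a ∈ μ.support, E a → c ≤ f a) :
    c * pr μ E ≤ mean μ f := by
  rw [pr, ← mean_mul_left]
  refine mean_mono fun a ha => ?_
  by_cases hE : E a
  · simpa [hE] using h a ha hE
  · simp [hE]

theorem pr_bind (μ : PMF α) (ν : α → PMF β) (E : β → Prop) :
    pr (μ.bind ν) E = mean μ fun a => pr (ν a) E := mean_bind _ _ _

theorem pr_map (μ : PMF α) (u : α → β) (E : β → Prop) :
    pr (μ.map u) E = pr μ fun a => E (u a) := mean_map _ _ _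

theorem pr_eq_apply (μ : PMF α) (a : α) : pr μ (· = a) = μ a := by
  classical
  rw [pr, mean, tsum_eq_single a]
  · simp
  · intro b hb
    simp [hb]

/-- The probability of the other value. -/
theorem prob_eq_false (μ : PMF Bool) : prob μ (· = false) = 1 - prob μ (· = true) := by
  have h : pr μ (· = false) + pr μ (· = true) = 1 := by
    rw [pr, pr, ← mean_add]
    refine Eq.trans ?_ (mean_const μ 1)
    congr 1
    funext a
    cases a <;> simp
  have := congrArg ENNReal.toReal h
  rw [ENNReal.toReal_add (pr_ne_top _ _) (pr_ne_top _ _), ← prob_eq, ← prob_eq] at this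
  simp at this
  linarith

theorem mean_bool (μ : PMF Bool) (f : Bool → ENNReal) :
    mean μ f = ENNReal.ofReal (prob μ (· = true)) * f true +
      ENNReal.ofReal (1 - prob μ (· = true)) * f false := by
  rw [← prob_eq_false, ofReal_prob, ofReal_prob, pr_eq_apply, pr_eq_apply, mean, tsum_fintype]
  simp

theorem prob_bind (μ : PMF α) (ν : α → PMF β) (E : β → Prop) :
    ENNReal.ofReal (prob (μ.bind ν) E) = mean μ fun a => ENNReal.ofReal (prob (ν a) E) := by
  simp only [ofReal_prob, pr_bind]

/-- Triangle inequality under the expectation. Since subtraction in `ENNReal` is truncated, a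
one-sided estimate is proved for both orders and the larger side is then selected. -/
theorem ofReal_abs_prob_bind_sub_le (μ : PMF α) (ν ν' : α → PMF β) (E : β → Prop) :
    ENNReal.ofReal |prob (μ.bind ν) E - prob (μ.bind ν') E| ≤
      mean μ fun a => ENNReal.ofReal |prob (ν a) E - prob (ν' a) E| := by
  have key : ∀ ν ν' : α → PMF β, ENNReal.ofReal (prob (μ.bind ν) E) ≤
      ENNReal.ofReal (prob (μ.bind ν') E) +
        mean μ fun a => ENNReal.ofReal |prob (ν a) E - prob (ν' a) E| := by
    intro ν ν'
    rw [prob_bind, prob_bind, ← mean_add]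
    refine mean_mono fun a _ => ?_
    rw [← ENNReal.ofReal_add (prob_nonneg _ _) (abs_nonneg _)]
    refine ENNReal.ofReal_le_ofReal ?_
    have := le_abs_self (prob (ν a) E - prob (ν' a) E)
    linarith
  rcases le_total (prob (μ.bind ν') E) (prob (μ.bind ν) E) with h | h
  · rw [abs_of_nonneg (sub_nonneg.2 h), ENNReal.ofReal_sub _ (prob_nonneg _ _)]
    exact tsub_le_iff_left.2 (key ν ν')
  · rw [abs_of_nonpos (sub_nonpos.2 h), neg_sub, ENNReal.ofReal_sub _ (prob_nonneg _ _)]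
    simp only [abs_sub_comm (prob (ν _) E)]
    exact tsub_le_iff_left.2 (key ν' ν)

end Mean

/-! ## Deviations of the random walk -/

theorem exp_le_quadratic {x : ℝ} (hx : |x| ≤ 1) : Real.exp x ≤ 1 + x + x ^ 2 := by
  have := (abs_le.1 (Real.abs_exp_sub_one_sub_id_le hx)).2
  linarith

/-- Chernoff's method: a step has absolute value at most one and mean `Δ / 2`, so the quadratic
bound for `exp` gives `1 + s Δ / 2 + s ^ 2`. The inequality `1 + y ≤ exp y` brings this into a form
that multiplies over the steps. -/
theorem mean_exp_walkStep_le (g : Bool → PMF Bool) {s : ℝ} (hs : |s| ≤ 1) :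
    mean (walkStep g) (fun x => ENNReal.ofReal (Real.exp (s * x))) ≤ ENNReal.ofReal (Real.exp
      (s * ((prob (g true) (· = true) - prob (g false) (· = true)) / 2) + s ^ 2)) := by
  set p := prob (g true) (· = true)
  set q := prob (g false) (· = true)
  have hp : 0 ≤ p ∧ p ≤ 1 := ⟨prob_nonneg _ _, prob_le_one _ _⟩
  have hq : 0 ≤ q ∧ q ≤ 1 := ⟨prob_nonneg _ _, prob_le_one _ _⟩
  have hu : ∀ f : Bool → ENNReal, mean (PMF.uniformOfFintype Bool) f =
      ENNReal.ofReal (1 / 2) * f true + ENNReal.ofReal (1 / 2) * f false := by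
    intro f
    rw [mean, tsum_fintype, Fintype.sum_bool]
    simp [PMF.uniformOfFintype_apply]
  have h1 : mean (walkStep g) (fun x => ENNReal.ofReal (Real.exp (s * x))) =
      ENNReal.ofReal (1 / 2 * (p * Real.exp s + (1 - p)) +
        1 / 2 * (q * Real.exp (-s) + (1 - q))) := by
    have e1 := Real.exp_pos s
    have e2 := Real.exp_pos (-s)
    rw [walkStep, mean_bind, hu, mean_map, mean_map, mean_bool, mean_bool]
    simp only [if_true, Bool.false_eq_true, if_false]
    rw [ENNReal.ofReal_add, ENNReal.ofReal_mul, ENNReal.ofReal_mul, ENNReal.ofReal_add,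
      ENNReal.ofReal_add, ENNReal.ofReal_mul, ENNReal.ofReal_mul]
    · simp [p, q]
    all_goals nlinarith [mul_nonneg hp.1 e1.le, mul_nonneg hq.1 e2.le]
  rw [h1]
  refine ENNReal.ofReal_le_ofReal ?_
  have h2 := exp_le_quadratic hs
  have h3 := exp_le_quadratic (x := -s) (by rwa [abs_neg])
  refine le_trans ?_ (Real.add_one_le_exp _)
  nlinarith [mul_le_mul_of_nonneg_left h2 hp.1, mul_le_mul_of_nonneg_left h3 hq.1, sq_nonneg s,
    mul_nonneg (sub_nonneg.2 hp.2) (sq_nonneg s), mul_nonneg (sub_nonneg.2 hq.2) (sq_nonneg s)]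

theorem mean_exp_walk_le {ξ : PMF ℤ} {s r : ℝ}
    (h : mean ξ (fun x => ENNReal.ofReal (Real.exp (s * x))) ≤ ENNReal.ofReal (Real.exp r))
    (N : ℕ) (z : ℤ) : mean (walk ξ N z) (fun x => ENNReal.ofReal (Real.exp (s * x))) ≤
      ENNReal.ofReal (Real.exp (N * r + s * z)) := by
  induction N generalizing z with
  | zero => simp [walk, mean_pure]
  | succ N ih =>
    rw [walk, mean_bind]
    refine (mean_mono fun x _ => ih (z + x)).trans ?_
    have e : ∀ x : ℤ, ENNReal.ofReal (Real.exp (N * r + s * ((z + x : ℤ) : ℝ))) =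
        ENNReal.ofReal (Real.exp (N * r + s * z)) * ENNReal.ofReal (Real.exp (s * x)) := by
      intro x
      rw [← ENNReal.ofReal_mul (Real.exp_pos _).le, ← Real.exp_add]
      congr 2
      push_cast
      ring
    simp only [e]
    rw [mean_mul_left]
    refine (mul_le_mul_right h _).trans ?_
    rw [← ENNReal.ofReal_mul (Real.exp_pos _).le, ← Real.exp_add]
    refine le_of_eq ?_
    congr 2
    push_cast
    ring

/-- Markov's inequality for `exp (s * x)`, where `hc` says that `B` exceeds the bound on the
logarithm of the moment by `c`. The sign of `s` selects the upper or the lower tail. -/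
theorem pr_walk_le (g : Bool → PMF Bool) {s : ℝ} (hs : |s| ≤ 1) (N : ℕ) (B c : ℝ)
    (hc : N * (s * ((prob (g true) (· = true) - prob (g false) (· = true)) / 2) + s ^ 2) + c ≤ B) :
    pr (walk (walkStep g) N 0) (fun x => B ≤ s * x) ≤ ENNReal.ofReal (Real.exp (-c)) := by
  have h := mean_exp_walk_le (mean_exp_walkStep_le g hs) N 0
  have h' := mul_pr_le_mean (μ := walk (walkStep g) N 0) (E := fun x => B ≤ s * x)
    (f := fun x => ENNReal.ofReal (Real.exp (s * x))) (ENNReal.ofReal (Real.exp B))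
    fun x _ hx => ENNReal.ofReal_le_ofReal (Real.exp_le_exp.2 hx)
  have h2 := h'.trans h
  rw [mul_comm, ← ENNReal.le_div_iff_mul_le (Or.inl (by simp [Real.exp_pos]))
    (Or.inl ENNReal.ofReal_ne_top), ← ENNReal.ofReal_div_of_pos (Real.exp_pos _),
    ← Real.exp_sub] at h2
  refine h2.trans (ENNReal.ofReal_le_ofReal (Real.exp_le_exp.2 ?_))
  simp only [Int.cast_zero, mul_zero, add_zero]
  linarith

/-- The test is unlikely to accept features with a large influence, or to reject features with a
small influence. -/
theorem pr_walk_test_le (g : Bool → PMF Bool) {a : ℕ} (ha : 0 < a) :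
    (6 / a < |prob (g true) (· = true) - prob (g false) (· = true)| →
      pr (walk (walkStep g) (4 * a ^ 3) 0) (fun x => x.natAbs < 8 * a ^ 2) ≤
        ENNReal.ofReal (2 / a)) ∧
    (|prob (g true) (· = true) - prob (g false) (· = true)| ≤ 2 / a →
      pr (walk (walkStep g) (4 * a ^ 3) 0) (fun x => ¬ x.natAbs < 8 * a ^ 2) ≤
        ENNReal.ofReal (2 / a)) := by
  set Δ := prob (g true) (· = true) - prob (g false) (· = true) with hΔ
  have ha' : (0 : ℝ) < a := by exact_mod_cast ha
  have ha1 : (1 : ℝ) ≤ a := by exact_mod_cast ha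
  have hexp : Real.exp (-a) ≤ 1 / a := by
    rw [Real.exp_neg, ← one_div]
    exact one_div_le_one_div_of_le ha' (by have := Real.add_one_le_exp (a : ℝ); linarith)
  -- With `s = ± 1 / (2a)` and `N = 4a³` steps, the drift contributes `± a² Δ`, the quadratic term
  -- contributes `a`, and the threshold `8a²` becomes `4a`. An influence of `6 / a` or `2 / a` puts
  -- the drift at `6a` or `2a`, a distance of `2a` from the threshold: one `a` pays for the
  -- quadratic term, the other is the exponent of the failure probability.
  have hs : |1 / (2 * (a : ℝ))| ≤ 1 := by
    rw [abs_of_pos (by positivity), div_le_one (by positivity)]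
    linarith
  have hs' : |-(1 / (2 * (a : ℝ)))| ≤ 1 := by rwa [abs_neg]
  have hnat : ∀ x : ℤ, x.natAbs < 8 * a ^ 2 ↔ |(x : ℝ)| < 8 * a ^ 2 := by
    intro x
    rw [← Int.cast_abs, Int.abs_eq_natAbs]
    exact_mod_cast Iff.rfl
  have hle : ENNReal.ofReal (Real.exp (-a)) ≤ ENNReal.ofReal (1 / a) := ENNReal.ofReal_le_ofReal hexp
  have hle2 : ENNReal.ofReal (1 / (a : ℝ)) ≤ ENNReal.ofReal (2 / a) :=
    ENNReal.ofReal_le_ofReal (by gcongr; norm_num)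
  have e1 : ∀ m : ℝ, ((4 * a ^ 3 : ℕ) : ℝ) * (1 / (2 * (a : ℝ)) * (m / 2) + (1 / (2 * (a : ℝ))) ^ 2) =
      a ^ 2 * m + a := by
    intro m
    push_cast
    field_simp
    ring
  have e2 : ∀ m : ℝ, ((4 * a ^ 3 : ℕ) : ℝ) * (-(1 / (2 * (a : ℝ))) * (m / 2) +
      (-(1 / (2 * (a : ℝ)))) ^ 2) = -(a ^ 2 * m) + a := by
    intro m
    push_cast
    field_simp
    ring
  constructor
  · intro h
    refine le_trans ?_ (hle.trans hle2)
    rcases lt_abs.1 h with h | h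
    · refine le_trans (pr_mono fun x _ hx => ?_) (pr_walk_le g hs' _ (-(4 * a)) a ?_)
      · rw [hnat, abs_lt] at hx
        have : 1 / (2 * (a : ℝ)) * x ≤ 1 / (2 * a) * (8 * a ^ 2) := by gcongr; exact hx.2.le
        have e : 1 / (2 * (a : ℝ)) * (8 * a ^ 2) = 4 * a := by field_simp; ring
        linarith
      · rw [e2, ← hΔ]
        have : a ^ 2 * (6 / a) ≤ a ^ 2 * Δ := by gcongr
        have e : (a : ℝ) ^ 2 * (6 / a) = 6 * a := by field_simp
        linarith
    · refine le_trans (pr_mono fun x _ hx => ?_) (pr_walk_le g hs _ (-(4 * a)) a ?_)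
      · rw [hnat, abs_lt] at hx
        have : 1 / (2 * (a : ℝ)) * (-(8 * a ^ 2)) ≤ 1 / (2 * a) * x := by gcongr; exact hx.1.le
        have e : 1 / (2 * (a : ℝ)) * (-(8 * a ^ 2)) = -(4 * a) := by field_simp; ring
        linarith
      · rw [e1, ← hΔ]
        have : a ^ 2 * (6 / a) ≤ a ^ 2 * -Δ := by gcongr
        have e : (a : ℝ) ^ 2 * (6 / a) = 6 * a := by field_simp
        linarith
  · intro h
    obtain ⟨h1, h2⟩ := abs_le.1 h
    have e : (a : ℝ) ^ 2 * (2 / a) = 2 * a := by field_simp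
    have hsum : pr (walk (walkStep g) (4 * a ^ 3) 0) (fun x => ¬ x.natAbs < 8 * a ^ 2) ≤
        ENNReal.ofReal (Real.exp (-a)) + ENNReal.ofReal (Real.exp (-a)) := by
      refine le_trans (pr_mono fun x _ hx => ?_) ((pr_or_le _ (fun x : ℤ => 4 * a ≤ 1 / (2 * (a : ℝ)) * x)
        (fun x : ℤ => 4 * a ≤ -(1 / (2 * (a : ℝ))) * x)).trans (add_le_add (pr_walk_le g hs _ (4 * a) a ?_)
          (pr_walk_le g hs' _ (4 * a) a ?_)))
      · rw [hnat, not_lt, le_abs] at hx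
        have e : 1 / (2 * (a : ℝ)) * (8 * a ^ 2) = 4 * a := by field_simp; ring
        rcases hx with hx | hx
        · left
          rw [← e]
          gcongr
        · right
          rw [← e, neg_mul, ← mul_neg]
          gcongr
      · rw [e1, ← hΔ]
        have : a ^ 2 * Δ ≤ a ^ 2 * (2 / a) := by gcongr
        linarith
      · rw [e2, ← hΔ]
        have : a ^ 2 * -Δ ≤ a ^ 2 * (2 / a) := by gcongr; linarith
        linarith
    refine hsum.trans ((add_le_add hle hle).trans ?_)
    rw [← ENNReal.ofReal_add (by positivity) (by positivity)]
    refine ENNReal.ofReal_le_ofReal (le_of_eq ?_)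
    ring


/-! ## The loss of the greedy choice -/

/-- Decisions are only ever added in front, so the flags known at an earlier time remain a suffix of
the final flags. Thus `J.drop (n - i)` is the state in which feature `i` was decided. -/
theorem drop_of_mem_support_greedyDist {test : List Bool → ℕ → PMF Bool} {rem : ℕ}
    {J J' : List Bool} {cnt sl : ℕ} (h : J' ∈ (greedyDist test rem J cnt sl).support) :
    J'.drop rem = J := by
  induction rem generalizing J cnt sl with
  | zero => simp [greedyDist] at h; simp [h]
  | succ rem ih =>
    simp only [greedyDist, PMF.mem_support_bind_iff] at h
    obtain ⟨a, -, h⟩ := h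
    rw [← List.tail_drop, ih h, List.tail_cons]

/-- The influence of the next feature, for the success probability `Γ`. -/
def influence (Γ : List Bool → ℝ) (J : List Bool) : ℝ := |Γ (true :: J) - Γ J|

open Classical in
/-- The number of features from `m` on that have a large influence but are not in `K`. -/
noncomputable def surprises (Γ : List Bool → ℝ) (n : ℕ) (K : Finset ℕ) (lo : ℝ) (m : ℕ)
    (J : List Bool) : ENNReal :=
  ∑ i ∈ Finset.Ico m n, if i ∉ K ∧ lo < influence Γ (J.drop (n - i)) then 1 else 0

/-- Each step is charged. A surprise at the current feature pays for the whole remaining loss, which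
is at most one; so does an error of the test, which has probability at most `δ`. Any other decision
is good: protecting costs at most `hi`, and not protecting costs nothing because unset flags leave
`Γ` unchanged.

The last hypothesis is an invariant: the remaining places for unprotected features together with the
elements of `K` already passed number at least `h₀ ≥ |K|`. A good rejection made by a test hits an
element of `K`, so it preserves the sum. Once the places are used up, all of `K` has been passed,
and the forced protections concern features outside `K`, which have small influence unless they are
surprises. -/
theorem mean_greedyDist_le {test : List Bool → ℕ → PMF Bool} {Γ : List Bool → ℝ} {n h₀ : ℕ}
    {lo hi : ℝ} {δ : ENNReal} {K : Finset ℕ} (hΓ : ∀ J, 0 ≤ Γ J ∧ Γ J ≤ 1) (hhi : 0 ≤ hi)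
    (hfalse : ∀ J, J.length < n → Γ (false :: J) = Γ J)
    (hacc : ∀ J rem, J.length + 1 + rem = n → hi < influence Γ J →
      pr (test J rem) (· = true) ≤ δ)
    (hrej : ∀ J rem, J.length + 1 + rem = n → influence Γ J ≤ lo →
      pr (test J rem) (· = false) ≤ δ)
    (hlh : lo ≤ hi) (hK : K.card ≤ h₀) (rem : ℕ) : ∀ (J : List Bool) (cnt sl : ℕ), cnt + sl = rem →
      J.length + rem = n → (cnt ≠ 0 → h₀ ≤ sl + (K.filter (· < J.length)).card) →
      mean (greedyDist test rem J cnt sl) (fun J' => ENNReal.ofReal |Γ J' - Γ J|) ≤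
        rem * (ENNReal.ofReal hi + δ) +
          mean (greedyDist test rem J cnt sl) (surprises Γ n K lo J.length) := by
  classical
  have hone : ∀ J J', ENNReal.ofReal |Γ J' - Γ J| ≤ 1 := by
    intro J J'
    rw [← ENNReal.ofReal_one]
    refine ENNReal.ofReal_le_ofReal (abs_le.2 ⟨?_, ?_⟩) <;> linarith [hΓ J, hΓ J']
  induction rem with
  | zero =>
    intro J cnt sl _ _ _
    simp [greedyDist, mean_pure]
  | succ rem ih =>
    intro J cnt sl hcs hlen hinv
    have hlt : J.length < n := by omega
    have hsplit : ∀ J', surprises Γ n K lo J.length J' =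
        (if J.length ∉ K ∧ lo < influence Γ (J'.drop (n - J.length)) then 1 else 0) +
          surprises Γ n K lo (J.length + 1) J' := fun J' =>
      Finset.sum_eq_sum_Ico_succ_bot hlt _
    -- A surprise here contributes one to the right-hand side along every continuation, since the
    -- earlier flags persist in the final ones.
    by_cases hP : J.length ∉ K ∧ lo < influence Γ J
    · refine (mean_le_const fun J' _ => hone J J').trans (le_trans ?_ le_add_self)
      rw [← mean_const (greedyDist test (rem + 1) J cnt sl) 1]
      refine mean_mono fun J' hJ' => ?_
      have := drop_of_mem_support_greedyDist hJ'
      rw [hsplit, show n - J.length = rem + 1 by omega, this, if_pos hP]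
      exact le_self_add
    have hsupp : ∀ a ∈ (decideFeature test rem J cnt sl).support,
        (a = true → cnt ≠ 0) ∧ (a = false → cnt ≠ 0 → sl ≠ 0) := by
      intro a ha
      unfold decideFeature at ha
      split_ifs at ha with h1 h2
      · simp at ha; subst ha; simp [h1]
      · simp at ha; subst ha; simp [h1]
      · simp [h1, h2]
    let good : Bool → Prop := fun a =>
      (a = true → influence Γ J ≤ hi) ∧ (a = false → cnt = 0 ∨ J.length ∈ K)
    have hbad : pr (decideFeature test rem J cnt sl) (fun a => ¬ good a) ≤ δ := by
      unfold decideFeature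
      split_ifs with h1 h2
      · rw [pr, mean_pure, if_neg]
        · exact zero_le
        · simp [good, h1]
      · rw [pr, mean_pure, if_neg]
        · exact zero_le
        · simp only [good, not_not, Bool.true_eq_false, IsEmpty.forall_iff, and_true, forall_const]
          by_contra hcon
          rw [not_le] at hcon
          have hmem : J.length ∈ K := by
            by_contra hmem
            exact hP ⟨hmem, hlh.trans_lt hcon⟩
          -- With `sl = 0` the invariant requires at least `|K|` elements of `K` strictly before the
          -- current feature, so this feature cannot be in `K` as well.
          have h3 := hinv h1
          have h4 : (K.filter (· < J.length)).card < K.card :=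
            Finset.card_lt_card (Finset.filter_ssubset.2 ⟨_, hmem, lt_irrefl _⟩)
          omega
      · by_cases hmem : J.length ∈ K
        · by_cases hcon : hi < influence Γ J
          · refine (pr_mono fun a _ ha => ?_).trans (hacc J rem (by omega) hcon)
            cases a
            · simp [good, hmem] at ha
            · rfl
          · have : pr (test J rem) (fun a => ¬ good a) ≤ pr (test J rem) fun _ => False := by
              refine pr_mono fun a _ ha => ?_
              cases a <;> simp_all [good]
            refine this.trans ?_
            simp [pr, mean]
        · have hle : influence Γ J ≤ lo := by
            by_contra hcon
            exact hP ⟨hmem, not_le.1 hcon⟩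
          refine (pr_mono fun a _ ha => ?_).trans (hrej J rem (by omega) hle)
          cases a
          · rfl
          · simp [good, hle.trans hlh] at ha
    have hstep : ∀ a ∈ (decideFeature test rem J cnt sl).support,
        mean (greedyDist test rem (a :: J) (if a then cnt - 1 else cnt) (if a then sl else sl - 1))
          (fun J' => ENNReal.ofReal |Γ J' - Γ J|) ≤ (if ¬ good a then 1 else 0) +
            ((ENNReal.ofReal hi + rem * (ENNReal.ofReal hi + δ)) + mean (greedyDist test rem (a :: J)
              (if a then cnt - 1 else cnt) (if a then sl else sl - 1))
                (surprises Γ n K lo (J.length + 1))) := by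
      intro a ha
      obtain ⟨hs1, hs2⟩ := hsupp a ha
      by_cases hg : good a
      · rw [if_neg (not_not.2 hg), zero_add]
        have hih := ih (a :: J) (if a then cnt - 1 else cnt) (if a then sl else sl - 1) ?_ ?_ ?_
        · have hcost : |Γ (a :: J) - Γ J| ≤ hi := by
            cases a
            · rw [hfalse J hlt]; simpa using hhi
            · exact hg.1 rfl
          refine le_trans (mean_mono (g := fun J' => ENNReal.ofReal hi +
            ENNReal.ofReal |Γ J' - Γ (a :: J)|) fun J' _ => ?_) ?_
          · rw [← ENNReal.ofReal_add hhi (abs_nonneg _)]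
            refine ENNReal.ofReal_le_ofReal ?_
            have := abs_sub_le (Γ J') (Γ (a :: J)) (Γ J)
            linarith
          · rw [mean_add, mean_const, add_assoc]
            exact add_le_add le_rfl hih
        · cases a
          · simp only [Bool.false_eq_true, if_false]
            have := hs2 rfl
            omega
          · simp only [if_true]
            have := hs1 rfl
            omega
        · simp; omega
        · intro hc
          cases a
          · simp only [Bool.false_eq_true, if_false] at hc ⊢
            -- The rejected feature belongs to `K` and is now counted as passed, which makes up for
            -- the lost unit of `sl`.
            have hmem := (hg.2 rfl).resolve_left hc
            have h3 := hinv hc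
            have h4 : (K.filter (· < J.length)).card <
                (K.filter (· < (false :: J).length)).card := by
              refine Finset.card_lt_card (Finset.ssubset_iff_of_subset ?_ |>.2
                ⟨J.length, by simp [hmem], by simp⟩)
              refine Finset.monotone_filter_right _ fun i hi => ?_
              simp only [List.length_cons]
              omega
            have := hs2 rfl hc
            omega
          · simp only [if_true] at hc ⊢
            have h3 := hinv (hs1 rfl)
            have h4 : (K.filter (· < J.length)).card ≤
                (K.filter (· < (true :: J).length)).card := by
              refine Finset.card_le_card (Finset.monotone_filter_right _ fun i hi => ?_)
              simp only [List.length_cons]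
              omega
            omega
      · rw [if_pos hg]
        exact (mean_le_const fun J' _ => hone J J').trans le_self_add
    rw [greedyDist, mean_bind, mean_bind]
    refine (mean_mono hstep).trans ?_
    rw [mean_add, mean_add, mean_const]
    have hpen : (mean (decideFeature test rem J cnt sl) fun a => mean (greedyDist test rem (a :: J)
        (if a then cnt - 1 else cnt) (if a then sl else sl - 1))
          (surprises Γ n K lo (J.length + 1))) ≤ mean (decideFeature test rem J cnt sl) fun a =>
        mean (greedyDist test rem (a :: J) (if a then cnt - 1 else cnt) (if a then sl else sl - 1))
          (surprises Γ n K lo J.length) :=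
      mean_mono fun a _ => mean_mono fun J' _ => by rw [hsplit]; exact le_add_self
    have hbad' : (mean (decideFeature test rem J cnt sl) fun a => if ¬ good a then 1 else 0) ≤ δ := by
      refine le_of_eq_of_le ?_ hbad
      unfold pr
      congr!
    refine (add_le_add hbad' (add_le_add le_rfl hpen)).trans (le_of_eq ?_)
    push_cast
    ring

/-! ## The success probability on mixed samples -/

/-- The probability that the answer is `true` on samples with the flags `J` for the first features
and unset flags for the others. -/
noncomputable def hybridProb (enc : Cmd) (lam : ℕ) (l : List (List Bool)) (c : Bool)
    (f : List Bool → PMF Bool) (J : List Bool) : ℝ :=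
  prob ((hybrid enc lam l c (J.reverse ++ List.replicate (l.length - J.length) false)).bind
    fun z => f (encodeList z)) (· = true)

section Loss

variable {enc : Cmd} {lam : ℕ} {l : List (List Bool)} {c : Bool} {f : List Bool → PMF Bool}

theorem probeDist_prob {J : List Bool} {rem : ℕ} (h : J.length + 1 + rem = l.length) (v : Bool) :
    prob (probeDist enc lam l c f J rem v) (· = true) = hybridProb enc lam l c f (v :: J) := by
  rw [probeDist, hybridProb, probeFlags]
  have : l.length - (v :: J).length = rem := by simp; omega
  rw [this, List.reverse_cons, List.append_assoc, List.singleton_append]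

/-- Undecided features are padded with unset flags anyway, so deciding not to protect a feature
changes nothing. -/
theorem hybridProb_false {J : List Bool} (h : J.length < l.length) :
    hybridProb enc lam l c f (false :: J) = hybridProb enc lam l c f J := by
  rw [hybridProb, hybridProb]
  have : l.length - J.length = (l.length - (false :: J).length) + 1 := by simp; omega
  rw [this, List.reverse_cons, List.append_assoc, List.singleton_append, List.replicate_succ]

theorem influence_hybridProb {J : List Bool} {rem : ℕ} (h : J.length + 1 + rem = l.length) :
    influence (hybridProb enc lam l c f) J = |prob (probeDist enc lam l c f J rem true) (· = true) -
      prob (probeDist enc lam l c f J rem false) (· = true)| := by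
  rw [influence, probeDist_prob h, probeDist_prob h, hybridProb_false (by omega)]

theorem mean_flagsDist_le {k : ℕ} {K : Finset ℕ} (hK : K.card ≤ l.length / 2)
    (hm : 0 < l.length * k) :
    mean (flagsDist enc lam l c k f) (fun J => ENNReal.ofReal
      |hybridProb enc lam l c f J - hybridProb enc lam l c f []|) ≤
      l.length * ENNReal.ofReal (8 / precision (l.length * k)) +
        mean (flagsDist enc lam l c k f) (surprises (hybridProb enc lam l c f) l.length K
          (2 / precision (l.length * k)) 0) := by
  have ha : 0 < precision (l.length * k) := by unfold precision; omega
  set a := precision (l.length * k) with hadef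
  have ha' : (0 : ℝ) < a := by exact_mod_cast ha
  -- At the start there are exactly `h₀ = l.length / 2` unprotected places, so the invariant holds
  -- with no feature passed yet.
  have key := mean_greedyDist_le (test := testDist enc lam l c f (rounds (l.length * k))
    (threshold (l.length * k))) (Γ := hybridProb enc lam l c f) (n := l.length)
    (h₀ := l.length / 2) (lo := 2 / a) (hi := 6 / a) (δ := ENNReal.ofReal (2 / a)) (K := K)
    (fun J => ⟨prob_nonneg _ _, prob_le_one _ _⟩) (by positivity) (fun J hJ => hybridProb_false hJ)
    (fun J rem h hi => ?_) (fun J rem h hi => ?_) (by gcongr; norm_num) hK l.length []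
    ((l.length + 1) / 2) (l.length / 2) (by omega) (by simp) (fun _ => by omega)
  · have e : ENNReal.ofReal (6 / a) + ENNReal.ofReal (2 / a) = ENNReal.ofReal (8 / (a : ℝ)) := by
      rw [← ENNReal.ofReal_add (by positivity) (by positivity)]
      congr 1
      ring
    rw [e] at key
    exact key
  · rw [influence_hybridProb h] at hi
    have := (pr_walk_test_le (probeDist enc lam l c f J rem) ha).1 hi
    rw [testDist, pr_map]
    simpa [rounds, threshold, ← hadef] using this
  · rw [influence_hybridProb h] at hi
    have := (pr_walk_test_le (probeDist enc lam l c f J rem) ha).2 hi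
    rw [testDist, pr_map]
    simpa [rounds, threshold, ← hadef] using this

end Loss


/-! ## Influences and distinguishing advantages -/

theorem mixL_set {α : Type} {V : List Bool} {X Y : List α} {i : ℕ} {v : Bool} {x y : α}
    (hx : X[i]? = some x) (hy : Y[i]? = some y) :
    mixL (V.set i v) X Y = (mixL V X Y).set i (if v then x else y) := by
  induction V generalizing X Y i with
  | nil => simp [mixL]
  | cons w V ih =>
    cases X with
    | nil => simp at hx
    | cons a X =>
      cases Y with
      | nil => simp at hy
      | cons b Y =>
        cases i with
        | zero => simp at hx hy; simp [mixL, hx, hy]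
        | succ i => simp at hx hy; simp [mixL, ih hx hy]

/-- The advantage of the classifier on a sample of which the `i`-th entry, under the public key
`pk`, is replaced by a new ciphertext. -/
noncomputable def swapAdv (enc : Cmd) (lam : ℕ) (pk : List Bool) (f : List Bool → PMF Bool) (i : ℕ)
    (z : List (List Bool)) : ℝ :=
  |prob ((encDist enc lam pk true).bind fun ct => f (encodeList (z.set i ct))) (· = true) -
    prob ((encDist enc lam pk false).bind fun ct => f (encodeList (z.set i ct))) (· = true)|

theorem swapAdv_le_one {enc : Cmd} {lam : ℕ} {pk : List Bool} {f : List Bool → PMF Bool} {i : ℕ}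
    {z : List (List Bool)} : swapAdv enc lam pk f i z ≤ 1 := by
  have h : ∀ μ : PMF Bool, 0 ≤ prob μ (· = true) ∧ prob μ (· = true) ≤ 1 := fun μ =>
    ⟨prob_nonneg _ _, prob_le_one _ _⟩
  refine abs_le.2 ⟨?_, ?_⟩
  · linarith [(h ((encDist enc lam pk true).bind fun ct => f (encodeList (z.set i ct)))).1,
      (h ((encDist enc lam pk false).bind fun ct => f (encodeList (z.set i ct)))).2]
  · linarith [(h ((encDist enc lam pk true).bind fun ct => f (encodeList (z.set i ct)))).2,
      (h ((encDist enc lam pk false).bind fun ct => f (encodeList (z.set i ct)))).1]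

section Influence

variable {enc : Cmd} {lam : ℕ} {l : List (List Bool)} {c : Bool} {f : List Bool → PMF Bool}

/-- The tentative entry of a probe may be drawn after the others, in place of the entry that the
hybrid has there. This is the shape of the experiment in which the challenge ciphertext is inserted.
-/
theorem probeDist_eq {J pk : List Bool} {rem : ℕ} (h : J.length + 1 + rem = l.length)
    (hpk : l[J.length]? = some pk) (v : Bool) : probeDist enc lam l c f J rem v =
      (hybrid enc lam l c (J.reverse ++ List.replicate (l.length - J.length) false)).bind fun z =>
        (encDist enc lam pk (if v then c else !c)).bind fun ct =>
          f (encodeList (z.set J.length ct)) := by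
  have hV : probeFlags J v rem =
      (J.reverse ++ List.replicate (l.length - J.length) false).set J.length v := by
    rw [show l.length - J.length = rem + 1 by omega, List.replicate_succ, probeFlags,
      List.set_append_right _ _ (by simp)]
    simp
  have hset := prodL_bind_set (mixL (J.reverse ++ List.replicate (l.length - J.length) false)
    (l.map fun p => encDist enc lam p c) (l.map fun p => encDist enc lam p (!c)))
    (encDist enc lam pk (if v then c else !c)) J.length
  rw [probeDist, hV]
  have hmix : hybrid enc lam l c ((J.reverse ++ List.replicate (l.length - J.length) false).set
      J.length v) = (hybrid enc lam l c (J.reverse ++ List.replicate (l.length - J.length)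
        false)).bind fun z => (encDist enc lam pk (if v then c else !c)).map fun ct =>
          z.set J.length ct := by
    rw [hybrid, hybrid, hset, mixL_set (x := encDist enc lam pk c) (y := encDist enc lam pk (!c))
      (by simp [hpk]) (by simp [hpk])]
    cases v <;> simp
  rw [hmix, PMF.bind_bind]
  exact bind_congr_support fun z _ => PMF.bind_map _ _ _

theorem influence_le_mean {J pk : List Bool} (hpk : l[J.length]? = some pk) :
    ENNReal.ofReal (influence (hybridProb enc lam l c f) J) ≤
      mean (hybrid enc lam l c (J.reverse ++ List.replicate (l.length - J.length) false)) fun z =>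
        ENNReal.ofReal (swapAdv enc lam pk f J.length z) := by
  have hlt : J.length < l.length := (List.getElem?_eq_some_iff.1 hpk).1
  have h : J.length + 1 + (l.length - J.length - 1) = l.length := by omega
  rw [influence_hybridProb h, probeDist_eq h hpk, probeDist_eq h hpk]
  refine (ofReal_abs_prob_bind_sub_le _ _ _ _).trans (mean_mono fun z _ => ?_)
  cases c
  · rw [abs_sub_comm]
    exact le_rfl
  · exact le_rfl

/-- The advantage is averaged over the hybrid: it is at most `ε` off the event and at most one on
it. -/
theorem influence_le_pr {J pk : List Bool} (hpk : l[J.length]? = some pk) {ε : ℝ} :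
    ENNReal.ofReal (influence (hybridProb enc lam l c f) J) ≤ ENNReal.ofReal ε +
      pr (hybrid enc lam l c (J.reverse ++ List.replicate (l.length - J.length) false)) fun z =>
        ε < swapAdv enc lam pk f J.length z := by
  refine (influence_le_mean hpk).trans ?_
  rw [← mean_const (hybrid enc lam l c (J.reverse ++ List.replicate (l.length - J.length) false))
    (ENNReal.ofReal ε), pr, ← mean_add]
  refine mean_mono fun z _ => ?_
  split_ifs with h
  · refine le_trans ?_ le_add_self
    rw [← ENNReal.ofReal_one]
    exact ENNReal.ofReal_le_ofReal swapAdv_le_one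
  · exact (ENNReal.ofReal_le_ofReal (not_lt.1 h)).trans le_self_add

/-- The distribution of the sample that is given to the second part of the reduction when feature
`i` is chosen. -/
noncomputable def featureLaw (enc : Cmd) (lam : ℕ) (l : List (List Bool)) (c : Bool) (k : ℕ)
    (f : List Bool → PMF Bool) (i : ℕ) : PMF (List (List Bool)) :=
  (flagsDist enc lam l c k f).bind fun J =>
    hybrid enc lam l c (cutFlags (selectFlags l.length (i + 1)).reverse J).reverse

theorem selectFlags_eq_append {m i : ℕ} (h : i < m) : selectFlags m (i + 1) =
    List.replicate i false ++ true :: List.replicate (m - 1 - i) false := by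
  rw [selectFlags_succ, show m = i + (1 + (m - 1 - i)) by omega, List.replicate_add,
    List.set_append_right _ _ (by simp), List.replicate_add]
  simp
  omega

theorem reverse_cutFlags {n i : ℕ} (h : i < n) (J : List Bool) :
    (cutFlags (selectFlags n (i + 1)).reverse J).reverse =
      (J.drop (n - i)).reverse ++ List.replicate (n - i) false := by
  have hcut : ∀ (d : ℕ) (E : List Bool),
      cutLength (List.replicate d false ++ true :: E) = d + 1 := by
    intro d E
    induction d with
    | zero => rfl
    | succ d ih => rw [List.replicate_succ, List.cons_append, cutLength, ih]
  have : cutLength (selectFlags n (i + 1)).reverse = n - i := by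
    rw [selectFlags_eq_append h, List.reverse_append, List.reverse_cons, List.reverse_replicate,
      List.reverse_replicate, List.append_assoc, List.singleton_append, hcut]
    omega
  rw [cutFlags, this, List.reverse_append, List.reverse_replicate]

/-- If the influence exceeds `2 / a` for some flags, then `influence_le_pr` with `ε ≤ 1 / a` leaves
probability at least `1 / a` for a hybrid on which the classifier has advantage more than `ε`.
Averaging over the flags loses the factor `a`. The cut flags of `featureLaw` are precisely the flags
with which this influence was measured. -/
theorem pr_influence_le {i k a : ℕ} (ha : 0 < a) {pk : List Bool} (hpk : l[i]? = some pk) {ε : ℝ}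
    (hεa : ε ≤ 1 / a) :
    pr (flagsDist enc lam l c k f) (fun J =>
      2 / a < influence (hybridProb enc lam l c f) (J.drop (l.length - i))) ≤
        a * pr (featureLaw enc lam l c k f i) (fun z => ε < swapAdv enc lam pk f i z) := by
  have ha' : (0 : ℝ) < a := by exact_mod_cast ha
  have hi : i < l.length := (List.getElem?_eq_some_iff.1 hpk).1
  rw [featureLaw, pr_bind]
  have h := mul_pr_le_mean (μ := flagsDist enc lam l c k f) (E := fun J =>
    2 / a < influence (hybridProb enc lam l c f) (J.drop (l.length - i)))
    (f := fun J => pr (hybrid enc lam l c (cutFlags (selectFlags l.length (i + 1)).reverse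
      J).reverse) fun z => ε < swapAdv enc lam pk f i z) (a : ENNReal)⁻¹ ?_
  · rw [mul_comm, ← div_eq_mul_inv] at h
    rw [mul_comm]
    exact (ENNReal.div_le_iff_le_mul (Or.inl (by exact_mod_cast ha.ne'))
      (Or.inl (ENNReal.natCast_ne_top a))).1 h
  · intro J hJ hlt
    have hlen : (J.drop (l.length - i)).length = i := by
      have := length_of_mem_support_greedyDist hJ
      simp only [List.length_drop, List.length_nil] at this ⊢
      omega
    have h1 := influence_le_pr (enc := enc) (lam := lam) (c := c) (f := f)
      (J := J.drop (l.length - i)) (pk := pk) (ε := ε)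
      (by rw [hlen, hpk])
    rw [hlen] at h1
    rw [reverse_cutFlags hi]
    have h2 : ENNReal.ofReal (1 / a) + ENNReal.ofReal (1 / (a : ℝ)) ≤ ENNReal.ofReal (1 / a) +
        pr (hybrid enc lam l c ((J.drop (l.length - i)).reverse ++
          List.replicate (l.length - i) false)) fun z => ε < swapAdv enc lam pk f i z := by
      rw [← ENNReal.ofReal_add (by positivity) (by positivity)]
      refine (ENNReal.ofReal_le_ofReal ?_).trans (h1.trans (add_le_add
        (ENNReal.ofReal_le_ofReal hεa) le_rfl))
      rw [← add_div]
      norm_num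
      exact hlt.le
    have h3 := (ENNReal.add_le_add_iff_left ENNReal.ofReal_ne_top).1 h2
    rwa [one_div, ENNReal.ofReal_inv_of_pos ha', ENNReal.ofReal_natCast] at h3

open Classical in
/-- The features whose influence is visible to the second part of the reduction. -/
noncomputable def visible (enc : Cmd) (lam : ℕ) (l : List (List Bool)) (c : Bool) (k : ℕ)
    (f : List Bool → PMF Bool) (ε : ℝ) (θ : ENNReal) : Finset ℕ :=
  (Finset.range l.length).filter fun i =>
    2 * θ ≤ pr (featureLaw enc lam l c k f i) fun z => ε < swapAdv enc lam (l.getD i []) f i z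

/-- A feature that is not visible shows a large influence with probability at most `a * (2 * θ)`,
where `a` is the precision. So the expected number of surprises is at most `n` times this. -/
theorem mean_loss_le {k : ℕ} (hm : 0 < l.length * k) {ε : ℝ} {θ : ENNReal}
    (hK : (visible enc lam l c k f ε θ).card ≤ l.length / 2)
    (hεa : ε ≤ 1 / precision (l.length * k)) :
    mean (flagsDist enc lam l c k f) (fun J => ENNReal.ofReal
      |hybridProb enc lam l c f J - hybridProb enc lam l c f []|) ≤
      l.length * ENNReal.ofReal (8 / precision (l.length * k)) +
        l.length * (precision (l.length * k) * (2 * θ)) := by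
  classical
  have ha : 0 < precision (l.length * k) := by unfold precision; omega
  refine (mean_flagsDist_le hK hm).trans (add_le_add le_rfl ?_)
  set a := precision (l.length * k) with hadef
  unfold surprises
  rw [mean_sum]
  refine (Finset.sum_le_card_nsmul _ _ (a * (2 * θ)) fun i hi => ?_).trans (by simp)
  rw [Finset.mem_Ico] at hi
  by_cases hv : i ∈ visible enc lam l c k f ε θ
  · simp [hv, mean]
  · have hpk : l[i]? = some (l.getD i []) := by simp [List.getD, List.getElem?_eq_getElem hi.2]
    have hlt : pr (featureLaw enc lam l c k f i) (fun z => ε < swapAdv enc lam (l.getD i []) f i z) ≤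
        2 * θ := by
      simp only [visible, Finset.mem_filter, Finset.mem_range, not_and, not_le] at hv
      exact (hv hi.2).le
    refine le_trans ?_ ((pr_influence_le ha hpk hεa).trans (by gcongr))
    refine mean_mono fun J _ => ?_
    simp only [hv, not_false_eq_true, true_and]
    split_ifs <;> simp

end Influence


/-! ## Counting the features with known secret keys -/

/-- The bit strings of length at most `B`. -/
def shortStrings (B : ℕ) : Finset (List Bool) :=
  (Finset.range (B + 1)).biUnion fun m => Finset.univ.image (List.ofFn : (Fin m → Bool) → List Bool)

theorem mem_shortStrings {B : ℕ} {w : List Bool} : w ∈ shortStrings B ↔ w.length ≤ B := by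
  simp only [shortStrings, Finset.mem_biUnion, Finset.mem_range, Finset.mem_image, Finset.mem_univ,
    true_and]
  constructor
  · rintro ⟨m, hm, f, rfl⟩
    simpa using Nat.lt_succ_iff.1 hm
  · exact fun h => ⟨w.length, by omega, w.get, List.ofFn_get w⟩

theorem card_shortStrings_le (B : ℕ) : (shortStrings B).card ≤ 2 ^ (B + 1) := by
  refine Finset.card_biUnion_le.trans ((Finset.sum_le_sum fun m _ =>
    Finset.card_image_le.trans_eq (by simp : _ = 2 ^ m)).trans ?_)
  have := Nat.geomSum_lt (m := 2) (n := B + 1) (s := Finset.range (B + 1)) le_rfl (by simp)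
  exact this.le

theorem uniformBits_apply_le (m : ℕ) (w : List Bool) : uniformBits m w ≤ 2⁻¹ ^ m := by
  rw [uniformBits, PMF.map_apply]
  by_cases h : ∃ f : Fin m → Bool, w = List.ofFn f
  · obtain ⟨f, rfl⟩ := h
    rw [tsum_eq_single f]
    · simp [PMF.uniformOfFintype_apply, ENNReal.inv_pow]
    · intro g hg
      rw [if_neg fun h => hg (List.ofFn_injective h).symm]
  · push Not at h
    simp [h]

/-- A probability distribution has few points of large mass. -/
theorem pr_uniformBits_le (m : ℕ) (μ : PMF (List Bool)) {M : ENNReal} (hM : M ≠ ⊤) (hM0 : M ≠ 0) :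
    pr (uniformBits m) (fun w => M⁻¹ ≤ μ w) ≤ M * 2⁻¹ ^ m := by
  have h : pr (uniformBits m) (fun w => M⁻¹ ≤ μ w) ≤ mean (uniformBits m) fun w => M * μ w := by
    refine mean_mono fun w _ => ?_
    split_ifs with hw
    · rw [← ENNReal.mul_inv_cancel hM0 hM]
      gcongr
    · exact zero_le
  refine h.trans ?_
  rw [mean_mul_left]
  gcongr
  rw [mean]
  refine (ENNReal.tsum_le_tsum fun w => mul_le_mul_left (uniformBits_apply_le m w) _).trans ?_
  rw [ENNReal.tsum_mul_left, μ.tsum_coe, mul_one]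

/-! ### Exponential moments of the number of predictable secret keys. -/

section Hits

/-- A pair of keys. -/
abbrev KeyPair := List Bool × List Bool

open Classical in
/-- The number of secret keys that lie in the sets `F i`, which depend on all the public keys. -/
noncomputable def hits (F : ℕ → List (List Bool) → Set (List Bool)) (ks : List KeyPair) : ℕ :=
  ((Finset.range ks.length).filter fun i => (ks.getD i ([], [])).2 ∈ F i (ks.map Prod.fst)).card

theorem hits_cons (F : ℕ → List (List Bool) → Set (List Bool)) (key : KeyPair)
    (ks : List KeyPair) [Decidable (key.2 ∈ F 0 (key.1 :: ks.map Prod.fst))] :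
    hits F (key :: ks) = (if key.2 ∈ F 0 (key.1 :: ks.map Prod.fst) then 1 else 0) +
      hits (fun i p => F (i + 1) (key.1 :: p)) ks := by
  classical
  unfold hits
  rw [List.length_cons, Finset.range_add_one', Finset.filter_insert, Finset.filter_map]
  split_ifs with h1 h2 h2
  · rw [Finset.card_insert_of_notMem (by simp), Finset.card_map, add_comm]
    rfl
  · exact absurd h1 (by simpa using h2)
  · exact absurd h2 (by simpa using h1)
  · rw [Finset.card_map, zero_add]
    rfl

/-- The set for a key depends on all public keys, including its own, whose correlation with the
secret key is unknown. Summing over every possible value `p` of the first public key fixes the set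
and leaves only the marginal law of the secret key. The first key then contributes the factor `∑ p,
(Pr[pk = p] + t β) ≤ 1 + t |P| β ≤ 2`. For the other keys `p` becomes a parameter of the sets, and
the induction hypothesis applies. -/
theorem mean_pow_hits_le {G : PMF KeyPair} {P : Finset (List Bool)} {β t : ENNReal}
    (hP : ∀ key ∈ G.support, key.1 ∈ P) (n : ℕ) (F : ℕ → List (List Bool) → Set (List Bool))
    (hF : ∀ i p, pr G (fun key => key.2 ∈ F i p) ≤ β) (ht : t * (P.card * β) ≤ 1) :
    mean (prodL (List.replicate n G)) (fun ks => t ^ hits F ks) ≤ 2 ^ n := by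
  classical
  induction n generalizing F with
  | zero => simp [prodL, mean_pure, hits]
  | succ n ih =>
    -- The actual public key is one of the summands, and the others are nonnegative. In the second
    -- term the condition `key.1 = p` is dropped on purpose, which is where the factor `P.card`
    -- arises.
    have hsplit : ∀ key ∈ G.support, ∀ ks, t ^ hits F (key :: ks) ≤ ∑ p ∈ P,
        ((if key.1 = p then 1 else 0) + t * (if key.2 ∈ F 0 (p :: ks.map Prod.fst) then 1 else 0)) *
          t ^ hits (fun i p' => F (i + 1) (p :: p')) ks := by
      intro key hkey ks
      refine le_trans ?_ (Finset.single_le_sum (fun _ _ => zero_le) (hP key hkey))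
      rw [hits_cons, pow_add, if_pos rfl]
      gcongr
      split_ifs <;> simp
    rw [List.replicate_succ, prodL, mean_bind]
    refine (mean_mono (g := fun key => mean (prodL (List.replicate n G)) fun ks => ∑ p ∈ P,
        ((if key.1 = p then 1 else 0) + t * (if key.2 ∈ F 0 (p :: ks.map Prod.fst) then 1 else 0)) *
          t ^ hits (fun i p' => F (i + 1) (p :: p')) ks) fun key hkey => ?_).trans ?_
    · rw [mean_map]
      exact mean_mono fun ks _ => hsplit key hkey ks
    -- The later keys are fixed before the first one is averaged, since the set for the first key
    -- depends on their public parts.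
    rw [mean_comm]
    have hin : ∀ ks : List KeyPair, (mean G fun key => ∑ p ∈ P,
        ((if key.1 = p then 1 else 0) + t * (if key.2 ∈ F 0 (p :: ks.map Prod.fst) then 1 else 0)) *
          t ^ hits (fun i p' => F (i + 1) (p :: p')) ks) ≤ ∑ p ∈ P,
        (pr G (fun key => key.1 = p) + t * β) * t ^ hits (fun i p' => F (i + 1) (p :: p')) ks := by
      intro ks
      rw [mean_sum]
      refine Finset.sum_le_sum fun p _ => ?_
      simp only [mul_comm _ (t ^ _), mean_mul_left, mean_add]
      gcongr
      · unfold pr; congr!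
      · refine le_trans (le_of_eq ?_) (hF 0 (p :: ks.map Prod.fst))
        unfold pr; congr!
    refine (mean_mono fun ks _ => hin ks).trans ?_
    rw [mean_sum]
    simp only [mean_mul_left]
    refine (Finset.sum_le_sum fun p _ => mul_le_mul_right (ih _ fun i p' => hF _ _) _).trans ?_
    rw [← Finset.sum_mul, pow_succ, mul_comm]
    gcongr
    rw [Finset.sum_add_distrib, Finset.sum_const, nsmul_eq_mul, ← one_add_one_eq_two]
    gcongr
    · simp only [pr]
      rw [← mean_sum]
      refine mean_le_const fun key _ => ?_
      have h : (∑ p ∈ P, if key.1 = p then (1 : ENNReal) else 0) ≤ 1 := by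
        rw [Finset.sum_ite_eq]
        split_ifs <;> simp
      convert h
    · rwa [mul_left_comm]

/-- Markov's inequality for `t ^ hits` with the largest admissible base `t = (P.card * β)⁻¹`. -/
theorem pr_le_hits {G : PMF KeyPair} {P : Finset (List Bool)} {β : ENNReal}
    (hP : ∀ key ∈ G.support, key.1 ∈ P) (n κ : ℕ) (F : ℕ → List (List Bool) → Set (List Bool))
    (hF : ∀ i p, pr G (fun key => key.2 ∈ F i p) ≤ β) (hβ : P.card * β ≤ 1)
    (hβ0 : P.card * β ≠ 0) :
    pr (prodL (List.replicate n G)) (fun ks => κ ≤ hits F ks) ≤ 2 ^ n * (P.card * β) ^ κ := by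
  have htop : P.card * β ≠ ⊤ := ne_top_of_le_ne_top ENNReal.one_ne_top hβ
  have h := mul_pr_le_mean (μ := prodL (List.replicate n G)) (E := fun ks => κ ≤ hits F ks)
    (f := fun ks => (P.card * β)⁻¹ ^ hits F ks) ((P.card * β)⁻¹ ^ κ)
    fun ks _ hk => pow_le_pow_right₀ (ENNReal.one_le_inv.2 hβ) hk
  have h' := h.trans (mean_pow_hits_le hP n F hF (ENNReal.inv_mul_cancel hβ0 htop).le)
  calc pr (prodL (List.replicate n G)) (fun ks => κ ≤ hits F ks)
      = (P.card * β) ^ κ * ((P.card * β)⁻¹ ^ κ *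
          pr (prodL (List.replicate n G)) (fun ks => κ ≤ hits F ks)) := by
        rw [← mul_assoc, ← mul_pow, ENNReal.mul_inv_cancel hβ0 htop, one_pow, one_mul]
    _ ≤ _ := by
        rw [mul_comm]
        gcongr

end Hits

/-- Each of the `κ = ⌊n/2⌋ + 1` predicted keys saves `ℓ` bits, while the model costs only `n ℓ / 2`.
At least `ℓ / 2` bits remain, and `ℓ ≥ (n + 1) (p + lam)` makes them pay for `p + lam` bits per
predicted key. The remaining constants are absorbed by `2 ^ (n + 1) * 2 ^ κ ≤ 8 ^ κ`. -/
theorem two_pow_mul_le {n ℓ p lam B M : ℕ} (hB : 2 * B ≤ n * ℓ) (hℓ : (n + 1) * (p + lam) ≤ ℓ)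
    (hM : (8 * M : ENNReal) * 2⁻¹ ^ lam ≤ 1) :
    (2 ^ (B + 1) : ENNReal) * (2 ^ n * (2 ^ (p + 1) * (M * 2⁻¹ ^ ℓ)) ^ (n / 2 + 1)) ≤
      8 * M * 2⁻¹ ^ lam := by
  set κ := n / 2 + 1 with hκ
  have hu : (2⁻¹ : ENNReal) ≤ 1 := by simp
  have h2u : ∀ e : ℕ, (2 : ENNReal) ^ e * 2⁻¹ ^ e = 1 := fun e => by
    rw [← mul_pow, ENNReal.mul_inv_cancel (by simp) (by simp), one_pow]
  have hexp : B + p * κ + lam * κ ≤ ℓ * κ := by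
    have h1 : n + 1 ≤ 2 * κ := by omega
    have h2 : 2 * κ ≤ n + 2 := by omega
    suffices h : 2 * (B + p * κ + lam * κ) ≤ 2 * (ℓ * κ) by omega
    -- The parity of `n`. For even `n` a full `ℓ` is spare and pays for `(n + 2) / 2` predicted
    -- keys; for odd `n` half of `ℓ` is spare and pays for `(n + 1) / 2` of them.
    rcases Nat.lt_or_ge (n + 1) (2 * κ) with h3 | h3
    · have h4 : 2 * κ = n + 2 := by omega
      have h5 : 2 * ((n + 1) * (p + lam)) ≤ 2 * ℓ := by omega
      nlinarith
    · have h4 : 2 * κ = n + 1 := by omega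
      nlinarith
  have hpow : ((8 * M : ENNReal) * 2⁻¹ ^ lam) ^ κ ≤ 8 * M * 2⁻¹ ^ lam := by
    rw [hκ]
    exact pow_le_of_le_one zero_le hM (by omega)
  refine le_trans ?_ hpow
  calc (2 ^ (B + 1) : ENNReal) * (2 ^ n * (2 ^ (p + 1) * (M * 2⁻¹ ^ ℓ)) ^ κ)
      = (2 ^ (n + 1) * 2 ^ κ) * (2 ^ (B + p * κ)) * M ^ κ * 2⁻¹ ^ (ℓ * κ) := by
        rw [mul_pow, mul_pow, ← pow_mul, ← pow_mul, pow_add _ B 1, add_mul, pow_add _ (p * κ),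
          pow_add _ B, pow_add _ n]
        ring
    _ ≤ (2 ^ (2 * κ) * 2 ^ κ) * (2 ^ (B + p * κ)) * M ^ κ * 2⁻¹ ^ (B + p * κ + lam * κ) := by
        gcongr ?_ * _ * _ * _ * ?_
        · exact pow_le_pow_right₀ (by norm_num) (by omega)
        · exact pow_le_pow_right_of_le_one' hu hexp
    _ = (2 ^ (2 * κ) * 2 ^ κ) * M ^ κ * 2⁻¹ ^ (lam * κ) *
        (2 ^ (B + p * κ) * 2⁻¹ ^ (B + p * κ)) := by
        rw [pow_add _ (B + p * κ)]
        ring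
    _ = ((8 * M : ENNReal) * 2⁻¹ ^ lam) ^ κ := by
        rw [h2u, mul_one, mul_pow, mul_pow, ← pow_mul, show (8 : ENNReal) = 2 ^ 3 by norm_num,
          ← pow_mul, ← pow_add]
        ring_nf


/-! ## Extraction of the secret keys of visible features -/

theorem KeysBounded.length_le_of_mem_hybrid {enc : Cmd} {lam b : ℕ} {l : List (List Bool)}
    (h : KeysBounded enc lam b l) {c : Bool} {V : List Bool} {z : List (List Bool)}
    (hz : z ∈ (hybrid enc lam l c V).support) {w : List Bool} (hw : w ∈ z) : w.length ≤ b := by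
  obtain ⟨μ, hμ, hw⟩ := exists_mem_of_mem_support_prodL hz hw
  rcases mem_or_mem_of_mem_mixL hμ with hμ | hμ <;>
  · obtain ⟨p, hp, rfl⟩ := List.mem_map.1 hμ
    exact h.ct_le p hp _ w hw

/-- Fair coins within a fixed time cannot in general produce a uniform index below `n`. Random
binary digits range over `2 ^ n.size ≤ 2 * n` values instead, which loses at most a factor of two.
-/
theorem bitsDist_zero_le {n i : ℕ} (hi : i < n) : (2 * n : ENNReal)⁻¹ ≤ bitsDist n.size 0 i := by
  have h1 : i < 2 ^ n.size := hi.trans (Nat.lt_size_self n)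
  have h2 : 2 ^ n.size ≤ 2 * n := by
    obtain ⟨m, hm⟩ : ∃ m, n.size = m + 1 :=
      ⟨n.size - 1, by have := Nat.size_pos.2 (show 0 < n by omega); omega⟩
    have := Nat.lt_size.1 (show m < n.size by omega)
    rw [hm, pow_succ]
    omega
  have h3 := le_bitsDist (m := 0) h1
  rw [zero_mul, zero_add] at h3
  refine le_trans ?_ h3
  rw [ENNReal.inv_pow.symm, ENNReal.inv_le_inv]
  exact_mod_cast h2

/-- The output of the extractor `E` with advantage parameter `1 / Q`. -/
noncomputable def extractLaw (E : Cmd) (lam Q : ℕ) (st pk : List Bool) : PMF (List Bool) :=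
  (final noOracle E [unary lam, unary Q, st, pk]).map fun s => s 0

/-! ### From distinguishing advantages to predictable secret keys. -/

namespace Components

variable {D : Components} {tN tθ tq : ℕ → ℕ} {lam n ℓ k b T W Q : ℕ} {E : Cmd} {ε : ℝ}

/-- The probability that the second part of the reduction has a large advantage for feature `i`
while the extractor fails to produce the secret key. -/
noncomputable def failure (D : Components) (E : Cmd) (lam k Q : ℕ) (ε : ℝ) (i : ℕ)
    (ks : List KeyPair) (h : List Bool) : ENNReal :=
  mean (featureLaw D.enc lam (ks.map Prod.fst) D.c k (classify D.C lam h) i) fun z =>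
    pr (extractLaw E lam Q (leakCode (selectFlags ks.length (i + 1)).reverse h z)
      (ks.getD i ([], [])).1) fun sk =>
        ε < swapAdv D.enc lam (ks.getD i ([], [])).1 (classify D.C lam h) i z ∧
          sk ≠ (ks.getD i ([], [])).2

/-- The second half of the reduction, run on a fixed leaked state, is literally the swap experiment,
so the advantages agree without loss. -/
theorem distAdv_guess {S : BigKeyEncryption} (henc : D.enc = S.enc) {i : ℕ} {h pk : List Bool}
    {z : List (List Bool)} (hC : ∀ x : List Bool, x.length ≤ b * (2 * b + 1) →
      HaltsWithin noOracle T D.C [unary lam, h, x]) (hlam : lam ≤ b) (hh : h.length ≤ b)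
    (hz : z.length ≤ b) (hzb : ∀ w ∈ z, w.length ≤ b)
    (hct : ∀ m : Bool, ∀ ct ∈ (encDist D.enc lam pk m).support, ct.length ≤ b) :
    distAdv S D.guess lam (leakCode (selectFlags z.length (i + 1)).reverse h z) pk =
      swapAdv D.enc lam pk (classify D.C lam h) i z := by
  have key : ∀ m, guessDist S D.guess lam
      (leakCode (selectFlags z.length (i + 1)).reverse h z) pk m =
      (encDist D.enc lam pk m).bind fun ct => classify D.C lam h (encodeList (z.set i ct)) := by
    intro m
    rw [guessDist, ← henc]
    refine bind_congr_support fun ct hct' => ?_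
    obtain ⟨g, hg, hr⟩ := runs_guess shortOracle_noOracle (D := D)
      (E := (selectFlags z.length (i + 1)).reverse) (pk := pk) hC hlam hh
      (by simpa [length_selectFlags] using hz) (by simp [length_selectFlags]) hzb (hct m ct hct')
    rw [List.reverse_reverse, List.length_reverse, length_selectFlags, mixL_selectFlags] at hr
    rw [hr.final_eq, PMF.map_comp]
    refine Eq.trans ?_ (PMF.map_id _)
    congr 1
    funext a
    simp [hg, bitOf]
  rw [distAdv, swapAdv, key, key]

/-- An independent key pair planted among independent key pairs is again a list of independent
pairs, whichever position it takes. So the reduction simulates the real generation of keys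
perfectly. -/
theorem mean_keysDist (G : PMF KeyPair) {i : ℕ} (hi : i < n) (F : KeyPair → List KeyPair → ENNReal) :
    (mean G fun key => mean (keysDist G key (selectFlags n (i + 1))) (F key)) =
      mean (prodL (List.replicate n G)) fun ks => F (ks.getD i ([], [])) ks := by
  have h1 : ∀ key, keysDist G key (selectFlags n (i + 1)) =
      (prodL (List.replicate n G)).map fun z => z.set i key := by
    intro key
    rw [keysDist, selectFlags_succ, List.map_set, List.map_replicate]
    simp only [if_true, Bool.false_eq_true, if_false]
    rw [← prodL_bind_set, PMF.map]
    simp only [PMF.pure_map]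
    rfl
  have h2 : prodL (List.replicate n G) = (prodL (List.replicate n G)).bind fun z =>
      G.map fun key => z.set i key := by
    rw [prodL_bind_set, show (List.replicate n G).set i G = List.replicate n G by simp]
  conv_rhs => rw [h2]
  simp only [h1, mean_map, mean_bind]
  rw [mean_comm]
  have : ∀ z ∈ (prodL (List.replicate n G)).support, ∀ key,
      F ((z.set i key).getD i ([], [])) (z.set i key) = F key (z.set i key) := by
    intro z hz key
    have hl := length_of_mem_support_prodL hz
    rw [List.length_replicate] at hl
    simp [List.getD, hl, hi]
  exact le_antisymm (mean_mono fun z hz => by simp only [this z hz]; exact le_rfl)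
    (mean_mono fun z hz => by simp only [this z hz]; exact le_rfl)

theorem mem_of_mem_support_replicate {G : PMF KeyPair} {ks : List KeyPair}
    (hks : ks ∈ (prodL (List.replicate n G)).support) :
    ks.length = n ∧ ∀ key ∈ ks, key ∈ G.support := by
  refine ⟨by simpa using length_of_mem_support_prodL hks, fun key hk => ?_⟩
  obtain ⟨μ, hμ, hk⟩ := exists_mem_of_mem_support_prodL hks hk
  rwa [List.eq_of_mem_replicate hμ] at hk

/-- The extraction game selects coordinate `i` with probability at least `1 / (2 n)`. Given this,
its keys, model and hybrid have the joint law of the real experiment, and the planted pair is the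
pair at position `i`. -/
theorem mean_failure_le {S : BigKeyEncryption} (hkey : D.keyGen = S.keyGen) (henc : D.enc = S.enc)
    (h : D.Bounded tN tθ tq lam n ℓ k b T W) {i : ℕ} (hi : i < n) :
    (2 * n : ENNReal)⁻¹ * mean (prodL (List.replicate n (keyGenDist D.keyGen lam ℓ))) (fun ks =>
        mean (learnDist D.enc D.L lam ks) (D.failure E lam k Q ε i ks)) ≤
      pr (extractionGame S D.leak E lam ℓ Q) fun o =>
        distAdv S D.guess lam o.2.1 o.1.1 > ε ∧ o.2.2 ≠ o.1.2 := by
  refine (mul_le_mul_right (mean_keysDist _ hi (fun key ks => mean (learnDist D.enc D.L lam ks)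
    fun m => mean (featureLaw D.enc lam (ks.map Prod.fst) D.c k (classify D.C lam m) i) fun z =>
      pr (extractLaw E lam Q (leakCode (selectFlags ks.length (i + 1)).reverse m z) key.1)
        fun sk => ε < swapAdv D.enc lam key.1 (classify D.C lam m) i z ∧ sk ≠ key.2)).ge _).trans ?_
  rw [← mean_mul_left, extractionGame, pr_bind, ← hkey]
  refine mean_mono fun key hk => ?_
  have hleak : leakDist D.leak lam key = D.leakLaw lam n ℓ k key := by
    obtain ⟨ρ, hr, e⟩ := runs_leak shortOracle_noOracle h hk
    rw [leakDist, hr.final_eq, e]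
  rw [pr_bind, hleak, leakLaw, mean_bind]
  -- Of the average over the chosen coordinate only the term for `i` is kept.
  refine le_trans ?_ (apply_mul_le_mean i)
  refine mul_le_mul' (bitsDist_zero_le hi) ?_
  rw [mean_bind]
  refine mean_mono fun ks hks => ?_
  have hks' := mem_of_mem_support_keysDist hk hks
  rw [length_selectFlags] at hks'
  have hlen : (ks.map Prod.fst).length = n := by simpa using hks'.1
  have hkb := h.keysBounded hks'.1 hks'.2
  rw [mean_bind]
  refine mean_mono fun m hm => ?_
  have hmb := h.model_le ks hks'.1 hks'.2 m hm
  rw [mean_bind, featureLaw, mean_bind, hlen, hks'.1]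
  refine mean_mono fun J hJ => ?_
  rw [mean_map]
  refine mean_mono fun z hz => ?_
  have hJl : J.length = n := by
    rw [← hlen]
    simpa using length_of_mem_support_greedyDist hJ
  have hV : (cutFlags (selectFlags n (i + 1)).reverse J).reverse.length =
      (ks.map Prod.fst).length := by
    rw [List.length_reverse, length_cutFlags (by rw [List.length_reverse, length_selectFlags, hJl]),
      hJl, hlen]
  have hzl : z.length = n := ((hkb.length_hybrid_le hV hz).1).trans hlen
  rw [pr_map, extractLaw, pr_map]
  have hadv := distAdv_guess henc (D := D) (b := b) (T := T) (i := i) (h := m) (pk := key.1)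
    (z := z) (fun x hx => h.haltC m x hmb hx) h.lam_le hmb (hzl.trans_le h.n_le)
    (fun w hw => hkb.length_le_of_mem_hybrid hz hw) (h.ct_le key hk)
  rw [hzl] at hadv
  simp only [hadv]
  exact pr_mono fun s _ hs => hs

/-- The strings that the extractor is likely to produce for feature `i`. -/
def likelyKeys (D : Components) (E : Cmd) (lam k Q : ℕ) (M : ENNReal) (h : List Bool) (i : ℕ)
    (p : List (List Bool)) : Set (List Bool) :=
  {sk | M⁻¹ ≤ ((featureLaw D.enc lam p D.c k (classify D.C lam h) i).bind fun z =>
    extractLaw E lam Q (leakCode (selectFlags p.length (i + 1)).reverse h z) (p.getD i [])) sk}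

/-- For a visible feature the advantage exceeds `ε` with probability at least `2 / M`, and the
extractor fails on such samples with probability less than `1 / M`. Hence it returns the true secret
key with probability at least `1 / M`, so this key is among the likely ones. -/
theorem card_visible_le_hits {M : ENNReal} (hM : M ≠ 0) {ks : List KeyPair} {h : List Bool}
    (hf : ∀ i < ks.length, D.failure E lam k Q ε i ks h < M⁻¹) :
    (visible D.enc lam (ks.map Prod.fst) D.c k (classify D.C lam h) ε M⁻¹).card ≤
      hits (D.likelyKeys E lam k Q M h) ks := by
  classical
  unfold hits visible
  refine Finset.card_le_card fun i hi => ?_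
  rw [Finset.mem_filter, Finset.mem_range, List.length_map] at hi
  rw [Finset.mem_filter, Finset.mem_range]
  refine ⟨hi.1, ?_⟩
  have hget : (ks.map Prod.fst).getD i [] = (ks.getD i ([], [])).1 := by
    simp [List.getD, hi.1]
  have hsplit : pr (featureLaw D.enc lam (ks.map Prod.fst) D.c k (classify D.C lam h) i)
      (fun z => ε < swapAdv D.enc lam (ks.getD i ([], [])).1 (classify D.C lam h) i z) ≤
      D.failure E lam k Q ε i ks h +
        ((featureLaw D.enc lam (ks.map Prod.fst) D.c k (classify D.C lam h) i).bind fun z =>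
          extractLaw E lam Q (leakCode (selectFlags ks.length (i + 1)).reverse h z)
            (ks.getD i ([], [])).1) (ks.getD i ([], [])).2 := by
    rw [← pr_eq_apply, pr_bind, failure, ← mean_add]
    refine mean_mono fun z _ => ?_
    refine le_trans ?_ (pr_or_le _ _ _)
    split_ifs with hz
    · rw [← mean_const (extractLaw E lam Q (leakCode (selectFlags ks.length (i + 1)).reverse h z)
        (ks.getD i ([], [])).1) 1, pr]
      refine mean_mono fun sk _ => ?_
      rw [if_pos]
      by_cases hs : sk = (ks.getD i ([], [])).2
      · exact Or.inr hs
      · exact Or.inl ⟨hz, hs⟩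
    · exact zero_le
  have h2 := hi.2
  rw [hget] at h2
  have h3 := h2.trans hsplit
  rw [two_mul] at h3
  have h4 := h3.trans (add_le_add (hf i hi.1).le le_rfl)
  rw [likelyKeys, Set.mem_ofPred_eq, List.length_map, hget]
  exact (ENNReal.add_le_add_iff_left (ENNReal.inv_ne_top.2 hM)).1 h4

/-- The distribution of the keys and of the model. -/
noncomputable def learnLaw (D : Components) (lam n ℓ : ℕ) : PMF (List KeyPair × List Bool) :=
  (prodL (List.replicate n (keyGenDist D.keyGen lam ℓ))).bind fun ks =>
    (learnDist D.enc D.L lam ks).map fun h => (ks, h)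

/-- Markov's inequality at level `1 / M` for each feature, followed by a union bound over the
features. -/
theorem pr_failure_le {S : BigKeyEncryption} (hkey : D.keyGen = S.keyGen) (henc : D.enc = S.enc)
    (h : D.Bounded tN tθ tq lam n ℓ k b T W) {ε' M : ENNReal} (hM : M ≠ 0) (hM' : M ≠ ⊤)
    (hE : pr (extractionGame S D.leak E lam ℓ Q) (fun o =>
        distAdv S D.guess lam o.2.1 o.1.1 > ε ∧ o.2.2 ≠ o.1.2) ≤ ε') :
    pr (D.learnLaw lam n ℓ) (fun o => ∃ i ∈ Finset.range n,
      M⁻¹ ≤ D.failure E lam k Q ε i o.1 o.2) ≤ n * (M * (2 * n * ε')) := by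
  refine (pr_exists_le (Finset.range n) fun i (o : List KeyPair × List Bool) =>
    M⁻¹ ≤ D.failure E lam k Q ε i o.1 o.2).trans ((Finset.sum_le_card_nsmul _ _
      (M * (2 * n * ε')) fun i hi => ?_).trans (by simp))
  have hi' := Finset.mem_range.1 hi
  have hn0 : (2 * n : ENNReal) ≠ 0 := by simp; omega
  have hnt : (2 * n : ENNReal) ≠ ⊤ := by finiteness
  have h1 := (mean_failure_le (E := E) (Q := Q) (ε := ε) hkey henc h hi').trans hE
  have h2 := mul_pr_le_mean (μ := D.learnLaw lam n ℓ)
    (E := fun o => M⁻¹ ≤ D.failure E lam k Q ε i o.1 o.2)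
    (f := fun o => D.failure E lam k Q ε i o.1 o.2) M⁻¹ fun o _ ho => ho
  rw [learnLaw, mean_bind] at h2
  simp only [mean_map] at h2
  rw [ENNReal.inv_mul_le_iff hn0 hnt] at h1
  exact (ENNReal.inv_mul_le_iff hM hM').1 (h2.trans h1)

/-- For a fixed string `h` in place of the model the likely keys are determined by the public keys
alone, so `pr_le_hits` applies with `β = M * 2⁻¹ ^ ℓ`. The actual model depends on all keys; a union
bound over all strings of at most `n ℓ / 2` bits removes this dependence. -/
theorem pr_hits_le {S : BigKeyEncryption} (hkey : D.keyGen = S.keyGen) {M : ℕ} (hM : 0 < M)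
    (hℓ : (n + 1) * (S.pkBound.eval lam + lam) ≤ ℓ)
    (hL : ∀ ks ∈ (prodL (List.replicate n (keyGenDist D.keyGen lam ℓ))).support,
      ∀ h ∈ (learnDist D.enc D.L lam ks).support, 2 * h.length ≤ n * ℓ) :
    pr (D.learnLaw lam n ℓ) (fun o => n / 2 + 1 ≤ hits (D.likelyKeys E lam k Q M o.2) o.1) ≤
      8 * M * 2⁻¹ ^ lam := by
  -- A claimed bound above one is trivial. Otherwise it supplies the condition `P.card * β ≤ 1` of
  -- the moment argument.
  rcases le_or_gt (8 * M * 2⁻¹ ^ lam : ENNReal) 1 with h1 | h1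
  swap
  · exact (pr_le_one _ _).trans h1.le
  set p := S.pkBound.eval lam with hp
  set G := keyGenDist D.keyGen lam ℓ with hG
  set P := shortStrings p
  set β : ENNReal := M * 2⁻¹ ^ ℓ with hβ
  have hM0 : (M : ENNReal) ≠ 0 := by exact_mod_cast hM.ne'
  have hP : ∀ key ∈ G.support, key.1 ∈ P := fun key hk =>
    mem_shortStrings.2 (S.pk_compact lam ℓ key (by rwa [hG, hkey] at hk))
  have hcard : (P.card : ENNReal) ≤ 2 ^ (p + 1) := by exact_mod_cast card_shortStrings_le p
  have hF : ∀ h i pks, pr G (fun key => key.2 ∈ D.likelyKeys E lam k Q M h i pks) ≤ β := by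
    intro h i pks
    rw [← pr_map G Prod.snd (fun sk => sk ∈ D.likelyKeys E lam k Q M h i pks), hG, hkey,
      S.sk_uniform]
    exact pr_uniformBits_le ℓ _ (ENNReal.natCast_ne_top M) hM0
  have hle : (P.card : ENNReal) * β ≤ 2 ^ (p + 1) * β := by gcongr
  have hone : (2 : ENNReal) ^ (p + 1) * β ≤ 1 := by
    refine le_trans ?_ h1
    have hexp : p + lam ≤ ℓ := by nlinarith
    have h2 : (2 : ENNReal) ^ p * 2⁻¹ ^ p = 1 := by
      rw [← mul_pow, ENNReal.mul_inv_cancel (by simp) (by simp), one_pow]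
    calc (2 : ENNReal) ^ (p + 1) * β ≤ 2 ^ (p + 1) * (M * 2⁻¹ ^ (p + lam)) := by
          gcongr _ * (_ * ?_)
          exact pow_le_pow_right_of_le_one' (by simp) hexp
      _ = 2 * M * 2⁻¹ ^ lam * (2 ^ p * 2⁻¹ ^ p) := by rw [pow_add, pow_add]; ring
      _ ≤ 8 * M * 2⁻¹ ^ lam := by
          rw [h2, mul_one]
          gcongr
          norm_num
  have hpos : (P.card : ENNReal) * β ≠ 0 := by
    have : P.card ≠ 0 := Finset.card_ne_zero_of_mem
      ((mem_shortStrings (w := [])).2 (Nat.zero_le p))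
    simp [hβ, this, hM.ne']
  refine le_trans ?_ (two_pow_mul_le (B := n * ℓ / 2) (by omega) hℓ h1)
  rw [learnLaw, pr_bind]
  simp only [pr_map]
  have hstep : mean (prodL (List.replicate n G)) (fun ks => pr (learnDist D.enc D.L lam ks) fun h =>
      n / 2 + 1 ≤ hits (D.likelyKeys E lam k Q M h) ks) ≤
      mean (prodL (List.replicate n G)) fun ks => ∑ h ∈ shortStrings (n * ℓ / 2),
        if n / 2 + 1 ≤ hits (D.likelyKeys E lam k Q M h) ks then 1 else 0 := by
    refine mean_mono fun ks hks => mean_le_const fun h hh => ?_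
    split_ifs with hx
    · refine le_trans ?_ (Finset.single_le_sum (fun _ _ => zero_le) (mem_shortStrings.2
        (show h.length ≤ n * ℓ / 2 by have := hL ks hks h hh; omega)))
      rw [if_pos hx]
    · exact zero_le
  refine hstep.trans ?_
  rw [mean_sum]
  refine (Finset.sum_le_card_nsmul _ _ (2 ^ n * (2 ^ (p + 1) * β) ^ (n / 2 + 1))
    fun h _ => ?_).trans ?_
  · refine le_trans (le_of_eq ?_) ((pr_le_hits hP n (n / 2 + 1) (D.likelyKeys E lam k Q M h)
      (hF h) (hle.trans hone) hpos).trans (by gcongr))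
    unfold pr
    congr!
  · rw [nsmul_eq_mul]
    gcongr
    exact_mod_cast card_shortStrings_le _

theorem pr_card_visible_le {S : BigKeyEncryption} (hkey : D.keyGen = S.keyGen)
    (henc : D.enc = S.enc) (h : D.Bounded tN tθ tq lam n ℓ k b T W) {ε' : ENNReal} {M : ℕ}
    (hM : 0 < M) (hℓ : (n + 1) * (S.pkBound.eval lam + lam) ≤ ℓ)
    (hL : ∀ ks ∈ (prodL (List.replicate n (keyGenDist D.keyGen lam ℓ))).support,
      ∀ h ∈ (learnDist D.enc D.L lam ks).support, 2 * h.length ≤ n * ℓ)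
    (hE : pr (extractionGame S D.leak E lam ℓ Q) (fun o =>
        distAdv S D.guess lam o.2.1 o.1.1 > ε ∧ o.2.2 ≠ o.1.2) ≤ ε') :
    pr (D.learnLaw lam n ℓ) (fun o => n / 2 < (visible D.enc lam (o.1.map Prod.fst) D.c k
      (classify D.C lam o.2) ε (M : ENNReal)⁻¹).card) ≤
        n * (M * (2 * n * ε')) + 8 * M * 2⁻¹ ^ lam := by
  have hM0 : (M : ENNReal) ≠ 0 := by exact_mod_cast hM.ne'
  refine le_trans ?_ (add_le_add (pr_failure_le hkey henc h hM0 (ENNReal.natCast_ne_top M) hE)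
    (pr_hits_le (E := E) (k := k) (Q := Q) hkey hM hℓ hL))
  refine le_trans (pr_mono fun o ho hv => ?_) (pr_or_le _ _ _)
  by_contra hcon
  rw [not_or] at hcon
  push Not at hcon
  rw [learnLaw, PMF.mem_support_bind_iff] at ho
  obtain ⟨ks, hks, ho⟩ := ho
  rw [PMF.mem_support_map_iff] at ho
  obtain ⟨m, -, rfl⟩ := ho
  have hlen := (mem_of_mem_support_replicate hks).1
  have := card_visible_le_hits (D := D) (E := E) (lam := lam) (k := k) (Q := Q) (ε := ε) hM0
    (ks := ks) (h := m) fun i hi => hcon.1 i (Finset.mem_range.2 (hlen ▸ hi))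
  have h2 := hcon.2
  simp only at h2 hv
  omega

end Components


/-! ## The gap of the attack -/

/-- The list of the public keys. -/
def publicKeys {n : ℕ} (st : State n) : List (List Bool) := (List.ofFn st).map Prod.fst

theorem length_publicKeys {n : ℕ} (st : State n) : (publicKeys st).length = n := by
  simp [publicKeys]

theorem encodeVec_publicKeys {n : ℕ} (st : State n) :
    (encodeVec fun i => (st i).1) = encodeList (publicKeys st) := by
  rw [encodeVec, publicKeys, List.map_ofFn]
  rfl

theorem map_ofFn_samp (S : BigKeyEncryption) (lam : ℕ) {n : ℕ} (st : State n) (b : Bool) :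
    (samp S lam st b).map List.ofFn = sampL S.enc lam (publicKeys st) b := by
  rw [samp, map_ofFn_product, sampL, publicKeys, List.map_ofFn, List.map_ofFn]
  rfl

theorem map_ofFn_gen (S : BigKeyEncryption) (lam n ℓ : ℕ) :
    (gen S lam n ℓ).map List.ofFn = prodL (List.replicate n (keyGenDist S.keyGen lam ℓ)) := by
  rw [gen, map_ofFn_product, List.ofFn_const]

theorem exists_eq_ofFn {α : Type} {n : ℕ} {l : List α} (h : l.length = n) :
    ∃ v : Fin n → α, l = List.ofFn v :=
  ⟨fun i => l[i], List.ext_getElem (by simp [h]) (by simp)⟩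

theorem mixL_ofFn {α : Type} {n : ℕ} (V : Fin n → Bool) (x y : Fin n → α) :
    mixL (List.ofFn V) (List.ofFn x) (List.ofFn y) = List.ofFn fun i => if V i then x i else y i := by
  induction n with
  | zero => simp [mixL]
  | succ n ih => simp [List.ofFn_succ, mixL, ih]

theorem count_ofFn {n : ℕ} (V : Fin n → Bool) :
    (List.ofFn V).count true = (Finset.univ.filter fun i => V i = true).card := by
  rw [Finset.card_filter]
  induction n with
  | zero => simp
  | succ n ih =>
    rw [List.ofFn_succ, List.count_cons, ih, Fin.sum_univ_succ, add_comm]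
    simp

/-- Only the `⌊n/2⌋` features outside `I` can differ, each with weight `1 / n`. -/
theorem protectMetric_lt_one {n : ℕ} {I : Finset (Fin n)} {x z : Fin n → List Bool}
    (hI : I.card = (n + 1) / 2) (h : ∀ i ∈ I, x i = z i) : protectMetric I x z < 1 := by
  rcases Nat.eq_zero_or_pos n with rfl | hn
  · simp [protectMetric, weightedHamming]
  have hn' : (0 : ℝ) < n := by exact_mod_cast hn
  have h1 : protectMetric I x z ≤ ∑ i ∈ Iᶜ, 1 / (n : ℝ) := by
    rw [protectMetric, weightedHamming, ← Finset.sum_add_sum_compl I]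
    rw [Finset.sum_eq_zero (s := I) fun i hi => by simp [h i hi], zero_add]
    refine Finset.sum_le_sum fun i hi => ?_
    rw [protectWeight, if_neg (Finset.mem_compl.1 hi)]
    split_ifs <;> simp
  refine h1.trans_lt ?_
  rw [Finset.sum_const, Finset.card_compl, Fintype.card_fin, hI, nsmul_eq_mul, mul_one_div,
    div_lt_one hn']
  exact_mod_cast (by omega)

theorem allowedOutput {n : ℕ} {x : Fin n → List Bool} {V : List Bool} {y : List (List Bool)}
    {s : Store} (hV : V.length = n) (hy : y.length = n) (hc : V.count true = (n + 1) / 2)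
    (h0 : s 0 = encodeList (mixL V (List.ofFn x) y)) (h1 : s 1 = V) : AllowedOutput x s := by
  obtain ⟨v, rfl⟩ := exists_eq_ofFn hV
  obtain ⟨y, rfl⟩ := exists_eq_ofFn hy
  rw [count_ofFn] at hc
  refine ⟨fun i => if v i then x i else y i, Finset.univ.filter fun i => v i = true, ?_, ?_, hc,
    protectMetric_lt_one hc fun i hi => ?_⟩
  · rw [h0, mixL_ofFn, encodeVec]
  · rw [h1]
    congr 1
    funext i
    simp
  · simp [(Finset.mem_filter.1 hi).2]

/-- The adversary outputs a mixture of its sample with a fresh sample of the other class, according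
to the greedy choice of flags with precision parameter `k`. -/
def MixesSamples (S : BigKeyEncryption) (A : Cmd) (lam k : ℕ) {n : ℕ} (st : State n)
    (aux : List (List Bool)) (t : ℕ) : Prop :=
  ∀ c : Bool, ∀ x ∈ (samp S lam st c).support, ∀ f : List Bool → PMF Bool,
    ∃ g : List Bool → List (List Bool) → Store,
      (∀ J y, g J y 0 = encodeList (mixL J.reverse (List.ofFn x) y) ∧ g J y 1 = J.reverse) ∧
      Runs (bitOracle f) A (load (attackInput lam st c x aux)) t
        ((flagsDist S.enc lam (publicKeys st) c k f).bind fun J =>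
          (sampL S.enc lam (publicKeys st) (!c)).map (g J))

/-! ### The gap as the loss of the greedy choice. -/

section Gap

variable {S : BigKeyEncryption} {A C : Cmd} {lam k n : ℕ} {st : State n} {aux : List (List Bool)}
  {t : ℕ} {h : List Bool}

theorem MixesSamples.allowed (hA : MixesSamples S A lam k st aux t) {c : Bool}
    {x : Fin n → List Bool} (hx : x ∈ (samp S lam st c).support) (f : List Bool → PMF Bool) :
    HaltsWithin (bitOracle f) t A (attackInput lam st c x aux) ∧
      ∀ s ∈ (final (bitOracle f) A (attackInput lam st c x aux)).support, AllowedOutput x s := by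
  obtain ⟨g, hg, hr⟩ := hA c x hx f
  refine ⟨hr.haltsWithin, fun s hs => ?_⟩
  rw [hr.final_eq, PMF.mem_support_bind_iff] at hs
  obtain ⟨J, hJ, hs⟩ := hs
  rw [PMF.mem_support_map_iff] at hs
  obtain ⟨y, hy, rfl⟩ := hs
  have hJl := length_of_mem_support_greedyDist hJ
  have hJc := count_of_mem_support_greedyDist (by omega) hJ
  rw [length_publicKeys] at hJl hJc
  exact allowedOutput (by simpa using hJl)
    ((length_of_mem_support_sampL hy).trans (length_publicKeys st)) (by simpa using hJc)
    (hg J y).1 (hg J y).2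

theorem hit_eq (b : Bool) : ((samp S lam st b).bind fun x => classify C lam h (encodeVec x)) =
    (hybrid S.enc lam (publicKeys st) (!b) (List.replicate n false)).bind fun z =>
      classify C lam h (encodeList z) := by
  have h1 : ∀ (m : ℕ) (X Y : List (PMF (List Bool))), X.length = m → Y.length = m →
      mixL (List.replicate m false) X Y = Y := by
    intro m
    induction m with
    | zero => intro X Y hX hY; simp [mixL, List.eq_nil_of_length_eq_zero hY]
    | succ m ih =>
      intro X Y hX hY
      obtain ⟨x, X, rfl⟩ := List.exists_cons_of_length_eq_add_one hX
      obtain ⟨y, Y, rfl⟩ := List.exists_cons_of_length_eq_add_one hY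
      simp [List.replicate_succ, mixL, ih X Y (by simpa using hX) (by simpa using hY)]
  rw [hybrid, h1 n _ _ (by simp [length_publicKeys]) (by simp [length_publicKeys]), Bool.not_not,
    ← sampL, ← map_ofFn_samp, PMF.bind_map]
  rfl

/-- The choice of flags uses the keys and the classifier but not the given sample, so the flags may
be drawn first. For fixed flags, mixing the sample with the independent fresh one yields the hybrid
exactly. -/
theorem MixesSamples.fool_eq (hA : MixesSamples S A lam k st aux t) (b : Bool) :
    ((samp S lam st (!b)).bind fun x =>
      (final (bitOracle (classify C lam h)) A (attackInput lam st (!b) x aux)).bind fun s =>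
        classify C lam h (s 0)) =
    (flagsDist S.enc lam (publicKeys st) (!b) k (classify C lam h)).bind fun J =>
      (hybrid S.enc lam (publicKeys st) (!b) J.reverse).bind fun z =>
        classify C lam h (encodeList z) := by
  have h1 : ∀ x ∈ (samp S lam st (!b)).support,
      ((final (bitOracle (classify C lam h)) A (attackInput lam st (!b) x aux)).bind fun s =>
        classify C lam h (s 0)) =
      (flagsDist S.enc lam (publicKeys st) (!b) k (classify C lam h)).bind fun J =>
        (sampL S.enc lam (publicKeys st) (!!b)).bind fun y =>
          classify C lam h (encodeList (mixL J.reverse (List.ofFn x) y)) := by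
    intro x hx
    obtain ⟨g, hg, hr⟩ := hA (!b) x hx (classify C lam h)
    rw [hr.final_eq, PMF.bind_bind]
    refine bind_congr_support fun J _ => ?_
    rw [PMF.bind_map]
    exact bind_congr_support fun y _ => by rw [Function.comp, (hg J y).1]
  rw [bind_congr_support h1, PMF.bind_comm]
  refine bind_congr_support fun J hJ => ?_
  have hJl := length_of_mem_support_greedyDist hJ
  rw [← sampL_bind_mixL (by simpa using hJl), ← map_ofFn_samp S lam st (!b), PMF.bind_map,
    PMF.bind_bind]
  refine bind_congr_support fun x _ => ?_
  rw [Function.comp, PMF.bind_map]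
  rfl

theorem abs_prob_sub_eq (μ ν : PMF Bool) (b : Bool) :
    |prob μ (· = b) - prob ν (· = b)| = |prob μ (· = true) - prob ν (· = true)| := by
  cases b
  · rw [prob_eq_false, prob_eq_false, abs_sub_comm]
    congr 1
    ring
  · rfl

theorem MixesSamples.gap_le (hA : MixesSamples S A lam k st aux t) (b : Bool) :
    ENNReal.ofReal (gap S C A lam st h aux b) ≤
      mean (flagsDist S.enc lam (publicKeys st) (!b) k (classify C lam h)) fun J =>
        ENNReal.ofReal |hybridProb S.enc lam (publicKeys st) (!b) (classify C lam h) J -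
          hybridProb S.enc lam (publicKeys st) (!b) (classify C lam h) []| := by
  rw [gap, hitProb, foolProb, abs_prob_sub_eq, hit_eq, hA.fool_eq, abs_sub_comm,
    ← bind_const' (flagsDist S.enc lam (publicKeys st) (!b) k (classify C lam h))
      ((hybrid S.enc lam (publicKeys st) (!b) (List.replicate n false)).bind fun z =>
      classify C lam h (encodeList z))]
  refine (ofReal_abs_prob_bind_sub_le _ _ _ _).trans (mean_mono fun J hJ => ?_)
  have hJl := length_of_mem_support_greedyDist hJ
  rw [hybridProb, hybridProb, show (publicKeys st).length - J.length = 0 by simp [hJl]]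
  simp [length_publicKeys]

/-- With precision `a = 24 n k` the good decisions and the errors of the tests cost `8 n / a = 1 /
(3 k)`. With `M = 192 (n k)²` the surprises cost `n * a * 2 / M = 1 / (4 k)`. The total is `7 / (12
k)`. Without features the gap is zero. -/
theorem MixesSamples.gap_lt (hA : MixesSamples S A lam k st aux t) (hk : 0 < k) {b : Bool} {ε : ℝ}
    (hεa : 0 < n → ε ≤ 1 / precision (n * k))
    (hK : (visible S.enc lam (publicKeys st) (!b) k (classify C lam h) ε
      ((192 * (n * k) ^ 2 : ℕ) : ENNReal)⁻¹).card ≤ n / 2) :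
    gap S C A lam st h aux b < 1 / k := by
  have hk' : (0 : ℝ) < k := by exact_mod_cast hk
  have hpos : (0 : ℝ) < 1 / k := by positivity
  refine (ENNReal.ofReal_lt_ofReal_iff hpos).1 ((hA.gap_le b).trans_lt ?_)
  rcases Nat.eq_zero_or_pos n with hn | hn
  · refine (mean_le_const (c := 0) fun J hJ => ?_).trans_lt (ENNReal.ofReal_pos.2 hpos)
    have hJl := length_of_mem_support_greedyDist hJ
    obtain rfl : J = [] := List.eq_nil_of_length_eq_zero (by simpa [length_publicKeys, hn] using hJl)
    simp
  have hn' : (0 : ℝ) < n := by exact_mod_cast hn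
  have h1 := mean_loss_le (l := publicKeys st) (k := k) (enc := S.enc) (lam := lam) (c := !b)
    (f := classify C lam h) (ε := ε) (by rw [length_publicKeys]; positivity)
    (by rw [length_publicKeys]; exact hK) (by rw [length_publicKeys]; exact hεa hn)
  refine h1.trans_lt ?_
  rw [length_publicKeys]
  set M : ℕ := 192 * (n * k) ^ 2 with hM
  have hM0 : (0 : ℝ) < M := by rw [hM]; push_cast; positivity
  rw [show ((M : ENNReal)⁻¹) = ENNReal.ofReal ((M : ℝ)⁻¹) by
    rw [ENNReal.ofReal_inv_of_pos hM0, ENNReal.ofReal_natCast], ← ENNReal.ofReal_natCast n,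
    ← ENNReal.ofReal_natCast (precision (n * k)), show (2 : ENNReal) = ENNReal.ofReal 2 by simp,
    ← ENNReal.ofReal_mul (by positivity), ← ENNReal.ofReal_mul (by positivity),
    ← ENNReal.ofReal_mul (by positivity), ← ENNReal.ofReal_mul (by positivity),
    ← ENNReal.ofReal_add (by positivity) (by positivity), ENNReal.ofReal_lt_ofReal_iff hpos, hM]
  unfold precision
  push_cast
  have e : (n : ℝ) * (8 / (24 * ((n : ℝ) * k))) +
      n * (24 * ((n : ℝ) * k) * (2 * (192 * ((n : ℝ) * k) ^ 2)⁻¹)) =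
      7 / 12 * (1 / k) := by
    field_simp
    norm_num
  rw [e]
  linarith

end Gap


/-! ## The reduction runs in polynomial time -/

theorem mem_support_prodL_replicate {α : Type} {μ : PMF α} {l : List α}
    (h : ∀ a ∈ l, a ∈ μ.support) : l ∈ (prodL (List.replicate l.length μ)).support := by
  induction l with
  | nil => simp [prodL]
  | cons a l ih =>
    simp only [List.length_cons, List.replicate_succ, prodL, PMF.mem_support_bind_iff,
      PMF.mem_support_map_iff]
    exact ⟨a, h a (by simp), l, ih fun a ha => h a (by simp [ha]), rfl⟩

theorem exists_state {S : BigKeyEncryption} {lam n ℓ : ℕ} {ks : List KeyPair} (hks : ks.length = n)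
    (h : ∀ key ∈ ks, key ∈ (keyGenDist S.keyGen lam ℓ).support) :
    ∃ st ∈ (gen S lam n ℓ).support, List.ofFn st = ks := by
  have := mem_support_prodL_replicate h
  rw [hks, ← map_ofFn_gen, PMF.mem_support_map_iff] at this
  exact this

theorem mem_support_of_mem_gen {S : BigKeyEncryption} {lam n ℓ : ℕ} {st : State n}
    (hst : st ∈ (gen S lam n ℓ).support) (i : Fin n) :
    st i ∈ (keyGenDist S.keyGen lam ℓ).support := by
  have h : List.ofFn st ∈ (prodL (List.replicate n (keyGenDist S.keyGen lam ℓ))).support := by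
    rw [← map_ofFn_gen, PMF.mem_support_map_iff]
    exact ⟨st, hst, rfl⟩
  exact (Components.mem_of_mem_support_replicate h).2 _ (List.mem_ofFn.2 ⟨i, rfl⟩)

theorem sampOracle_eq (S : BigKeyEncryption) (lam : ℕ) {n : ℕ} (st : State n) :
    sampOracle S lam st = sampleOracle S.enc lam (publicKeys st) := by
  funext w
  rw [sampOracle, sampleOracle, ← map_ofFn_samp, PMF.map_comp]
  rfl

theorem learn_eq (S : BigKeyEncryption) (L : Cmd) (lam : ℕ) {n : ℕ} (st : State n) :
    learn S L lam st = learnDist S.enc L lam (List.ofFn st) := by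
  rw [learn, learnDist, sampOracle_eq]
  rfl

theorem haltsWithin_mono {O : Oracle} {T T' : ℕ} {P : Cmd} {xs : List (List Bool)}
    (h : HaltsWithin O T P xs) (hT : T ≤ T') : HaltsWithin O T' P xs :=
  (Runs.of_haltsWithin h).mono hT |>.haltsWithin

/-- An output is at most as long as the input plus the running time, so a function that is
computable in this way is polynomially bounded. -/
theorem UnaryPolyTime.le {f : ℕ → ℕ} {P : Cmd} {p : Polynomial ℕ} (h : ∀ k,
    HaltsWithin noOracle (p.eval k) P [unary k] ∧
      ∀ s ∈ (final noOracle P [unary k]).support, s 0 = unary (f k)) (k : ℕ) :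
    f k ≤ k + p.eval k := by
  obtain ⟨s, hs⟩ := (final noOracle P [unary k]).support_nonempty
  have := length_le_of_mem_support_final (h k).1 hs 0
  rw [(h k).2 s hs] at this
  simpa [load, unary] using this

/-- A probabilistic polynomial-time computation of the parameters of the attack. -/
structure ParamPrograms (n : ℕ → ℕ) where
  (Pn PN Pθ : Cmd)
  (tN tθ : ℕ → ℕ)
  pn : Polynomial ℕ
  computes : ∀ lam, HaltsWithin noOracle (pn.eval lam) Pn [unary lam] ∧
    ∀ s ∈ (final noOracle Pn [unary lam]).support, s 0 = unary (n lam)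
  evalN : Evaluates PN rounds 32 26 tN
  evalθ : Evaluates Pθ threshold 32 27 tθ
  polyN : PolyBounded tN
  polyθ : PolyBounded tθ

theorem UnaryPolyTime.exists_paramPrograms {n : ℕ → ℕ} (h : UnaryPolyTime n) :
    Nonempty (ParamPrograms n) := by
  obtain ⟨Pn, pn, hPn⟩ := h
  obtain ⟨PN, tN, polyN, evalN⟩ := exists_eval_program
    (Polynomial.C (4 * 24 ^ 3) * Polynomial.X ^ 3) (x := 32) (o := 26) (by decide) (by decide)
    (by decide) (by decide) (by decide)
  obtain ⟨Pθ, tθ, polyθ, evalθ⟩ := exists_eval_program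
    (Polynomial.C (8 * 24 ^ 2) * Polynomial.X ^ 2) (x := 32) (o := 27) (by decide) (by decide)
    (by decide) (by decide) (by decide)
  refine ⟨⟨Pn, PN, Pθ, tN, tθ, pn, hPn, fun O s k h1 h2 h3 h4 => ?_, fun O s k h1 h2 h3 h4 => ?_,
    polyN, polyθ⟩⟩
  · have := evalN O s k h1 h2 h3 h4
    rwa [show (Polynomial.C (4 * 24 ^ 3) * Polynomial.X ^ 3 : Polynomial ℕ).eval k = rounds k by
      simp only [rounds, precision, Polynomial.eval_mul, Polynomial.eval_C, Polynomial.eval_pow,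
        Polynomial.eval_X]; ring] at this
  · have := evalθ O s k h1 h2 h3 h4
    rwa [show (Polynomial.C (8 * 24 ^ 2) * Polynomial.X ^ 2 : Polynomial ℕ).eval k = threshold k by
      simp only [threshold, precision, Polynomial.eval_mul, Polynomial.eval_C,
        Polynomial.eval_pow, Polynomial.eval_X]; ring] at this

namespace ParamPrograms

variable {n : ℕ → ℕ}

theorem polyBounded (Z : ParamPrograms n) : PolyBounded n :=
  (PolyBounded.add PolyBounded.id (PolyBounded.eval Z.pn)).mono (UnaryPolyTime.le Z.computes)

/-- A bound for the evaluation of the parameters. -/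
def width (Z : ParamPrograms n) (m : ℕ) : ℕ := Z.tN m + Z.tθ m + rounds m + threshold m

theorem polyBounded_width (Z : ParamPrograms n) : PolyBounded Z.width := by
  have h1 := Z.polyN
  have h2 := Z.polyθ
  unfold width rounds threshold precision
  fun_prop

theorem paramBound (Z : ParamPrograms n) {m W : ℕ} (hW : Z.width m ≤ W) :
    ParamBound Z.PN Z.Pθ Z.tN Z.tθ m W := by
  simp only [width] at hW
  exact ⟨Z.evalN, Z.evalθ, by omega, by omega, by omega, by omega⟩

end ParamPrograms

namespace Components

theorem exists_bounded (S : BigKeyEncryption) {n ℓ : ℕ → ℕ} (Z : ParamPrograms n)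
    (hℓ : UnaryPolyTime ℓ) {L C : Cmd} (hL : IsLearner S n ℓ L) (hC : IsClassifier C)
    (hB : ModelSizeAtMost S n ℓ L (fun lam => (n lam : ℝ) / 2 * (ℓ lam : ℝ))) (q : Polynomial ℕ)
    (c : Bool) : ∃ (D : Components) (tq b T W : ℕ → ℕ), D.keyGen = S.keyGen ∧ D.enc = S.enc ∧
      D.L = L ∧ D.C = C ∧ D.c = c ∧ PolyBounded b ∧ PolyBounded T ∧ PolyBounded W ∧
      ∀ lam, D.Bounded Z.tN Z.tθ tq lam (n lam) (ℓ lam) (q.eval lam) (b lam) (T lam) (W lam) := by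
  obtain ⟨Pℓ, pℓ, hPℓ⟩ := hℓ
  obtain ⟨Pq, tq, polyq, evalq⟩ := exists_eval_program q (x := 0) (o := 4) (by decide) (by decide)
    (by decide) (by decide) (by decide)
  obtain ⟨pk, hpk⟩ := S.keyGen_time
  obtain ⟨pe, hpe⟩ := S.enc_time
  obtain ⟨pc, hpc⟩ := S.ct_compact
  obtain ⟨pL, hpL⟩ := hL
  obtain ⟨pC, hpC⟩ := hC
  have polyn := Z.polyBounded
  have polyℓ : PolyBounded ℓ :=
    (PolyBounded.add PolyBounded.id (PolyBounded.eval pℓ)).mono (UnaryPolyTime.le hPℓ)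
  have e := PolyBounded.eval
  -- A single bound for the scheme, the learner and the parameters spares separate bookkeeping. The
  -- last summand covers the length of the models.
  let b : ℕ → ℕ := fun lam => 1 + lam + n lam + ℓ lam + Z.pn.eval lam + pℓ.eval lam +
    pk.eval (lam + ℓ lam) + pe.eval lam + pc.eval lam + pL.eval lam + S.pkBound.eval lam +
    n lam * ℓ lam
  let T : ℕ → ℕ := fun lam => pC.eval (lam + b lam + b lam * (2 * b lam + 1))
  let W : ℕ → ℕ := fun lam => Z.width (n lam * q.eval lam) + tq lam
  have polyb : PolyBounded b := by
    have h1 := e Z.pn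
    have h2 := e pℓ
    have h3 : PolyBounded fun lam => pk.eval (lam + ℓ lam) :=
      (e pk).comp (g := fun lam => lam + ℓ lam) (by fun_prop)
    have h4 := e pe
    have h5 := e pc
    have h6 := e pL
    have h7 := e S.pkBound
    fun_prop
  have polyT : PolyBounded T := (e pC).comp (by fun_prop)
  have polyW : PolyBounded W := by
    have h1 := e q
    exact (Z.polyBounded_width.comp (by fun_prop)).add polyq
  refine ⟨⟨S.keyGen, S.enc, Z.Pn, Pℓ, Z.PN, Z.Pθ, Pq, L, C, c⟩, tq, b, T, W, rfl, rfl, rfl, rfl, rfl,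
    polyb, polyT, polyW, fun lam => ?_⟩
  have hlearn : ∀ ks : List KeyPair, ks.length = n lam →
      (∀ key ∈ ks, key ∈ (keyGenDist S.keyGen lam (ℓ lam)).support) →
      HaltsWithin (sampleOracle S.enc lam (ks.map Prod.fst)) (pL.eval lam) L
        [unary lam, keysCode ks] ∧
      ∀ h ∈ (learnDist S.enc L lam ks).support, 2 * h.length ≤ n lam * ℓ lam := by
    intro ks hks hkey
    obtain ⟨st, hst, rfl⟩ := exists_state hks hkey
    refine ⟨?_, fun h hh => ?_⟩
    · have := hpL lam st hst
      rwa [sampOracle_eq] at this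
    · rw [← learn_eq] at hh
      have := hB lam st hst h hh
      have h2 : (2 * h.length : ℝ) ≤ n lam * ℓ lam := by linarith
      exact_mod_cast h2
  exact
    { one_le := by simp only [b]; omega
      lam_le := by simp only [b]; omega
      n_le := by simp only [b]; omega
      ℓ_le := by simp only [b]; omega
      haltn := haltsWithin_mono (Z.computes lam).1 (by simp only [b]; omega)
      finaln := (Z.computes lam).2
      haltℓ := haltsWithin_mono (hPℓ lam).1 (by simp only [b]; omega)
      finalℓ := (hPℓ lam).2
      haltKey := haltsWithin_mono (hpk lam (ℓ lam)) (by simp only [b]; omega)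
      key_le := fun key hkey => by
        refine ⟨(S.pk_compact lam (ℓ lam) key hkey).trans (by simp only [b]; omega), ?_⟩
        have h1 : key.2 ∈ (uniformBits (ℓ lam)).support := by
          rw [← S.sk_uniform lam (ℓ lam), PMF.mem_support_map_iff]
          exact ⟨key, hkey, rfl⟩
        rw [uniformBits, PMF.mem_support_map_iff] at h1
        obtain ⟨f, -, hf⟩ := h1
        rw [← hf, List.length_ofFn]
        simp only [b]
        omega
      haltEnc := fun key hkey m => haltsWithin_mono (hpe lam (ℓ lam) key hkey m)
        (by simp only [b]; omega)
      ct_le := fun key hkey m ct hct => (hpc lam (ℓ lam) key hkey m ct hct).trans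
        (by simp only [b]; omega)
      haltL := fun ks hks hkey => haltsWithin_mono (hlearn ks hks hkey).1 (by simp only [b]; omega)
      model_le := fun ks hks hkey h hh => by
        have := (hlearn ks hks hkey).2 h hh
        simp only [b]
        omega
      haltC := fun h x hh hx => haltsWithin_mono (hpC lam h x)
        (monotone_eval pC (by omega))
      param := Z.paramBound (Nat.le_add_right _ _)
      evalq := fun O s h0 h4 h6 h10 => evalq O s lam h0 h4 h6 h10
      timeq := Nat.le_add_left _ _ }

variable {D : Components} {tN tθ tq : ℕ → ℕ} {lam n ℓ k b T W : ℕ}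

/-- The second half has to be fast only on states that the first half can leak, so the bounds on
model, flags and hybrid are read off from the support of `leakLaw`. -/
theorem haltsWithin_guess (h : D.Bounded tN tθ tq lam n ℓ k b T W) {key : List Bool × List Bool}
    (hkey : key ∈ (keyGenDist D.keyGen lam ℓ).support) {st : List Bool}
    (hst : st ∈ (leakDist D.leak lam key).support) {m : Bool} {ct : List Bool}
    (hct : ct ∈ (encDist D.enc lam key.1 m).support) :
    HaltsWithin noOracle (D.guessTime b T) D.guess [unary lam, st, key.1, ct] := by
  have hleak : leakDist D.leak lam key = D.leakLaw lam n ℓ k key := by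
    obtain ⟨ρ, hr, e⟩ := runs_leak shortOracle_noOracle h hkey
    rw [leakDist, hr.final_eq, e]
  simp only [hleak, leakLaw, PMF.mem_support_bind_iff, PMF.mem_support_map_iff] at hst
  obtain ⟨i, -, ks, hks, w, hw, J, hJ, z, hz, rfl⟩ := hst
  have hks' := mem_of_mem_support_keysDist hkey hks
  rw [length_selectFlags] at hks'
  have hlen : (ks.map Prod.fst).length = n := by simpa using hks'.1
  have hkb := h.keysBounded hks'.1 hks'.2
  have hmb := h.model_le ks hks'.1 hks'.2 w hw
  have hJl : J.length = n := by
    rw [← hlen]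
    simpa using length_of_mem_support_greedyDist hJ
  have hE : (selectFlags n (i + 1)).reverse.length = n := by
    rw [List.length_reverse, length_selectFlags]
  have hV : (cutFlags (selectFlags n (i + 1)).reverse J).reverse.length =
      (ks.map Prod.fst).length := by
    rw [List.length_reverse, length_cutFlags (by rw [hE, hJl]), hJl, hlen]
  obtain ⟨g, -, hr⟩ := runs_guess shortOracle_noOracle (D := D) (pk := key.1) (ct := ct)
    (E := (selectFlags n (i + 1)).reverse) (z := z) (fun x hx => h.haltC w x hmb hx) h.lam_le hmb
    (hE.trans_le h.n_le) (((hkb.length_hybrid_le hV hz).1.trans hlen).trans hE.symm)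
    (fun v hv => hkb.length_le_of_mem_hybrid hz hv) (h.ct_le key hkey m ct hct)
  exact hr.haltsWithin

theorem learnLaw_eq {S : BigKeyEncryption} (hkey : D.keyGen = S.keyGen) (henc : D.enc = S.enc) :
    D.learnLaw lam n ℓ = (genLearn S D.L lam n ℓ).map fun o => (List.ofFn o.1, o.2) := by
  rw [learnLaw, hkey, ← map_ofFn_gen, genLearn, PMF.bind_map, PMF.map_bind, henc]
  refine bind_congr_support fun st _ => ?_
  rw [Function.comp, PMF.map_comp, learn_eq]
  rfl

theorem length_model_le {S : BigKeyEncryption} {n ℓ : ℕ → ℕ} (hkey : D.keyGen = S.keyGen)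
    (henc : D.enc = S.enc)
    (hB : ModelSizeAtMost S n ℓ D.L (fun lam => (n lam : ℝ) / 2 * (ℓ lam : ℝ))) (lam : ℕ) :
    ∀ ks ∈ (prodL (List.replicate (n lam) (keyGenDist D.keyGen lam (ℓ lam)))).support,
      ∀ h ∈ (learnDist D.enc D.L lam ks).support, 2 * h.length ≤ n lam * ℓ lam := by
  intro ks hks h hh
  rw [hkey, ← map_ofFn_gen, PMF.mem_support_map_iff] at hks
  obtain ⟨st, hst, rfl⟩ := hks
  rw [henc, ← learn_eq] at hh
  have := hB lam st hst h hh
  have h2 : (2 * h.length : ℝ) ≤ n lam * ℓ lam := by linarith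
  exact_mod_cast h2

end Components

/-- The attack has a small gap except with small probability. -/
theorem eventually_pr_gap_le {S : BigKeyEncryption} {n ℓ : ℕ → ℕ} (hn : UnaryPolyTime n)
    (hℓ : UnaryPolyTime ℓ)
    (hlarge : ∀ᶠ lam in atTop, (n lam + 1) * (S.pkBound.eval lam + lam) ≤ ℓ lam)
    (hS : KeyKnowledgeSecure S ℓ) {L C : Cmd} (hL : IsLearner S n ℓ L) (hC : IsClassifier C)
    (hB : ModelSizeAtMost S n ℓ L (fun lam => (n lam : ℝ) / 2 * (ℓ lam : ℝ))) {q Q : Polynomial ℕ}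
    (hq : ∀ lam, 0 < q.eval lam) (hQ : ∀ lam, 24 * (n lam * q.eval lam) < Q.eval lam) {A : Cmd}
    {aux : ℕ → List (List Bool)} (hA : ∀ lam, ∀ st ∈ (gen S lam (n lam) (ℓ lam)).support,
      ∃ t, MixesSamples S A lam (q.eval lam) st (aux lam) t) (b : Bool) :
    ∀ᶠ lam in atTop, pr (genLearn S L lam (n lam) (ℓ lam)) (fun o =>
        ¬ gap S C A lam o.1 o.2 (aux lam) b < 1 / ((q.eval lam : ℕ) : ℝ)) ≤
      n lam * ((192 * (n lam * q.eval lam) ^ 2 : ℕ) * (2 * n lam *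
        ENNReal.ofReal (1 / (Q.eval lam : ℕ)))) +
          8 * (192 * (n lam * q.eval lam) ^ 2 : ℕ) * 2⁻¹ ^ lam := by
  obtain ⟨Z⟩ := hn.exists_paramPrograms
  obtain ⟨D, tq, β, T, W, hkey, henc, rfl, rfl, hc, polyb, polyT, polyW, hD⟩ :=
    Components.exists_bounded S Z hℓ hL hC hB q (!b)
  have hleak : ∃ p : Polynomial ℕ, ∀ lam, ∀ key ∈ (keyGenDist S.keyGen lam (ℓ lam)).support,
      HaltsWithin noOracle (p.eval lam) D.leak [unary lam, key.1, key.2] := by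
    obtain ⟨p, hp⟩ := Components.PolyBounded.leakTime D polyb (PolyBounded.eval q) polyT polyW
    refine ⟨p, fun lam key hk => ?_⟩
    obtain ⟨ρ, hr, -⟩ := Components.runs_leak shortOracle_noOracle (hD lam) (by rwa [hkey])
    exact (hr.mono (hp lam)).haltsWithin
  obtain ⟨pg, hpg⟩ := Components.PolyBounded.guessTime D polyb polyT
  obtain ⟨E, -, hE⟩ := hS D.leak D.guess hleak ⟨pg, fun lam key hk st hst m ct hct =>
    haltsWithin_mono (Components.haltsWithin_guess (hD lam) (by rwa [hkey]) hst
      (by rwa [henc])) (hpg lam)⟩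
  filter_upwards [hlarge, hE Q fun lam => (Nat.zero_le _).trans_lt (hQ lam)] with lam h1 h2
  have hQ' := hQ lam
  have hQr : (0 : ℝ) < (Q.eval lam : ℕ) := by exact_mod_cast (Nat.zero_le _).trans_lt hQ'
  -- The case `n = 0` is separate because the mass parameter `M` would vanish there.
  rcases Nat.eq_zero_or_pos (n lam) with hn0 | hn0
  · refine le_trans (le_of_eq ?_) zero_le
    refine le_antisymm (mean_le_const fun o ho => ?_) zero_le
    rw [genLearn, PMF.mem_support_bind_iff] at ho
    obtain ⟨st, hst, ho⟩ := ho
    rw [PMF.mem_support_map_iff] at ho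
    obtain ⟨h, -, rfl⟩ := ho
    obtain ⟨t, ht⟩ := hA lam st hst
    have hlt := ht.gap_lt (C := D.C) (h := h) (b := b) (ε := 0) (hq lam)
      (fun hpos => absurd hn0 hpos.ne') (by
        refine (Finset.card_le_card (Finset.filter_subset _ _)).trans ?_
        simp [length_publicKeys, hn0])
    rw [if_neg (not_not.2 hlt)]
  have hM : 0 < 192 * (n lam * q.eval lam) ^ 2 := by
    have := hq lam
    positivity
  have h3 : pr (extractionGame S D.leak E lam (ℓ lam) (Q.eval lam)) (fun o =>
      distAdv S D.guess lam o.2.1 o.1.1 > 1 / ((Q.eval lam : ℕ) : ℝ) ∧ o.2.2 ≠ o.1.2) ≤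
      ENNReal.ofReal (1 / (Q.eval lam : ℕ)) := by
    rw [← ofReal_prob]
    exact ENNReal.ofReal_le_ofReal h2.le
  have h4 := Components.pr_card_visible_le hkey henc (hD lam) hM h1
    (Components.length_model_le hkey henc hB lam) h3
  rw [Components.learnLaw_eq hkey henc, pr_map] at h4
  refine le_trans (pr_mono fun o ho hgap => ?_) h4
  rw [genLearn, PMF.mem_support_bind_iff] at ho
  obtain ⟨st, hst, ho⟩ := ho
  rw [PMF.mem_support_map_iff] at ho
  obtain ⟨h, -, rfl⟩ := ho
  obtain ⟨t, ht⟩ := hA lam st hst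
  by_contra hcon
  refine hgap (ht.gap_lt (hq lam) (ε := 1 / (Q.eval lam : ℕ)) (fun _ => ?_) ?_)
  · have hpos : 0 < 24 * (n lam * q.eval lam) := by
      have := hq lam
      positivity
    unfold precision
    exact one_div_le_one_div_of_le (by exact_mod_cast hpos) (by exact_mod_cast hQ'.le)
  · rw [not_lt, hc, henc] at hcon
    exact hcon


/-! ## The attack runs in polynomial time -/

theorem chooseTime_mono (enc Pn : Cmd) {b k k' t W : ℕ} (h : k ≤ k') :
    chooseTime enc Pn b k t W ≤ chooseTime enc Pn b k' t W := by
  unfold chooseTime setupTime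
  gcongr

theorem load_attackInput {n : ℕ} (lam : ℕ) (st : State n) (c : Bool) (x : Fin n → List Bool)
    (k : ℕ) : load (attackInput lam st c x [unary k]) =
      update (load (attackInput lam st c x [])) 4 (unary k) := by
  funext i
  rcases Nat.lt_or_ge i 5 with hi | hi
  · interval_cases i <;> simp [load, attackInput]
  · obtain ⟨j, rfl⟩ := Nat.exists_eq_add_of_le' hi
    rw [Function.update_of_ne (by omega)]
    simp [load, attackInput]

theorem fresh_load_attackInput {n : ℕ} (lam : ℕ) (st : State n) (c : Bool) (x : Fin n → List Bool)
    (k : ℕ) : Fresh lam (publicKeys st) c k (fun _ => True)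
      (load (attackInput lam st c x [unary k])) := by
  have hnil : ∀ i, 5 ≤ i → load (attackInput lam st c x [unary k]) i = [] := by
    intro i hi
    obtain ⟨j, rfl⟩ := Nat.exists_eq_add_of_le' hi
    simp [load, attackInput]
  have hreg : ∀ j r, load (attackInput lam st c x [unary k]) (region j r) = [] := fun j r =>
    hnil _ (by simp only [region]; omega)
  exact
    { frame := trivial
      idle := ⟨fun r h1 _ => hnil r (by omega), hreg 1⟩
      h0 := by simp [load, attackInput]
      h1 := by simp [load, attackInput]
      h2 := by simp [load, attackInput, encodeVec_publicKeys]
      h4 := by simp [load, attackInput]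
      h6 := hnil 6 (by decide)
      work := fun r h1 _ => hnil r (by omega)
      region := hreg 2 }

/-- All bounds are evaluated at the common argument `lam + k`, which is harmless because polynomials
over `ℕ` are monotone; this gives one polynomial for both parameters. -/
theorem ParamPrograms.mixesSamples (S : BigKeyEncryption) {n : ℕ → ℕ} (ℓ : ℕ → ℕ)
    (Z : ParamPrograms n) : ∃ p : Polynomial ℕ, ∀ lam k,
      ∀ st ∈ (gen S lam (n lam) (ℓ lam)).support,
        MixesSamples S (attack S.enc Z.Pn Z.PN Z.Pθ) lam k st [unary k] (p.eval (lam + k)) := by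
  obtain ⟨pe, hpe⟩ := S.enc_time
  obtain ⟨pc, hpc⟩ := S.ct_compact
  obtain ⟨B, hB⟩ : PolyBounded fun lam => 1 + lam + n lam + Z.pn.eval lam + pe.eval lam +
      pc.eval lam + S.pkBound.eval lam := by
    have h0 := Z.polyBounded
    have h1 := PolyBounded.eval Z.pn
    have h2 := PolyBounded.eval pe
    have h3 := PolyBounded.eval pc
    have h4 := PolyBounded.eval S.pkBound
    fun_prop
  obtain ⟨w, hw⟩ := Z.polyBounded_width
  obtain ⟨p, hp⟩ : PolyBounded fun x => chooseTime S.enc Z.Pn (B.eval x) x 3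
      (w.eval (B.eval x * x)) + assembleTime S.enc (B.eval x) := by
    have h1 := PolyBounded.eval B
    have h2 : PolyBounded fun x => w.eval (B.eval x * x) :=
      (PolyBounded.eval w).comp (by fun_prop)
    unfold assembleTime
    fun_prop
  refine ⟨p, fun lam k st hst c x hx f => ?_⟩
  have hb := hB lam
  beta_reduce at hb
  have hmono : B.eval lam ≤ B.eval (lam + k) := monotone_eval B (Nat.le_add_right _ _)
  have hkeys : KeysBounded S.enc lam (B.eval (lam + k)) (publicKeys st) := by
    have hmem : ∀ p ∈ publicKeys st, ∃ key ∈ (keyGenDist S.keyGen lam (ℓ lam)).support,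
        key.1 = p := by
      intro p hp
      obtain ⟨key, hkey, rfl⟩ := List.mem_map.1 hp
      obtain ⟨i, rfl⟩ := List.mem_ofFn.1 hkey
      exact ⟨_, mem_support_of_mem_gen hst i, rfl⟩
    refine ⟨by omega, by omega, by rw [length_publicKeys]; omega, fun p hp m => ?_, fun p hp => ?_,
      fun p hp m ct hct => ?_⟩ <;> obtain ⟨key, hkey, rfl⟩ := hmem p hp
    · exact haltsWithin_mono (hpe lam _ key hkey m) (by omega)
    · exact (S.pk_compact lam _ key hkey).trans (by omega)
    · exact (hpc lam _ key hkey m ct hct).trans (by omega)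
  have hxs : List.ofFn x ∈ (sampL S.enc lam (publicKeys st) c).support := by
    rw [← map_ofFn_samp, PMF.mem_support_map_iff]
    exact ⟨x, hx, rfl⟩
  have hW : Z.width (n lam * k) ≤ w.eval (B.eval (lam + k) * (lam + k)) :=
    (hw _).trans (monotone_eval w (Nat.mul_le_mul (by omega) (by omega)))
  obtain ⟨g, hg, hr⟩ := runs_attack (Pn := Z.Pn) (PN := Z.PN) (Pθ := Z.Pθ) (f := f)
    (x := List.ofFn x) hkeys
    (haltsWithin_mono (Z.computes lam).1 (by omega)) (by rw [length_publicKeys]; exact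
      (Z.computes lam).2) (by rw [length_publicKeys]; exact Z.paramBound hW)
    (fresh_load_attackInput lam st c x k) (length_of_mem_support_sampL hxs)
    (hkeys.length_sampL_le hxs).1 (by simp [load, attackInput, encodeVec])
  exact ⟨g, hg, hr.mono (((Nat.add_le_add_right (chooseTime_mono _ _ (Nat.le_add_left k lam)) _)).trans
    (hp _))⟩

theorem MixesSamples.attackWithin {S : BigKeyEncryption} {A : Cmd} {lam k n ℓ t : ℕ}
    {aux : List (List Bool)}
    (h : ∀ st ∈ (gen S lam n ℓ).support, MixesSamples S A lam k st aux t) :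
    AttackWithin S A lam n ℓ aux t :=
  fun st hst _ _ hx f => (h st hst).allowed hx f

/-- Weak robustness grants the adversary no further input. A prefix computes the accuracy parameter
from `1^lam` and leaves the store exactly as if it had been supplied. -/
theorem MixesSamples.prepend {S : BigKeyEncryption} {A Pq : Cmd} {lam k n t t' : ℕ} {st : State n}
    (h : MixesSamples S A lam k st [unary k] t)
    (hq : ∀ (O : Oracle) (s : Store), s 0 = unary lam → s 4 = [] → s 6 = [] → s 10 = [] →
      Runs O Pq s t' (PMF.pure (update s 4 (unary k)))) :
    MixesSamples S (Pq ;; A) lam k st [] (t' + t) := by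
  intro c x hx f
  obtain ⟨g, hg, hr⟩ := h c x hx f
  rw [load_attackInput] at hr
  exact ⟨g, hg, Runs.seqp (hq _ _ (by simp [load, attackInput]) (by simp [load, attackInput])
    (by simp [load, attackInput]) (by simp [load, attackInput])) hr le_rfl⟩

/-! ## Negligible functions -/

/-- To beat `lam ^ m` the hypothesis is used with `m + 1`, since `lam ^ m / (lam + 1) ^ (m + 1) ≤ 1
/ (lam + 1)`. The other term is a polynomial times an exponential. -/
theorem negligible_of_le {f : ℕ → ℝ} (hf : ∀ lam, 0 ≤ f lam) (P : Polynomial ℕ)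
    (h : ∀ m : ℕ, ∀ᶠ lam : ℕ in atTop,
      f lam ≤ 1 / ((lam : ℝ) + 1) ^ m + (P.eval lam : ℕ) * (1 / 2) ^ lam) : Negligible f := by
  have h2 : Asymptotics.SuperpolynomialDecay atTop (fun lam : ℕ => (lam : ℝ))
      fun lam : ℕ => ((1 : ℝ) / 2) ^ lam := fun m =>
    tendsto_pow_const_mul_const_pow_of_abs_lt_one m (by rw [abs_of_pos] <;> norm_num)
  have h3 := h2.polynomial_mul (P.map (Nat.castRingHom ℝ))
  intro m
  have hm := h3 m
  have h1 : Tendsto (fun lam : ℕ => 1 / ((lam : ℝ) + 1)) atTop (nhds 0) :=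
    tendsto_one_div_add_atTop_nhds_zero_nat
  have hsum := h1.add hm
  rw [add_zero] at hsum
  refine tendsto_of_tendsto_of_tendsto_of_le_of_le' tendsto_const_nhds hsum
    (Eventually.of_forall fun lam => mul_nonneg (by positivity) (hf lam)) ?_
  filter_upwards [h (m + 1)] with lam hlam
  have hl : (0 : ℝ) ≤ (lam : ℝ) ^ m := by positivity
  refine (mul_le_mul_of_nonneg_left hlam hl).trans ?_
  rw [mul_add]
  refine add_le_add ?_ (le_of_eq ?_)
  · rw [mul_one_div, pow_succ, div_le_div_iff₀ (by positivity) (by positivity), one_mul]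
    gcongr
    linarith
  · simp [Polynomial.eval_natCast_map]

/-- Neither the attack nor the probability in question involves `Q`. For each exponent `m` the
polynomial `Q` is chosen anew, with a new extractor, so large that the extraction error drops below
`(lam + 1) ^ (-m)`. -/
theorem negligible_gap {S : BigKeyEncryption} {n ℓ : ℕ → ℕ} (hn : UnaryPolyTime n)
    (hℓ : UnaryPolyTime ℓ)
    (hlarge : ∀ᶠ lam in atTop, (n lam + 1) * (S.pkBound.eval lam + lam) ≤ ℓ lam)
    (hS : KeyKnowledgeSecure S ℓ) {L C : Cmd} (hL : IsLearner S n ℓ L) (hC : IsClassifier C)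
    (hB : ModelSizeAtMost S n ℓ L (fun lam => (n lam : ℝ) / 2 * (ℓ lam : ℝ))) {q : Polynomial ℕ}
    (hq : ∀ lam, 0 < q.eval lam) {A : Cmd} {aux : ℕ → List (List Bool)}
    (hA : ∀ lam, ∀ st ∈ (gen S lam (n lam) (ℓ lam)).support,
      ∃ t, MixesSamples S A lam (q.eval lam) st (aux lam) t) (b : Bool) :
    Negligible fun lam => prob (genLearn S L lam (n lam) (ℓ lam)) fun o =>
      ¬ gap S C A lam o.1 o.2 (aux lam) b < 1 / ((q.eval lam : ℕ) : ℝ) := by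
  obtain ⟨Z⟩ := hn.exists_paramPrograms
  obtain ⟨N, hN⟩ := Z.polyBounded
  refine negligible_of_le (fun lam => prob_nonneg _ _) (1536 * (N * q) ^ 2) fun m => ?_
  -- The term `384 N⁴ q²` dominates the factor `n * 192 (n q)² * 2 n` in front of `1 / Q`, and `24 N
  -- q + 1` ensures that `1 / Q` is below the reciprocal of the precision.
  have hQ : ∀ lam, ((384 * N ^ 4 * q ^ 2 + 24 * N * q + 1) * (Polynomial.X + 1) ^ m).eval lam =
      (384 * N.eval lam ^ 4 * q.eval lam ^ 2 + 24 * N.eval lam * q.eval lam + 1) *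
        (lam + 1) ^ m := fun lam => by simp
  have key := eventually_pr_gap_le hn hℓ hlarge hS hL hC hB hq
    (Q := (384 * N ^ 4 * q ^ 2 + 24 * N * q + 1) * (Polynomial.X + 1) ^ m) (fun lam => by
      rw [hQ]
      have h1 : 1 ≤ (lam + 1) ^ m := Nat.one_le_pow _ _ (by omega)
      have h2 : n lam * q.eval lam ≤ N.eval lam * q.eval lam := Nat.mul_le_mul_right _ (hN lam)
      refine lt_of_lt_of_le ?_ (Nat.le_mul_of_pos_right _ h1)
      rw [mul_assoc 24]
      omega) hA b
  filter_upwards [key] with lam h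
  rw [← ENNReal.ofReal_le_ofReal_iff (by positivity), ofReal_prob]
  refine h.trans ?_
  rw [hQ]
  set a := N.eval lam
  set d := q.eval lam
  have hna : (n lam : ℝ) ≤ a := by exact_mod_cast hN lam
  have e1 : (2 : ENNReal)⁻¹ = ENNReal.ofReal (1 / 2) := by
    rw [one_div, ENNReal.ofReal_inv_of_pos two_pos]
    simp
  rw [e1, ← ENNReal.ofReal_pow (by positivity), ← ENNReal.ofReal_natCast (n lam),
    ← ENNReal.ofReal_natCast (192 * (n lam * d) ^ 2), show (2 : ENNReal) = ENNReal.ofReal 2 by simp,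
    show (8 : ENNReal) = ENNReal.ofReal 8 by simp, ← ENNReal.ofReal_mul (by positivity),
    ← ENNReal.ofReal_mul (by positivity), ← ENNReal.ofReal_mul (by positivity),
    ← ENNReal.ofReal_mul (by positivity), ← ENNReal.ofReal_mul (by positivity),
    ← ENNReal.ofReal_mul (by positivity), ← ENNReal.ofReal_add (by positivity) (by positivity)]
  refine ENNReal.ofReal_le_ofReal (add_le_add ?_ ?_)
  · push_cast
    have hl : (0 : ℝ) < ((lam : ℝ) + 1) ^ m := by positivity
    have hle : (n lam : ℝ) * (192 * ((n lam : ℝ) * d) ^ 2 * (2 * n lam)) ≤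
        384 * (a : ℝ) ^ 4 * (d : ℝ) ^ 2 + 24 * a * d + 1 := by
      have h4 : (n lam : ℝ) ^ 4 ≤ (a : ℝ) ^ 4 := by gcongr
      have h5 : 384 * (n lam : ℝ) ^ 4 * (d : ℝ) ^ 2 ≤ 384 * (a : ℝ) ^ 4 * (d : ℝ) ^ 2 := by gcongr
      have h6 : (0 : ℝ) ≤ 24 * a * d := by positivity
      calc (n lam : ℝ) * (192 * ((n lam : ℝ) * d) ^ 2 * (2 * n lam))
          = 384 * (n lam : ℝ) ^ 4 * (d : ℝ) ^ 2 := by ring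
        _ ≤ _ := by linarith
    set K := 384 * (a : ℝ) ^ 4 * (d : ℝ) ^ 2 + 24 * a * d + 1 with hK
    have hKpos : 0 < K := by positivity
    calc (n lam : ℝ) * (192 * ((n lam : ℝ) * d) ^ 2 * (2 * n lam *
          (1 / (K * ((lam : ℝ) + 1) ^ m))))
        = (n lam : ℝ) * (192 * ((n lam : ℝ) * d) ^ 2 * (2 * n lam)) *
          (1 / (K * ((lam : ℝ) + 1) ^ m)) := by ring
      _ ≤ K * (1 / (K * ((lam : ℝ) + 1) ^ m)) := by gcongr
      _ = 1 / ((lam : ℝ) + 1) ^ m := by field_simp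
  · have e2 : ((1536 * (N * q) ^ 2 : Polynomial ℕ).eval lam) = 1536 * (a * d) ^ 2 := by
      simp [a, d]
    rw [e2]
    push_cast
    rw [← mul_assoc, show (8 : ℝ) * 192 = 1536 by norm_num]
    gcongr

end RobustLearning

/-! ### Both parts of the theorem. -/

theorem mainTheorem1 (S : BigKeyEncryption) (n ℓ : ℕ → ℕ)
    (hn : UnaryPolyTime n) (hℓ : UnaryPolyTime ℓ)
    (hlarge : ∀ᶠ lam in atTop, (n lam + 1) * (S.pkBound.eval lam + lam) ≤ ℓ lam)
    (hS : KeyKnowledgeSecure S ℓ) :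
    (∃ A : Cmd,
      (∃ p : Polynomial ℕ, ∀ lam k : ℕ,
        AttackWithin S A lam (n lam) (ℓ lam) [unary k] (p.eval (lam + k))) ∧
      ∀ L C : Cmd, IsLearner S n ℓ L → IsClassifier C →
        ModelSizeAtMost S n ℓ L (fun lam => (n lam : ℝ) / 2 * (ℓ lam : ℝ)) →
        ∀ q : Polynomial ℕ, (∀ lam, 0 < q.eval lam) →
          Negligible fun lam => prob (genLearn S L lam (n lam) (ℓ lam)) fun o =>
            ∃ b : Bool, ¬ gap S C A lam o.1 o.2 [unary (q.eval lam)] b < 1 / ((q.eval lam : ℕ) : ℝ)) ∧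
    ∀ ε δ γ η : ℕ → ℝ,
      (∃ q : Polynomial ℕ, (∀ lam, 0 < q.eval lam) ∧
        ∀ᶠ lam in atTop, 1 / ((q.eval lam : ℕ) : ℝ) ≤ γ lam) →
      (∃ c : ℝ, c < 1 ∧ ∀ᶠ lam in atTop, η lam ≤ c) →
      ¬ WeaklyRobustlyLearnable S n ℓ (fun lam => (n lam : ℝ) / 2 * (ℓ lam : ℝ)) ε δ γ η := by
  obtain ⟨Z⟩ := hn.exists_paramPrograms
  obtain ⟨p, hp⟩ := Z.mixesSamples S ℓ
  refine ⟨⟨attack S.enc Z.Pn Z.PN Z.Pθ, ⟨p, fun lam k => MixesSamples.attackWithin (hp lam k)⟩, ?_⟩,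
    ?_⟩
  · intro L C hL hC hB q hq
    have h := negligible_gap hn hℓ hlarge hS hL hC hB hq (aux := fun lam => [unary (q.eval lam)])
      fun lam st hst => ⟨_, hp lam (q.eval lam) st hst⟩
    refine ((h true).add (h false)).trans_eventually_abs_le (Eventually.of_forall fun lam => ?_)
    simp only [Function.comp, Pi.add_apply]
    rw [abs_of_nonneg (prob_nonneg _ _), abs_of_nonneg (add_nonneg (prob_nonneg _ _)
      (prob_nonneg _ _)), ← ENNReal.ofReal_le_ofReal_iff (add_nonneg (prob_nonneg _ _)
      (prob_nonneg _ _)), ENNReal.ofReal_add (prob_nonneg _ _) (prob_nonneg _ _), ofReal_prob,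
      ofReal_prob, ofReal_prob]
    refine le_trans (pr_mono fun o _ ho => ?_) (pr_or_le _ _ _)
    obtain ⟨b, hb⟩ := ho
    cases b
    · exact Or.inr hb
    · exact Or.inl hb
  · rintro ε δ γ η ⟨q, hq, hγ⟩ ⟨c, hc, hη⟩ ⟨L, C, hL, hC, hB, -, hrob⟩
    -- The adversary against weak robustness first computes `1^(q(lam))`, with `1 / q ≤ γ`, and then
    -- runs the attack of the first part.
    obtain ⟨Pq, tq, polyq, evalq⟩ := exists_eval_program q (x := 0) (o := 4) (by decide)
      (by decide) (by decide) (by decide) (by decide)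
    have hmix : ∀ lam, ∀ st ∈ (gen S lam (n lam) (ℓ lam)).support,
        MixesSamples S (Pq ;; attack S.enc Z.Pn Z.PN Z.Pθ) lam (q.eval lam) st []
          (tq lam + p.eval (lam + q.eval lam)) := fun lam st hst =>
      (hp lam (q.eval lam) st hst).prepend fun O s h0 h4 h6 h10 => evalq O s lam h0 h4 h6 h10
    obtain ⟨p', hp'⟩ : PolyBounded fun lam => tq lam + p.eval (lam + q.eval lam) := by
      have h1 := PolyBounded.eval q
      exact polyq.add ((PolyBounded.eval p).comp (g := fun lam => lam + q.eval lam) (by fun_prop))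
    have hrob' := hrob (Pq ;; attack S.enc Z.Pn Z.PN Z.Pθ) ⟨p', fun lam st hst c x hx f =>
      ⟨haltsWithin_mono ((hmix lam st hst).allowed hx f).1 (hp' lam),
        ((hmix lam st hst).allowed hx f).2⟩⟩ true
    -- Superpolynomial decay with exponent `0` is plain convergence to zero. One class is enough,
    -- since robustness is required for both.
    have hneg := negligible_gap hn hℓ hlarge hS hL hC hB hq (aux := fun _ => [])
      (fun lam st hst => ⟨_, hmix lam st hst⟩) true 0
    simp only [pow_zero, one_mul] at hneg
    -- For a large `lam` the gap reaches `1 / q` with probability below `1 - c`, but robustness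
    -- makes it exceed `γ ≥ 1 / q` with probability at least `1 - η ≥ 1 - c`.
    obtain ⟨lam, h1, h2, h3, h4⟩ := (((hneg.eventually_lt_const (sub_pos.2 hc)).and
      (hγ.and (hη.and hrob'))).exists)
    have h5 : prob (genLearn S L lam (n lam) (ℓ lam)) (fun o =>
        γ lam < gap S C (Pq ;; attack S.enc Z.Pn Z.PN Z.Pθ) lam o.1 o.2 [] true) ≤
        prob (genLearn S L lam (n lam) (ℓ lam)) (fun o =>
          ¬ gap S C (Pq ;; attack S.enc Z.Pn Z.PN Z.Pθ) lam o.1 o.2 [] true <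
            1 / ((q.eval lam : ℕ) : ℝ)) := by
      rw [prob_eq, prob_eq]
      exact ENNReal.toReal_mono (pr_ne_top _ _) (pr_mono fun o _ ho => not_lt.2 (h2.trans ho.le))
    linarith
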